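/- Let $M>0$, $p>1$. For $u+v<0$ let $r_S(u,v)\in(0,2M)$ be the solution of $r_*(r_S)=\tfrac12(u+v)$, where $r_*(r)=r+2M\log\frac{2M-r}{2M}$, and let $\Omega_S^2=\frac{2M}{r_S}-1$ (the Schwarzschild interior). For $U>0$ put $u=-4M\log\frac{4M}{U}$, $\widehat\Omega_S^2=\frac{2M}{r_S}e^{-r_S/2M}e^{v/4M}$ (which is $e^{-1+v/4M}$ at $U=0$). **System.** For $(r,\widehat\Omega^2,\phi)(U,v)$ with $r,\widehat\Omega^2>0$ consider the spherically symmetric Einstein--scalar field equations $\partial_U(r\partial_vr)=\partial_v(r\partial_Ur)=-\tfrac14\widehat\Omega^2$, $\ \partial_U\partial_v\log\widehat\Omega^2=-2\partial_U\phi\,\partial_v\phi+\tfrac12r^{-2}\widehat\Omega^2+2r^{-2}\partial_Ur\,\partial_vr$, $\ \partial_U(\widehat\Omega^{-2}\partial_Ur)=-r\widehat\Omega^{-2}(\partial_U\phi)^2$, $\ \partial_v(\widehat\Omega^{-2}\partial_vr)=-r\widehat\Omega^{-2}(\partial_v\phi)^2$, $\ \partial_U(r\partial_v\phi)=-\partial_vr\,\partial_U\phi$,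 $\ \partial_v(r\partial_U\phi)=-\partial_Ur\,\partial_v\phi$. Write $Y=\frac{1}{-\partial_Ur}\partial_U=\frac{1}{-\partial_ur}\partial_u$ and $\Omega^2=\widehat\Omega^2\frac{dU}{du}=\widehat\Omega^2e^{u/4M}$. **Data.** Let $p\le q<3p-1$, $D_1,D_2,D_3,v_0>0$. The data are smooth $(r,\phi)$, $r>0$, on $\{U=0,\ v\ge v_0\}$ and on $\{0\le U\le U_0,\ v=v_0\}$, which agree at $(0,v_0)$, satisfy on each hypersurface the respective constraint (second-order equation for $r$ above involving only tangential derivatives) with $\widehat\Omega^2=\widehat\Omega_S^2$, and are such that $r(0,v)\to2M$ and $\phi(0,v)\to0$ as $v\to\infty$, $\partial_Ur(0,v_0)<0$, $$D_1(M^{-1}v)^{-q}\le r\partial_v\phi(0,v)\le D_2(M^{-1}v)^{-p},\qquad \sup_{0\le U\le U_0}|rY\phi|(U,v_0)+|\partial_Ur|(0,v_0)\le D_3 .$$ **Claim.** Let also $\rho>0$ and consider only data with $r(0,v_0)\ge\rho$. There are constants $C_0$, $C_\delta$, $C_{r_0}$, $C_{\delta,r_0}$ (depending only on $M,p$ and the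 indicated $\delta$, $r_0$) such that for all $\Delta_1$ suitably large depending on $M,p,D_2,D_3,v_0,\rho$ there is $C_1>0$ depending on $\Delta_1$ and these quantities, such that for all $\Delta_2$ suitably large depending on $C_1,\Delta_1$ and these quantities, all $\epsilon>0$, all $\delta>0$ suitably small depending on all of the preceding, all $r_0>0$, and all $U_0>0$ suitably small depending on all of the preceding (but not on $q$, $D_1$ or the data): for all data as above with $r(U,v_0)>r_0$ for $0\le U\le U_0$, there is a smooth solution with these data, with $\partial_Ur<0$, which exists in the whole region $D=[0,U_0)\times[v_0,\infty)\cap\{r\ge r_0\}$. (That is, it is defined on a relatively open past subset $Q$ of $[0,U_0)\times[v_0,\infty)$ containing the initial hypersurfaces, $D=Q\cap\{r\ge r_0\}$, and each point $(U,v)$ of $[0,U_0)\times[v_0,\infty)$ outside $D$ has some $(U',v)\in Q$, $U'\le U$, with $r(U',v)<r_0$.) It satisfies the following, where $x=M^{-1}v$, $E=e^{\frac1{4M}(v-|u|)}$, and $\mathcal R=D\cap\{U>0,\ v-|u|\le-\delta^{-1}\}$, $\mathcal N=(D\cap\{U>0\})\setminus\mathcal R$. On $D$: $r^2|\partial_v\phi|\le2\Delta_1Mx^{-p}$,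 $\ r|Y\phi|\le2\Delta_1x^{-p}$, $\ |-\Omega^{-2}\partial_ur-\tfrac12|\le C_1x^{-2p+1}$, $\ |r\partial_vr+M-\tfrac12r|\le C_1Mx^{-2p+1}$. On $\mathcal R$ (red-shift region): $|\partial_u\log\frac{\Omega^2}{\Omega_S^2}|\le\Delta_2Ex^{-2p+1}$, $\ |\frac{\Omega^2}{\Omega_S^2}-1|\le C_0\epsilon\Delta_2x^{-2p+1}$, $\ |\partial_u(r-r_S)|\le(C_0\epsilon\Delta_2+C_1)Ex^{-2p+1}$, $\ |r-r_S|\le(C_0\epsilon\Delta_2E+C_1)Mx^{-2p+1}$, $\ |\partial_v(r-r_S)|\le(C_0\epsilon\Delta_2E+C_1)x^{-2p+1}$, $\ |\partial_u\log\frac{r^2\Omega^2}{r_S^2\Omega_S^2}|\le\tfrac12\Delta_2Ex^{-2p+1}$, $\ r|\partial_v\phi|\le\tfrac14\Delta_1x^{-p}$, $\ |Y\phi|\le\tfrac14M^{-1}\Delta_1x^{-p}$. Where $v-|u|=-\delta^{-1}$ in $D$: $r<2M$ and $|\log\frac{r^2\Omega^2}{2Mr-r^2}|\le C_\delta(\epsilon\Delta_2E+C_1)x^{-2p+1}$.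 Where $\partial_vr=0$ in $D\cap\{U>0\}$: the point lies in $\mathcal R$ and $|r-2M|\le C_1Mx^{-2p+1}$. On $\mathcal N$ (no-shift region): $r<2M$, $\ |\frac{r^2\Omega^2}{2Mr-r^2}-1|$, $\ |-\partial_ur-(Mr^{-1}-\tfrac12)|$, $\ |\frac{\partial_ur}{\partial_vr}-1|$ and $\ |v-|u|-2r_*(r)|$ are all $\le C_{\delta,r_0}(C_1+\epsilon\Delta_2)x^{-2p+2}$, $\ |\partial_v\log(r^2\Omega^2)-r^{-1}+Mr^{-2}|\le C_{r_0}C_1x^{-2p+1}$, $\ |1-\frac v{|u|}|\le C_{\delta,r_0}(C_1+\epsilon\Delta_2)x^{-1}$, $\ r^2|\partial_v\phi|\le M\Delta_1x^{-p}$, $\ r^2|\partial_u\phi|\le M\Delta_1x^{-p}$, $\ r|Y\phi|\le\Delta_1x^{-p}$. -/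

import Mathlib

open Set Filter
open scoped ContDiff Topology

namespace EinsteinScalar

noncomputable section

/-! ### The Schwarzschild interior of mass `M` -/

/-- The tortoise function `r_*(r) = r + 2M log ((2M - r) / 2M)`. -/
def rStar (M r : ℝ) : ℝ := r + 2 * M * Real.log ((2 * M - r) / (2 * M))

/-- The Schwarzschild radius `r_S(u,v)`: the solution in `(0, 2M)` of `r_*(r_S) = (u + v) / 2`,
for `u + v < 0` (see `rS_spec` and `rS_unique`). -/
def rS (M u v : ℝ) : ℝ := Function.invFunOn (rStar M) (Ioo 0 (2 * M)) ((u + v) / 2)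

theorem rStar_strictAntiOn {M : ℝ} (hM : 0 < M) : StrictAntiOn (rStar M) (Ioo 0 (2 * M)) := by
  have hd : ∀ r ∈ Ioo (0 : ℝ) (2 * M),
      HasDerivAt (rStar M) (1 + 2 * M * (-1 / (2 * M) / ((2 * M - r) / (2 * M)))) r := by
    intro r hr
    have h1 : (2 * M - r) / (2 * M) ≠ 0 := by
      have := hr.2
      have : 0 < (2 * M - r) / (2 * M) := by apply div_pos <;> linarith
      exact this.ne'
    have h2 : HasDerivAt (fun x : ℝ => (2 * M - x) / (2 * M)) (-1 / (2 * M)) r :=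
      ((hasDerivAt_id r).const_sub (2 * M)).div_const (2 * M)
    exact (hasDerivAt_id r).add ((h2.log h1).const_mul (2 * M))
  apply strictAntiOn_of_deriv_neg (convex_Ioo _ _)
  · exact fun r hr => (hd r hr).continuousAt.continuousWithinAt
  · intro r hr
    rw [interior_Ioo] at hr
    rw [(hd r hr).deriv]
    have h1 : 0 < 2 * M - r := by linarith [hr.2]
    have h2 : 1 + 2 * M * (-1 / (2 * M) / ((2 * M - r) / (2 * M))) = -(r / (2 * M - r)) := by
      field_simp
      ring
    rw [h2]
    exact neg_neg_of_pos (div_pos hr.1 h1)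

theorem rS_spec {M u v : ℝ} (hM : 0 < M) (huv : u + v < 0) :
    rS M u v ∈ Ioo 0 (2 * M) ∧ rStar M (rS M u v) = (u + v) / 2 := by
  have hex : ∃ r ∈ Ioo (0 : ℝ) (2 * M), rStar M r = (u + v) / 2 := by
    set y := (u + v) / 2 with hy
    have hy0 : y < 0 := by rw [hy]; linarith
    set t := Real.exp (y / (2 * M) - 1) with ht
    have ht0 : 0 < t := Real.exp_pos _
    have ht1 : t < 1 := by
      rw [ht, Real.exp_lt_one_iff]
      have : y / (2 * M) < 0 := div_neg_of_neg_of_pos hy0 (by linarith)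
      linarith
    have hr1 : 0 < 2 * M * (1 - t) := by apply mul_pos <;> linarith
    have hr2 : 2 * M * (1 - t) < 2 * M := by nlinarith
    have hval : rStar M (2 * M * (1 - t)) = y - 2 * M * t := by
      have h1 : (2 * M - 2 * M * (1 - t)) / (2 * M) = t := by field_simp; ring
      rw [rStar, h1, ht, Real.log_exp]
      field_simp
      ring
    have hcont : ContinuousOn (rStar M) (Icc 0 (2 * M * (1 - t))) := by
      unfold rStar
      apply ContinuousOn.add continuousOn_id
      apply ContinuousOn.mul continuousOn_const
      apply ContinuousOn.log (by fun_prop)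
      intro x hx
      have : 0 < (2 * M - x) / (2 * M) := by
        apply div_pos <;> linarith [hx.2]
      exact this.ne'
    have h0 : rStar M 0 = 0 := by
      have : (2 * M) / (2 * M) = 1 := div_self (by linarith)
      simp [rStar, this]
    have := intermediate_value_Icc' hr1.le hcont
    obtain ⟨r, hr, hrv⟩ := this (show y ∈ Icc _ _ by
      rw [hval, h0]; constructor
      · have : 0 < 2 * M * t := by positivity
        linarith
      · exact hy0.le)
    refine ⟨r, ⟨lt_of_le_of_ne hr.1 ?_, lt_of_le_of_lt hr.2 hr2⟩, hrv⟩
    rintro rfl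
    rw [h0] at hrv
    linarith
  exact Function.invFunOn_pos hex

theorem rS_unique {M u v r : ℝ} (hM : 0 < M) (huv : u + v < 0) (hr : r ∈ Ioo 0 (2 * M))
    (h : rStar M r = (u + v) / 2) : r = rS M u v :=
  (rStar_strictAntiOn hM).injOn hr (rS_spec hM huv).1 (h.trans (rS_spec hM huv).2.symm)

/-- `Ω_S²(u,v) = 2M / r_S - 1`. -/
def Omega2S (M u v : ℝ) : ℝ := 2 * M / rS M u v - 1

/-- The change of coordinates `u = -4M log (4M / U)`, for `U > 0`. -/
def uOf (M U : ℝ) : ℝ := -(4 * M) * Real.log (4 * M / U)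

/-- The inverse change of coordinates `U = 4M exp (u / 4M)`. -/
def UOf (M u : ℝ) : ℝ := 4 * M * Real.exp (u / (4 * M))

theorem uOf_UOf {M : ℝ} (hM : 0 < M) (u : ℝ) : uOf M (UOf M u) = u := by
  have h : 4 * M / (4 * M * Real.exp (u / (4 * M))) = Real.exp (-(u / (4 * M))) := by
    rw [Real.exp_neg]
    field_simp
  rw [uOf, UOf, h, Real.log_exp]
  field_simp

/-- The Schwarzschild lapse in `(U,v)` coordinates, extended to the horizon `U = 0`, where
`r_S = 2M`. -/
def OmegaHat2S (M U v : ℝ) : ℝ :=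
  if U = 0 then Real.exp (-1 + v / (4 * M))
  else 2 * M / rS M (uOf M U) v * Real.exp (-rS M (uOf M U) v / (2 * M)) * Real.exp (v / (4 * M))

/-! ### Functions of `(U,v)` on the quadrant `U ≥ 0`, `v ≥ v₀` -/

/-- `∂_U f` (one-sided at `U = 0`). -/
def dU (f : ℝ → ℝ → ℝ) (U v : ℝ) : ℝ := derivWithin (fun U' => f U' v) (Ici 0) U

/-- `∂_v f` (one-sided at `v = v₀`). -/
def dV (v₀ : ℝ) (f : ℝ → ℝ → ℝ) (U v : ℝ) : ℝ := derivWithin (fun v' => f U v') (Ici v₀) v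

/-- `Y f = (-∂_U r)⁻¹ ∂_U f`. This does not change if `U` is replaced by another coordinate,
such as `u`, with the same level sets. -/
def Yd (r f : ℝ → ℝ → ℝ) (U v : ℝ) : ℝ := dU f U v / (-dU r U v)

/-- The spherically symmetric Einstein-scalar field system for `(r, Ω̂², φ)` in `(U,v)` coordinates,
on a subset `Q` of the quadrant: `r`, `Ω̂²`, `φ` are smooth on `Q`, `r` and `Ω̂²` are positive,
and the propagation and constraint equations hold. -/
structure IsSolutionOn (v₀ : ℝ) (Q : Set (ℝ × ℝ)) (r Ω2 φ : ℝ → ℝ → ℝ) : Prop where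
  r_smooth : ContDiffOn ℝ ∞ (fun x : ℝ × ℝ => r x.1 x.2) Q
  Ω2_smooth : ContDiffOn ℝ ∞ (fun x : ℝ × ℝ => Ω2 x.1 x.2) Q
  φ_smooth : ContDiffOn ℝ ∞ (fun x : ℝ × ℝ => φ x.1 x.2) Q
  r_pos : ∀ U v, (U, v) ∈ Q → 0 < r U v
  Ω2_pos : ∀ U v, (U, v) ∈ Q → 0 < Ω2 U v
  wave_r_U : ∀ U v, (U, v) ∈ Q →
    dU (fun U' v' => r U' v' * dV v₀ r U' v') U v = -(1 / 4) * Ω2 U v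
  wave_r_v : ∀ U v, (U, v) ∈ Q →
    dV v₀ (fun U' v' => r U' v' * dU r U' v') U v = -(1 / 4) * Ω2 U v
  wave_Ω2 : ∀ U v, (U, v) ∈ Q →
    dU (dV v₀ (fun U' v' => Real.log (Ω2 U' v'))) U v
      = -2 * dU φ U v * dV v₀ φ U v + 1 / 2 * Ω2 U v / r U v ^ 2
        + 2 * dU r U v * dV v₀ r U v / r U v ^ 2
  raychaudhuri_U : ∀ U v, (U, v) ∈ Q →
    dU (fun U' v' => (Ω2 U' v')⁻¹ * dU r U' v') U v = -r U v * (Ω2 U v)⁻¹ * dU φ U v ^ 2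
  raychaudhuri_v : ∀ U v, (U, v) ∈ Q →
    dV v₀ (fun U' v' => (Ω2 U' v')⁻¹ * dV v₀ r U' v') U v
      = -r U v * (Ω2 U v)⁻¹ * dV v₀ φ U v ^ 2
  wave_φ_U : ∀ U v, (U, v) ∈ Q →
    dU (fun U' v' => r U' v' * dV v₀ φ U' v') U v = -dV v₀ r U v * dU φ U v
  wave_φ_v : ∀ U v, (U, v) ∈ Q →
    dV v₀ (fun U' v' => r U' v' * dU φ U' v') U v = -dU r U v * dV v₀ φ U v

/-! ### Characteristic initial data -/

/-- Smooth characteristic initial data: `(rH, φH)` are the values of `(r, φ)` on the event horizon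
`{U = 0, v ≥ v₀}`, `(rI, φI)` those on the ingoing cone `{0 ≤ U ≤ U₀, v = v₀}`. On both, `Ω̂²` has
its Schwarzschild value and the constraint equation holds. The sign of `∂_U r` at the corner is what
makes the vector field `Y` meaningful. -/
structure IsInitialData (M p q D₁ D₂ D₃ v₀ U₀ : ℝ) (rH φH rI φI : ℝ → ℝ) : Prop where
  rH_smooth : ContDiffOn ℝ ∞ rH (Ici v₀)
  φH_smooth : ContDiffOn ℝ ∞ φH (Ici v₀)
  rI_smooth : ContDiffOn ℝ ∞ rI (Icc 0 U₀)
  φI_smooth : ContDiffOn ℝ ∞ φI (Icc 0 U₀)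
  rH_pos : ∀ v ∈ Ici v₀, 0 < rH v
  rI_pos : ∀ U ∈ Icc 0 U₀, 0 < rI U
  corner_r : rH v₀ = rI 0
  corner_φ : φH v₀ = φI 0
  constraint_H : ∀ v ∈ Ici v₀,
    derivWithin (fun v' => (OmegaHat2S M 0 v')⁻¹ * derivWithin rH (Ici v₀) v') (Ici v₀) v
      = -rH v * (OmegaHat2S M 0 v)⁻¹ * derivWithin φH (Ici v₀) v ^ 2
  constraint_I : ∀ U ∈ Icc 0 U₀,
    derivWithin (fun U' => (OmegaHat2S M U' v₀)⁻¹ * derivWithin rI (Icc 0 U₀) U') (Icc 0 U₀) U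
      = -rI U * (OmegaHat2S M U v₀)⁻¹ * derivWithin φI (Icc 0 U₀) U ^ 2
  rH_lim : Tendsto rH atTop (𝓝 (2 * M))
  φH_lim : Tendsto φH atTop (𝓝 0)
  ingoing : derivWithin rI (Icc 0 U₀) 0 < 0
  bound_H : ∀ v ∈ Ici v₀,
    D₁ * (v / M) ^ (-q) ≤ rH v * derivWithin φH (Ici v₀) v ∧
      rH v * derivWithin φH (Ici v₀) v ≤ D₂ * (v / M) ^ (-p)
  bound_I : ∀ U ∈ Icc 0 U₀,
    |rI U * (derivWithin φI (Icc 0 U₀) U / (-derivWithin rI (Icc 0 U₀) U))|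
      + |derivWithin rI (Icc 0 U₀) 0| ≤ D₃

/-- `(r, Ω̂², φ)` takes the given initial data on the two initial hypersurfaces. -/
structure AttainsData (M v₀ U₀ : ℝ) (rH φH rI φI : ℝ → ℝ) (r Ω2 φ : ℝ → ℝ → ℝ) : Prop where
  on_H : ∀ v ∈ Ici v₀, r 0 v = rH v ∧ φ 0 v = φH v ∧ Ω2 0 v = OmegaHat2S M 0 v
  on_I : ∀ U ∈ Ico 0 U₀, r U v₀ = rI U ∧ φ U v₀ = φI U ∧ Ω2 U v₀ = OmegaHat2S M U v₀

/-- The part `{r ≥ r₀}` of the domain `Q` of a solution. -/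
def DReg (Q : Set (ℝ × ℝ)) (r : ℝ → ℝ → ℝ) (r₀ : ℝ) : Set (ℝ × ℝ) :=
  {x | x ∈ Q ∧ r₀ ≤ r x.1 x.2}

/-- `Q` is a domain for the characteristic problem on which the solution covers the whole of
`[0,U₀) × [v₀,∞) ∩ {r ≥ r₀}`: it is a relatively open past set of `[0,U₀) × [v₀,∞)` that contains
the initial hypersurfaces, and a point of `[0,U₀) × [v₀,∞)` is missing from `Q ∩ {r ≥ r₀}` only if
the ingoing null line from the horizon to that point meets a point of `Q` with `r < r₀`. -/
structure IsFullDomain (v₀ U₀ r₀ : ℝ) (Q : Set (ℝ × ℝ)) (r : ℝ → ℝ → ℝ) : Prop where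
  rel_open : ∃ O : Set (ℝ × ℝ), IsOpen O ∧ Q = O ∩ (Ico 0 U₀ ×ˢ Ici v₀)
  past : ∀ U v U' v', (U, v) ∈ Q → 0 ≤ U' → U' ≤ U → v₀ ≤ v' → v' ≤ v → (U', v') ∈ Q
  horizon : ∀ v ∈ Ici v₀, (0, v) ∈ Q
  ingoing_cone : ∀ U ∈ Ico 0 U₀, (U, v₀) ∈ Q
  full : ∀ U ∈ Ico 0 U₀, ∀ v ∈ Ici v₀, (U, v) ∉ DReg Q r r₀ →
    ∃ U', 0 ≤ U' ∧ U' ≤ U ∧ (U', v) ∈ Q ∧ r U' v < r₀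

/-! ### Eddington-Finkelstein-type coordinates `(u,v)` and the regions -/

/-- A function of `(U,v)` as a function of `(u,v)`. -/
def toEF (M : ℝ) (f : ℝ → ℝ → ℝ) (u v : ℝ) : ℝ := f (UOf M u) v

/-- `Ω²(u,v) = Ω̂²(U(u),v) dU/du`. -/
def Omega2 (M : ℝ) (Ω2hat : ℝ → ℝ → ℝ) (u v : ℝ) : ℝ :=
  Ω2hat (UOf M u) v * Real.exp (u / (4 * M))

/-- `∂_u` for functions of `(u,v)`. -/
def du (F : ℝ → ℝ → ℝ) (u v : ℝ) : ℝ := deriv (fun u' => F u' v) u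

/-- The set of the `(u,v)` that describe points of `D ∩ {U > 0}`. -/
def EFReg (M : ℝ) (D : Set (ℝ × ℝ)) : Set (ℝ × ℝ) := {x | (UOf M x.1, x.2) ∈ D}

/-- The red-shift region `v - |u| ≤ -1/δ`. -/
def RedShift (M δ : ℝ) (D : Set (ℝ × ℝ)) : Set (ℝ × ℝ) :=
  {x | x ∈ EFReg M D ∧ x.2 - |x.1| ≤ -δ⁻¹}

/-- The no-shift region, the complement of the red-shift region. -/
def NoShift (M δ : ℝ) (D : Set (ℝ × ℝ)) : Set (ℝ × ℝ) := EFReg M D \ RedShift M δ D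

/-- The curve `v - |u| = -1/δ`. -/
def GammaDelta (M δ : ℝ) (D : Set (ℝ × ℝ)) : Set (ℝ × ℝ) :=
  {x | x ∈ EFReg M D ∧ x.2 - |x.1| = -δ⁻¹}

/-! ### The estimates -/

/-- Estimates on all of `D` (`U = 0` included), where `Ω⁻² ∂_u r = Ω̂⁻² ∂_U r`. -/
structure GlobalEstimates (M p v₀ Δ₁ C : ℝ) (D : Set (ℝ × ℝ)) (r Ω2hat φ : ℝ → ℝ → ℝ) :
    Prop where
  dvφ : ∀ U v, (U, v) ∈ D → r U v ^ 2 * |dV v₀ φ U v| ≤ 2 * Δ₁ * M * (v / M) ^ (-p)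
  Yφ : ∀ U v, (U, v) ∈ D → r U v * |Yd r φ U v| ≤ 2 * Δ₁ * (v / M) ^ (-p)
  dur : ∀ U v, (U, v) ∈ D →
    |-(Ω2hat U v)⁻¹ * dU r U v - 1 / 2| ≤ C * (v / M) ^ (-2 * p + 1)
  dvr : ∀ U v, (U, v) ∈ D →
    |r U v * dV v₀ r U v + (M - 1 / 2 * r U v)| ≤ C * M * (v / M) ^ (-2 * p + 1)

/-- Estimates in the red-shift region, on its boundary `v - |u| = -1/δ`, and on the apparent
horizon `∂_v r = 0`. Here `C₀` stands for `C`, `C` for `C(Δ₁, D₂, D₃, v₀)` and `Kδ` for `C_δ`. -/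
structure RedShiftEstimates (M p v₀ Δ₁ Δ₂ C₀ C ε δ Kδ : ℝ) (D : Set (ℝ × ℝ))
    (r Ω2hat φ : ℝ → ℝ → ℝ) : Prop where
  du_log_Ω2 : ∀ u v, (u, v) ∈ RedShift M δ D →
    |du (fun u' v' => Real.log (Omega2 M Ω2hat u' v' / Omega2S M u' v')) u v|
      ≤ Δ₂ * Real.exp ((v - |u|) / (4 * M)) * (v / M) ^ (-2 * p + 1)
  Ω2_sub : ∀ u v, (u, v) ∈ RedShift M δ D →
    |Omega2 M Ω2hat u v / Omega2S M u v - 1| ≤ C₀ * ε * Δ₂ * (v / M) ^ (-2 * p + 1)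
  du_r_sub : ∀ u v, (u, v) ∈ RedShift M δ D →
    |du (fun u' v' => toEF M r u' v' - rS M u' v') u v|
      ≤ C₀ * ε * Δ₂ * Real.exp ((v - |u|) / (4 * M)) * (v / M) ^ (-2 * p + 1)
        + C * Real.exp ((v - |u|) / (4 * M)) * (v / M) ^ (-2 * p + 1)
  r_sub : ∀ u v, (u, v) ∈ RedShift M δ D →
    |toEF M r u v - rS M u v|
      ≤ C₀ * ε * Δ₂ * M * Real.exp ((v - |u|) / (4 * M)) * (v / M) ^ (-2 * p + 1)
        + C * M * (v / M) ^ (-2 * p + 1)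
  dv_r_sub : ∀ u v, (u, v) ∈ RedShift M δ D →
    |dV v₀ (fun u' v' => toEF M r u' v' - rS M u' v') u v|
      ≤ C₀ * ε * Δ₂ * Real.exp ((v - |u|) / (4 * M)) * (v / M) ^ (-2 * p + 1)
        + C * (v / M) ^ (-2 * p + 1)
  log_on_gamma : ∀ u v, (u, v) ∈ GammaDelta M δ D → toEF M r u v < 2 * M ∧
    |Real.log (toEF M r u v ^ 2 * Omega2 M Ω2hat u v / (2 * M * toEF M r u v - toEF M r u v ^ 2))|
      ≤ Kδ * (ε * Δ₂ * Real.exp ((v - |u|) / (4 * M)) + C) * (v / M) ^ (-2 * p + 1)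
  apparent_horizon : ∀ u v, (u, v) ∈ EFReg M D → dV v₀ (toEF M r) u v = 0 →
    (u, v) ∈ RedShift M δ D ∧ |toEF M r u v - 2 * M| ≤ C * M * (v / M) ^ (-2 * p + 1)
  du_log_r2Ω2 : ∀ u v, (u, v) ∈ RedShift M δ D →
    |du (fun u' v' => Real.log (toEF M r u' v' ^ 2 * Omega2 M Ω2hat u' v'
        / (rS M u' v' ^ 2 * Omega2S M u' v'))) u v|
      ≤ 1 / 2 * Δ₂ * Real.exp ((v - |u|) / (4 * M)) * (v / M) ^ (-2 * p + 1)
  dvφ : ∀ u v, (u, v) ∈ RedShift M δ D →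
    toEF M r u v * |dV v₀ (toEF M φ) u v| ≤ 1 / 4 * Δ₁ * (v / M) ^ (-p)
  Yφ : ∀ u v, (u, v) ∈ RedShift M δ D →
    |toEF M (Yd r φ) u v| ≤ 1 / 4 * M⁻¹ * Δ₁ * (v / M) ^ (-p)

/-- Estimates in the no-shift region. Here `C` stands for `C(Δ₁, D₂, D₃, v₀)`, `Kr` for `C_{r₀}`
and `Kδr` for `C_{δ,r₀}`. The two last fields compare `v` with `|u|`; in Schwarzschild
`v - |u| = 2 r_*(r)`. -/
structure NoShiftEstimates (M p v₀ Δ₁ Δ₂ C ε δ Kr Kδr : ℝ) (D : Set (ℝ × ℝ))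
    (r Ω2hat φ : ℝ → ℝ → ℝ) : Prop where
  r_lt : ∀ u v, (u, v) ∈ NoShift M δ D → toEF M r u v < 2 * M
  Ω2_sub : ∀ u v, (u, v) ∈ NoShift M δ D →
    |toEF M r u v ^ 2 * Omega2 M Ω2hat u v / (2 * M * toEF M r u v - toEF M r u v ^ 2) - 1|
      ≤ Kδr * (C + ε * Δ₂) * (v / M) ^ (-2 * p + 2)
  dv_log_Ω2 : ∀ u v, (u, v) ∈ NoShift M δ D →
    |dV v₀ (fun u' v' => Real.log (toEF M r u' v' ^ 2 * Omega2 M Ω2hat u' v')) u v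
        - (toEF M r u v)⁻¹ + M / toEF M r u v ^ 2|
      ≤ Kr * C * (v / M) ^ (-2 * p + 1)
  dur : ∀ u v, (u, v) ∈ NoShift M δ D →
    |-du (toEF M r) u v - (M / toEF M r u v - 1 / 2)|
      ≤ Kδr * (C + ε * Δ₂) * (v / M) ^ (-2 * p + 2)
  ratio : ∀ u v, (u, v) ∈ NoShift M δ D →
    |du (toEF M r) u v / dV v₀ (toEF M r) u v - 1|
      ≤ Kδr * (C + ε * Δ₂) * (v / M) ^ (-2 * p + 2)
  dvφ : ∀ u v, (u, v) ∈ NoShift M δ D →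
    toEF M r u v ^ 2 * |dV v₀ (toEF M φ) u v| ≤ M * Δ₁ * (v / M) ^ (-p)
  duφ : ∀ u v, (u, v) ∈ NoShift M δ D →
    toEF M r u v ^ 2 * |du (toEF M φ) u v| ≤ M * Δ₁ * (v / M) ^ (-p)
  Yφ : ∀ u v, (u, v) ∈ NoShift M δ D →
    toEF M r u v * |toEF M (Yd r φ) u v| ≤ Δ₁ * (v / M) ^ (-p)
  level_curves : ∀ u v, (u, v) ∈ NoShift M δ D →
    |(v - |u|) - 2 * rStar M (toEF M r u v)| ≤ Kδr * (C + ε * Δ₂) * (v / M) ^ (-2 * p + 2)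
  v_over_u : ∀ u v, (u, v) ∈ NoShift M δ D →
    |1 - (v / |u|)| ≤ Kδr * (C + ε * Δ₂) * (v / M) ^ (-1 : ℝ)

end

end EinsteinScalar

/-!
The equations are written as a first-order system for the fields of `EinsteinScalar.Fields`, in
which `r`, `Ω̂²`, `φ` and their first derivatives are transported in `U` or in `v`. With the
nonlinearities cut off to Lipschitz functions this system has a global solution by a contraction
argument (`exists_goursat`, `exists_truncatedSol`). Where the solution is tame the cut-off is
inactive, the constraints propagate (`IsPreSol.isCharSol`), and the solution is smooth
(`IsCharSol.ckOn_all`). It remains to show that it is tame as long as `r` is bounded below.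

On the event horizon the Raychaudhuri equation and `r → 2M` give the rates of decay of
`r - 2M` and `∂_v r` (`exists_horizonBounds`). In the interior the bootstrap assumptions are
`|r² ∂_v φ| < M B P` and `|r Y φ| < B P` with `P = (v/M)^{-p}`, where `B` depends only on the
parameters of the data. They imply that `-Ω⁻² ∂_u r` is close to `1/2` (`Setting.f_near`) and that
`r ∂_v r + M - r/2` is small (`Setting.massFn_le`). Hence, for late `v` and `r ≥ r₁`,
`r |∂_v r| ≤ M - r₁/4`, and the equation for `r² ∂_v φ` improves its bound (`Setting.A_le`). The
damping coefficient in the transport equation for `r Y φ` is at least `(M - r₁/16) / r²`, up to the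
loss `p / v` from the weight, which improves the bound for `r Y φ` (`Setting.rYφ_le`): the gain in
the first estimate is larger than the loss in the second. In a bounded range of `v` the improvement
comes from the continuity of the solution at the horizon, if the range of `U` is small
(`RectSol.exists_nearHorizon`), and from the red-shift (`exists_strip_bound`). A continuity argument
on `goodRegion` then shows that the bounds hold throughout `r ≥ r₀` (`Problem.isFullDomain`).

In the red-shift region, where `E = e^{(v-|u|)/4M}` is small, the deviation `Λ` of
`∂_U log Ω̂²` from its Schwarzschild value, in the appropriate weighted norm, satisfies
`Λ ≤ C (1 + Λ E)`, hence is bounded (`Setting.exists_redShift`). In the no-shift region the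
equations are integrated in `v` from the curve `v - |u| = -δ⁻¹`, along lines whose length is bounded
in terms of `δ` and `r₀` (`Setting.noShift`). One may take `C₀ = 1` and for `Δ₁` any sufficiently
large multiple of `B`; `Δ₂` and `ε` enter through the smallness of `δ` and `U₀`.
-/

namespace EinsteinScalar

/-! ### Comparison lemmas for functions of one variable -/

theorem le_of_deriv_nonneg {f f' : ℝ → ℝ} {a b : ℝ} (hab : a ≤ b)
    (hf : ∀ t ∈ Icc a b, HasDerivWithinAt f (f' t) (Icc a b) t)
    (h0 : ∀ t ∈ Icc a b, 0 ≤ f' t) : f a ≤ f b := by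
  refine monotoneOn_of_hasDerivWithinAt_nonneg (f' := f') (convex_Icc a b)
    (fun t ht => (hf t ht).continuousWithinAt) (fun t ht => ?_) (fun t ht => h0 t (interior_subset ht))
    (left_mem_Icc.2 hab) (right_mem_Icc.2 hab) hab
  exact (hf t (interior_subset ht)).mono interior_subset

theorem le_of_deriv_nonpos {f f' : ℝ → ℝ} {a b : ℝ} (hab : a ≤ b)
    (hf : ∀ t ∈ Icc a b, HasDerivWithinAt f (f' t) (Icc a b) t)
    (h0 : ∀ t ∈ Icc a b, f' t ≤ 0) : f b ≤ f a := by
  have := le_of_deriv_nonneg (f := fun t => -f t) (f' := fun t => -f' t) hab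
    (fun t ht => (hf t ht).neg) (fun t ht => by linarith [h0 t ht])
  linarith

/-- Comparison of two functions by their derivatives. -/
theorem sub_le_sub_of_deriv_le {f f' g g' : ℝ → ℝ} {a b : ℝ} (hab : a ≤ b)
    (hf : ∀ t ∈ Icc a b, HasDerivWithinAt f (f' t) (Icc a b) t)
    (hg : ∀ t ∈ Icc a b, HasDerivWithinAt g (g' t) (Icc a b) t)
    (h : ∀ t ∈ Icc a b, f' t ≤ g' t) : f b - f a ≤ g b - g a := by
  have := le_of_deriv_nonneg (f := fun t => g t - f t) (f' := fun t => g' t - f' t) hab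
    (fun t ht => (hg t ht).sub (hf t ht)) (fun t ht => by linarith [h t ht])
  linarith

theorem abs_sub_le_of_abs_deriv_le {f f' g g' : ℝ → ℝ} {a b : ℝ} (hab : a ≤ b)
    (hf : ∀ t ∈ Icc a b, HasDerivWithinAt f (f' t) (Icc a b) t)
    (hg : ∀ t ∈ Icc a b, HasDerivWithinAt g (g' t) (Icc a b) t)
    (h : ∀ t ∈ Icc a b, |f' t| ≤ g' t) : |f b - f a| ≤ g b - g a := by
  rw [abs_le]
  constructor
  · have := sub_le_sub_of_deriv_le (f := fun t => -f t) (f' := fun t => -f' t) hab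
      (fun t ht => (hf t ht).neg) hg (fun t ht => (neg_le_abs _).trans (h t ht))
    linarith
  · exact sub_le_sub_of_deriv_le hab hf hg (fun t ht => (le_abs_self _).trans (h t ht))

theorem abs_sub_le_of_abs_deriv_le_const {f f' : ℝ → ℝ} {a b C : ℝ} (hab : a ≤ b)
    (hf : ∀ t ∈ Icc a b, HasDerivWithinAt f (f' t) (Icc a b) t)
    (h : ∀ t ∈ Icc a b, |f' t| ≤ C) : |f b - f a| ≤ C * (b - a) := by
  have := abs_sub_le_of_abs_deriv_le (g := fun t => C * t) (g' := fun _ => C) hab hf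
    (fun t _ => by simpa using ((hasDerivAt_id t).const_mul C).hasDerivWithinAt) h
  linarith

/-- A function that does not increase where it exceeds `m` stays below `m`. -/
theorem le_of_deriv_nonpos_above {f f' : ℝ → ℝ} {a b m : ℝ} (hab : a ≤ b)
    (hf : ∀ t ∈ Icc a b, HasDerivWithinAt f (f' t) (Icc a b) t)
    (h0 : f a ≤ m) (h : ∀ t ∈ Icc a b, m < f t → f' t ≤ 0) : f b ≤ m := by
  by_contra hb
  push Not at hb
  have hc : ContinuousOn f (Icc a b) := fun t ht => (hf t ht).continuousWithinAt
  -- the last time at which `f ≤ m`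
  set S := {t ∈ Icc a b | f t ≤ m} with hS
  have hSc : IsClosed S := hc.preimage_isClosed_of_isClosed isClosed_Icc isClosed_Iic
  have hne : S.Nonempty := ⟨a, left_mem_Icc.2 hab, h0⟩
  have hbd : BddAbove S := ⟨b, fun t ht => ht.1.2⟩
  have hmem := hSc.csSup_mem hne hbd
  set s := sSup S with hs
  have hsub : Icc s b ⊆ Icc a b := Icc_subset_Icc_left hmem.1.1
  have key : f b ≤ f s := by
    refine antitoneOn_of_hasDerivWithinAt_nonpos (f' := f') (convex_Icc s b)
      (hc.mono hsub) (fun t ht => ((hf t (hsub (interior_subset ht))).mono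
        (interior_subset.trans hsub))) (fun t ht => ?_)
      (left_mem_Icc.2 hmem.1.2) (right_mem_Icc.2 hmem.1.2) hmem.1.2
    rw [interior_Icc] at ht
    refine h t (hsub (Ioo_subset_Icc_self ht)) ?_
    by_contra hle
    push Not at hle
    exact absurd (le_csSup hbd (show t ∈ S from ⟨hsub (Ioo_subset_Icc_self ht), hle⟩))
      (not_le.2 ht.1)
  linarith [hmem.2]

/-- The maximum principle for `y' = -κ y + g` with `|g| ≤ κ m`. -/
theorem abs_le_of_damped {y κ g : ℝ → ℝ} {a b m : ℝ} (hab : a ≤ b)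
    (hy : ∀ t ∈ Icc a b, HasDerivWithinAt y (-κ t * y t + g t) (Icc a b) t)
    (hκ : ∀ t ∈ Icc a b, 0 ≤ κ t)
    (hg : ∀ t ∈ Icc a b, |g t| ≤ κ t * m) (h0 : |y a| ≤ m) : |y b| ≤ m := by
  rw [abs_le] at h0 ⊢
  constructor
  · have := le_of_deriv_nonpos_above (f := fun t => -y t) (m := m) hab
      (fun t ht => (hy t ht).neg) (by linarith) (fun t ht hm => by
        have h1 := (abs_le.1 (hg t ht)).1
        have h2 := mul_le_mul_of_nonneg_left hm.le (hκ t ht)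
        linarith)
    linarith
  · exact le_of_deriv_nonpos_above (m := m) hab hy h0.2 (fun t ht hm => by
        have h1 := (abs_le.1 (hg t ht)).2
        have h2 := mul_le_mul_of_nonneg_left hm.le (hκ t ht)
        linarith)

/-- Growth of `y' = -κ y + g` when `κ` is only bounded below. -/
theorem abs_le_of_growth {y κ g : ℝ → ℝ} {a b m c k : ℝ} (hab : a ≤ b)
    (hy : ∀ t ∈ Icc a b, HasDerivWithinAt y (-κ t * y t + g t) (Icc a b) t)
    (hk : 0 ≤ k) (hκ : ∀ t ∈ Icc a b, -k ≤ κ t)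
    (hg : ∀ t ∈ Icc a b, |g t| ≤ c) (h0 : |y a| ≤ m) (hm : 0 ≤ m) (hc : 0 ≤ c) :
    |y b| ≤ Real.exp (k * (b - a)) * (m + c * (b - a)) := by
  have aux : ∀ (z gz : ℝ → ℝ),
      (∀ t ∈ Icc a b, HasDerivWithinAt z (-κ t * z t + gz t) (Icc a b) t) →
      (∀ t ∈ Icc a b, |gz t| ≤ c) → |z a| ≤ m →
      z b ≤ Real.exp (k * (b - a)) * (m + c * (b - a)) := by
    intro z gz hz hgz hz0
    have hE : ∀ t, HasDerivAt (fun t => Real.exp (-(k * (t - a))))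
        (Real.exp (-(k * (t - a))) * (-(k * 1))) t := fun t =>
      ((((hasDerivAt_id t).sub_const a).const_mul k).neg).exp
    have hder : ∀ t ∈ Icc a b, HasDerivWithinAt
        (fun t => z t * Real.exp (-(k * (t - a))) - c * (t - a))
        ((-κ t * z t + gz t) * Real.exp (-(k * (t - a)))
          + z t * (Real.exp (-(k * (t - a))) * (-(k * 1))) - c * 1) (Icc a b) t := fun t ht =>
      ((hz t ht).mul (hE t).hasDerivWithinAt).sub
        ((((hasDerivAt_id t).sub_const a).const_mul c).hasDerivWithinAt)
    have := le_of_deriv_nonpos_above (m := m) hab hder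
      (by simpa using (le_abs_self _).trans hz0) (fun t ht hmt => by
        have hta : 0 ≤ t - a := by linarith [ht.1]
        have hpos : 0 < z t * Real.exp (-(k * (t - a))) := by nlinarith
        have hzt : 0 < z t := by
          by_contra hneg
          push Not at hneg
          nlinarith [Real.exp_pos (-(k * (t - a)))]
        have he1 : Real.exp (-(k * (t - a))) ≤ 1 := by
          rw [Real.exp_le_one_iff]; nlinarith
        have he0 := Real.exp_pos (-(k * (t - a)))
        have h1 : gz t * Real.exp (-(k * (t - a))) ≤ c := by
          have := (abs_le.1 (hgz t ht)).2
          nlinarith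
        have h2 := mul_nonneg (mul_nonneg (by linarith [hκ t ht] : 0 ≤ κ t + k) hzt.le) he0.le
        nlinarith)
    have he : Real.exp (k * (b - a)) * Real.exp (-(k * (b - a))) = 1 := by
      rw [← Real.exp_add]; simp
    have h3 : z b * Real.exp (-(k * (b - a))) ≤ m + c * (b - a) := by linarith
    calc z b = Real.exp (k * (b - a)) * (z b * Real.exp (-(k * (b - a)))) := by
          rw [mul_left_comm, he, mul_one]
      _ ≤ _ := mul_le_mul_of_nonneg_left h3 (Real.exp_pos _).le
  rw [abs_le]
  constructor
  · have := aux (fun t => -y t) (fun t => -g t)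
      (fun t ht => (hy t ht).neg.congr_deriv (by ring))
      (fun t ht => by simpa using hg t ht) (by simpa using h0)
    linarith
  · exact aux y g hy hg h0

/-- A solution of a linear homogeneous equation that starts positive stays positive. -/
theorem pos_of_linear {y κ : ℝ → ℝ} {a b : ℝ} (hab : a ≤ b)
    (hy : ∀ t ∈ Icc a b, HasDerivWithinAt y (κ t * y t) (Icc a b) t)
    (hκ : ContinuousOn κ (Icc a b)) (h0 : 0 < y a) : 0 < y b := by
  obtain ⟨k, hk⟩ := isCompact_Icc.exists_bound_of_continuousOn hκ
  by_contra hb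
  push Not at hb
  have hc : ContinuousOn y (Icc a b) := fun t ht => (hy t ht).continuousWithinAt
  -- the first zero
  obtain ⟨t0, ht0, hz⟩ : (0 : ℝ) ∈ y '' Icc a b := intermediate_value_Icc' hab hc ⟨hb, h0.le⟩
  have hE : ∀ t, HasDerivAt (fun t => Real.exp (2 * k * t)) (Real.exp (2 * k * t) * (2 * k * 1)) t :=
    fun t => (((hasDerivAt_id t).const_mul (2 * k))).exp
  have hsub : Icc a t0 ⊆ Icc a b := Icc_subset_Icc_right ht0.2
  have := le_of_deriv_nonneg (f := fun t => y t * y t * Real.exp (2 * k * t)) ht0.1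
    (fun t ht => ((((hy t (hsub ht)).mono hsub).mul ((hy t (hsub ht)).mono hsub)).mul
      (hE t).hasDerivWithinAt)) (fun t ht => by
        have h1 := (abs_le.1 (by simpa using hk t (hsub ht))).1
        have h2 := mul_nonneg (mul_self_nonneg (y t)) (Real.exp_pos (2 * k * t)).le
        have h3 := mul_nonneg h2 (by linarith : 0 ≤ κ t + k)
        simp only [Pi.mul_apply]
        nlinarith)
  simp only [hz] at this
  have h4 : 0 < y a * y a * Real.exp (2 * k * a) := by positivity
  linarith

/-! ### Calculus on a rectangle -/

/-- Symmetry of mixed partial derivatives in integrated form: if `∂_v f = g`, `∂_U g = h = ∂_v K`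
and `∂_U f = K` on the side `v = v₀`, then `∂_U f = K` everywhere. -/
theorem hasDerivWithinAt_of_mixed {f g h K : ℝ → ℝ → ℝ} {u₀ a v₀ b : ℝ}
    (hf : ∀ U ∈ Icc u₀ a, ∀ v ∈ Icc v₀ b, HasDerivWithinAt (fun v' => f U v') (g U v) (Icc v₀ b) v)
    (hg : ∀ U ∈ Icc u₀ a, ∀ v ∈ Icc v₀ b, HasDerivWithinAt (fun U' => g U' v) (h U v) (Icc u₀ a) U)
    (hK : ∀ U ∈ Icc u₀ a, ∀ v ∈ Icc v₀ b, HasDerivWithinAt (fun v' => K U v') (h U v) (Icc v₀ b) v)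
    (hc : ContinuousOn (fun x : ℝ × ℝ => h x.1 x.2) (Icc u₀ a ×ˢ Icc v₀ b))
    (h0 : ∀ U ∈ Icc u₀ a, HasDerivWithinAt (fun U' => f U' v₀) (K U v₀) (Icc u₀ a) U) :
    ∀ U ∈ Icc u₀ a, ∀ v ∈ Icc v₀ b,
      HasDerivWithinAt (fun U' => f U' v) (K U v) (Icc u₀ a) U := by
  intro U hU v hv
  have hv0 : v₀ ∈ Icc v₀ b := left_mem_Icc.2 (hv.1.trans hv.2)
  rw [hasDerivWithinAt_iff_isLittleO, Asymptotics.isLittleO_iff]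
  intro c hc0
  have hT : 0 < b - v₀ + 1 := by linarith [hv.1, hv.2]
  set ε := c / (2 * (b - v₀ + 1)) with hε
  have hε0 : 0 < ε := by positivity
  have huc : UniformContinuousOn (fun x : ℝ × ℝ => h x.1 x.2) (Icc u₀ a ×ˢ Icc v₀ b) :=
    (isCompact_Icc.prod isCompact_Icc).uniformContinuousOn_of_continuous hc
  obtain ⟨δ, hδ0, hδ⟩ := Metric.uniformContinuousOn_iff.1 huc ε hε0
  have h0' := h0 U hU
  rw [hasDerivWithinAt_iff_isLittleO, Asymptotics.isLittleO_iff] at h0'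
  filter_upwards [h0' (half_pos hc0), self_mem_nhdsWithin,
    mem_nhdsWithin_of_mem_nhds (Metric.ball_mem_nhds U hδ0)] with U' h1 hU' hball
  have hseg : uIcc U U' ⊆ Icc u₀ a := uIcc_subset_Icc hU hU'
  have hsmall : ∀ v' ∈ Icc v₀ b, |g U' v' - g U v' - (U' - U) * h U v'| ≤ ε * |U' - U| := by
    intro v' hv'
    have := Convex.norm_image_sub_le_of_norm_hasDerivWithin_le (s := uIcc U U')
      (f := fun s => g s v' - s * h U v') (f' := fun s => h s v' - 1 * h U v') (C := ε)
      (fun s hs => ((hg s (hseg hs) v' hv').mono hseg).sub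
        (((hasDerivAt_id s).mul_const (h U v')).hasDerivWithinAt))
      (fun s hs => by
        have hd : dist (s, v') (U, v') < δ := by
          rw [Prod.dist_eq]
          simp only [dist_self]
          rw [max_eq_left dist_nonneg, Real.dist_eq]
          have := abs_sub_left_of_mem_uIcc hs
          rw [Metric.mem_ball, Real.dist_eq] at hball
          linarith [abs_sub_comm s U]
        have := hδ (s, v') ⟨hseg hs, hv'⟩ (U, v') ⟨hU, hv'⟩ hd
        rw [Real.dist_eq] at this
        simpa using this.le)
      (convex_uIcc U U') left_mem_uIcc right_mem_uIcc
    simp only [Real.norm_eq_abs] at this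
    calc _ = |g U' v' - U' * h U v' - (g U v' - U * h U v')| := by congr 1; ring
      _ ≤ _ := this
  have hsub : Icc v₀ v ⊆ Icc v₀ b := Icc_subset_Icc_right hv.2
  have hmain := abs_sub_le_of_abs_deriv_le_const (C := ε * |U' - U|) hv.1
    (f := fun v' => f U' v' - f U v' - (U' - U) * K U v')
    (f' := fun v' => g U' v' - g U v' - (U' - U) * h U v')
    (fun t ht => ((((hf U' hU' t (hsub ht)).mono hsub).sub ((hf U hU t (hsub ht)).mono hsub)).sub
      (((hK U hU t (hsub ht)).mono hsub).const_mul (U' - U))))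
    (fun t ht => hsmall t (hsub ht))
  simp only [smul_eq_mul, Real.norm_eq_abs] at h1 ⊢
  have h2 : ε * |U' - U| * (v - v₀) ≤ c / 2 * |U' - U| := by
    have : ε * (v - v₀) ≤ c / 2 := by
      rw [hε, div_mul_eq_mul_div, div_le_div_iff₀ (by positivity) (by positivity)]
      nlinarith [hv.1, hv.2]
    nlinarith [abs_nonneg (U' - U)]
  have h3 := abs_le.1 (hmain.trans h2)
  have h4 := abs_le.1 h1
  rw [abs_le]
  constructor <;> linarith [h3.1, h3.2, h4.1, h4.2]

theorem hasFDerivWithinAt_of_partials {f fU fV : ℝ → ℝ → ℝ} {u₀ a v₀ b : ℝ}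
    (hU : ∀ U ∈ Icc u₀ a, ∀ v ∈ Icc v₀ b,
      HasDerivWithinAt (fun U' => f U' v) (fU U v) (Icc u₀ a) U)
    (hV : ∀ U ∈ Icc u₀ a, ∀ v ∈ Icc v₀ b,
      HasDerivWithinAt (fun v' => f U v') (fV U v) (Icc v₀ b) v)
    (hc : ContinuousOn (fun x : ℝ × ℝ => fU x.1 x.2) (Icc u₀ a ×ˢ Icc v₀ b))
    {x : ℝ × ℝ} (hx : x ∈ Icc u₀ a ×ˢ Icc v₀ b) :
    HasFDerivWithinAt (fun x : ℝ × ℝ => f x.1 x.2)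
      (fU x.1 x.2 • ContinuousLinearMap.fst ℝ ℝ ℝ + fV x.1 x.2 • ContinuousLinearMap.snd ℝ ℝ ℝ)
      (Icc u₀ a ×ˢ Icc v₀ b) x := by
  obtain ⟨U, v⟩ := x
  obtain ⟨hxU, hxv⟩ := hx
  simp only at hxU hxv ⊢
  rw [hasFDerivWithinAt_iff_isLittleO, Asymptotics.isLittleO_iff]
  intro c hc0
  have h1 := hV U hxU v hxv
  rw [hasDerivWithinAt_iff_isLittleO, Asymptotics.isLittleO_iff] at h1
  have h2 : Tendsto (fun y : ℝ × ℝ => y.2) (𝓝[Icc u₀ a ×ˢ Icc v₀ b] (U, v)) (𝓝[Icc v₀ b] v) := by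
    refine tendsto_nhdsWithin_iff.2 ⟨?_, ?_⟩
    · exact (continuous_snd.tendsto (U, v)).mono_left nhdsWithin_le_nhds
    · filter_upwards [self_mem_nhdsWithin] with y hy using hy.2
  have h3 := h2.eventually (h1 (half_pos hc0))
  obtain ⟨δ, hδ0, hδ⟩ := Metric.continuousWithinAt_iff.1 (hc (U, v) ⟨hxU, hxv⟩) (c / 2) (half_pos hc0)
  filter_upwards [h3, self_mem_nhdsWithin, mem_nhdsWithin_of_mem_nhds
    (Metric.ball_mem_nhds (U, v) hδ0)] with y hy hmem hball
  obtain ⟨U', v'⟩ := y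
  obtain ⟨hU', hv'⟩ := hmem
  simp only at hU' hv' hy
  have hseg : uIcc U U' ⊆ Icc u₀ a := uIcc_subset_Icc hxU hU'
  have hsm := Convex.norm_image_sub_le_of_norm_hasDerivWithin_le (s := uIcc U U')
      (f := fun s => f s v' - s * fU U v) (f' := fun s => fU s v' - 1 * fU U v) (C := c / 2)
      (fun s hs => ((hU s (hseg hs) v' hv').mono hseg).sub
        (((hasDerivAt_id s).mul_const (fU U v)).hasDerivWithinAt))
      (fun s hs => by
        rw [Metric.mem_ball, Prod.dist_eq, max_lt_iff] at hball
        have hd : dist (s, v') (U, v) < δ := by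
          rw [Prod.dist_eq, max_lt_iff]
          refine ⟨?_, hball.2⟩
          have := abs_sub_left_of_mem_uIcc hs
          have h5 := hball.1
          simp only [Real.dist_eq] at h5 ⊢
          linarith [abs_sub_comm s U]
        have := hδ (x := (s, v')) ⟨hseg hs, hv'⟩ hd
        rw [Real.dist_eq] at this
        simpa using this.le)
      (convex_uIcc U U') left_mem_uIcc right_mem_uIcc
  simp only [Real.norm_eq_abs, smul_eq_mul] at hsm hy
  have e1 : |U' - U| ≤ ‖((U', v') - (U, v) : ℝ × ℝ)‖ := norm_fst_le ((U', v') - (U, v) : ℝ × ℝ)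
  have e2 : |v' - v| ≤ ‖((U', v') - (U, v) : ℝ × ℝ)‖ := norm_snd_le ((U', v') - (U, v) : ℝ × ℝ)
  have h6 := abs_le.1 hsm
  have h7 := abs_le.1 hy
  simp only [add_apply, smul_apply,
    ContinuousLinearMap.coe_fst', ContinuousLinearMap.coe_snd', Prod.fst_sub, Prod.snd_sub,
    smul_eq_mul, Real.norm_eq_abs (f U' v' - _ - _)]
  rw [abs_le]
  constructor <;> nlinarith [h6.1, h6.2, h7.1, h7.2]

theorem uniqueDiffOn_rect {u₀ a v₀ b : ℝ} (ha : u₀ < a) (hb : v₀ < b) :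
    UniqueDiffOn ℝ (Icc u₀ a ×ˢ Icc v₀ b) :=
  (uniqueDiffOn_Icc ha).prod (uniqueDiffOn_Icc hb)

/-- A function on a rectangle is `C^(k+1)` if its partial derivatives are `C^k`. -/
theorem contDiffOn_succ_of_partials {f fU fV : ℝ → ℝ → ℝ} {u₀ a v₀ b : ℝ} (ha : u₀ < a) (hb : v₀ < b)
    {k : ℕ}
    (hU : ∀ U ∈ Icc u₀ a, ∀ v ∈ Icc v₀ b,
      HasDerivWithinAt (fun U' => f U' v) (fU U v) (Icc u₀ a) U)
    (hV : ∀ U ∈ Icc u₀ a, ∀ v ∈ Icc v₀ b,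
      HasDerivWithinAt (fun v' => f U v') (fV U v) (Icc v₀ b) v)
    (hcU : ContDiffOn ℝ k (fun x : ℝ × ℝ => fU x.1 x.2) (Icc u₀ a ×ˢ Icc v₀ b))
    (hcV : ContDiffOn ℝ k (fun x : ℝ × ℝ => fV x.1 x.2) (Icc u₀ a ×ˢ Icc v₀ b)) :
    ContDiffOn ℝ (k + 1 : ℕ) (fun x : ℝ × ℝ => f x.1 x.2) (Icc u₀ a ×ˢ Icc v₀ b) := by
  have : ((k + 1 : ℕ) : WithTop ℕ∞) = (k : WithTop ℕ∞) + 1 := by norm_cast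
  rw [this, contDiffOn_succ_iff_hasFDerivWithinAt_of_uniqueDiffOn (uniqueDiffOn_rect ha hb)]
  refine ⟨fun h => by simp at h, fun x => fU x.1 x.2 • ContinuousLinearMap.fst ℝ ℝ ℝ
    + fV x.1 x.2 • ContinuousLinearMap.snd ℝ ℝ ℝ,
    (hcU.smul contDiffOn_const).add (hcV.smul contDiffOn_const), fun x hx => ?_⟩
  exact hasFDerivWithinAt_of_partials hU hV hcU.continuousOn hx

/-- Restriction to a rectangle and constant extension along the axes. -/
theorem continuous_clip {g : ℝ → ℝ → ℝ} {u₀ a v₀ b : ℝ} (ha : u₀ ≤ a) (hb : v₀ ≤ b)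
    (hg : ContinuousOn (fun x : ℝ × ℝ => g x.1 x.2) (Icc u₀ a ×ˢ Icc v₀ b)) :
    Continuous (fun x : ℝ × ℝ => g (projIcc u₀ a ha x.1) (projIcc v₀ b hb x.2)) :=
  hg.comp_continuous (f := fun x : ℝ × ℝ =>
    ((projIcc u₀ a ha x.1 : ℝ), (projIcc v₀ b hb x.2 : ℝ)))
    (by fun_prop) (fun x => ⟨Subtype.mem _, Subtype.mem _⟩)

theorem integral_eq_clip {g : ℝ → ℝ → ℝ} {u₀ a v₀ b : ℝ} (ha : u₀ ≤ a) (hb : v₀ ≤ b)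
    {U v : ℝ} (hU : U ∈ Icc u₀ a) (hv : v ∈ Icc v₀ b) :
    ∫ s in u₀..U, g s v
      = ∫ s in u₀..U, g (projIcc u₀ a ha s) (projIcc v₀ b hb v) := by
  refine intervalIntegral.integral_congr fun s hs => ?_
  rw [uIcc_of_le hU.1] at hs
  simp only [projIcc_of_mem ha ⟨hs.1, hs.2.trans hU.2⟩, projIcc_of_mem hb hv]

theorem continuousOn_integral {g : ℝ → ℝ → ℝ} {u₀ a v₀ b : ℝ} (ha : u₀ ≤ a) (hb : v₀ ≤ b)
    (hg : ContinuousOn (fun x : ℝ × ℝ => g x.1 x.2) (Icc u₀ a ×ˢ Icc v₀ b)) :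
    ContinuousOn (fun x : ℝ × ℝ => ∫ s in u₀..x.1, g s x.2) (Icc u₀ a ×ˢ Icc v₀ b) := by
  have h1 : Continuous (fun x : ℝ × ℝ => ∫ s in u₀..x.1,
      g (projIcc u₀ a ha s) (projIcc v₀ b hb x.2)) := by
    refine intervalIntegral.continuous_parametric_intervalIntegral_of_continuous
      (f := fun x : ℝ × ℝ => fun s : ℝ => g (projIcc u₀ a ha s) (projIcc v₀ b hb x.2)) ?_
      continuous_fst
    exact (continuous_clip ha hb hg).comp
      (f := fun y : (ℝ × ℝ) × ℝ => (y.2, y.1.2)) (by fun_prop)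
  exact h1.continuousOn.congr fun x hx => integral_eq_clip ha hb hx.1 hx.2

theorem hasDerivWithinAt_integral {g : ℝ → ℝ → ℝ} {u₀ a v₀ b : ℝ}
    (hg : ContinuousOn (fun x : ℝ × ℝ => g x.1 x.2) (Icc u₀ a ×ˢ Icc v₀ b))
    {U v : ℝ} (hU : U ∈ Icc u₀ a) (hv : v ∈ Icc v₀ b) :
    HasDerivWithinAt (fun U' => ∫ s in u₀..U', g s v) (g U v) (Icc u₀ a) U := by
  have ha := hU.1.trans hU.2
  have hb := hv.1.trans hv.2
  have hcont : Continuous (fun s => g (projIcc u₀ a ha s) (projIcc v₀ b hb v)) :=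
    (continuous_clip ha hb hg).comp (f := fun s : ℝ => (s, v)) (by fun_prop)
  have h1 : HasDerivAt (fun U' => ∫ s in u₀..U', g (projIcc u₀ a ha s) (projIcc v₀ b hb v))
      (g (projIcc u₀ a ha U) (projIcc v₀ b hb v)) U :=
    intervalIntegral.integral_hasDerivAt_right (hcont.intervalIntegrable _ _)
      (hcont.stronglyMeasurableAtFilter _ _) hcont.continuousAt
  rw [projIcc_of_mem ha hU, projIcc_of_mem hb hv] at h1
  exact h1.hasDerivWithinAt.congr (fun s hs => by
      rw [integral_eq_clip ha hb hs hv, projIcc_of_mem hb hv])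
    (by rw [integral_eq_clip ha hb hU hv, projIcc_of_mem hb hv])

/-- Integration in one variable preserves `C^k` on a rectangle. -/
theorem contDiffOn_integral {u₀ a v₀ b : ℝ} (ha : u₀ < a) (hb : v₀ < b) (k : ℕ) :
    ∀ {g : ℝ → ℝ → ℝ}, ContDiffOn ℝ k (fun x : ℝ × ℝ => g x.1 x.2) (Icc u₀ a ×ˢ Icc v₀ b) →
    ContDiffOn ℝ k (fun x : ℝ × ℝ => ∫ s in u₀..x.1, g s x.2) (Icc u₀ a ×ˢ Icc v₀ b) := by
  induction k with
  | zero =>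
    intro g hg
    simp only [CharP.cast_eq_zero, contDiffOn_zero] at hg ⊢
    exact continuousOn_integral ha.le hb.le hg
  | succ k ih =>
    intro g hg
    have hR := uniqueDiffOn_rect ha hb
    have hg' : ContDiffOn ℝ ((k : WithTop ℕ∞) + 1) (fun x : ℝ × ℝ => g x.1 x.2)
        (Icc u₀ a ×ˢ Icc v₀ b) := by exact_mod_cast hg
    have hgk : ContDiffOn ℝ k (fun x : ℝ × ℝ => g x.1 x.2) (Icc u₀ a ×ˢ Icc v₀ b) :=
      hg.of_le (by exact_mod_cast k.le_succ)
    rw [contDiffOn_succ_iff_hasFDerivWithinAt_of_uniqueDiffOn hR] at hg'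
    obtain ⟨-, g', hg'c, hg'd⟩ := hg'
    set gv : ℝ → ℝ → ℝ := fun U v => g' (U, v) (0, 1) with hgv
    have hgvc : ContDiffOn ℝ k (fun x : ℝ × ℝ => gv x.1 x.2) (Icc u₀ a ×ˢ Icc v₀ b) :=
      hg'c.clm_apply contDiffOn_const
    have hgvd : ∀ U ∈ Icc u₀ a, ∀ v ∈ Icc v₀ b,
        HasDerivWithinAt (fun v' => g U v') (gv U v) (Icc v₀ b) v := by
      intro U hU v hv
      have h1 := hg'd (U, v) ⟨hU, hv⟩
      have h2 : HasDerivWithinAt (fun v' : ℝ => (U, v')) ((0 : ℝ), (1 : ℝ)) (Icc v₀ b) v :=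
        ((hasDerivAt_const v U).prodMk (hasDerivAt_id v)).hasDerivWithinAt
      exact h1.comp_hasDerivWithinAt v h2 (fun v' hv' => ⟨hU, hv'⟩)
    refine contDiffOn_succ_of_partials ha hb (f := fun U v => ∫ s in u₀..U, g s v)
      (fU := g) (fV := fun U v => ∫ s in u₀..U, gv s v)
      (fun U hU v hv => hasDerivWithinAt_integral hgk.continuousOn hU hv) ?_ hgk (ih hgvc)
    have hsw : ContinuousOn (fun x : ℝ × ℝ => gv x.2 x.1) (Icc v₀ b ×ˢ Icc u₀ a) :=
      hgvc.continuousOn.comp continuous_swap.continuousOn (fun x hx => ⟨hx.2, hx.1⟩)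
    intro U hU v hv
    refine hasDerivWithinAt_of_mixed (f := fun v U => ∫ s in u₀..U, g s v) (g := fun v U => g U v)
      (h := fun v U => gv U v) (K := fun v U => ∫ s in u₀..U, gv s v)
      (fun v hv U hU => hasDerivWithinAt_integral hgk.continuousOn hU hv)
      (fun v hv U hU => hgvd U hU v hv)
      (fun v hv U hU => hasDerivWithinAt_integral hgvc.continuousOn hU hv) hsw
      (fun v hv => by simpa using hasDerivWithinAt_const v (Icc v₀ b) (0 : ℝ)) v hv U hU

/-! ### The characteristic initial value problem for Lipschitz nonlinearities -/

/-- An exponential weight absorbs an integration against its rate. -/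
theorem norm_integral_le_of_exp_weight {E : Type*} [NormedAddCommGroup E] [NormedSpace ℝ E]
    {f : ℝ → E} {a x κ C : ℝ} (hax : a ≤ x)
    (hf : ∀ s ∈ Icc a x, ‖f s‖ ≤ C * κ * Real.exp (κ * (s - a))) (hC : 0 ≤ C) :
    ‖∫ s in a..x, f s‖ ≤ C * Real.exp (κ * (x - a)) := by
  have hd : ∀ s, HasDerivAt (fun s => C * Real.exp (κ * (s - a)))
      (C * κ * Real.exp (κ * (s - a))) s := fun s => by
    have := ((((hasDerivAt_id s).sub_const a).const_mul κ).exp).const_mul C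
    exact this.congr_deriv (by simp only [id]; ring)
  have hc : Continuous fun s => C * κ * Real.exp (κ * (s - a)) := by fun_prop
  calc ‖∫ s in a..x, f s‖ ≤ ∫ s in a..x, C * κ * Real.exp (κ * (s - a)) := by
        refine intervalIntegral.norm_integral_le_of_norm_le hax ?_ (hc.intervalIntegrable _ _)
        exact MeasureTheory.ae_of_all _ fun s hs => hf s (Ioc_subset_Icc_self hs)
    _ = C * Real.exp (κ * (x - a)) - C * Real.exp (κ * (a - a)) :=
        intervalIntegral.integral_eq_sub_of_hasDerivAt (fun s _ => hd s) (hc.intervalIntegrable _ _)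
    _ ≤ _ := by have := Real.exp_pos (κ * (a - a)); nlinarith

section Goursat

variable {E₁ E₂ : Type} [NormedAddCommGroup E₁] [NormedSpace ℝ E₁] [CompleteSpace E₁]
  [NormedAddCommGroup E₂] [NormedSpace ℝ E₂] [CompleteSpace E₂]

/-- Global solvability of the characteristic initial value problem `∂_U w = S(v) F(w,z)`,
`∂_v z = G(w,z)` in integrated form, for Lipschitz `F` and `G`. The solution is the fixed point of
a contraction in a space of functions with an exponential weight. -/
theorem exists_goursat (F : E₁ × E₂ → E₁) (G : E₁ × E₂ → E₂) {L : NNReal} (hF : LipschitzWith L F)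
    (hG : LipschitzWith L G) (S : ℝ → ℝ) (hS : Continuous S) (hSm : Monotone S)
    (hS1 : ∀ v, 0 < S v) (v₀ : ℝ) (w₀ : ℝ → E₁) (z₀ : ℝ → E₂) (hw : Continuous w₀)
    (hz : Continuous z₀) {C : ℝ} (hwC : ∀ v, ‖w₀ v‖ ≤ C) (hzC : ∀ U, ‖z₀ U‖ ≤ C) :
    ∃ (w : ℝ → ℝ → E₁) (z : ℝ → ℝ → E₂), Continuous (fun x : ℝ × ℝ => w x.1 x.2) ∧
      Continuous (fun x : ℝ × ℝ => z x.1 x.2) ∧ ∀ U v, 0 ≤ U → v₀ ≤ v →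
        w U v = w₀ v + ∫ s in (0 : ℝ)..U, S v • F (w s v, z s v) ∧
        z U v = z₀ U + ∫ t in v₀..v, G (w U t, z U t) := by
  -- `l` is positive even when `L = 0`.
  set l : ℝ := L + 1 with hl
  have hl0 : 0 < l := by positivity
  have hLl : (L : ℝ) ≤ l := by rw [hl]; linarith
  have hC0 : 0 ≤ C := (norm_nonneg _).trans (hwC 0)
  -- The unknowns are regarded as functions on the whole plane, constant beyond the boundary.
  set cU : ℝ → ℝ := fun U => max U 0 with hcU
  set cV : ℝ → ℝ := fun v => max v v₀ with hcV
  have hcUc : Continuous cU := by fun_prop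
  have hcVc : Continuous cV := by fun_prop
  -- The weight grows at the rate `4l` in both variables, so each integration gains a factor
  -- `1 / (4l)`.
  set ρ : ℝ × ℝ → ℝ := fun x =>
    Real.exp (4 * l * S (cV x.2) * (cU x.1 - 0)) * Real.exp (4 * l * (cV x.2 - v₀)) with hρ
  have hρc : Continuous ρ := by fun_prop
  have hρ0 : ∀ x, 0 < ρ x := fun x => mul_pos (Real.exp_pos _) (Real.exp_pos _)
  have hρ1 : ∀ x, 1 ≤ ρ x := fun x => by
    refine one_le_mul_of_one_le_of_one_le (Real.one_le_exp ?_) (Real.one_le_exp ?_)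
    · have := hS1 (cV x.2)
      have : 0 ≤ cU x.1 - 0 := by simp [hcU]
      positivity
    · have : 0 ≤ cV x.2 - v₀ := by simp [hcV]
      positivity
  set y₀ : ℝ × ℝ → E₁ × E₂ := fun x => (w₀ (cV x.2), z₀ (cU x.1)) with hy₀
  have hy₀c : Continuous y₀ := by fun_prop
  have hy₀C : ∀ x, ‖y₀ x‖ ≤ C := fun x => by
    simp only [hy₀, Prod.norm_def]
    exact max_le (hwC _) (hzC _)
  -- The unknown is the deviation from the data, divided by `ρ`; it is a bounded function.
  set X := BoundedContinuousFunction (ℝ × ℝ) (E₁ × E₂)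
  set Y : X → ℝ × ℝ → E₁ × E₂ := fun f x => y₀ x + ρ x • f x with hY
  have hYc : ∀ f : X, Continuous (Y f) := fun f => hy₀c.add (hρc.smul f.continuous)
  -- bounds for the two integrals
  have key1 : ∀ (φ : ℝ → E₁) (x : ℝ × ℝ) (A : ℝ), 0 ≤ A →
      (∀ s ∈ Icc 0 (cU x.1), ‖φ s‖ ≤ A * ρ (s, cV x.2)) →
      ‖∫ s in (0 : ℝ)..cU x.1, S (cV x.2) • φ s‖ ≤ A / (4 * l) * ρ x := by
    intro φ x A hA hφ
    have hSx := hS1 (cV x.2)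
    have := norm_integral_le_of_exp_weight (f := fun s => S (cV x.2) • φ s) (a := 0)
      (x := cU x.1) (κ := 4 * l * S (cV x.2))
      (C := A / (4 * l) * Real.exp (4 * l * (cV x.2 - v₀))) (le_max_right _ _)
      (fun s hs => by
        have h1 := hφ s hs
        have e1 : cU s = s := max_eq_left hs.1
        have e2 : cV (cV x.2) = cV x.2 := max_eq_left (le_max_right _ _)
        simp only [hρ, e1, e2] at h1
        rw [norm_smul, Real.norm_of_nonneg hSx.le]
        calc S (cV x.2) * ‖φ s‖ ≤ S (cV x.2) * _ := mul_le_mul_of_nonneg_left h1 hSx.le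
          _ = _ := by field_simp) (by positivity)
    refine this.trans (le_of_eq ?_)
    simp only [hρ]
    ring
  have key2 : ∀ (φ : ℝ → E₂) (x : ℝ × ℝ) (A : ℝ), 0 ≤ A →
      (∀ t ∈ Icc v₀ (cV x.2), ‖φ t‖ ≤ A * ρ (cU x.1, t)) →
      ‖∫ t in v₀..cV x.2, φ t‖ ≤ A / (4 * l) * ρ x := by
    intro φ x A hA hφ
    have := norm_integral_le_of_exp_weight (f := φ) (a := v₀)
      (x := cV x.2) (κ := 4 * l)
      (C := A / (4 * l) * Real.exp (4 * l * S (cV x.2) * (cU x.1 - 0))) (le_max_right _ _)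
      (fun t ht => by
        have h1 := hφ t ht
        have e1 : cU (cU x.1) = cU x.1 := max_eq_left (le_max_right _ _)
        have e2 : cV t = t := max_eq_left ht.1
        have h0 : 0 ≤ cU x.1 - 0 := by simp [hcU]
        simp only [hρ, e1, e2] at h1
        have h3 : Real.exp (4 * l * S t * (cU x.1 - 0))
            ≤ Real.exp (4 * l * S (cV x.2) * (cU x.1 - 0)) := by
          rw [Real.exp_le_exp]
          have := hSm ht.2
          gcongr
        calc ‖φ t‖ ≤ _ := h1
          _ ≤ A * (Real.exp (4 * l * S (cV x.2) * (cU x.1 - 0)) * Real.exp (4 * l * (t - v₀))) := by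
            gcongr
          _ = _ := by field_simp) (by positivity)
    refine this.trans (le_of_eq ?_)
    simp only [hρ]
    ring
  -- the integral operator
  set T₁ : X → ℝ × ℝ → E₁ := fun f x =>
    ∫ s in (0 : ℝ)..cU x.1, S (cV x.2) • F (Y f (s, cV x.2)) with hT₁
  set T₂ : X → ℝ × ℝ → E₂ := fun f x => ∫ t in v₀..cV x.2, G (Y f (cU x.1, t)) with hT₂
  have hT₁c : ∀ f, Continuous (T₁ f) := fun f =>
    intervalIntegral.continuous_parametric_intervalIntegral_of_continuous
      (f := fun x : ℝ × ℝ => fun s : ℝ => S (cV x.2) • F (Y f (s, cV x.2)))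
      (by have := hYc f; have := hF.continuous; fun_prop) (hcUc.comp continuous_fst)
  have hT₂c : ∀ f, Continuous (T₂ f) := fun f =>
    intervalIntegral.continuous_parametric_intervalIntegral_of_continuous
      (f := fun x : ℝ × ℝ => fun t : ℝ => G (Y f (cU x.1, t)))
      (by have := hYc f; have := hG.continuous; fun_prop) (hcVc.comp continuous_snd)
  have hYn : ∀ (f : X) x, ‖Y f x‖ ≤ (C + ‖f‖) * ρ x := fun f x => by
    calc ‖Y f x‖ ≤ ‖y₀ x‖ + ‖ρ x • f x‖ := norm_add_le _ _
      _ ≤ C * ρ x + ‖f‖ * ρ x := by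
        rw [norm_smul, Real.norm_of_nonneg (hρ0 x).le, mul_comm (ρ x)]
        refine add_le_add ((hy₀C x).trans (le_mul_of_one_le_right hC0 (hρ1 x))) ?_
        exact mul_le_mul_of_nonneg_right (f.norm_coe_le_norm x) (hρ0 x).le
      _ = _ := by ring
  have hlin : ∀ {E : Type} [NormedAddCommGroup E] (H : E₁ × E₂ → E), LipschitzWith L H →
      ∀ y, ‖H y‖ ≤ ‖H 0‖ + L * ‖y‖ := fun H hH y => by
    have := hH.dist_le_mul y 0
    rw [dist_eq_norm, dist_zero_right] at this
    calc ‖H y‖ = ‖H 0 + (H y - H 0)‖ := by congr 1; abel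
      _ ≤ _ := (norm_add_le _ _).trans (by gcongr)
  have hbd : ∀ f : X, ∃ B, ∀ x, ‖(ρ x)⁻¹ • (T₁ f x, T₂ f x)‖ ≤ B := by
    intro f
    set A := ‖F 0‖ + ‖G 0‖ + L * (C + ‖f‖) with hA
    have hA0 : 0 ≤ A := by positivity
    refine ⟨A / (4 * l), fun x => ?_⟩
    have hle : ∀ x, ‖F 0‖ + ‖G 0‖ + L * ‖Y f x‖ ≤ A * ρ x := fun x => by
      have h1 := mul_le_mul_of_nonneg_left (hYn f x) L.2
      have h2 : ‖F 0‖ + ‖G 0‖ ≤ (‖F 0‖ + ‖G 0‖) * ρ x :=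
        le_mul_of_one_le_right (by positivity) (hρ1 x)
      calc _ ≤ (‖F 0‖ + ‖G 0‖) * ρ x + L * ((C + ‖f‖) * ρ x) := add_le_add h2 h1
        _ = _ := by rw [hA]; ring
    have h1 := key1 (fun s => F (Y f (s, cV x.2))) x A hA0 (fun s _ =>
      (hlin F hF _).trans (by have := hle (s, cV x.2); have := norm_nonneg (G 0); linarith))
    have h2 := key2 (fun t => G (Y f (cU x.1, t))) x A hA0 (fun t _ =>
      (hlin G hG _).trans (by have := hle (cU x.1, t); have := norm_nonneg (F 0); linarith))
    rw [norm_smul, norm_inv, Real.norm_of_nonneg (hρ0 x).le, inv_mul_le_iff₀ (hρ0 x), Prod.norm_def,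
      mul_comm]
    exact max_le h1 h2
  choose B hB using hbd
  set T : X → X := fun f => BoundedContinuousFunction.ofNormedAddCommGroup
    (fun x => (ρ x)⁻¹ • (T₁ f x, T₂ f x))
    ((hρc.inv₀ fun x => (hρ0 x).ne').smul ((hT₁c f).prodMk (hT₂c f))) (B f) (hB f) with hT
  have hcontr : ContractingWith (1 / 2) T := by
    refine ⟨by norm_num, LipschitzWith.of_dist_le_mul fun f g => ?_⟩
    rw [BoundedContinuousFunction.dist_le (by positivity)]
    intro x
    have hd : ∀ {E : Type} [NormedAddCommGroup E] (H : E₁ × E₂ → E), LipschitzWith L H → ∀ x,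
        ‖H (Y f x) - H (Y g x)‖ ≤ (l * dist f g) * ρ x := fun H hH x => by
      have h1 := hH.dist_le_mul (Y f x) (Y g x)
      rw [dist_eq_norm] at h1
      refine h1.trans ?_
      have h2 : dist (Y f x) (Y g x) ≤ dist f g * ρ x := by
        simp only [hY, dist_add_left]
        rw [dist_smul₀, Real.norm_of_nonneg (hρ0 x).le, mul_comm]
        exact mul_le_mul_of_nonneg_right (BoundedContinuousFunction.dist_coe_le_dist x) (hρ0 x).le
      calc (L : ℝ) * _ ≤ l * (dist f g * ρ x) := by gcongr
        _ = _ := by ring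
    have h1 := key1 (fun s => F (Y f (s, cV x.2)) - F (Y g (s, cV x.2))) x (l * dist f g)
      (by positivity) (fun s _ => hd F hF _)
    have h2 := key2 (fun t => G (Y f (cU x.1, t)) - G (Y g (cU x.1, t))) x (l * dist f g)
      (by positivity) (fun t _ => hd G hG _)
    have e1 : ∫ s in (0 : ℝ)..cU x.1, S (cV x.2) • (F (Y f (s, cV x.2)) - F (Y g (s, cV x.2)))
        = T₁ f x - T₁ g x := by
      simp only [hT₁, smul_sub]
      refine intervalIntegral.integral_sub ?_ ?_ <;> refine Continuous.intervalIntegrable ?_ _ _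
      · have := hYc f; have := hF.continuous; fun_prop
      · have := hYc g; have := hF.continuous; fun_prop
    have e2 : ∫ t in v₀..cV x.2, (G (Y f (cU x.1, t)) - G (Y g (cU x.1, t)))
        = T₂ f x - T₂ g x := by
      simp only [hT₂]
      refine intervalIntegral.integral_sub ?_ ?_ <;> refine Continuous.intervalIntegrable ?_ _ _
      · have := hYc f; have := hG.continuous; fun_prop
      · have := hYc g; have := hG.continuous; fun_prop
    rw [e1] at h1
    rw [e2] at h2
    have e3 : l * dist f g / (4 * l) * ρ x ≤ 1 / 2 * dist f g * ρ x := by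
      have : l * dist f g / (4 * l) = 1 / 4 * dist f g := by field_simp
      rw [this]
      have := mul_nonneg (dist_nonneg.trans (BoundedContinuousFunction.dist_coe_le_dist (f := f) (g := g) x))
        (hρ0 x).le
      linarith
    simp only [hT, BoundedContinuousFunction.coe_ofNormedAddCommGroup]
    rw [dist_smul₀, norm_inv, Real.norm_of_nonneg (hρ0 x).le, inv_mul_le_iff₀ (hρ0 x), dist_eq_norm,
      Prod.mk_sub_mk, Prod.norm_def, mul_comm]
    push_cast
    exact max_le (h1.trans e3) (h2.trans e3)
  set f := hcontr.fixedPoint T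
  have hfix : T f = f := hcontr.fixedPoint_isFixedPt
  have hval : ∀ x, Y f x = y₀ x + (T₁ f x, T₂ f x) := fun x => by
    have h1 : f x = (ρ x)⁻¹ • (T₁ f x, T₂ f x) := by
      conv_lhs => rw [← hfix]
      rfl
    simp only [hY]
    rw [h1, smul_inv_smul₀ (hρ0 x).ne']
  refine ⟨fun U v => (Y f (U, v)).1, fun U v => (Y f (U, v)).2, continuous_fst.comp (hYc f),
    continuous_snd.comp (hYc f), fun U v hU hv => ?_⟩
  have eU : cU U = U := max_eq_left hU
  have eV : cV v = v := max_eq_left hv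
  have h := hval (U, v)
  simp only [hT₁, hT₂, hy₀, eU, eV] at h
  exact ⟨by simpa using congrArg Prod.fst h, by simpa using congrArg Prod.snd h⟩

end Goursat

/-! ### The system in first-order form -/

/-- The unknowns of the system together with their first derivatives, as functions of `(U,v)`:
`ν = ∂_U r`, `ζ = ∂_U φ`, `β = ∂_U log Ω`, `lam = ∂_v r`, `θ = ∂_v φ`, `α = ∂_v log Ω`, where `Ω`
stands for `Ω̂²`. -/
structure Fields where
  r : ℝ → ℝ → ℝ
  Ω : ℝ → ℝ → ℝ
  φ : ℝ → ℝ → ℝ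
  ν : ℝ → ℝ → ℝ
  ζ : ℝ → ℝ → ℝ
  β : ℝ → ℝ → ℝ
  lam : ℝ → ℝ → ℝ
  θ : ℝ → ℝ → ℝ
  α : ℝ → ℝ → ℝ

namespace Fields

/-- The value of `∂_U ∂_v r` prescribed by the wave equation for `r`. -/
noncomputable def N (F : Fields) (U v : ℝ) : ℝ := -F.Ω U v / (4 * F.r U v) - F.ν U v * F.lam U v / F.r U v

/-- The value of `∂_U ∂_v φ` prescribed by the wave equation for `φ`. -/
noncomputable def H (F : Fields) (U v : ℝ) : ℝ := -(F.lam U v * F.ζ U v + F.ν U v * F.θ U v) / F.r U v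

/-- The value of `∂_U ∂_v log Ω` prescribed by the wave equation for `Ω`. -/
noncomputable def A (F : Fields) (U v : ℝ) : ℝ :=
  -2 * F.ζ U v * F.θ U v + 1 / 2 * F.Ω U v / F.r U v ^ 2 + 2 * F.ν U v * F.lam U v / F.r U v ^ 2

/-- The same fields with the two null directions exchanged. -/
def swap (F : Fields) : Fields where
  r v U := F.r U v
  Ω v U := F.Ω U v
  φ v U := F.φ U v
  ν v U := F.lam U v
  ζ v U := F.θ U v
  β v U := F.α U v
  lam v U := F.ν U v
  θ v U := F.ζ U v
  α v U := F.β U v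

theorem N_swap (F : Fields) (U v : ℝ) : F.swap.N v U = F.N U v := by
  simp only [N, swap]; ring

theorem H_swap (F : Fields) (U v : ℝ) : F.swap.H v U = F.H U v := by
  simp only [H, swap]; ring

theorem A_swap (F : Fields) (U v : ℝ) : F.swap.A v U = F.A U v := by
  simp only [A, swap]; ring

end Fields

/-- `C^k` on a closed rectangle. -/
def CkOn (u₀ a v₀ b : ℝ) (k : ℕ) (f : ℝ → ℝ → ℝ) : Prop :=
  ContDiffOn ℝ k (fun x : ℝ × ℝ => f x.1 x.2) (Icc u₀ a ×ˢ Icc v₀ b)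

theorem CkOn.swap {u₀ a v₀ b : ℝ} {k : ℕ} {f : ℝ → ℝ → ℝ} (h : CkOn u₀ a v₀ b k f) :
    CkOn v₀ b u₀ a k (fun v U => f U v) :=
  ContDiffOn.comp (g := fun x : ℝ × ℝ => f x.1 x.2) (f := Prod.swap) h
    (contDiff_snd.prodMk contDiff_fst).contDiffOn (fun _ hx => ⟨hx.2, hx.1⟩)

/-- The equations and data that determine the fields: transport equations for `lam`, `θ`, `α` in
the direction of `U` and for the other unknowns in the direction of `v`. -/
structure IsPreSol (F : Fields) (u₀ a v₀ b : ℝ) : Prop where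
  r_c : CkOn u₀ a v₀ b 0 F.r
  Ω_c : CkOn u₀ a v₀ b 0 F.Ω
  φ_c : CkOn u₀ a v₀ b 0 F.φ
  ν_c : CkOn u₀ a v₀ b 0 F.ν
  ζ_c : CkOn u₀ a v₀ b 0 F.ζ
  β_c : CkOn u₀ a v₀ b 0 F.β
  lam_c : CkOn u₀ a v₀ b 0 F.lam
  θ_c : CkOn u₀ a v₀ b 0 F.θ
  α_c : CkOn u₀ a v₀ b 0 F.α
  r_pos : ∀ U ∈ Icc u₀ a, ∀ v ∈ Icc v₀ b, 0 < F.r U v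
  Ω_pos : ∀ U ∈ Icc u₀ a, ∀ v ∈ Icc v₀ b, 0 < F.Ω U v
  r_v : ∀ U ∈ Icc u₀ a, ∀ v ∈ Icc v₀ b, HasDerivWithinAt (fun v => F.r U v) (F.lam U v) (Icc v₀ b) v
  φ_v : ∀ U ∈ Icc u₀ a, ∀ v ∈ Icc v₀ b, HasDerivWithinAt (fun v => F.φ U v) (F.θ U v) (Icc v₀ b) v
  Ω_v : ∀ U ∈ Icc u₀ a, ∀ v ∈ Icc v₀ b,
    HasDerivWithinAt (fun v => F.Ω U v) (F.α U v * F.Ω U v) (Icc v₀ b) v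
  ν_v : ∀ U ∈ Icc u₀ a, ∀ v ∈ Icc v₀ b, HasDerivWithinAt (fun v => F.ν U v) (F.N U v) (Icc v₀ b) v
  ζ_v : ∀ U ∈ Icc u₀ a, ∀ v ∈ Icc v₀ b, HasDerivWithinAt (fun v => F.ζ U v) (F.H U v) (Icc v₀ b) v
  β_v : ∀ U ∈ Icc u₀ a, ∀ v ∈ Icc v₀ b, HasDerivWithinAt (fun v => F.β U v) (F.A U v) (Icc v₀ b) v
  lam_U : ∀ U ∈ Icc u₀ a, ∀ v ∈ Icc v₀ b, HasDerivWithinAt (fun U => F.lam U v) (F.N U v) (Icc u₀ a) U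
  θ_U : ∀ U ∈ Icc u₀ a, ∀ v ∈ Icc v₀ b, HasDerivWithinAt (fun U => F.θ U v) (F.H U v) (Icc u₀ a) U
  α_U : ∀ U ∈ Icc u₀ a, ∀ v ∈ Icc v₀ b, HasDerivWithinAt (fun U => F.α U v) (F.A U v) (Icc u₀ a) U
  r_U₀ : ∀ U ∈ Icc u₀ a, HasDerivWithinAt (fun U => F.r U v₀) (F.ν U v₀) (Icc u₀ a) U
  φ_U₀ : ∀ U ∈ Icc u₀ a, HasDerivWithinAt (fun U => F.φ U v₀) (F.ζ U v₀) (Icc u₀ a) U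
  Ω_U₀ : ∀ U ∈ Icc u₀ a, HasDerivWithinAt (fun U => F.Ω U v₀) (F.β U v₀ * F.Ω U v₀) (Icc u₀ a) U
  ν_U₀ : ∀ U ∈ Icc u₀ a, HasDerivWithinAt (fun U => F.ν U v₀)
    (F.β U v₀ * F.ν U v₀ - F.r U v₀ * F.ζ U v₀ ^ 2) (Icc u₀ a) U
  lam_v₀ : ∀ v ∈ Icc v₀ b, HasDerivWithinAt (fun v => F.lam u₀ v)
    (F.α u₀ v * F.lam u₀ v - F.r u₀ v * F.θ u₀ v ^ 2) (Icc v₀ b) v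

/-- The full system with both Raychaudhuri equations, symmetric in the two null directions. -/
structure IsCharSol (F : Fields) (u₀ a v₀ b : ℝ) : Prop where
  r_c : CkOn u₀ a v₀ b 0 F.r
  Ω_c : CkOn u₀ a v₀ b 0 F.Ω
  φ_c : CkOn u₀ a v₀ b 0 F.φ
  ν_c : CkOn u₀ a v₀ b 0 F.ν
  ζ_c : CkOn u₀ a v₀ b 0 F.ζ
  β_c : CkOn u₀ a v₀ b 0 F.β
  lam_c : CkOn u₀ a v₀ b 0 F.lam
  θ_c : CkOn u₀ a v₀ b 0 F.θ
  α_c : CkOn u₀ a v₀ b 0 F.α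
  r_pos : ∀ U ∈ Icc u₀ a, ∀ v ∈ Icc v₀ b, 0 < F.r U v
  Ω_pos : ∀ U ∈ Icc u₀ a, ∀ v ∈ Icc v₀ b, 0 < F.Ω U v
  r_v : ∀ U ∈ Icc u₀ a, ∀ v ∈ Icc v₀ b, HasDerivWithinAt (fun v => F.r U v) (F.lam U v) (Icc v₀ b) v
  φ_v : ∀ U ∈ Icc u₀ a, ∀ v ∈ Icc v₀ b, HasDerivWithinAt (fun v => F.φ U v) (F.θ U v) (Icc v₀ b) v
  Ω_v : ∀ U ∈ Icc u₀ a, ∀ v ∈ Icc v₀ b,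
    HasDerivWithinAt (fun v => F.Ω U v) (F.α U v * F.Ω U v) (Icc v₀ b) v
  ν_v : ∀ U ∈ Icc u₀ a, ∀ v ∈ Icc v₀ b, HasDerivWithinAt (fun v => F.ν U v) (F.N U v) (Icc v₀ b) v
  ζ_v : ∀ U ∈ Icc u₀ a, ∀ v ∈ Icc v₀ b, HasDerivWithinAt (fun v => F.ζ U v) (F.H U v) (Icc v₀ b) v
  β_v : ∀ U ∈ Icc u₀ a, ∀ v ∈ Icc v₀ b, HasDerivWithinAt (fun v => F.β U v) (F.A U v) (Icc v₀ b) v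
  r_U : ∀ U ∈ Icc u₀ a, ∀ v ∈ Icc v₀ b, HasDerivWithinAt (fun U => F.r U v) (F.ν U v) (Icc u₀ a) U
  φ_U : ∀ U ∈ Icc u₀ a, ∀ v ∈ Icc v₀ b, HasDerivWithinAt (fun U => F.φ U v) (F.ζ U v) (Icc u₀ a) U
  Ω_U : ∀ U ∈ Icc u₀ a, ∀ v ∈ Icc v₀ b,
    HasDerivWithinAt (fun U => F.Ω U v) (F.β U v * F.Ω U v) (Icc u₀ a) U
  lam_U : ∀ U ∈ Icc u₀ a, ∀ v ∈ Icc v₀ b, HasDerivWithinAt (fun U => F.lam U v) (F.N U v) (Icc u₀ a) U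
  θ_U : ∀ U ∈ Icc u₀ a, ∀ v ∈ Icc v₀ b, HasDerivWithinAt (fun U => F.θ U v) (F.H U v) (Icc u₀ a) U
  α_U : ∀ U ∈ Icc u₀ a, ∀ v ∈ Icc v₀ b, HasDerivWithinAt (fun U => F.α U v) (F.A U v) (Icc u₀ a) U
  ν_U : ∀ U ∈ Icc u₀ a, ∀ v ∈ Icc v₀ b, HasDerivWithinAt (fun U => F.ν U v)
    (F.β U v * F.ν U v - F.r U v * F.ζ U v ^ 2) (Icc u₀ a) U
  lam_v : ∀ U ∈ Icc u₀ a, ∀ v ∈ Icc v₀ b, HasDerivWithinAt (fun v => F.lam U v)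
    (F.α U v * F.lam U v - F.r U v * F.θ U v ^ 2) (Icc v₀ b) v

namespace IsCharSol

variable {F : Fields} {u₀ a v₀ b : ℝ}

theorem swap (h : IsCharSol F u₀ a v₀ b) : IsCharSol F.swap v₀ b u₀ a where
  r_c := h.r_c.swap
  Ω_c := h.Ω_c.swap
  φ_c := h.φ_c.swap
  ν_c := h.lam_c.swap
  ζ_c := h.θ_c.swap
  β_c := h.α_c.swap
  lam_c := h.ν_c.swap
  θ_c := h.ζ_c.swap
  α_c := h.β_c.swap
  r_pos v hv U hU := h.r_pos U hU v hv
  Ω_pos v hv U hU := h.Ω_pos U hU v hv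
  r_v v hv U hU := h.r_U U hU v hv
  φ_v v hv U hU := h.φ_U U hU v hv
  Ω_v v hv U hU := h.Ω_U U hU v hv
  ν_v v hv U hU := by rw [Fields.N_swap]; exact h.lam_U U hU v hv
  ζ_v v hv U hU := by rw [Fields.H_swap]; exact h.θ_U U hU v hv
  β_v v hv U hU := by rw [Fields.A_swap]; exact h.α_U U hU v hv
  r_U v hv U hU := h.r_v U hU v hv
  φ_U v hv U hU := h.φ_v U hU v hv
  Ω_U v hv U hU := h.Ω_v U hU v hv
  lam_U v hv U hU := by rw [Fields.N_swap]; exact h.ν_v U hU v hv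
  θ_U v hv U hU := by rw [Fields.H_swap]; exact h.ζ_v U hU v hv
  α_U v hv U hU := by rw [Fields.A_swap]; exact h.β_v U hU v hv
  ν_U v hv U hU := h.lam_v U hU v hv
  lam_v v hv U hU := h.ν_U U hU v hv

/-- The equation `∂_v (r ∂_U r) = -Ω/4`. -/
theorem rν_v (h : IsCharSol F u₀ a v₀ b) {U v : ℝ} (hU : U ∈ Icc u₀ a) (hv : v ∈ Icc v₀ b) :
    HasDerivWithinAt (fun v => F.r U v * F.ν U v) (-(1 / 4) * F.Ω U v) (Icc v₀ b) v := by
  have hr := (h.r_pos U hU v hv).ne'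
  refine ((h.r_v U hU v hv).mul (h.ν_v U hU v hv)).congr_deriv ?_
  simp only [Fields.N]; field_simp; ring

theorem rlam_U (h : IsCharSol F u₀ a v₀ b) {U v : ℝ} (hU : U ∈ Icc u₀ a) (hv : v ∈ Icc v₀ b) :
    HasDerivWithinAt (fun U => F.r U v * F.lam U v) (-(1 / 4) * F.Ω U v) (Icc u₀ a) U :=
  h.swap.rν_v hv hU

theorem rζ_v (h : IsCharSol F u₀ a v₀ b) {U v : ℝ} (hU : U ∈ Icc u₀ a) (hv : v ∈ Icc v₀ b) :
    HasDerivWithinAt (fun v => F.r U v * F.ζ U v) (-F.ν U v * F.θ U v) (Icc v₀ b) v := by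
  have hr := (h.r_pos U hU v hv).ne'
  refine ((h.r_v U hU v hv).mul (h.ζ_v U hU v hv)).congr_deriv ?_
  simp only [Fields.H]; field_simp; ring

theorem rθ_U (h : IsCharSol F u₀ a v₀ b) {U v : ℝ} (hU : U ∈ Icc u₀ a) (hv : v ∈ Icc v₀ b) :
    HasDerivWithinAt (fun U => F.r U v * F.θ U v) (-F.lam U v * F.ζ U v) (Icc u₀ a) U :=
  h.swap.rζ_v hv hU

theorem logΩ_v (h : IsCharSol F u₀ a v₀ b) {U v : ℝ} (hU : U ∈ Icc u₀ a) (hv : v ∈ Icc v₀ b) :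
    HasDerivWithinAt (fun v => Real.log (F.Ω U v)) (F.α U v) (Icc v₀ b) v := by
  have hΩ := (h.Ω_pos U hU v hv).ne'
  exact ((h.Ω_v U hU v hv).log hΩ).congr_deriv (by field_simp)

theorem logΩ_U (h : IsCharSol F u₀ a v₀ b) {U v : ℝ} (hU : U ∈ Icc u₀ a) (hv : v ∈ Icc v₀ b) :
    HasDerivWithinAt (fun U => Real.log (F.Ω U v)) (F.β U v) (Icc u₀ a) U :=
  h.swap.logΩ_v hv hU

theorem mono (h : IsCharSol F u₀ a v₀ b) {a' b' : ℝ} (ha : a' ≤ a) (hb : b' ≤ b) :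
    IsCharSol F u₀ a' v₀ b' := by
  have hA : Icc u₀ a' ⊆ Icc u₀ a := Icc_subset_Icc_right ha
  have hB : Icc v₀ b' ⊆ Icc v₀ b := Icc_subset_Icc_right hb
  have hAB := prod_mono hA hB
  exact
  { r_c := ContDiffOn.mono h.r_c hAB
    Ω_c := ContDiffOn.mono h.Ω_c hAB
    φ_c := ContDiffOn.mono h.φ_c hAB
    ν_c := ContDiffOn.mono h.ν_c hAB
    ζ_c := ContDiffOn.mono h.ζ_c hAB
    β_c := ContDiffOn.mono h.β_c hAB
    lam_c := ContDiffOn.mono h.lam_c hAB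
    θ_c := ContDiffOn.mono h.θ_c hAB
    α_c := ContDiffOn.mono h.α_c hAB
    r_pos := fun U hU v hv => h.r_pos U (hA hU) v (hB hv)
    Ω_pos := fun U hU v hv => h.Ω_pos U (hA hU) v (hB hv)
    r_v := fun U hU v hv => (h.r_v U (hA hU) v (hB hv)).mono hB
    φ_v := fun U hU v hv => (h.φ_v U (hA hU) v (hB hv)).mono hB
    Ω_v := fun U hU v hv => (h.Ω_v U (hA hU) v (hB hv)).mono hB
    ν_v := fun U hU v hv => (h.ν_v U (hA hU) v (hB hv)).mono hB
    ζ_v := fun U hU v hv => (h.ζ_v U (hA hU) v (hB hv)).mono hB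
    β_v := fun U hU v hv => (h.β_v U (hA hU) v (hB hv)).mono hB
    lam_v := fun U hU v hv => (h.lam_v U (hA hU) v (hB hv)).mono hB
    r_U := fun U hU v hv => (h.r_U U (hA hU) v (hB hv)).mono hA
    φ_U := fun U hU v hv => (h.φ_U U (hA hU) v (hB hv)).mono hA
    Ω_U := fun U hU v hv => (h.Ω_U U (hA hU) v (hB hv)).mono hA
    ν_U := fun U hU v hv => (h.ν_U U (hA hU) v (hB hv)).mono hA
    lam_U := fun U hU v hv => (h.lam_U U (hA hU) v (hB hv)).mono hA
    θ_U := fun U hU v hv => (h.θ_U U (hA hU) v (hB hv)).mono hA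
    α_U := fun U hU v hv => (h.α_U U (hA hU) v (hB hv)).mono hA }

end IsCharSol

theorem CkOn.continuousOn {u₀ a v₀ b : ℝ} {k : ℕ} {f : ℝ → ℝ → ℝ} (h : CkOn u₀ a v₀ b k f) :
    ContinuousOn (fun x : ℝ × ℝ => f x.1 x.2) (Icc u₀ a ×ˢ Icc v₀ b) := ContDiffOn.continuousOn h

theorem contDiffOn_N {F : Fields} {S : Set (ℝ × ℝ)} {k : ℕ}
    (hr : ContDiffOn ℝ k (fun x : ℝ × ℝ => F.r x.1 x.2) S)
    (hΩ : ContDiffOn ℝ k (fun x : ℝ × ℝ => F.Ω x.1 x.2) S)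
    (hν : ContDiffOn ℝ k (fun x : ℝ × ℝ => F.ν x.1 x.2) S)
    (hl : ContDiffOn ℝ k (fun x : ℝ × ℝ => F.lam x.1 x.2) S)
    (h0 : ∀ x ∈ S, 0 < F.r x.1 x.2) : ContDiffOn ℝ k (fun x : ℝ × ℝ => F.N x.1 x.2) S := by
  simp only [Fields.N]
  have h4 : ∀ x ∈ S, 4 * F.r x.1 x.2 ≠ 0 := fun x hx => by have := h0 x hx; positivity
  exact (hΩ.neg.div (contDiffOn_const.mul hr) h4).sub
    ((hν.mul hl).div hr fun x hx => (h0 x hx).ne')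

theorem contDiffOn_H {F : Fields} {S : Set (ℝ × ℝ)} {k : ℕ}
    (hr : ContDiffOn ℝ k (fun x : ℝ × ℝ => F.r x.1 x.2) S)
    (hζ : ContDiffOn ℝ k (fun x : ℝ × ℝ => F.ζ x.1 x.2) S)
    (hθ : ContDiffOn ℝ k (fun x : ℝ × ℝ => F.θ x.1 x.2) S)
    (hν : ContDiffOn ℝ k (fun x : ℝ × ℝ => F.ν x.1 x.2) S)
    (hl : ContDiffOn ℝ k (fun x : ℝ × ℝ => F.lam x.1 x.2) S)
    (h0 : ∀ x ∈ S, 0 < F.r x.1 x.2) : ContDiffOn ℝ k (fun x : ℝ × ℝ => F.H x.1 x.2) S := by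
  simp only [Fields.H]
  exact ((hl.mul hζ).add (hν.mul hθ)).neg.div hr fun x hx => (h0 x hx).ne'

theorem contDiffOn_A {F : Fields} {S : Set (ℝ × ℝ)} {k : ℕ}
    (hr : ContDiffOn ℝ k (fun x : ℝ × ℝ => F.r x.1 x.2) S)
    (hΩ : ContDiffOn ℝ k (fun x : ℝ × ℝ => F.Ω x.1 x.2) S)
    (hζ : ContDiffOn ℝ k (fun x : ℝ × ℝ => F.ζ x.1 x.2) S)
    (hθ : ContDiffOn ℝ k (fun x : ℝ × ℝ => F.θ x.1 x.2) S)
    (hν : ContDiffOn ℝ k (fun x : ℝ × ℝ => F.ν x.1 x.2) S)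
    (hl : ContDiffOn ℝ k (fun x : ℝ × ℝ => F.lam x.1 x.2) S)
    (h0 : ∀ x ∈ S, 0 < F.r x.1 x.2) : ContDiffOn ℝ k (fun x : ℝ × ℝ => F.A x.1 x.2) S := by
  simp only [Fields.A]
  have h2 : ∀ x ∈ S, F.r x.1 x.2 ^ 2 ≠ 0 := fun x hx => by have := h0 x hx; positivity
  exact (((contDiffOn_const.mul hζ).mul hθ).add
    ((contDiffOn_const.mul hΩ).div (hr.pow 2) h2)).add
    (((contDiffOn_const.mul hν).mul hl).div (hr.pow 2) h2)

namespace IsPreSol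

variable {F : Fields} {u₀ a v₀ b : ℝ}

theorem rectPos (h : IsPreSol F u₀ a v₀ b) : ∀ x ∈ Icc u₀ a ×ˢ Icc v₀ b, 0 < F.r x.1 x.2 :=
  fun x hx => h.r_pos x.1 hx.1 x.2 hx.2

/-- Propagation of the constraints. The Raychaudhuri equation in `U` holds on `v = v₀`; it holds
everywhere because `∂_v (ν² + r (β ν - r ζ²)) = -β Ω / 4 = ∂_U ∂_v (r ν)`. -/
theorem isCharSol (h : IsPreSol F u₀ a v₀ b) (ha : u₀ ≤ a) (hb : v₀ ≤ b) :
    IsCharSol F u₀ a v₀ b := by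
  have hu₀ : u₀ ∈ Icc u₀ a := left_mem_Icc.2 ha
  have hv₀ : v₀ ∈ Icc v₀ b := left_mem_Icc.2 hb
  have hcN : ContinuousOn (fun x : ℝ × ℝ => F.N x.1 x.2) (Icc u₀ a ×ˢ Icc v₀ b) :=
    (contDiffOn_N h.r_c h.Ω_c h.ν_c h.lam_c h.rectPos).continuousOn
  have hcH : ContinuousOn (fun x : ℝ × ℝ => F.H x.1 x.2) (Icc u₀ a ×ˢ Icc v₀ b) :=
    (contDiffOn_H h.r_c h.ζ_c h.θ_c h.ν_c h.lam_c h.rectPos).continuousOn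
  have hcA : ContinuousOn (fun x : ℝ × ℝ => F.A x.1 x.2) (Icc u₀ a ×ˢ Icc v₀ b) :=
    (contDiffOn_A h.r_c h.Ω_c h.ζ_c h.θ_c h.ν_c h.lam_c h.rectPos).continuousOn
  -- `∂_U r = ν` and `∂_U φ = ζ` hold on `v = v₀` and propagate by the equality of mixed derivatives.
  have hrU := hasDerivWithinAt_of_mixed h.r_v h.lam_U h.ν_v hcN h.r_U₀
  have hφU := hasDerivWithinAt_of_mixed h.φ_v h.θ_U h.ζ_v hcH h.φ_U₀
  have hΩU : ∀ U ∈ Icc u₀ a, ∀ v ∈ Icc v₀ b,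
      HasDerivWithinAt (fun U => F.Ω U v) (F.β U v * F.Ω U v) (Icc u₀ a) U := by
    have hlog := hasDerivWithinAt_of_mixed (f := fun U v => Real.log (F.Ω U v)) (g := F.α)
      (h := F.A) (K := F.β) (fun U hU v hv =>
        ((h.Ω_v U hU v hv).log (h.Ω_pos U hU v hv).ne').congr_deriv
          (by have := (h.Ω_pos U hU v hv).ne'; field_simp)) h.α_U h.β_v hcA
      (fun U hU => ((h.Ω_U₀ U hU).log (h.Ω_pos U hU v₀ hv₀).ne').congr_deriv
          (by have := (h.Ω_pos U hU v₀ hv₀).ne'; field_simp))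
    intro U hU v hv
    have h1 := (hlog U hU v hv).exp
    rw [Real.exp_log (h.Ω_pos U hU v hv), mul_comm] at h1
    exact h1.congr (fun s hs => (Real.exp_log (h.Ω_pos s hs v hv)).symm)
      (Real.exp_log (h.Ω_pos U hU v hv)).symm
  have hνU : ∀ U ∈ Icc u₀ a, ∀ v ∈ Icc v₀ b, HasDerivWithinAt (fun U => F.ν U v)
      (F.β U v * F.ν U v - F.r U v * F.ζ U v ^ 2) (Icc u₀ a) U := by
    -- The Raychaudhuri equation in `U`, from the mixed derivative of `r ν`.
    have hrν := hasDerivWithinAt_of_mixed (f := fun U v => F.r U v * F.ν U v)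
      (g := fun U v => -(1 / 4) * F.Ω U v) (h := fun U v => -(1 / 4) * (F.β U v * F.Ω U v))
      (K := fun U v => F.ν U v ^ 2 + F.r U v * (F.β U v * F.ν U v - F.r U v * F.ζ U v ^ 2))
      (fun U hU v hv => ((h.r_v U hU v hv).mul (h.ν_v U hU v hv)).congr_deriv (by
        have hr := (h.r_pos U hU v hv).ne'
        simp only [Fields.N]; field_simp; ring))
      (fun U hU v hv => (hΩU U hU v hv).const_mul _)
      (fun U hU v hv => (((h.ν_v U hU v hv).pow 2).add ((h.r_v U hU v hv).mul
        (((h.β_v U hU v hv).mul (h.ν_v U hU v hv)).sub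
          ((h.r_v U hU v hv).mul ((h.ζ_v U hU v hv).pow 2))))).congr_deriv (by
        have hr := (h.r_pos U hU v hv).ne'
        simp only [Fields.N, Fields.H, Fields.A, Pi.mul_apply, Pi.pow_apply, Pi.sub_apply]
        field_simp; ring))
      ((continuousOn_const).mul (h.β_c.continuousOn.mul h.Ω_c.continuousOn))
      (fun U hU => ((h.r_U₀ U hU).mul (h.ν_U₀ U hU)).congr_deriv (by ring))
    intro U hU v hv
    have hr := (h.r_pos U hU v hv).ne'
    refine (((hrν U hU v hv).div (hrU U hU v hv) hr).congr_of_eventuallyEq_of_mem ?_ hU).congr_deriv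
      (by field_simp; ring)
    filter_upwards [self_mem_nhdsWithin] with s hs
    have hr := (h.r_pos s hs v hv).ne'
    simp only [Pi.div_apply]; field_simp
  have hlv : ∀ v ∈ Icc v₀ b, ∀ U ∈ Icc u₀ a, HasDerivWithinAt (fun v => F.lam U v)
      (F.α U v * F.lam U v - F.r U v * F.θ U v ^ 2) (Icc v₀ b) v := by
    -- The Raychaudhuri equation in `v`, with the roles of `U` and `v` exchanged.
    have hrl := hasDerivWithinAt_of_mixed (f := fun v U => F.r U v * F.lam U v)
      (g := fun v U => -(1 / 4) * F.Ω U v) (h := fun v U => -(1 / 4) * (F.α U v * F.Ω U v))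
      (K := fun v U => F.lam U v ^ 2 + F.r U v * (F.α U v * F.lam U v - F.r U v * F.θ U v ^ 2))
      (fun v hv U hU => ((hrU U hU v hv).mul (h.lam_U U hU v hv)).congr_deriv (by
        have hr := (h.r_pos U hU v hv).ne'
        simp only [Fields.N]; field_simp; ring))
      (fun v hv U hU => (h.Ω_v U hU v hv).const_mul _)
      (fun v hv U hU => (((h.lam_U U hU v hv).pow 2).add ((hrU U hU v hv).mul
        (((h.α_U U hU v hv).mul (h.lam_U U hU v hv)).sub
          ((hrU U hU v hv).mul ((h.θ_U U hU v hv).pow 2))))).congr_deriv (by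
        have hr := (h.r_pos U hU v hv).ne'
        simp only [Fields.N, Fields.H, Fields.A, Pi.mul_apply, Pi.pow_apply, Pi.sub_apply]
        field_simp; ring))
      ((continuousOn_const).mul (h.α_c.swap.continuousOn.mul h.Ω_c.swap.continuousOn))
      (fun v hv => ((h.r_v u₀ hu₀ v hv).mul (h.lam_v₀ v hv)).congr_deriv (by ring))
    intro v hv U hU
    have hr := (h.r_pos U hU v hv).ne'
    refine (((hrl v hv U hU).div (h.r_v U hU v hv) hr).congr_of_eventuallyEq_of_mem
      ?_ hv).congr_deriv (by field_simp; ring)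
    filter_upwards [self_mem_nhdsWithin] with s hs
    have hr := (h.r_pos U hU s hs).ne'
    simp only [Pi.div_apply]; field_simp
  exact
  { r_c := h.r_c, Ω_c := h.Ω_c, φ_c := h.φ_c, ν_c := h.ν_c, ζ_c := h.ζ_c, β_c := h.β_c
    lam_c := h.lam_c, θ_c := h.θ_c, α_c := h.α_c, r_pos := h.r_pos, Ω_pos := h.Ω_pos
    r_v := h.r_v, φ_v := h.φ_v, Ω_v := h.Ω_v, ν_v := h.ν_v, ζ_v := h.ζ_v, β_v := h.β_v
    r_U := hrU, φ_U := hφU, Ω_U := hΩU, lam_U := h.lam_U, θ_U := h.θ_U, α_U := h.α_U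
    ν_U := hνU, lam_v := fun U hU v hv => hlv v hv U hU }

end IsPreSol

namespace IsCharSol

variable {F : Fields} {u₀ a v₀ b : ℝ}

theorem rectPos (h : IsCharSol F u₀ a v₀ b) : ∀ x ∈ Icc u₀ a ×ˢ Icc v₀ b, 0 < F.r x.1 x.2 :=
  fun x hx => h.r_pos x.1 hx.1 x.2 hx.2

/-- Gain of a derivative for `θ`: the equation `∂_U (r θ) = -lam ζ` can be differentiated in `v`
without using a `v`-derivative of `θ`. -/
theorem ckOn_succ_θ (h : IsCharSol F u₀ a v₀ b) (ha : u₀ < a) (hb : v₀ < b) {k : ℕ}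
    (hr : CkOn u₀ a v₀ b (k + 1) F.r) (hζ : CkOn u₀ a v₀ b k F.ζ)
    (hν : CkOn u₀ a v₀ b k F.ν) (hl : CkOn u₀ a v₀ b k F.lam) (hθ : CkOn u₀ a v₀ b k F.θ)
    (hα : CkOn u₀ a v₀ b k F.α)
    (h0 : ContDiffOn ℝ (k + 1 : ℕ) (fun v => F.r u₀ v * F.θ u₀ v) (Icc v₀ b)) :
    CkOn u₀ a v₀ b (k + 1) F.θ := by
  have hu₀ : u₀ ∈ Icc u₀ a := left_mem_Icc.2 ha.le
  have hr' : CkOn u₀ a v₀ b k F.r := ContDiffOn.of_le hr (by exact_mod_cast k.le_succ)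
  set T0' := derivWithin (fun v => F.r u₀ v * F.θ u₀ v) (Icc v₀ b) with hT0'
  have hT0d : ∀ v ∈ Icc v₀ b, HasDerivWithinAt (fun v => F.r u₀ v * F.θ u₀ v) (T0' v)
      (Icc v₀ b) v := fun v hv =>
    ((h0.differentiableOn (by simp)) v hv).hasDerivWithinAt
  have hT0c : ContDiffOn ℝ k T0' (Icc v₀ b) :=
    h0.derivWithin (uniqueDiffOn_Icc hb) (by norm_cast)
  set G : ℝ → ℝ → ℝ := fun U v => -((F.α U v * F.lam U v - F.r U v * F.θ U v ^ 2) * F.ζ U v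
    + F.lam U v * F.H U v) with hG
  have hGk : CkOn u₀ a v₀ b k G :=
    ((((hα.mul hl).sub (hr'.mul (hθ.pow 2))).mul hζ).add
      (hl.mul (contDiffOn_H hr' hζ hθ hν hl h.rectPos))).neg
  set K : ℝ → ℝ → ℝ := fun U v => T0' v + ∫ s in u₀..U, G s v with hK
  have hKk : CkOn u₀ a v₀ b k K :=
    ContDiffOn.add (hT0c.comp (f := Prod.snd) contDiff_snd.contDiffOn (fun x hx => hx.2))
      (contDiffOn_integral ha hb k hGk)
  have hTv := hasDerivWithinAt_of_mixed (f := fun v U => F.r U v * F.θ U v)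
    (g := fun v U => -F.lam U v * F.ζ U v) (h := fun v U => G U v) (K := fun v U => K U v)
    (fun v hv U hU => h.rθ_U hU hv)
    (fun v hv U hU => ((h.lam_v U hU v hv).neg.mul (h.ζ_v U hU v hv)).congr_deriv (by
      simp only [hG, Pi.neg_apply]; ring))
    (fun v hv U hU => (hasDerivWithinAt_integral hGk.continuousOn hU hv).const_add (T0' v))
    hGk.swap.continuousOn (fun v hv => (hT0d v hv).congr_deriv (by simp [hK]))
  have hT : CkOn u₀ a v₀ b (k + 1) (fun U v => F.r U v * F.θ U v) :=
    contDiffOn_succ_of_partials ha hb (fun U hU v hv => h.rθ_U hU hv)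
      (fun U hU v hv => hTv v hv U hU) (hl.neg.mul hζ) hKk
  refine ContDiffOn.congr (ContDiffOn.div hT hr fun x hx => (h.rectPos x hx).ne') fun x hx => ?_
  have := (h.rectPos x hx).ne'
  simp only [Pi.div_apply]
  field_simp

theorem ckOn_α (h : IsCharSol F u₀ a v₀ b) (ha : u₀ < a) (hb : v₀ < b) {k : ℕ}
    (hA : CkOn u₀ a v₀ b k F.A) (h0 : ContDiffOn ℝ k (fun v => F.α u₀ v) (Icc v₀ b)) :
    CkOn u₀ a v₀ b k F.α := by
  have h1 : CkOn u₀ a v₀ b k (fun U v => F.α u₀ v + ∫ s in u₀..U, F.A s v) :=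
    ContDiffOn.add (h0.comp (f := Prod.snd) contDiff_snd.contDiffOn (fun x hx => hx.2))
      (contDiffOn_integral ha hb k hA)
  refine ContDiffOn.congr h1 fun x hx => ?_
  obtain ⟨U, v⟩ := x
  obtain ⟨hU, hv⟩ := hx
  simp only at hU hv ⊢
  have hsub : Icc u₀ U ⊆ Icc u₀ a := Icc_subset_Icc_right hU.2
  have := abs_sub_le_of_abs_deriv_le_const (C := 0) hU.1
    (f := fun U => F.α U v - ∫ s in u₀..U, F.A s v)
    (fun s hs => (((h.α_U s (hsub hs) v hv).mono hsub).sub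
      ((hasDerivWithinAt_integral hA.continuousOn (hsub hs) hv).mono hsub)))
    (fun s hs => by simp)
  simp only [intervalIntegral.integral_same, zero_mul, abs_nonpos_iff] at this
  linarith

/-- A solution with smooth data is smooth. -/
theorem ckOn_all (h : IsCharSol F u₀ a v₀ b) (ha : u₀ < a) (hb : v₀ < b)
    (hrθ : ContDiffOn ℝ ∞ (fun v => F.r u₀ v * F.θ u₀ v) (Icc v₀ b))
    (hrζ : ContDiffOn ℝ ∞ (fun U => F.r U v₀ * F.ζ U v₀) (Icc u₀ a))
    (hα : ContDiffOn ℝ ∞ (fun v => F.α u₀ v) (Icc v₀ b))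
    (hβ : ContDiffOn ℝ ∞ (fun U => F.β U v₀) (Icc u₀ a)) (k : ℕ) :
    CkOn u₀ a v₀ b k F.r ∧ CkOn u₀ a v₀ b k F.Ω ∧ CkOn u₀ a v₀ b k F.φ ∧
    CkOn u₀ a v₀ b k F.ν ∧ CkOn u₀ a v₀ b k F.ζ ∧ CkOn u₀ a v₀ b k F.β ∧
    CkOn u₀ a v₀ b k F.lam ∧ CkOn u₀ a v₀ b k F.θ ∧ CkOn u₀ a v₀ b k F.α := by
  induction k with
  | zero => exact ⟨h.r_c, h.Ω_c, h.φ_c, h.ν_c, h.ζ_c, h.β_c, h.lam_c, h.θ_c, h.α_c⟩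
  | succ k ih =>
    obtain ⟨ir, iΩ, iφ, iν, iζ, iβ, il, iθ, iα⟩ := ih
    have hle : ((k + 1 : ℕ) : WithTop ℕ∞) ≤ ∞ := by exact_mod_cast le_top
    have iN := contDiffOn_N ir iΩ iν il h.rectPos
    have cr : CkOn u₀ a v₀ b (k + 1) F.r := contDiffOn_succ_of_partials ha hb h.r_U h.r_v iν il
    have cφ : CkOn u₀ a v₀ b (k + 1) F.φ := contDiffOn_succ_of_partials ha hb h.φ_U h.φ_v iζ iθ
    have cΩ : CkOn u₀ a v₀ b (k + 1) F.Ω := contDiffOn_succ_of_partials ha hb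
      (fU := fun U v => F.β U v * F.Ω U v) (fV := fun U v => F.α U v * F.Ω U v)
      h.Ω_U h.Ω_v (iβ.mul iΩ) (iα.mul iΩ)
    have cν : CkOn u₀ a v₀ b (k + 1) F.ν := contDiffOn_succ_of_partials ha hb
      (fU := fun U v => F.β U v * F.ν U v - F.r U v * F.ζ U v ^ 2)
      h.ν_U h.ν_v ((iβ.mul iν).sub (ir.mul (iζ.pow 2))) iN
    have cl : CkOn u₀ a v₀ b (k + 1) F.lam := contDiffOn_succ_of_partials ha hb
      (fV := fun U v => F.α U v * F.lam U v - F.r U v * F.θ U v ^ 2)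
      h.lam_U h.lam_v iN ((iα.mul il).sub (ir.mul (iθ.pow 2)))
    have cθ := h.ckOn_succ_θ ha hb cr iζ iν il iθ iα (hrθ.of_le hle)
    have cζ : CkOn u₀ a v₀ b (k + 1) F.ζ :=
      (h.swap.ckOn_succ_θ hb ha cr.swap iθ.swap il.swap iν.swap iζ.swap iβ.swap
        (hrζ.of_le hle)).swap
    have cA : CkOn u₀ a v₀ b (k + 1) F.A := contDiffOn_A cr cΩ cζ cθ cν cl h.rectPos
    have cα := h.ckOn_α ha hb cA (hα.of_le hle)
    have cβ : CkOn u₀ a v₀ b (k + 1) F.β :=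
      (h.swap.ckOn_α hb ha (by
        have := cA.swap
        exact this.congr fun x _ => Fields.A_swap F x.2 x.1) (hβ.of_le hle)).swap
    exact ⟨cr, cΩ, cφ, cν, cζ, cβ, cl, cθ, cα⟩

end IsCharSol

/-! ### The Schwarzschild interior up to the event horizon -/

/-- The function `y ↦ (1 - y) e^y`, which is `U V` in Kruskal coordinates at `r = 2 M y`. -/
noncomputable def kruskal (y : ℝ) : ℝ := (1 - y) * Real.exp y

theorem hasDerivAt_kruskal (y : ℝ) : HasDerivAt kruskal (-y * Real.exp y) y :=
  (((hasDerivAt_id y).const_sub 1).mul (Real.hasDerivAt_exp y)).congr_deriv (by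
    simp only [id]; ring)

theorem contDiff_kruskal : ContDiff ℝ ∞ kruskal :=
  (contDiff_const.sub contDiff_id).mul Real.contDiff_exp

theorem strictAntiOn_kruskal : StrictAntiOn kruskal (Ici 0) := by
  refine strictAntiOn_of_deriv_neg (convex_Ici 0) contDiff_kruskal.continuous.continuousOn
    fun y hy => ?_
  rw [interior_Ici] at hy
  rw [(hasDerivAt_kruskal y).deriv]
  have := mul_pos (show 0 < y from hy) (Real.exp_pos y)
  linarith

/-- The inverse of `kruskal` on `(0,∞)`, with values `r / 2M` on Schwarzschild. -/
noncomputable def kInv (E : ℝ) : ℝ := Function.invFunOn kruskal (Ioi 0) E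

theorem kInv_spec {E : ℝ} (hE : E < 1) : 0 < kInv E ∧ kruskal (kInv E) = E := by
  have hex : ∃ y ∈ Ioi (0 : ℝ), kruskal y = E := by
    have h1 : kruskal (2 + |E|) ≤ E := by
      have he : 1 ≤ Real.exp (2 + |E|) := Real.one_le_exp (by positivity)
      have : 0 ≤ |E| := abs_nonneg E
      have := neg_abs_le E
      unfold kruskal
      nlinarith
    have h0 : kruskal 0 = 1 := by simp [kruskal]
    obtain ⟨y, hy, hyE⟩ := intermediate_value_Icc' (by positivity : (0 : ℝ) ≤ 2 + |E|)
      contDiff_kruskal.continuous.continuousOn (show E ∈ Icc _ _ from ⟨h1, by rw [h0]; exact hE.le⟩)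
    refine ⟨y, lt_of_le_of_ne hy.1 ?_, hyE⟩
    rintro rfl
    rw [h0] at hyE
    linarith
  exact Function.invFunOn_pos hex

theorem kInv_eq {E y : ℝ} (hy : 0 < y) (h : kruskal y = E) : kInv E = y := by
  have hE : E < 1 := by
    rw [← h, show (1 : ℝ) = kruskal 0 by simp [kruskal]]
    exact strictAntiOn_kruskal self_mem_Ici hy.le hy
  obtain ⟨h1, h2⟩ := kInv_spec hE
  exact strictAntiOn_kruskal.injOn (show (0 : ℝ) ≤ _ from h1.le) (show (0 : ℝ) ≤ _ from hy.le)
    (h2.trans h.symm)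

theorem kInv_zero : kInv 0 = 1 := kInv_eq one_pos (by simp [kruskal])

theorem kInv_anti {E E' : ℝ} (h : E < E') (hE' : E' < 1) : kInv E' < kInv E := by
  obtain ⟨h1, h2⟩ := kInv_spec hE'
  obtain ⟨h3, h4⟩ := kInv_spec (h.trans hE')
  by_contra hle
  push Not at hle
  have := strictAntiOn_kruskal.antitoneOn (show (0 : ℝ) ≤ _ from h3.le) (show (0 : ℝ) ≤ _ from h1.le) hle
  linarith

theorem kInv_le_one {E : ℝ} (h0 : 0 ≤ E) (hE : E < 1) : kInv E ≤ 1 := by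
  rcases h0.eq_or_lt with rfl | h
  · exact kInv_zero.le
  · exact (kInv_anti h hE).le.trans kInv_zero.le

theorem kInv_lt_one {E : ℝ} (h0 : 0 < E) (hE : E < 1) : kInv E < 1 :=
  (kInv_anti h0 hE).trans_eq kInv_zero

theorem contDiffAt_kInv {E : ℝ} (hE : E < 1) : ContDiffAt ℝ ∞ kInv E := by
  obtain ⟨h1, h2⟩ := kInv_spec hE
  have hne : -kInv E * Real.exp (kInv E) ≠ 0 := by
    have := mul_pos h1 (Real.exp_pos (kInv E)); linarith
  set f' : ℝ ≃L[ℝ] ℝ := ContinuousLinearEquiv.unitsEquivAut ℝ (Units.mk0 _ hne)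
  have hf' : HasFDerivAt kruskal (f' : ℝ →L[ℝ] ℝ) (kInv E) :=
    (hasDerivAt_kruskal (kInv E)).hasFDerivAt_equiv hne
  have hcd : ContDiffAt ℝ ∞ kruskal (kInv E) := contDiff_kruskal.contDiffAt
  have hsd : HasStrictFDerivAt kruskal (f' : ℝ →L[ℝ] ℝ) (kInv E) :=
    hcd.hasStrictFDerivAt' hf' (by simp)
  have h3 := hcd.to_localInverse hf' (by simp)
  have h4 : ∀ᶠ y in 𝓝 (kruskal (kInv E)), kInv y = hcd.localInverse hf' (by simp) y := by
    have e1 := hsd.eventually_right_inverse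
    have e2 : ∀ᶠ y in 𝓝 (kruskal (kInv E)), 0 < hsd.localInverse kruskal f' (kInv E) y :=
      hsd.localInverse_tendsto.eventually (lt_mem_nhds h1)
    filter_upwards [e1, e2] with y hy hy2
    exact kInv_eq hy2 hy
  have h5 := h3.congr_of_eventuallyEq h4
  rwa [h2] at h5

theorem hasDerivAt_kInv {E : ℝ} (hE : E < 1) :
    HasDerivAt kInv (-(Real.exp (-kInv E) / kInv E)) E := by
  obtain ⟨h1, h2⟩ := kInv_spec hE
  have hne : -kInv E * Real.exp (kInv E) ≠ 0 := by
    have := mul_pos h1 (Real.exp_pos (kInv E)); linarith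
  have := HasDerivAt.of_local_left_inverse (contDiffAt_kInv hE).continuousAt
    (hasDerivAt_kruskal (kInv E)) hne
    (by filter_upwards [gt_mem_nhds hE] with y hy using (kInv_spec hy).2)
  refine this.congr_deriv ?_
  rw [Real.exp_neg]
  field_simp

/-- The quantity `E = e^{(u+v)/4M} = (U/4M) e^{v/4M}`. -/
noncomputable def EE (M U v : ℝ) : ℝ := U / (4 * M) * Real.exp (v / (4 * M))

/-- The Schwarzschild radius as a function of `(U,v)`, smooth across `U = 0`. -/
noncomputable def rK (M U v : ℝ) : ℝ := 2 * M * kInv (EE M U v)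

/-- The Schwarzschild lapse `Ω̂²` as a function of `(U,v)`, smooth across `U = 0`. -/
noncomputable def ΩK (M U v : ℝ) : ℝ :=
  Real.exp (-kInv (EE M U v)) / kInv (EE M U v) * Real.exp (v / (4 * M))

/-- `∂_U log Ω̂²` on Schwarzschild. -/
noncomputable def βK (M U v : ℝ) : ℝ := 1 / 2 * ΩK M U v * (1 / rK M U v + 1 / (2 * M))

theorem hasDerivAt_EE_U (M U v : ℝ) :
    HasDerivAt (fun U => EE M U v) (1 / (4 * M) * Real.exp (v / (4 * M))) U :=
  ((hasDerivAt_id U).div_const (4 * M)).mul_const _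

theorem hasDerivAt_EE_v (M U v : ℝ) :
    HasDerivAt (fun v => EE M U v) (EE M U v * (1 / (4 * M))) v :=
  ((((hasDerivAt_id v).div_const (4 * M)).exp).const_mul (U / (4 * M))).congr_deriv (by
    simp only [EE, id]; ring)

theorem EE_nonneg {M U v : ℝ} (hM : 0 < M) (hU : 0 ≤ U) : 0 ≤ EE M U v := by
  unfold EE; positivity

theorem EE_pos {M U v : ℝ} (hM : 0 < M) (hU : 0 < U) : 0 < EE M U v := by
  unfold EE; positivity

theorem EE_mono {M U v U' v' : ℝ} (hM : 0 < M) (hU0 : 0 ≤ U) (hU : U ≤ U') (hv : v ≤ v') :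
    EE M U v ≤ EE M U' v' := by
  have := hU0.trans hU
  unfold EE; gcongr

theorem rK_pos {M U v : ℝ} (hM : 0 < M) (hE : EE M U v < 1) : 0 < rK M U v :=
  mul_pos (by positivity) (kInv_spec hE).1

theorem ΩK_pos {M U v : ℝ} (hE : EE M U v < 1) : 0 < ΩK M U v :=
  mul_pos (div_pos (Real.exp_pos _) (kInv_spec hE).1) (Real.exp_pos _)

theorem rK_zero (M v : ℝ) : rK M 0 v = 2 * M := by simp [rK, EE, kInv_zero]

theorem ΩK_zero (M v : ℝ) : ΩK M 0 v = Real.exp (-1 + v / (4 * M)) := by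
  simp [ΩK, EE, kInv_zero, Real.exp_add]

theorem hasDerivAt_rK_U {M U v : ℝ} (hM : 0 < M) (hE : EE M U v < 1) :
    HasDerivAt (fun U => rK M U v) (-(1 / 2) * ΩK M U v) U :=
  (((hasDerivAt_kInv hE).comp U (hasDerivAt_EE_U M U v)).const_mul (2 * M)).congr_deriv (by
    have := (kInv_spec hE).1.ne'
    simp only [ΩK]; field_simp; norm_num)

/-- The defining relation of `kInv` in the form `e^{-h} E = 1 - h`. -/
theorem exp_neg_kInv_mul {E : ℝ} (hE : E < 1) : Real.exp (-kInv E) * E = 1 - kInv E := by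
  have h := (kInv_spec hE).2
  unfold kruskal at h
  nth_rewrite 2 [← h]
  rw [mul_left_comm, ← Real.exp_add]
  simp

theorem hasDerivAt_rK_v {M U v : ℝ} (hM : 0 < M) (hE : EE M U v < 1) :
    HasDerivAt (fun v => rK M U v) (1 / 2 - M / rK M U v) v :=
  (((hasDerivAt_kInv hE).comp v (hasDerivAt_EE_v M U v)).const_mul (2 * M)).congr_deriv (by
    have h1 := (kInv_spec hE).1.ne'
    have h2 := exp_neg_kInv_mul hE
    simp only [rK]; field_simp; linarith)

theorem ΩK_eq {M U v : ℝ} (hM : 0 < M) (U' : ℝ) (h : rK M U' v = rK M U v) :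
    ΩK M U v = 2 * M / rK M U' v * Real.exp (-(rK M U' v / (2 * M)) + v / (4 * M)) := by
  rw [h, Real.exp_add]
  simp only [ΩK, rK]
  have : 2 * M * kInv (EE M U v) / (2 * M) = kInv (EE M U v) := by field_simp
  rw [this]
  field_simp

theorem hasDerivAt_ΩK_v {M U v : ℝ} (hM : 0 < M) (hE : EE M U v < 1) :
    HasDerivAt (fun v => ΩK M U v) (M / rK M U v ^ 2 * ΩK M U v) v := by
  have hr := (rK_pos hM hE).ne'
  have h := hasDerivAt_rK_v hM hE
  have h1 := ((hasDerivAt_const v (2 * M)).div h hr).mul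
    (((h.div_const (2 * M)).neg.add ((hasDerivAt_id v).div_const (4 * M))).exp)
  have e : (fun v => ΩK M U v) = fun v => 2 * M / rK M U v
      * Real.exp (-(rK M U v / (2 * M)) + v / (4 * M)) := funext fun v => ΩK_eq hM U rfl
  rw [e]
  refine h1.congr_deriv ?_
  rw [ΩK_eq hM U rfl]
  simp only [id, Pi.neg_apply, Pi.add_apply, Pi.div_apply]
  field_simp
  ring

theorem hasDerivAt_ΩK_U {M U v : ℝ} (hM : 0 < M) (hE : EE M U v < 1) :
    HasDerivAt (fun U => ΩK M U v) (βK M U v * ΩK M U v) U := by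
  have hr := (rK_pos hM hE).ne'
  have h := hasDerivAt_rK_U hM hE
  have h1 := ((hasDerivAt_const U (2 * M)).div h hr).mul
    (((h.div_const (2 * M)).neg.add (hasDerivAt_const U (v / (4 * M)))).exp)
  have e : (fun U => ΩK M U v) = fun U => 2 * M / rK M U v
      * Real.exp (-(rK M U v / (2 * M)) + v / (4 * M)) := funext fun U => ΩK_eq hM U rfl
  rw [e]
  refine h1.congr_deriv ?_
  simp only [βK]
  nth_rewrite 4 [ΩK_eq hM U rfl]
  simp only [Pi.neg_apply, Pi.add_apply, Pi.div_apply]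
  field_simp
  ring

theorem hasDerivAt_βK_v {M U v : ℝ} (hM : 0 < M) (hE : EE M U v < 1) :
    HasDerivAt (fun v => βK M U v) (ΩK M U v * M / rK M U v ^ 3) v := by
  have hr := (rK_pos hM hE).ne'
  refine (((hasDerivAt_ΩK_v hM hE).const_mul (1 / 2)).mul
    (((hasDerivAt_const v (1 : ℝ)).div (hasDerivAt_rK_v hM hE) hr).add_const (1 / (2 * M)))).congr_deriv ?_
  simp only [Pi.div_apply]
  field_simp
  ring

theorem contDiffAt_EE (M : ℝ) (x : ℝ × ℝ) : ContDiffAt ℝ ∞ (fun x : ℝ × ℝ => EE M x.1 x.2) x :=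
  (contDiffAt_fst.div_const _).mul (contDiffAt_snd.div_const _).exp

theorem contDiffAt_kInv_EE {M : ℝ} {x : ℝ × ℝ} (hE : EE M x.1 x.2 < 1) :
    ContDiffAt ℝ ∞ (fun x : ℝ × ℝ => kInv (EE M x.1 x.2)) x :=
  ContDiffAt.comp x (contDiffAt_kInv hE) (contDiffAt_EE M x)

theorem contDiffAt_ΩK {M : ℝ} {x : ℝ × ℝ} (hE : EE M x.1 x.2 < 1) :
    ContDiffAt ℝ ∞ (fun x : ℝ × ℝ => ΩK M x.1 x.2) x :=
  (((contDiffAt_kInv_EE hE).neg.exp).div (contDiffAt_kInv_EE hE) (kInv_spec hE).1.ne').mul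
    (contDiffAt_snd.div_const _).exp

theorem contDiffAt_βK {M : ℝ} (hM : 0 < M) {x : ℝ × ℝ} (hE : EE M x.1 x.2 < 1) :
    ContDiffAt ℝ ∞ (fun x : ℝ × ℝ => βK M x.1 x.2) x :=
  ((contDiffAt_const.mul (contDiffAt_ΩK hE))).mul
    ((contDiffAt_const.div (contDiffAt_const.mul (contDiffAt_kInv_EE hE))
      (rK_pos hM hE).ne').add contDiffAt_const)

/-! The relation to the functions `rS`, `OmegaHat2S` and `Omega2S`. -/

theorem EE_UOf {M : ℝ} (hM : 0 < M) (u v : ℝ) : EE M (UOf M u) v = Real.exp ((u + v) / (4 * M)) := by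
  rw [EE, UOf, add_div, Real.exp_add]
  field_simp

theorem UOf_uOf {M U : ℝ} (hM : 0 < M) (hU : 0 < U) : UOf M (uOf M U) = U := by
  have : -(4 * M) * Real.log (4 * M / U) / (4 * M) = -Real.log (4 * M / U) := by field_simp
  rw [UOf, uOf, this, Real.exp_neg, Real.exp_log (by positivity)]
  field_simp

theorem rS_eq_rK {M u v : ℝ} (hM : 0 < M) (huv : u + v < 0) : rS M u v = rK M (UOf M u) v := by
  obtain ⟨hr, hs⟩ := rS_spec hM huv
  have h2M : (0 : ℝ) < 2 * M := by positivity
  have hpos : 0 < (2 * M - rS M u v) / (2 * M) := div_pos (by linarith [hr.2]) h2M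
  have : kInv (EE M (UOf M u) v) = rS M u v / (2 * M) := by
    refine kInv_eq (div_pos hr.1 h2M) ?_
    have h1 : (u + v) / (4 * M) = rS M u v / (2 * M) + Real.log ((2 * M - rS M u v) / (2 * M)) := by
      unfold rStar at hs
      have : (u + v) / (4 * M) = (u + v) / 2 / (2 * M) := by field_simp; norm_num
      rw [this, ← hs]
      field_simp
    rw [EE_UOf hM, h1, Real.exp_add, Real.exp_log hpos, kruskal, mul_comm]
    congr 1
    field_simp
  rw [rK, this]
  field_simp

theorem OmegaHat2S_eq_ΩK {M U v : ℝ} (hM : 0 < M) (hU : 0 ≤ U) (hE : EE M U v < 1) :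
    OmegaHat2S M U v = ΩK M U v := by
  rcases hU.eq_or_lt with rfl | hU
  · rw [OmegaHat2S, if_pos rfl, ΩK_zero]
  · rw [OmegaHat2S, if_neg hU.ne']
    have huv : uOf M U + v < 0 := by
      rw [← UOf_uOf hM hU, EE_UOf hM, Real.exp_lt_one_iff] at hE
      by_contra hcon
      push Not at hcon
      exact absurd (div_nonneg hcon (by positivity)) (not_le.2 hE)
    rw [rS_eq_rK hM huv, UOf_uOf hM hU, ΩK_eq hM U rfl, Real.exp_add]
    ring_nf

theorem Omega2S_eq {M u v : ℝ} (hM : 0 < M) (huv : u + v < 0) :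
    Omega2S M u v = ΩK M (UOf M u) v * Real.exp (u / (4 * M)) := by
  have hE : EE M (UOf M u) v < 1 := by
    rw [EE_UOf hM, Real.exp_lt_one_iff]; exact div_neg_of_neg_of_pos huv (by positivity)
  have h1 := exp_neg_kInv_mul hE
  have h2 := (kInv_spec hE).1.ne'
  have h3 : Real.exp (v / (4 * M)) * Real.exp (u / (4 * M)) = EE M (UOf M u) v := by
    rw [EE_UOf hM, ← Real.exp_add]; congr 1; ring
  rw [Omega2S, rS_eq_rK hM huv, ΩK, mul_assoc, h3, rK]
  field_simp
  linarith

/-! ### The polynomial weights -/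

/-- The weight `(v/M)^{-p}`. -/
noncomputable def wP (M p v : ℝ) : ℝ := (v / M) ^ (-p)

/-- The weight `(v/M)^{-2p+1}`. -/
noncomputable def wq (M p v : ℝ) : ℝ := (v / M) ^ (-2 * p + 1)

section Weights

variable {M p v : ℝ}

theorem wP_pos (hM : 0 < M) (hv : 0 < v) : 0 < wP M p v := Real.rpow_pos_of_pos (div_pos hv hM) _

theorem wq_pos (hM : 0 < M) (hv : 0 < v) : 0 < wq M p v := Real.rpow_pos_of_pos (div_pos hv hM) _

theorem wP_sq (hM : 0 < M) (hv : 0 < v) : wP M p v ^ 2 = wq M p v * (M / v) := by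
  have hx := div_pos hv hM
  rw [wP, wq, ← Real.rpow_natCast, ← Real.rpow_mul hx.le, ← inv_div v M, ← Real.rpow_neg_one,
    ← Real.rpow_add hx]
  congr 1
  push_cast
  ring

theorem wP_anti (hM : 0 < M) (hp : 0 < p) (hv : 0 < v) {v' : ℝ} (h : v ≤ v') :
    wP M p v' ≤ wP M p v :=
  Real.rpow_le_rpow_of_nonpos (div_pos hv hM) (by gcongr) (by linarith)

theorem wq_anti (hM : 0 < M) (hp : 1 < p) (hv : 0 < v) {v' : ℝ} (h : v ≤ v') :
    wq M p v' ≤ wq M p v :=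
  Real.rpow_le_rpow_of_nonpos (div_pos hv hM) (by gcongr) (by linarith)

theorem hasDerivAt_rpow_div (hM : 0 < M) (hv : 0 < v) (s : ℝ) :
    HasDerivAt (fun v => (v / M) ^ s) (s / v * (v / M) ^ s) v := by
  have hx := div_pos hv hM
  refine (((hasDerivAt_id v).div_const M).rpow_const (p := s) (Or.inl hx.ne')).congr_deriv ?_
  simp only [id]
  rw [Real.rpow_sub_one hx.ne']
  field_simp

theorem hasDerivAt_wP (hM : 0 < M) (hv : 0 < v) : HasDerivAt (wP M p) (-(p / v) * wP M p v) v :=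
  (hasDerivAt_rpow_div hM hv (-p)).congr_deriv (by rw [wP]; ring)

theorem hasDerivAt_wq (hM : 0 < M) (hv : 0 < v) :
    HasDerivAt (wq M p) (-((2 * p - 1) / v) * wq M p v) v :=
  (hasDerivAt_rpow_div hM hv (-2 * p + 1)).congr_deriv (by rw [wq]; ring)

theorem tendsto_rpow_div_neg (hM : 0 < M) {s : ℝ} (hs : s < 0) :
    Tendsto (fun v : ℝ => (v / M) ^ s) atTop (𝓝 0) := by
  have h1 := tendsto_rpow_neg_atTop (show 0 < -s by linarith)
  rw [neg_neg] at h1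
  exact h1.comp (tendsto_id.atTop_div_const hM)

theorem tendsto_wP (hM : 0 < M) (hp : 1 < p) : Tendsto (wP M p) atTop (𝓝 0) :=
  tendsto_rpow_div_neg hM (by linarith)

theorem tendsto_wq (hM : 0 < M) (hp : 1 < p) : Tendsto (wq M p) atTop (𝓝 0) :=
  tendsto_rpow_div_neg hM (by linarith)

theorem exists_rpow_le_exp (m A : ℝ) (hm : 0 ≤ m) (hA : 0 < A) :
    ∃ K : ℝ, 0 < K ∧ ∀ y : ℝ, 0 ≤ y → y ^ m ≤ K * Real.exp (y / A) := by
  obtain ⟨n, hn⟩ := exists_nat_ge m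
  refine ⟨1 + n.factorial * A ^ n, by positivity, fun y hy => ?_⟩
  have hA1 : 0 ≤ n.factorial * A ^ n := by positivity
  rcases le_total y 1 with h | h
  · calc y ^ m ≤ 1 := Real.rpow_le_one hy h hm
      _ ≤ (1 + n.factorial * A ^ n) * 1 := by linarith
      _ ≤ _ := by
        gcongr
        exact Real.one_le_exp (by positivity)
  · have h1 := Real.pow_div_factorial_le_exp (y / A) (by positivity) n
    rw [div_pow, div_div, div_le_iff₀ (by positivity)] at h1
    calc y ^ m ≤ y ^ (n : ℝ) := Real.rpow_le_rpow_of_exponent_le h hn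
      _ = y ^ n := Real.rpow_natCast y n
      _ ≤ Real.exp (y / A) * (A ^ n * n.factorial) := h1
      _ ≤ _ := by nlinarith [Real.exp_pos (y / A)]

theorem exists_exp_le_wq (hM : 0 < M) (hp : 1 < p) :
    ∃ K : ℝ, 0 < K ∧ ∀ v : ℝ, 0 < v → Real.exp (-(v / (4 * M))) ≤ K * wq M p v := by
  obtain ⟨K, hK, h⟩ := exists_rpow_le_exp (2 * p - 1) 4 (by linarith) (by norm_num)
  refine ⟨K, hK, fun v hv => ?_⟩
  have hx := div_pos hv hM
  have h1 := h (v / M) hx.le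
  have h2 : wq M p v = ((v / M) ^ (2 * p - 1))⁻¹ := by
    rw [wq, ← Real.rpow_neg hx.le]; congr 1; ring
  have h3 : 0 < (v / M) ^ (2 * p - 1) := Real.rpow_pos_of_pos hx _
  have h4 : v / M / 4 = v / (4 * M) := by field_simp
  rw [h4] at h1
  rw [h2, Real.exp_neg, ← div_eq_mul_inv, le_div_iff₀ h3, inv_mul_le_iff₀ (Real.exp_pos _)]
  linarith [h1]

/-- The weight decays slower than any exponential. -/
theorem exists_wq_le_exp (hM : 0 < M) (hp : 1 < p) {v₀ : ℝ} (hv₀ : 0 < v₀) :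
    ∃ K : ℝ, 0 < K ∧ ∀ t v : ℝ, v₀ ≤ t → t ≤ v →
      wq M p t ≤ K * wq M p v * Real.exp ((v - t) / (8 * M)) := by
  obtain ⟨K, hK, h⟩ := exists_rpow_le_exp (2 * p - 1) (8 * M / v₀) (by linarith) (by positivity)
  refine ⟨K * Real.exp (v₀ / (8 * M)), by positivity, fun t v ht htv => ?_⟩
  have ht0 : 0 < t := hv₀.trans_le ht
  have hv0 : 0 < v := ht0.trans_le htv
  have h1 := h (1 + (v - t) / v₀) (by linarith [div_nonneg (sub_nonneg.2 htv) hv₀.le])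
  have h2 : v / t ≤ 1 + (v - t) / v₀ := by
    have : (v - t) / t ≤ (v - t) / v₀ :=
      div_le_div_of_nonneg_left (sub_nonneg.2 htv) hv₀ ht
    have : v / t = 1 + (v - t) / t := by field_simp; ring
    linarith
  have h3 : wq M p t = wq M p v * (v / t) ^ (2 * p - 1) := by
    rw [wq, wq, show -2 * p + 1 = -(2 * p - 1) by ring, Real.rpow_neg (by positivity),
      Real.rpow_neg (by positivity), Real.div_rpow ht0.le hM.le, Real.div_rpow hv0.le hM.le,
      Real.div_rpow hv0.le ht0.le]
    have : 0 < v ^ (2 * p - 1) := Real.rpow_pos_of_pos hv0 _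
    have : 0 < t ^ (2 * p - 1) := Real.rpow_pos_of_pos ht0 _
    have : 0 < M ^ (2 * p - 1) := Real.rpow_pos_of_pos hM _
    field_simp
  have h4 : (1 + (v - t) / v₀) / (8 * M / v₀) = v₀ / (8 * M) + (v - t) / (8 * M) := by field_simp
  rw [h4, Real.exp_add] at h1
  have hq := wq_pos (p := p) hM hv0
  calc wq M p t = wq M p v * (v / t) ^ (2 * p - 1) := h3
    _ ≤ wq M p v * (1 + (v - t) / v₀) ^ (2 * p - 1) := by
      gcongr
      linarith
    _ ≤ wq M p v * (K * (Real.exp (v₀ / (8 * M)) * Real.exp ((v - t) / (8 * M)))) := by gcongr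
    _ = _ := by ring

end Weights

/-! ### The event horizon -/

/-- The lapse `Ω̂²` on the event horizon. -/
noncomputable def ΩH (M v : ℝ) : ℝ := Real.exp (-1 + v / (4 * M))

theorem ΩH_pos (M v : ℝ) : 0 < ΩH M v := Real.exp_pos _

theorem ΩH_mono {M v v' : ℝ} (hM : 0 < M) (h : v ≤ v') : ΩH M v ≤ ΩH M v' := by
  unfold ΩH; gcongr

theorem hasDerivAt_ΩH (M v : ℝ) : HasDerivAt (ΩH M) (1 / (4 * M) * ΩH M v) v :=
  ((((hasDerivAt_id v).div_const (4 * M)).const_add (-1)).exp).congr_deriv (by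
    simp only [ΩH, id]; ring)

/-- The bounds on the event horizon that follow from the decay of `∂_v φ`: `n` is `-r ∂_U r`, and
`c` is a constant that depends on the parameters of the data only. -/
structure HorizonBounds (M p D₂ v₀ ρ c : ℝ) (r lam θ n : ℝ → ℝ) : Prop where
  r_ge : ∀ v, v₀ ≤ v → ρ ≤ r v
  r_le : ∀ v, v₀ ≤ v → r v ≤ 2 * M
  r_near : ∀ v, v₀ ≤ v → 2 * M - r v ≤ c * wq M p v
  lam_nonneg : ∀ v, v₀ ≤ v → 0 ≤ lam v
  lam_le : ∀ v, v₀ ≤ v → lam v ≤ c * wq M p v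
  rθ_nonneg : ∀ v, v₀ ≤ v → 0 ≤ r v * θ v
  rθ_le : ∀ v, v₀ ≤ v → r v * θ v ≤ D₂ * wP M p v
  n_pos : ∀ v, v₀ ≤ v → 0 < n v
  n_deriv : ∀ v, HasDerivAt n (1 / 4 * ΩH M v) v
  n_le : ∀ v, v₀ ≤ v → n v ≤ c * ΩH M v
  f_near : ∀ v, v₀ ≤ v → |n v / (r v * ΩH M v) - 1 / 2| ≤ c * wq M p v

section Horizon

variable {M p D₂ v₀ ρ : ℝ} {r lam θ : ℝ → ℝ}

/-- On the event horizon `∂_v r ≥ 0`: otherwise the Raychaudhuri equation would make `r` vanish. -/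
theorem horizon_lam_nonneg (hM : 0 < M) (hrpos : ∀ v, v₀ ≤ v → 0 < r v)
    (hr : ∀ v ∈ Ici v₀, HasDerivWithinAt r (lam v) (Ici v₀) v)
    (hg : ∀ v ∈ Ici v₀, HasDerivWithinAt (fun v => (ΩH M v)⁻¹ * lam v)
      (-r v * (ΩH M v)⁻¹ * θ v ^ 2) (Ici v₀) v) : ∀ v, v₀ ≤ v → 0 ≤ lam v := by
  intro v hv
  by_contra hneg
  push Not at hneg
  have hsub : ∀ b, Icc v b ⊆ Ici v₀ := fun b t ht => hv.trans ht.1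
  have hle : ∀ t, v ≤ t → lam t ≤ lam v := by
    intro t ht
    have h1 := le_of_deriv_nonpos ht (fun s hs => (hg s (hsub t hs)).mono (hsub t)) (fun s hs => by
      have := hrpos s (hsub t hs)
      have := ΩH_pos M s
      have : 0 ≤ r s * (ΩH M s)⁻¹ * θ s ^ 2 := by positivity
      linarith)
    have h2 := ΩH_pos M t
    have h3 := ΩH_pos M v
    have h4 := ΩH_mono hM ht
    rw [← div_eq_inv_mul, ← div_eq_inv_mul, div_le_div_iff₀ h2 h3] at h1
    nlinarith
  -- At `b` the radius would vanish.
  set b := v + r v / (-lam v) with hb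
  have hvb : v ≤ b := by
    have := div_pos (hrpos v hv) (neg_pos.2 hneg)
    linarith
  have := sub_le_sub_of_deriv_le (g := fun t => lam v * t) (g' := fun _ => lam v) hvb
    (fun s hs => (hr s (hsub b hs)).mono (hsub b))
    (fun t _ => by simpa using ((hasDerivAt_id t).const_mul (lam v)).hasDerivWithinAt)
    (fun s hs => hle s hs.1)
  have h5 : lam v * b - lam v * v = -r v := by
    have := hneg.ne
    rw [hb]; field_simp; ring
  linarith [hrpos b (hv.trans hvb)]

/-- If `λ = ∂_v r` exceeded `K P²` somewhere, with `P = (v/M)^{-p}`, then `Ω̂⁻² λ - K P² Ω̂⁻²`, which is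
nondecreasing, would be positive from there on and `r` would grow without bound, contrary to
`r ≤ 2M`. -/
theorem horizon_lam_le (hM : 0 < M) (hp : 1 < p) (hv₀ : 0 < v₀) (hρ : 0 < ρ)
    (hrρ : ∀ v, v₀ ≤ v → ρ ≤ r v) (hrM : ∀ v, v₀ ≤ v → r v ≤ 2 * M)
    (hr : ∀ v ∈ Ici v₀, HasDerivWithinAt r (lam v) (Ici v₀) v)
    (hg : ∀ v ∈ Ici v₀, HasDerivWithinAt (fun v => (ΩH M v)⁻¹ * lam v)
      (-r v * (ΩH M v)⁻¹ * θ v ^ 2) (Ici v₀) v)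
    (hθ0 : ∀ v, v₀ ≤ v → 0 ≤ r v * θ v) (hθ : ∀ v, v₀ ≤ v → r v * θ v ≤ D₂ * wP M p v) :
    ∀ v, v₀ ≤ v → lam v ≤ 4 * M * D₂ ^ 2 / ρ * wP M p v ^ 2 := by
  intro v hv
  by_contra hneg
  push Not at hneg
  set K := 4 * M * D₂ ^ 2 / ρ with hK
  have hK0 : 0 ≤ K := by positivity
  have hsub : ∀ b, Icc v b ⊆ Ici v₀ := fun b t ht => hv.trans ht.1
  have hΩ0 := ΩH_pos M
  -- The positive lower bound for the monotone quantity.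
  set κ := (ΩH M v)⁻¹ * (lam v - K * wP M p v ^ 2) with hκ
  have hκ0 : 0 < κ := mul_pos (inv_pos.2 (hΩ0 v)) (by linarith)
  have hle : ∀ t, v ≤ t → κ * ΩH M v ≤ lam t := by
    intro t ht
    have h1 := le_of_deriv_nonneg ht
      (f := fun v => (ΩH M v)⁻¹ * lam v - K * (wP M p v ^ 2 * (ΩH M v)⁻¹))
      (fun s hs => ((hg s (hsub t hs)).mono (hsub t)).sub
        ((((hasDerivAt_wP hM (hv₀.trans_le (hsub t hs))).pow 2).mul
          ((hasDerivAt_ΩH M s).inv (hΩ0 s).ne')).const_mul K).hasDerivWithinAt) (fun s hs => by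
        have hs0 : v₀ ≤ s := hsub t hs
        have hspos : 0 < s := hv₀.trans_le hs0
        have e1 := hrρ s hs0
        have e2 := hθ0 s hs0
        have e3 := hθ s hs0
        have hr0 : 0 < r s := hρ.trans_le e1
        have hΩs := hΩ0 s
        have e4 : (r s * θ s) ^ 2 ≤ D₂ ^ 2 * wP M p s ^ 2 := by
          rw [← mul_pow]; gcongr
        have e5 : r s * θ s ^ 2 ≤ K / (4 * M) * wP M p s ^ 2 := by
          have : r s * θ s ^ 2 = (r s * θ s) ^ 2 / r s := by field_simp
          rw [this, hK]
          calc _ ≤ D₂ ^ 2 * wP M p s ^ 2 / ρ := by gcongr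
            _ = _ := by field_simp
        have e6 : 0 ≤ K * (2 * p / s) * wP M p s ^ 2 := by positivity
        have e7 : -r s * (ΩH M s)⁻¹ * θ s ^ 2 - K * (2 * wP M p s * (-(p / s) * wP M p s)
            * (ΩH M s)⁻¹ + wP M p s ^ 2 * (-(1 / (4 * M) * ΩH M s) / ΩH M s ^ 2))
            = (ΩH M s)⁻¹ * (K / (4 * M) * wP M p s ^ 2 - r s * θ s ^ 2
              + K * (2 * p / s) * wP M p s ^ 2) := by
          field_simp; ring
        simp only [Pi.inv_apply, Pi.pow_apply, Nat.cast_ofNat, Nat.add_one_sub_one, pow_one]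
        rw [e7]
        exact mul_nonneg (inv_pos.2 hΩs).le (by linarith))
    have h2 : κ ≤ (ΩH M t)⁻¹ * lam t := by
      have : 0 ≤ K * (wP M p t ^ 2 * (ΩH M t)⁻¹) := by have := hΩ0 t; positivity
      have e : κ = (ΩH M v)⁻¹ * lam v - K * (wP M p v ^ 2 * (ΩH M v)⁻¹) := by rw [hκ]; ring
      linarith
    rw [← div_eq_inv_mul, le_div_iff₀ (hΩ0 t)] at h2
    exact (mul_le_mul_of_nonneg_left (ΩH_mono hM ht) hκ0.le).trans h2
  set d := κ * ΩH M v with hd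
  have hd0 : 0 < d := mul_pos hκ0 (hΩ0 v)
  -- At `b` the radius would exceed `2M`.
  set b := v + (2 * M + 1) / d with hb
  have hvb : v ≤ b := by
    have : 0 < (2 * M + 1) / d := by positivity
    linarith
  have := sub_le_sub_of_deriv_le (f := fun t => d * t) (f' := fun _ => d) hvb
    (fun t _ => by simpa using ((hasDerivAt_id t).const_mul d).hasDerivWithinAt)
    (fun s hs => (hr s (hsub b hs)).mono (hsub b))
    (fun s hs => hle s hs.1)
  have h5 : d * b - d * v = 2 * M + 1 := by rw [hb]; field_simp; ring
  linarith [hrρ v hv, hrM b (hv.trans hvb)]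

/-- The bounds on the event horizon. The constant `c` is uniform over all data with the given
parameters, which is why the data are quantified after it. -/
theorem exists_horizonBounds (hM : 0 < M) (hp : 1 < p) {D₃ : ℝ} (hD₃ : 0 < D₃)
    (hv₀ : 0 < v₀) (hρ : 0 < ρ) : ∃ c : ℝ, 1 ≤ c ∧ ∀ (r lam θ : ℝ → ℝ) (n₀ : ℝ),
      ρ ≤ r v₀ → (∀ v, v₀ ≤ v → 0 < r v) → Tendsto r atTop (𝓝 (2 * M)) →
      (∀ v ∈ Ici v₀, HasDerivWithinAt r (lam v) (Ici v₀) v) →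
      (∀ v ∈ Ici v₀, HasDerivWithinAt (fun v => (ΩH M v)⁻¹ * lam v)
        (-r v * (ΩH M v)⁻¹ * θ v ^ 2) (Ici v₀) v) →
      (∀ v, v₀ ≤ v → 0 ≤ r v * θ v) → (∀ v, v₀ ≤ v → r v * θ v ≤ D₂ * wP M p v) →
      0 < n₀ → n₀ ≤ 2 * M * D₃ →
      HorizonBounds M p D₂ v₀ ρ c r lam θ (fun v => n₀ + M * (ΩH M v - ΩH M v₀)) := by
  obtain ⟨K₁, hK₁, hexp⟩ := exists_exp_le_wq hM hp
  set K := 4 * M * D₂ ^ 2 / ρ with hK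
  have hK0 : 0 ≤ K := by positivity
  have hp1 : 0 < 2 * p - 1 := by linarith
  set c₁ := K * M / (2 * p - 1) with hc₁
  have hc₁0 : 0 ≤ c₁ := by positivity
  set c₂ := (2 * (2 * M * D₃) + 2 * M * ΩH M v₀) / (2 * ρ) * (Real.exp 1 * K₁) + c₁ / (2 * ρ) with hc₂
  have hΩ0 := ΩH_pos M
  have hc₂0 : 0 ≤ c₂ := by have := hΩ0 v₀; positivity
  have hq0 := wq_pos (p := p) hM hv₀
  set c := 1 + c₁ + K * (M / v₀) + c₂ + (1 / 2 + c₂ * wq M p v₀) * (2 * M) with hc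
  have t1 : 0 ≤ K * (M / v₀) := by positivity
  have t2 : 0 ≤ (1 / 2 + c₂ * wq M p v₀) * (2 * M) := by positivity
  refine ⟨c, by linarith, fun r lam θ n₀ hρr hrpos hlim hr hg hθ0 hθ hn₀ hn₀' => ?_⟩
  have hlam0 := horizon_lam_nonneg hM hrpos hr hg
  have hmono : ∀ s t, v₀ ≤ s → s ≤ t → r s ≤ r t := fun s t hs hst =>
    le_of_deriv_nonneg hst (fun x hx => (hr x (hs.trans hx.1)).mono (fun y hy => hs.trans hy.1))
      (fun x hx => hlam0 x (hs.trans hx.1))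
  have hrρ : ∀ v, v₀ ≤ v → ρ ≤ r v := fun v hv => hρr.trans (hmono v₀ v le_rfl hv)
  have hrM : ∀ v, v₀ ≤ v → r v ≤ 2 * M := fun v hv =>
    ge_of_tendsto hlim (by filter_upwards [eventually_ge_atTop v] with t ht using hmono v t hv ht)
  have hlamle := horizon_lam_le hM hp hv₀ hρ hrρ hrM hr hg hθ0 hθ
  -- `r + c₁ (v/M)^{-2p+1}` is nonincreasing with limit `2M`.
  have hnear : ∀ v, v₀ ≤ v → 2 * M - r v ≤ c₁ * wq M p v := by
    intro v hv
    have : 2 * M ≤ r v + c₁ * wq M p v := by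
      refine le_of_tendsto hlim ?_
      filter_upwards [eventually_ge_atTop v] with t ht
      have h1 := le_of_deriv_nonpos ht (f := fun v => r v + c₁ * wq M p v)
        (fun x hx => ((hr x (hv.trans hx.1)).mono (fun y hy => hv.trans hy.1)).add
          (((hasDerivAt_wq hM (hv₀.trans_le (hv.trans hx.1))).const_mul c₁).hasDerivWithinAt))
        (fun x hx => by
          have hx0 : 0 < x := hv₀.trans_le (hv.trans hx.1)
          have h2 := hlamle x (hv.trans hx.1)
          rw [wP_sq hM hx0] at h2
          have h3 : c₁ * (-((2 * p - 1) / x) * wq M p x) = -(K * (wq M p x * (M / x))) := by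
            rw [hc₁]; field_simp
          linarith)
      have h4 : 0 ≤ c₁ * wq M p t := mul_nonneg hc₁0 (wq_pos hM (by linarith)).le
      linarith
    linarith
  -- `n` grows like `M Ω̂²`, so the contribution of its initial value is exponentially small.
  have hf : ∀ v, v₀ ≤ v → |(n₀ + M * (ΩH M v - ΩH M v₀)) / (r v * ΩH M v) - 1 / 2|
      ≤ c₂ * wq M p v := by
    intro v hv
    have hv0 : 0 < v := hv₀.trans_le hv
    have hr0 := hrpos v hv
    have hΩ := hΩ0 v
    have hΩ' := hΩ0 v₀
    have e1 : (n₀ + M * (ΩH M v - ΩH M v₀)) / (r v * ΩH M v) - 1 / 2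
        = (2 * n₀ - 2 * M * ΩH M v₀) / (2 * r v) * (ΩH M v)⁻¹ + (2 * M - r v) / (2 * r v) := by
      field_simp; ring
    have e2 : (ΩH M v)⁻¹ ≤ Real.exp 1 * K₁ * wq M p v := by
      have : (ΩH M v)⁻¹ = Real.exp 1 * Real.exp (-(v / (4 * M))) := by
        rw [ΩH, ← Real.exp_neg, ← Real.exp_add]; congr 1; ring
      rw [this, mul_assoc]
      exact mul_le_mul_of_nonneg_left (hexp v hv0) (Real.exp_pos _).le
    rw [e1]
    have e3 : |(2 * n₀ - 2 * M * ΩH M v₀) / (2 * r v) * (ΩH M v)⁻¹|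
        ≤ (2 * (2 * M * D₃) + 2 * M * ΩH M v₀) / (2 * ρ) * (Real.exp 1 * K₁ * wq M p v) := by
      rw [abs_mul, abs_of_pos (inv_pos.2 hΩ), abs_div, abs_of_pos (by positivity : 0 < 2 * r v)]
      have : |2 * n₀ - 2 * M * ΩH M v₀| ≤ 2 * (2 * M * D₃) + 2 * M * ΩH M v₀ := by
        have : 0 < 2 * M * ΩH M v₀ := by positivity
        rw [abs_le]; constructor <;> linarith
      have := hrρ v hv
      gcongr
    have e4 : |(2 * M - r v) / (2 * r v)| ≤ c₁ / (2 * ρ) * wq M p v := by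
      rw [abs_of_nonneg (div_nonneg (by linarith [hrM v hv]) (by positivity))]
      calc (2 * M - r v) / (2 * r v) ≤ c₁ * wq M p v / (2 * ρ) := by
            have := hrρ v hv
            have := hnear v hv
            have : 0 ≤ c₁ * wq M p v := mul_nonneg hc₁0 (wq_pos hM hv0).le
            gcongr
        _ = _ := by ring
    calc _ ≤ _ := abs_add_le _ _
      _ ≤ _ := add_le_add e3 e4
      _ = _ := by rw [hc₂]; ring
  have hqv : ∀ v, v₀ ≤ v → 0 < wq M p v := fun v hv => wq_pos hM (hv₀.trans_le hv)
  have hnpos : ∀ v, v₀ ≤ v → 0 < n₀ + M * (ΩH M v - ΩH M v₀) := fun v hv => by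
    have := ΩH_mono hM hv
    have : 0 ≤ M * (ΩH M v - ΩH M v₀) := mul_nonneg hM.le (by linarith)
    linarith
  refine ⟨hrρ, hrM, fun v hv => (hnear v hv).trans ?_, hlam0, fun v hv => (hlamle v hv).trans ?_, hθ0,
    hθ, hnpos, fun v => ?_, fun v hv => ?_, fun v hv => (hf v hv).trans ?_⟩
  · have := hqv v hv; gcongr; linarith
  · rw [wP_sq hM (hv₀.trans_le hv), mul_left_comm, mul_comm]
    have h1 : K * (M / v) ≤ K * (M / v₀) := by gcongr
    have := hqv v hv; gcongr; linarith
  · refine (((hasDerivAt_ΩH M v).sub_const (ΩH M v₀)).const_mul M |>.const_add n₀).congr_deriv ?_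
    field_simp
  · have h1 := (abs_le.1 (hf v hv)).2
    have hrΩ : 0 < r v * ΩH M v := mul_pos (hrpos v hv) (hΩ0 v)
    have h2 : (n₀ + M * (ΩH M v - ΩH M v₀)) / (r v * ΩH M v) ≤ 1 / 2 + c₂ * wq M p v₀ := by
      have := mul_le_mul_of_nonneg_left (wq_anti hM hp hv₀ hv) hc₂0
      linarith
    rw [div_le_iff₀ hrΩ] at h2
    calc _ ≤ _ := h2
      _ ≤ (1 / 2 + c₂ * wq M p v₀) * (2 * M * ΩH M v) := by
        have := hrM v hv
        have := hΩ0 v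
        gcongr
      _ = (1 / 2 + c₂ * wq M p v₀) * (2 * M) * ΩH M v := by ring
      _ ≤ _ := by have := hΩ0 v; gcongr; linarith
  · have := hqv v hv; gcongr; linarith

end Horizon

/-! ### Solutions on rectangles and the bootstrap assumptions -/

/-- A solution on the rectangle `[0,a] × [v₀,b]`, with data on the horizon that satisfy the bounds
of `HorizonBounds`, and with data on the ingoing cone for which `Ω̂²` is that of Schwarzschild and
`|r Y φ| ≤ D₃`. -/
structure RectSol (M p D₂ D₃ v₀ ρ c : ℝ) (rH lH θH nH : ℝ → ℝ) (F : Fields) (a b : ℝ) : Prop where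
  sol : IsCharSol F 0 a v₀ b
  hor : HorizonBounds M p D₂ v₀ ρ c rH lH θH nH
  ha : 0 ≤ a
  hb : v₀ ≤ b
  r_H : ∀ v ∈ Icc v₀ b, F.r 0 v = rH v
  lam_H : ∀ v ∈ Icc v₀ b, F.lam 0 v = lH v
  θ_H : ∀ v ∈ Icc v₀ b, F.θ 0 v = θH v
  α_H : ∀ v ∈ Icc v₀ b, F.α 0 v = 1 / (4 * M)
  Ω_H : ∀ v ∈ Icc v₀ b, F.Ω 0 v = ΩH M v
  n_H : ∀ v ∈ Icc v₀ b, F.r 0 v * F.ν 0 v = -nH v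
  Ω_I : ∀ U ∈ Icc 0 a, F.Ω U v₀ = ΩK M U v₀
  β_I : ∀ U ∈ Icc 0 a, F.β U v₀ = βK M U v₀
  ζ_I : ∀ U ∈ Icc 0 a, |F.r U v₀ * F.ζ U v₀| ≤ D₃ * -F.ν U v₀

/-- The bootstrap assumptions. The crude bounds by `K` only serve to keep the solution regular and
to make everything continuous at the horizon in a bounded range of `v`; they do not enter the
constants of the decay rates. -/
structure Bootstrap (M p v₀ c B r₁ K k Ed : ℝ) (F : Fields) (a b : ℝ) : Prop where
  r_ge : ∀ U ∈ Icc 0 a, ∀ v ∈ Icc v₀ b, r₁ ≤ F.r U v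
  A_le : ∀ U ∈ Icc 0 a, ∀ v ∈ Icc v₀ b, |F.r U v ^ 2 * F.θ U v| ≤ M * B * wP M p v
  ζ_le : ∀ U ∈ Icc 0 a, ∀ v ∈ Icc v₀ b, |F.r U v * F.ζ U v| ≤ B * wP M p v * -F.ν U v
  lam_le : ∀ U ∈ Icc 0 a, ∀ v ∈ Icc v₀ b, |F.lam U v| ≤ K
  θ_le : ∀ U ∈ Icc 0 a, ∀ v ∈ Icc v₀ b, |F.θ U v| ≤ K
  α_le : ∀ U ∈ Icc 0 a, ∀ v ∈ Icc v₀ b, |F.α U v| ≤ K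
  ν_le : ∀ U ∈ Icc 0 a, ∀ v ∈ Icc v₀ b, |F.ν U v| ≤ K * Real.exp (k * (v - v₀))
  Ω_le : ∀ U ∈ Icc 0 a, ∀ v ∈ Icc v₀ b, |F.Ω U v| ≤ K * Real.exp (k * (v - v₀))
  ζ_le' : ∀ U ∈ Icc 0 a, ∀ v ∈ Icc v₀ b, |F.ζ U v| ≤ K * Real.exp (k * (v - v₀))
  n_le : ∀ U ∈ Icc 0 a, ∀ v ∈ Icc v₀ b, EE M U v ≤ Ed →
    -(F.r U v * F.ν U v) ≤ 8 * c * Real.exp (v / (4 * M))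

/-- Closeness to the horizon for `v ≤ v₁`. -/
structure NearHorizon (M v₀ v₁ η : ℝ) (rH lH θH nH : ℝ → ℝ) (F : Fields) (a b : ℝ) : Prop where
  lam : ∀ U ∈ Icc 0 a, ∀ v ∈ Icc v₀ b, v ≤ v₁ → |F.lam U v - lH v| ≤ η
  θ : ∀ U ∈ Icc 0 a, ∀ v ∈ Icc v₀ b, v ≤ v₁ → |F.θ U v - θH v| ≤ η
  r : ∀ U ∈ Icc 0 a, ∀ v ∈ Icc v₀ b, v ≤ v₁ → rH v - F.r U v ≤ η
  Ω : ∀ U ∈ Icc 0 a, ∀ v ∈ Icc v₀ b, v ≤ v₁ → F.Ω U v ≤ ΩH M v * Real.exp η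
  f : ∀ U ∈ Icc 0 a, ∀ v ∈ Icc v₀ b, v ≤ v₁ →
    -F.ν U v / F.Ω U v ≤ nH v / (rH v * ΩH M v) * Real.exp η

namespace RectSol

variable {M p D₂ D₃ v₀ ρ c a b : ℝ} {rH lH θH nH : ℝ → ℝ} {F : Fields}

theorem zero_mem (h : RectSol M p D₂ D₃ v₀ ρ c rH lH θH nH F a b) : (0 : ℝ) ∈ Icc 0 a :=
  left_mem_Icc.2 h.ha

theorem v₀_mem (h : RectSol M p D₂ D₃ v₀ ρ c rH lH θH nH F a b) : v₀ ∈ Icc v₀ b :=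
  left_mem_Icc.2 h.hb

/-- The Raychaudhuri equation for `f = -∂_U r / Ω̂²`. -/
theorem f_U (h : RectSol M p D₂ D₃ v₀ ρ c rH lH θH nH F a b) {U v : ℝ} (hU : U ∈ Icc 0 a)
    (hv : v ∈ Icc v₀ b) : HasDerivWithinAt (fun U => -F.ν U v / F.Ω U v)
      (F.r U v * F.ζ U v ^ 2 / F.Ω U v) (Icc 0 a) U := by
  have hΩ := (h.sol.Ω_pos U hU v hv).ne'
  refine ((h.sol.ν_U U hU v hv).neg.div (h.sol.Ω_U U hU v hv) hΩ).congr_deriv ?_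
  simp only [Pi.neg_apply]
  field_simp
  ring

theorem n_v (h : RectSol M p D₂ D₃ v₀ ρ c rH lH θH nH F a b) {U v : ℝ} (hU : U ∈ Icc 0 a)
    (hv : v ∈ Icc v₀ b) : HasDerivWithinAt (fun v => -(F.r U v * F.ν U v))
      (1 / 4 * F.Ω U v) (Icc v₀ b) v :=
  (h.sol.rν_v hU hv).neg.congr_deriv (by ring)

theorem f_H (h : RectSol M p D₂ D₃ v₀ ρ c rH lH θH nH F a b) {v : ℝ} (hv : v ∈ Icc v₀ b) :
    -F.ν 0 v / F.Ω 0 v = nH v / (rH v * ΩH M v) := by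
  have h1 := h.n_H v hv
  have h2 := h.sol.r_pos 0 h.zero_mem v hv
  have h3 := ΩH_pos M v
  rw [h.r_H v hv] at h1 h2
  rw [h.Ω_H v hv, div_eq_div_iff h3.ne' (by positivity)]
  linear_combination -ΩH M v * h1

/-- By the Raychaudhuri equation `f = -Ω̂⁻² ∂_U r` is nondecreasing in `U`, so it is at least its value
on the horizon. -/
theorem f_ge (h : RectSol M p D₂ D₃ v₀ ρ c rH lH θH nH F a b) {U v : ℝ} (hU : U ∈ Icc 0 a)
    (hv : v ∈ Icc v₀ b) : nH v / (rH v * ΩH M v) ≤ -F.ν U v / F.Ω U v := by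
  rw [← h.f_H hv]
  have hsub : Icc 0 U ⊆ Icc 0 a := Icc_subset_Icc_right hU.2
  exact le_of_deriv_nonneg hU.1 (fun s hs => (h.f_U (hsub hs) hv).mono hsub) (fun s hs => by
    have := h.sol.Ω_pos s (hsub hs) v hv
    have := h.sol.r_pos s (hsub hs) v hv
    positivity)

theorem rH_pos (h : RectSol M p D₂ D₃ v₀ ρ c rH lH θH nH F a b) {v : ℝ}
    (hv : v ∈ Icc v₀ b) : 0 < rH v := by
  rw [← h.r_H v hv]; exact h.sol.r_pos 0 h.zero_mem v hv

theorem fH_pos (h : RectSol M p D₂ D₃ v₀ ρ c rH lH θH nH F a b) {v : ℝ}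
    (hv : v ∈ Icc v₀ b) : 0 < nH v / (rH v * ΩH M v) :=
  div_pos (h.hor.n_pos v hv.1) (mul_pos (h.rH_pos hv) (ΩH_pos M v))

theorem f_pos (h : RectSol M p D₂ D₃ v₀ ρ c rH lH θH nH F a b) {U v : ℝ} (hU : U ∈ Icc 0 a)
    (hv : v ∈ Icc v₀ b) : 0 < -F.ν U v / F.Ω U v := (h.fH_pos hv).trans_le (h.f_ge hU hv)

theorem ν_neg (h : RectSol M p D₂ D₃ v₀ ρ c rH lH θH nH F a b) {U v : ℝ} (hU : U ∈ Icc 0 a)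
    (hv : v ∈ Icc v₀ b) : F.ν U v < 0 := by
  have h1 := h.f_pos hU hv
  have h2 := h.sol.Ω_pos U hU v hv
  by_contra hn
  push Not at hn
  have : -F.ν U v / F.Ω U v ≤ 0 := div_nonpos_of_nonpos_of_nonneg (by linarith) h2.le
  linarith

theorem n_pos (h : RectSol M p D₂ D₃ v₀ ρ c rH lH θH nH F a b) {U v : ℝ} (hU : U ∈ Icc 0 a)
    (hv : v ∈ Icc v₀ b) : 0 < -(F.r U v * F.ν U v) := by
  have := mul_pos (h.sol.r_pos U hU v hv) (neg_pos.2 (h.ν_neg hU hv))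
  linarith

theorem r_anti (h : RectSol M p D₂ D₃ v₀ ρ c rH lH θH nH F a b) {U U' v : ℝ} (hU' : 0 ≤ U')
    (hUU : U' ≤ U) (hU : U ≤ a) (hv : v ∈ Icc v₀ b) : F.r U v ≤ F.r U' v := by
  have hsub : Icc U' U ⊆ Icc 0 a := Icc_subset_Icc hU' hU
  exact le_of_deriv_nonpos hUU (fun s hs => (h.sol.r_U s (hsub hs) v hv).mono hsub)
    (fun s hs => (h.ν_neg (hsub hs) hv).le)

theorem r_le_H (h : RectSol M p D₂ D₃ v₀ ρ c rH lH θH nH F a b) {U v : ℝ} (hU : U ∈ Icc 0 a)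
    (hv : v ∈ Icc v₀ b) : F.r U v ≤ rH v := by
  rw [← h.r_H v hv]; exact h.r_anti le_rfl hU.1 hU.2 hv

theorem r_le (h : RectSol M p D₂ D₃ v₀ ρ c rH lH θH nH F a b) {U v : ℝ} (hU : U ∈ Icc 0 a)
    (hv : v ∈ Icc v₀ b) : F.r U v ≤ 2 * M := (h.r_le_H hU hv).trans (h.hor.r_le v hv.1)

/-- If `|r Y φ| ≤ m` between the horizon and a point, then `f` exceeds its value on the horizon at
most by a factor that is a power of the ratio of the radii. -/
theorem f_le (h : RectSol M p D₂ D₃ v₀ ρ c rH lH θH nH F a b) {U v m : ℝ} (hU : U ∈ Icc 0 a)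
    (hv : v ∈ Icc v₀ b) (hm : ∀ s ∈ Icc 0 U, |F.r s v * F.ζ s v| ≤ m * -F.ν s v) :
    -F.ν U v / F.Ω U v
      ≤ nH v / (rH v * ΩH M v) * Real.exp (m ^ 2 * (Real.log (rH v) - Real.log (F.r U v))) := by
  have hsub : Icc 0 U ⊆ Icc 0 a := Icc_subset_Icc_right hU.2
  have h1 := sub_le_sub_of_deriv_le (g := fun U => -(m ^ 2 * Real.log (F.r U v))) hU.1
    (fun s hs => ((h.f_U (hsub hs) hv).mono hsub).log (h.f_pos (hsub hs) hv).ne')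
    (fun s hs => ((((h.sol.r_U s (hsub hs) v hv).mono hsub).log
      (h.sol.r_pos s (hsub hs) v hv).ne').const_mul (m ^ 2)).neg) (fun s hs => by
      have hr := h.sol.r_pos s (hsub hs) v hv
      have hΩ := h.sol.Ω_pos s (hsub hs) v hv
      have hν := neg_pos.2 (h.ν_neg (hsub hs) hv)
      have h2 := pow_le_pow_left₀ (abs_nonneg _) (hm s hs) 2
      rw [sq_abs, mul_pow, mul_pow] at h2
      have e1 : F.r s v * F.ζ s v ^ 2 / F.Ω s v / (-F.ν s v / F.Ω s v)
          = F.r s v ^ 2 * F.ζ s v ^ 2 / (F.r s v * -F.ν s v) := by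
        field_simp
      have e2 : -(m ^ 2 * (F.ν s v / F.r s v)) = m ^ 2 * (-F.ν s v) ^ 2 / (F.r s v * -F.ν s v) := by
        have := hν.ne'
        field_simp
      rw [e1, e2]
      gcongr)
  rw [h.f_H hv, h.r_H v hv] at h1
  have h3 := h.f_pos hU hv
  have h4 := h.fH_pos hv
  rw [← Real.log_le_log_iff h3 (by positivity), Real.log_mul h4.ne' (Real.exp_ne_zero _),
    Real.log_exp]
  linarith

end RectSol

/-- The coefficient of the transport equation for `r Y φ`; it is positive near the horizon, which is
the red-shift effect. -/
noncomputable def damp (F : Fields) (U v : ℝ) : ℝ :=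
  1 / (4 * F.r U v * (-F.ν U v / F.Ω U v)) - F.lam U v / F.r U v

namespace RectSol

variable {M p D₂ D₃ v₀ ρ c a b : ℝ} {rH lH θH nH : ℝ → ℝ} {F : Fields}

/-- The transport equation for `r Y φ`, with the coefficient `damp`. -/
theorem rYφ_v (h : RectSol M p D₂ D₃ v₀ ρ c rH lH θH nH F a b) {U v : ℝ} (hU : U ∈ Icc 0 a)
    (hv : v ∈ Icc v₀ b) : HasDerivWithinAt (fun v => F.r U v * F.ζ U v / -F.ν U v)
      (-damp F U v * (F.r U v * F.ζ U v / -F.ν U v) + F.θ U v) (Icc v₀ b) v := by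
  have hr := (h.sol.r_pos U hU v hv).ne'
  have hΩ := (h.sol.Ω_pos U hU v hv).ne'
  have hν := (h.ν_neg hU hv).ne
  refine ((h.sol.rζ_v hU hv).div (h.sol.ν_v U hU v hv).neg (neg_ne_zero.2 hν)).congr_deriv ?_
  simp only [damp, Fields.N, Pi.neg_apply]
  field_simp
  ring

theorem rYφ_div_v (hM : 0 < M) (hv₀ : 0 < v₀) (h : RectSol M p D₂ D₃ v₀ ρ c rH lH θH nH F a b)
    {U v : ℝ} (hU : U ∈ Icc 0 a) (hv : v ∈ Icc v₀ b) :
    HasDerivWithinAt (fun v => F.r U v * F.ζ U v / -F.ν U v / wP M p v)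
      (-(damp F U v - p / v) * (F.r U v * F.ζ U v / -F.ν U v / wP M p v) + F.θ U v / wP M p v)
      (Icc v₀ b) v := by
  have hv0 := hv₀.trans_le hv.1
  have hP := (wP_pos (p := p) hM hv0).ne'
  refine ((h.rYφ_v hU hv).div (hasDerivAt_wP hM hv0).hasDerivWithinAt hP).congr_deriv ?_
  field_simp
  ring

theorem abs_ζ_le_iff (h : RectSol M p D₂ D₃ v₀ ρ c rH lH θH nH F a b) {U v m : ℝ}
    (hU : U ∈ Icc 0 a) (hv : v ∈ Icc v₀ b) :
    |F.r U v * F.ζ U v| ≤ m * -F.ν U v ↔ |F.r U v * F.ζ U v / -F.ν U v| ≤ m := by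
  have hν := neg_pos.2 (h.ν_neg hU hv)
  rw [abs_div, abs_of_pos hν, div_le_iff₀ hν]

/-- By continuity the solution is close to its values on the horizon in a bounded range of `v`, if
the range of `U` is small. -/
theorem exists_nearHorizon (hM : 0 < M) (hv₀ : 0 < v₀) (hp : 1 < p) {v₁ η B r₁ K k : ℝ}
    (hv₁ : v₀ ≤ v₁) (hη : 0 < η) (hB : 0 < B) (hr₁ : 0 < r₁) (hK : 0 < K) (hk : 0 < k) :
    ∃ a₀ : ℝ, 0 < a₀ ∧ ∀ (D₂ D₃ ρ c Ed : ℝ) (rH lH θH nH : ℝ → ℝ) (F : Fields) (a b : ℝ),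
      a ≤ a₀ → RectSol M p D₂ D₃ v₀ ρ c rH lH θH nH F a b →
      Bootstrap M p v₀ c B r₁ K k Ed F a b → NearHorizon M v₀ v₁ η rH lH θH nH F a b := by
  set S := Real.exp (k * (v₁ - v₀)) with hS
  have hS0 : 0 < S := Real.exp_pos _
  -- `L` bounds all the `U`-derivatives for `v ≤ v₁`.
  set L := K * S + (K * S / (4 * r₁) + K * S * K / r₁) + (K * (K * S) + K * S * K) / r₁
    + (2 * (K * S) * K + 1 / 2 * (K * S) / r₁ ^ 2 + 2 * (K * S) * K / r₁ ^ 2) with hL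
  have hL0 : 0 < L := by positivity
  -- the lapse on the ingoing cone is continuous at the horizon
  have hE0 : EE M 0 v₀ < 1 := by simp [EE]
  have hcont : ContinuousAt (fun U => Real.log (ΩK M U v₀)) 0 :=
    ((hasDerivAt_ΩK_U hM hE0).continuousAt).log (ΩK_pos hE0).ne'
  obtain ⟨d, hd, hdΩ⟩ := Metric.continuousAt_iff.1 hcont (η / 2) (by positivity)
  set P₀ := wP M p v₀ with hP₀
  have hP₀0 : 0 < P₀ := wP_pos hM hv₀
  refine ⟨min (d / 2) (min (η / L) (min (η / (2 * L * (v₁ - v₀ + 1))) (η * r₁ / ((B * P₀) ^ 2 * L)))),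
    by have : 0 < v₁ - v₀ + 1 := by linarith
       positivity, fun D₂ D₃ ρ c Ed rH lH θH nH F a b ha h hW => ?_⟩
  have ha1 : a ≤ d / 2 := ha.trans (min_le_left _ _)
  have ha2 : a ≤ η / L := ha.trans ((min_le_right _ _).trans (min_le_left _ _))
  have ha3 : a ≤ η / (2 * L * (v₁ - v₀ + 1)) :=
    ha.trans ((min_le_right _ _).trans ((min_le_right _ _).trans (min_le_left _ _)))
  have ha4 : a ≤ η * r₁ / ((B * P₀) ^ 2 * L) :=
    ha.trans ((min_le_right _ _).trans ((min_le_right _ _).trans (min_le_right _ _)))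
  have ha2' : L * a ≤ η := by rw [le_div_iff₀ hL0] at ha2; linarith
  have ha3' : L * a * (v₁ - v₀) ≤ η / 2 := by
    have : 0 < v₁ - v₀ + 1 := by linarith
    rw [le_div_iff₀ (by positivity)] at ha3
    have := mul_nonneg hL0.le h.ha
    nlinarith
  have ha4' : (B * P₀) ^ 2 * (L * a / r₁) ≤ η := by
    rw [le_div_iff₀ (by positivity)] at ha4
    rw [← mul_div_assoc, div_le_iff₀ hr₁]
    linarith
  have hSv : ∀ v, v ≤ v₁ → K * Real.exp (k * (v - v₀)) ≤ K * S := fun v hv => by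
    rw [hS]; gcongr
  have key : ∀ U ∈ Icc 0 a, ∀ v ∈ Icc v₀ b, v ≤ v₁ → |F.ν U v| ≤ L ∧ |F.N U v| ≤ L ∧
      |F.H U v| ≤ L ∧ |F.A U v| ≤ L := by
    intro U hU v hv hv1
    have hr := hW.r_ge U hU v hv
    have hr0 := hr₁.trans_le hr
    have hν := (hW.ν_le U hU v hv).trans (hSv v hv1)
    have hΩ := (hW.Ω_le U hU v hv).trans (hSv v hv1)
    have hζ := (hW.ζ_le' U hU v hv).trans (hSv v hv1)
    have hl := hW.lam_le U hU v hv
    have hθ := hW.θ_le U hU v hv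
    have t1 : 0 < K * S := by positivity
    have t2 : 0 < K * S / (4 * r₁) + K * S * K / r₁ := by positivity
    have t3 : 0 < (K * (K * S) + K * S * K) / r₁ := by positivity
    have t4 : 0 < 2 * (K * S) * K + 1 / 2 * (K * S) / r₁ ^ 2 + 2 * (K * S) * K / r₁ ^ 2 := by
      positivity
    refine ⟨by linarith, ?_, ?_, ?_⟩
    · have : |F.N U v| ≤ K * S / (4 * r₁) + K * S * K / r₁ := by
        rw [Fields.N]
        refine (abs_sub _ _).trans (add_le_add ?_ ?_)
        · rw [abs_div, abs_neg, abs_of_pos (by positivity : 0 < 4 * F.r U v)]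
          gcongr
        · rw [abs_div, abs_mul, abs_of_pos hr0]
          gcongr
      linarith
    · have : |F.H U v| ≤ (K * (K * S) + K * S * K) / r₁ := by
        rw [Fields.H, abs_div, abs_neg, abs_of_pos hr0]
        have : |F.lam U v * F.ζ U v + F.ν U v * F.θ U v| ≤ K * (K * S) + K * S * K := by
          refine (abs_add_le _ _).trans (add_le_add ?_ ?_) <;> rw [abs_mul] <;> gcongr
        gcongr
      linarith
    · have : |F.A U v| ≤ 2 * (K * S) * K + 1 / 2 * (K * S) / r₁ ^ 2 + 2 * (K * S) * K / r₁ ^ 2 := by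
        rw [Fields.A]
        refine (abs_add_le _ _).trans (add_le_add ((abs_add_le _ _).trans (add_le_add ?_ ?_)) ?_)
        · rw [abs_mul, abs_mul, abs_neg, abs_two]
          gcongr
        · rw [abs_div, abs_mul, abs_of_pos (by positivity : 0 < F.r U v ^ 2),
            abs_of_pos (by norm_num : (0 : ℝ) < 1 / 2)]
          gcongr
        · rw [abs_div, abs_mul, abs_mul, abs_two, abs_of_pos (by positivity : 0 < F.r U v ^ 2)]
          gcongr
      linarith
  have hUL : ∀ U ∈ Icc 0 a, L * (U - 0) ≤ L * a := fun U hU => by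
    have := hU.2; gcongr; linarith
  have hdr : ∀ U ∈ Icc 0 a, ∀ v ∈ Icc v₀ b, v ≤ v₁ → rH v - F.r U v ≤ L * a := by
    intro U hU v hv hv1
    have hsub : Icc 0 U ⊆ Icc 0 a := Icc_subset_Icc_right hU.2
    have := abs_sub_le_of_abs_deriv_le_const (C := L) hU.1
      (fun s hs => (h.sol.r_U s (hsub hs) v hv).mono hsub) (fun s hs => (key s (hsub hs) v hv hv1).1)
    rw [h.r_H v hv] at this
    linarith [neg_le_abs (F.r U v - rH v), hUL U hU]
  have hdα : ∀ U ∈ Icc 0 a, ∀ v ∈ Icc v₀ b, v ≤ v₁ → |F.α U v - 1 / (4 * M)| ≤ L * a := by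
    intro U hU v hv hv1
    have hsub : Icc 0 U ⊆ Icc 0 a := Icc_subset_Icc_right hU.2
    have := abs_sub_le_of_abs_deriv_le_const (C := L) hU.1
      (fun s hs => (h.sol.α_U s (hsub hs) v hv).mono hsub)
      (fun s hs => (key s (hsub hs) v hv hv1).2.2.2)
    rw [h.α_H v hv] at this
    exact this.trans (hUL U hU)
  refine ⟨fun U hU v hv hv1 => ?_, fun U hU v hv hv1 => ?_, fun U hU v hv hv1 => ?_,
    fun U hU v hv hv1 => ?_, fun U hU v hv hv1 => ?_⟩
  · have hsub : Icc 0 U ⊆ Icc 0 a := Icc_subset_Icc_right hU.2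
    have := abs_sub_le_of_abs_deriv_le_const (C := L) hU.1
      (fun s hs => (h.sol.lam_U s (hsub hs) v hv).mono hsub)
      (fun s hs => (key s (hsub hs) v hv hv1).2.1)
    rw [h.lam_H v hv] at this
    linarith [hUL U hU]
  · have hsub : Icc 0 U ⊆ Icc 0 a := Icc_subset_Icc_right hU.2
    have := abs_sub_le_of_abs_deriv_le_const (C := L) hU.1
      (fun s hs => (h.sol.θ_U s (hsub hs) v hv).mono hsub)
      (fun s hs => (key s (hsub hs) v hv hv1).2.2.1)
    rw [h.θ_H v hv] at this
    linarith [hUL U hU]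
  · exact (hdr U hU v hv hv1).trans ha2'
  · have hsub : Icc v₀ v ⊆ Icc v₀ b := Icc_subset_Icc_right hv.2
    have h1 := sub_le_sub_of_deriv_le hv.1 (g := fun v => (1 / (4 * M) + L * a) * v)
      (g' := fun _ => 1 / (4 * M) + L * a)
      (fun s hs => (h.sol.logΩ_v hU (hsub hs)).mono hsub)
      (fun s _ => by
        simpa using ((hasDerivAt_id s).const_mul (1 / (4 * M) + L * a)).hasDerivWithinAt)
      (fun s hs => by
        linarith [(abs_le.1 (hdα U hU s (hsub hs) (hs.2.trans hv1))).2])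
    rw [h.Ω_I U hU] at h1
    have h2 : Real.log (ΩK M U v₀) - Real.log (ΩK M 0 v₀) ≤ η / 2 := by
      have hdist : dist U 0 < d := by
        rw [Real.dist_eq, sub_zero, abs_of_nonneg hU.1]; linarith [hU.2]
      have := (hdΩ hdist).le
      rw [Real.dist_eq] at this
      exact (le_abs_self _).trans this
    rw [ΩK_zero, Real.log_exp] at h2
    have h3 : Real.log (F.Ω U v) ≤ -1 + v / (4 * M) + η := by
      have e1 : (1 / (4 * M) + L * a) * v - (1 / (4 * M) + L * a) * v₀
          = v / (4 * M) - v₀ / (4 * M) + L * a * (v - v₀) := by ring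
      have e2 : L * a * (v - v₀) ≤ L * a * (v₁ - v₀) := by
        have := mul_nonneg hL0.le h.ha
        gcongr
      rw [e1] at h1
      linarith
    rw [Real.log_le_iff_le_exp (h.sol.Ω_pos U hU v hv), Real.exp_add] at h3
    exact h3
  · have hsub : Icc 0 U ⊆ Icc 0 a := Icc_subset_Icc_right hU.2
    have hv0 := hv₀.trans_le hv.1
    refine (h.f_le hU hv (m := B * P₀) (fun s hs => (hW.ζ_le s (hsub hs) v hv).trans ?_)).trans ?_
    · have := h.ν_neg (hsub hs) hv
      have : 0 ≤ -F.ν s v := by linarith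
      have := wP_anti (p := p) hM (by linarith) hv₀ hv.1
      gcongr
    · have := h.fH_pos hv
      gcongr
      refine le_trans ?_ ha4'
      gcongr
      have hr := hW.r_ge U hU v hv
      have hr0 := hr₁.trans_le hr
      have hrH := h.rH_pos hv
      rw [← Real.log_div hrH.ne' hr0.ne']
      have h1 := Real.log_le_sub_one_of_pos (div_pos hrH hr0)
      have h2 : rH v / F.r U v - 1 = (rH v - F.r U v) / F.r U v := by field_simp
      rw [h2] at h1
      refine h1.trans ?_
      have := hdr U hU v hv hv1
      have := mul_nonneg hL0.le h.ha
      gcongr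

end RectSol

/-! ### Closing the bootstrap assumptions -/

theorem exp_le_one_add_two_mul {x : ℝ} (h0 : 0 ≤ x) (h1 : x ≤ 1) : Real.exp x ≤ 1 + 2 * x := by
  have := Real.abs_exp_sub_one_le (x := x) (by rwa [abs_of_nonneg h0])
  rw [abs_of_nonneg h0] at this
  linarith [le_abs_self (Real.exp x - 1)]

namespace RectSol

variable {M p D₂ D₃ v₀ ρ c a b : ℝ} {rH lH θH nH : ℝ → ℝ} {F : Fields}

/-- Near the horizon `r ∂_v φ` inherits the bound of the data, with twice the constant. -/
theorem r_abs_θ_le_strip (hM : 0 < M) (hp : 1 < p) (hD₂ : 0 < D₂) (hv₀ : 0 < v₀)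
    (h : RectSol M p D₂ D₃ v₀ ρ c rH lH θH nH F a b) {v₁ η : ℝ}
    (hN : NearHorizon M v₀ v₁ η rH lH θH nH F a b) (hη : 0 < η)
    (hη' : 2 * M * η ≤ D₂ * wP M p v₁) {U v : ℝ} (hU : U ∈ Icc 0 a) (hv : v ∈ Icc v₀ b)
    (hv1 : v ≤ v₁) : F.r U v * |F.θ U v| ≤ 2 * D₂ * wP M p v := by
  have hr := h.sol.r_pos U hU v hv
  have hrH := h.rH_pos hv
  have h1 := h.hor.rθ_nonneg v hv.1
  have h2 := h.hor.rθ_le v hv.1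
  have hθ0 : 0 ≤ θH v := nonneg_of_mul_nonneg_right h1 hrH
  have h3 := hN.θ U hU v hv hv1
  have h4 : |F.θ U v| ≤ θH v + η := by
    have := abs_sub_abs_le_abs_sub (F.θ U v) (θH v)
    rw [abs_of_nonneg hθ0] at this
    linarith
  have h5 : F.r U v * |F.θ U v| ≤ F.r U v * θH v + F.r U v * η := by
    rw [← mul_add]; gcongr
  have h6 : F.r U v * θH v ≤ rH v * θH v := by
    have := h.r_le_H hU hv
    gcongr
  have h7 : F.r U v * η ≤ 2 * M * η := by
    have := h.r_le hU hv
    gcongr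
  have h8 : D₂ * wP M p v₁ ≤ D₂ * wP M p v := by
    have := wP_anti (p := p) hM (by linarith) (hv₀.trans_le hv.1) hv1
    gcongr
  linarith

/-- The bound for `r Y φ` near the horizon. After a time that depends on the data only, the
red-shift damps `r Y φ / v^{-p}`; before that time Grönwall's inequality is enough. -/
theorem exists_strip_bound (hM : 0 < M) (hp : 1 < p) (hD₂ : 0 < D₂) (hD₃ : 0 < D₃) (hv₀ : 0 < v₀)
    (hρ : 0 < ρ) (hc : 1 ≤ c) :
    ∃ B₁ : ℝ, 32 * D₂ ≤ B₁ ∧ ∀ (v₁ η : ℝ) (rH lH θH nH : ℝ → ℝ) (F : Fields) (a b : ℝ),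
      RectSol M p D₂ D₃ v₀ ρ c rH lH θH nH F a b → NearHorizon M v₀ v₁ η rH lH θH nH F a b →
      0 < η → η ≤ 1 / 64 → η ≤ M / 2 → η ≤ ρ / 2 → 2 * M * η ≤ D₂ * wP M p v₁ →
      ∀ U ∈ Icc 0 a, ∀ v ∈ Icc v₀ b, v ≤ v₁ →
        |F.r U v * F.ζ U v / -F.ν U v| ≤ B₁ * wP M p v := by
  have hp0 : 0 < p := by linarith
  set q₀ := wq M p v₀ with hq₀
  have hq₀0 : 0 < q₀ := wq_pos hM hv₀
  set P₀ := wP M p v₀ with hP₀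
  have hP₀0 : 0 < P₀ := wP_pos hM hv₀
  have ht : Tendsto (fun v => c * wq M p v) atTop (𝓝 0) := by
    simpa using (tendsto_wq hM hp).const_mul c
  -- After `va` the damping exceeds the loss `p / v` from the weight by `1 / (16M)`.
  obtain ⟨va, hva0, hva1, hva2, hva3⟩ := ((eventually_ge_atTop v₀).and
    ((ht.eventually_le_const (show (0 : ℝ) < 1 / 64 by norm_num)).and
    ((ht.eventually_le_const (show (0 : ℝ) < M / 2 by linarith)).and
    (eventually_ge_atTop (32 * p * M))))).exists
  have hva : 0 < va := hv₀.trans_le hva0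
  set κ₀ := (c * q₀ + 1) * 2 / ρ with hκ₀
  have hκ₀0 : 0 ≤ κ₀ := by positivity
  set cθ := D₂ * P₀ / ρ + 1 / 64 with hcθ
  have hcθ0 : 0 ≤ cθ := by positivity
  -- The Grönwall bound up to `va`.
  set Ba := Real.exp (κ₀ * (va - v₀)) * (D₃ + cθ * (va - v₀)) with hBa
  have hBa0 : 0 ≤ Ba := by
    have : 0 ≤ va - v₀ := by linarith
    positivity
  have hPa := wP_pos (p := p) hM hva
  refine ⟨Ba / wP M p va + 32 * D₂, by linarith [div_nonneg hBa0 hPa.le], ?_⟩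
  intro v₁ η rH lH θH nH F a b h hN hη hη1 hη2 hη3 hη4 U hU v hv hv1
  have hr_ge : ∀ s ∈ Icc v₀ b, s ≤ v₁ → ρ / 2 ≤ F.r U s := fun s hs hs1 => by
    linarith [hN.r U hU s hs hs1, h.hor.r_ge s hs.1]
  have hlam : ∀ s ∈ Icc v₀ b, s ≤ v₁ → F.lam U s ≤ c * wq M p s + η := fun s hs hs1 => by
    linarith [(abs_le.1 (hN.lam U hU s hs hs1)).2, h.hor.lam_le s hs.1]
  -- the range up to `va`
  have early : ∀ w ∈ Icc v₀ b, w ≤ v₁ → w ≤ va → |F.r U w * F.ζ U w / -F.ν U w| ≤ Ba := by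
    intro w hw hw1 hwa
    have hsub : Icc v₀ w ⊆ Icc v₀ b := Icc_subset_Icc_right hw.2
    have h1 := abs_le_of_growth (k := κ₀) (c := cθ) (m := D₃) hw.1
      (fun s hs => (h.rYφ_v hU (hsub hs)).mono hsub) hκ₀0 (fun s hs => by
        have hs1 := hs.2.trans hw1
        have hr := hr_ge s (hsub hs) hs1
        have hr0 := h.sol.r_pos U hU s (hsub hs)
        have hf := h.f_pos hU (hsub hs)
        have hl := hlam s (hsub hs) hs1
        have e1 : 0 < 1 / (4 * F.r U s * (-F.ν U s / F.Ω U s)) := by positivity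
        have e2 : F.lam U s / F.r U s ≤ κ₀ := by
          rw [div_le_iff₀ hr0]
          have e3 : c * wq M p s ≤ c * q₀ := by
            have := wq_anti hM hp hv₀ hs.1
            gcongr
          have e4 : κ₀ * (ρ / 2) = c * q₀ + 1 := by rw [hκ₀]; field_simp
          have e5 := mul_le_mul_of_nonneg_left hr hκ₀0
          linarith
        rw [damp]
        linarith)
      (fun s hs => by
        have hs1 := hs.2.trans hw1
        have hsb := hsub hs
        have e1 := h.hor.rθ_nonneg s hsb.1
        have e2 := h.hor.rθ_le s hsb.1
        have e3 : 0 ≤ θH s := nonneg_of_mul_nonneg_right e1 (h.rH_pos hsb)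
        have e4 : ρ * θH s ≤ rH s * θH s := by
          have := h.hor.r_ge s hsb.1
          gcongr
        have e5 : D₂ * wP M p s ≤ D₂ * P₀ := by
          have := wP_anti hM hp0 hv₀ hs.1
          gcongr
        have e6 : θH s ≤ D₂ * P₀ / ρ := by rw [le_div_iff₀ hρ]; linarith
        have e7 := hN.θ U hU s hsb hs1
        have := abs_sub_abs_le_abs_sub (F.θ U s) (θH s)
        rw [abs_of_nonneg e3] at this
        linarith)
      ((h.abs_ζ_le_iff hU h.v₀_mem).1 (h.ζ_I U hU)) hD₃.le hcθ0
    refine h1.trans ?_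
    have : 0 ≤ w - v₀ := by linarith [hw.1]
    rw [hBa]
    gcongr
  rcases le_total v va with hle | hle
  · have h1 := early v hv hv1 hle
    have h2 := wP_anti hM hp0 (hv₀.trans_le hv.1) hle
    have h3 : Ba ≤ Ba / wP M p va * wP M p v := by
      calc Ba = Ba / wP M p va * wP M p va := by field_simp
        _ ≤ _ := by gcongr
    have h4 := wP_pos (p := p) hM (hv₀.trans_le hv.1)
    have : 0 ≤ 32 * D₂ * wP M p v := by positivity
    linarith
  · have hsub : Icc va v ⊆ Icc v₀ b := Icc_subset_Icc hva0 hv.2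
    have hPv := wP_pos (p := p) hM (hv₀.trans_le hv.1)
    have hη0 := exp_le_one_add_two_mul hη.le (by linarith)
    have hd : ∀ s ∈ Icc va v, 1 / (16 * M) ≤ damp F U s - p / s := by
      intro s hs
      have hs1 := hs.2.trans hv1
      have hsb := hsub hs
      have hs0 : 0 < s := hva.trans_le hs.1
      have hr0 := h.sol.r_pos U hU s hsb
      have hq1 : c * wq M p s ≤ c * wq M p va := by
        have := wq_anti hM hp hva hs.1
        gcongr
      have e0 : M ≤ F.r U s := by
        linarith [hN.r U hU s hsb hs1, h.hor.r_near s hsb.1]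
      have e1 : F.lam U s / F.r U s ≤ 1 / (32 * M) := by
        rw [div_le_div_iff₀ hr0 (by positivity)]
        have := hlam s hsb hs1
        have : F.lam U s * (32 * M) ≤ (1 / 32) * (32 * M) := by
          have : F.lam U s ≤ 1 / 32 := by linarith
          gcongr
        linarith
      have e2 : p / s ≤ 1 / (32 * M) := by
        rw [div_le_div_iff₀ hs0 (by positivity)]
        linarith [hs.1]
      have e3 : 1 / (8 * M) ≤ 1 / (4 * F.r U s * (-F.ν U s / F.Ω U s)) := by
        have hf := h.f_pos hU hsb
        have f1 := hN.f U hU s hsb hs1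
        have f2 := (abs_le.1 (h.hor.f_near s hsb.1)).2
        have f3 : -F.ν U s / F.Ω U s ≤ 1 := by
          have f4 : nH s / (rH s * ΩH M s) ≤ 33 / 64 := by linarith
          calc _ ≤ _ := f1
            _ ≤ 33 / 64 * (1 + 2 * (1 / 64)) := by
              have := h.fH_pos hsb
              refine mul_le_mul f4 ?_ (Real.exp_pos _).le (by norm_num)
              linarith
            _ ≤ _ := by norm_num
        have hr2 := h.r_le hU hsb
        refine one_div_le_one_div_of_le (by positivity) ?_
        calc 4 * F.r U s * (-F.ν U s / F.Ω U s) ≤ 4 * (2 * M) * 1 := by gcongr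
          _ = 8 * M := by ring
      have e4 : 1 / (8 * M) = 1 / (32 * M) + 1 / (32 * M) + 1 / (16 * M) := by
        field_simp; norm_num
      rw [damp]
      linarith
    have h0 : |F.r U va * F.ζ U va / -F.ν U va / wP M p va| ≤ Ba / wP M p va + 32 * D₂ := by
      rw [abs_div, abs_of_pos hPa]
      have := early va (hsub (left_mem_Icc.2 hle)) (hle.trans hv1) le_rfl
      have : |F.r U va * F.ζ U va / -F.ν U va| / wP M p va ≤ Ba / wP M p va := by gcongr
      linarith
    have h1 := abs_le_of_damped (y := fun v => F.r U v * F.ζ U v / -F.ν U v / wP M p v)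
      (κ := fun s => damp F U s - p / s) (g := fun s => F.θ U s / wP M p s) hle
      (fun s hs => (rYφ_div_v hM hv₀ h hU (hsub hs)).mono hsub)
      (fun s hs => le_trans (by positivity) (hd s hs)) (fun s hs => by
        have hs1 := hs.2.trans hv1
        have hsb := hsub hs
        have hs0 : 0 < s := hva.trans_le hs.1
        have hP := wP_pos (p := p) hM hs0
        have hq1 : c * wq M p s ≤ c * wq M p va := by
          have := wq_anti hM hp hva hs.1
          gcongr
        have e0 : M ≤ F.r U s := by
          linarith [hN.r U hU s hsb hs1, h.hor.r_near s hsb.1]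
        have e1 := h.r_abs_θ_le_strip hM hp hD₂ hv₀ hN hη hη4 hU hsb hs1
        have e2 : M * |F.θ U s| ≤ F.r U s * |F.θ U s| := by gcongr
        have e3 : 1 / (16 * M) * (32 * D₂) ≤ (damp F U s - p / s) * (Ba / wP M p va + 32 * D₂) := by
          refine mul_le_mul (hd s hs) ?_ (by positivity) (le_trans (by positivity) (hd s hs))
          linarith [div_nonneg hBa0 hPa.le]
        refine le_trans ?_ e3
        rw [abs_div, abs_of_pos hP, div_le_iff₀ hP]
        have : 1 / (16 * M) * (32 * D₂) * wP M p s = 2 * D₂ * wP M p s / M := by field_simp; norm_num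
        rw [this, le_div_iff₀ hM]
        linarith) h0
    rw [abs_div, abs_of_pos hPv, div_le_iff₀ hPv] at h1
    exact h1

end RectSol

/-- The constant in the bound for `r ∂_v r + M - r/2`. -/
noncomputable def massC (M c : ℝ) : ℝ := (2 * M + 1) * c + 4 * M * (c + 1) + 1

/-- The constant in the bound for `∂_v log (r² Ω²) - 1/r + M/r²`. -/
noncomputable def lapseC (M v₀ c B ρ : ℝ) : ℝ :=
  M * B ^ 2 * (M / v₀) + massC M c + 4 * M ^ 2 * (c / (2 * ρ ^ 2) + 2 * c / ρ)

/-- The constant in the crude bounds. -/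
noncomputable def crudeC (M p v₀ c B ρ r₁ : ℝ) : ℝ :=
  (massC M c * wq M p v₀ + M) / r₁ + M * B * wP M p v₀ / r₁ ^ 2
    + ((lapseC M v₀ c B ρ * wq M p v₀ + M) / r₁ ^ 2 + 1 / r₁
      + 2 * ((massC M c * wq M p v₀ + M) / r₁ ^ 2))
    + 4 * c * Real.exp (v₀ / (4 * M)) * (1 + 1 / r₁ + 4 / r₁ + B * wP M p v₀ / r₁ ^ 2)

/-- The time `v₁` is so late that the error terms are small. -/
structure LateTime (M p v₀ c B r₁ v₁ : ℝ) : Prop where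
  v₀_le : v₀ ≤ v₁
  quarter : (c + 1) * wq M p v₁ ≤ 1 / 4
  mass : massC M c * wq M p v₁ ≤ r₁ / 4
  damp : (4 * M * (c + 1) + massC M c) * wq M p v₁ + 4 * M ^ 2 * (p / v₁) ≤ r₁ / 16
  X_le : B ^ 2 * wP M p v₁ ^ 2 * Real.log (2 * M / r₁) ≤ 1
  X_q : (1 + 2 * (c * wq M p v₀)) * (B ^ 2 * (M / v₁) * Real.log (2 * M / r₁)) ≤ 1
  n : (c / (2 * M ^ 2) + 2 * (c + 1) / M) * (v₁ * wq M p v₁ / (2 * p - 2)) ≤ 1 / 4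
  near : 2 * c * wq M p v₁ ≤ M / 2

theorem tendsto_mul_wq {M p : ℝ} (hM : 0 < M) (hp : 1 < p) :
    Tendsto (fun v => v * wq M p v) atTop (𝓝 0) := by
  have h1 : Tendsto (fun v : ℝ => M * (v / M) ^ (-2 * p + 2)) atTop (𝓝 (M * 0)) :=
    (tendsto_rpow_div_neg hM (by linarith)).const_mul M
  rw [mul_zero] at h1
  refine h1.congr' ?_
  filter_upwards [eventually_gt_atTop 0] with v hv
  have hx := div_pos hv hM
  rw [wq, show -2 * p + 2 = (-2 * p + 1) + 1 by ring, Real.rpow_add_one hx.ne']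
  field_simp

/-- The conditions of `LateTime` all hold eventually, because the weights tend to zero. -/
theorem exists_lateTime {M p v₀ c B r₁ : ℝ} (hM : 0 < M) (hp : 1 < p) (hr₁ : 0 < r₁) :
    ∃ v₁, LateTime M p v₀ c B r₁ v₁ := by
  have hq := tendsto_wq hM hp
  have hP := (tendsto_wP hM hp).pow 2
  have hv : ∀ m : ℝ, Tendsto (fun v : ℝ => m / v) atTop (𝓝 0) := fun m =>
    tendsto_const_nhds.div_atTop tendsto_id
  have t1 : Tendsto (fun v => (c + 1) * wq M p v) atTop (𝓝 0) := by simpa using hq.const_mul _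
  have t2 : Tendsto (fun v => massC M c * wq M p v) atTop (𝓝 0) := by simpa using hq.const_mul _
  have t3 : Tendsto (fun v => (4 * M * (c + 1) + massC M c) * wq M p v + 4 * M ^ 2 * (p / v))
      atTop (𝓝 0) := by
    simpa using (hq.const_mul (4 * M * (c + 1) + massC M c)).add ((hv p).const_mul (4 * M ^ 2))
  have t4 : Tendsto (fun v => B ^ 2 * wP M p v ^ 2 * Real.log (2 * M / r₁)) atTop (𝓝 0) := by
    simpa using (hP.const_mul (B ^ 2)).mul_const (Real.log (2 * M / r₁))
  have t5 : Tendsto (fun v => (1 + 2 * (c * wq M p v₀)) * (B ^ 2 * (M / v) * Real.log (2 * M / r₁)))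
      atTop (𝓝 0) := by
    simpa using (((hv M).const_mul (B ^ 2)).mul_const (Real.log (2 * M / r₁))).const_mul
      (1 + 2 * (c * wq M p v₀))
  have t6 : Tendsto (fun v => (c / (2 * M ^ 2) + 2 * (c + 1) / M) * (v * wq M p v / (2 * p - 2)))
      atTop (𝓝 0) := by
    simpa using ((tendsto_mul_wq hM hp).div_const (2 * p - 2)).const_mul
      (c / (2 * M ^ 2) + 2 * (c + 1) / M)
  have t7 : Tendsto (fun v => 2 * c * wq M p v) atTop (𝓝 0) := by simpa using hq.const_mul (2 * c)
  obtain ⟨v, h0, h1, h2, h3, h4, h5, h6, h7⟩ := ((eventually_ge_atTop v₀).and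
    ((t1.eventually_le_const (show (0 : ℝ) < 1 / 4 by norm_num)).and
    ((t2.eventually_le_const (show (0 : ℝ) < r₁ / 4 by positivity)).and
    ((t3.eventually_le_const (show (0 : ℝ) < r₁ / 16 by positivity)).and
    ((t4.eventually_le_const (show (0 : ℝ) < 1 by norm_num)).and
    ((t5.eventually_le_const (show (0 : ℝ) < 1 by norm_num)).and
    ((t6.eventually_le_const (show (0 : ℝ) < 1 / 4 by norm_num)).and
    (t7.eventually_le_const (show (0 : ℝ) < M / 2 by positivity))))))))).exists
  exact ⟨v, h0, h1, h2, h3, h4, h5, h6, h7⟩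

/-- A solution on a rectangle that satisfies the bootstrap assumptions, in the range of parameters
in which they can be improved. -/
structure Setting (M p D₂ D₃ v₀ ρ c B r₁ K k Ed v₁ η : ℝ) (rH lH θH nH : ℝ → ℝ) (F : Fields)
    (a b : ℝ) : Prop where
  hM : 0 < M
  hp : 1 < p
  hD₂ : 0 < D₂
  hv₀ : 0 < v₀
  hρ : 0 < ρ
  hc : 1 ≤ c
  hr₁ : 0 < r₁
  hr₁M : r₁ ≤ M / 2
  hB : 64 * D₂ ≤ B
  hk : k = 1 / r₁ + 1 / (4 * M)
  rect : RectSol M p D₂ D₃ v₀ ρ c rH lH θH nH F a b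
  boot : Bootstrap M p v₀ c B r₁ K k Ed F a b
  near : NearHorizon M v₀ v₁ η rH lH θH nH F a b
  late : LateTime M p v₀ c B r₁ v₁
  η_pos : 0 < η
  η_le : η ≤ 1 / 64
  η_ρ : η ≤ ρ / 2
  η_θ : 2 * M * η ≤ D₂ * wP M p v₁
  η_mass : (2 * M + c * wq M p v₀ + 1) * η ≤ wq M p v₁
  η_f : (1 + 2 * (c * wq M p v₀)) * η ≤ wq M p v₁
  Ed_le : 32 * c / M * Ed ≤ 1 / 4
  Ed_le' : 32 * c * Ed ≤ M / 2
  strip : ∀ U ∈ Icc 0 a, ∀ v ∈ Icc v₀ b, v ≤ v₁ →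
    |F.r U v * F.ζ U v / -F.ν U v| ≤ B / 2 * wP M p v

namespace Setting

variable {M p D₂ D₃ v₀ ρ c B r₁ K k Ed v₁ η a b U v : ℝ} {rH lH θH nH : ℝ → ℝ} {F : Fields}

theorem v_pos (S : Setting M p D₂ D₃ v₀ ρ c B r₁ K k Ed v₁ η rH lH θH nH F a b)
    (hv : v ∈ Icc v₀ b) : 0 < v := S.hv₀.trans_le hv.1

theorem q_pos (S : Setting M p D₂ D₃ v₀ ρ c B r₁ K k Ed v₁ η rH lH θH nH F a b)
    (hv : v ∈ Icc v₀ b) : 0 < wq M p v := wq_pos S.hM (S.v_pos hv)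

theorem P_pos (S : Setting M p D₂ D₃ v₀ ρ c B r₁ K k Ed v₁ η rH lH θH nH F a b)
    (hv : v ∈ Icc v₀ b) : 0 < wP M p v := wP_pos S.hM (S.v_pos hv)

theorem B_pos (S : Setting M p D₂ D₃ v₀ ρ c B r₁ K k Ed v₁ η rH lH θH nH F a b) : 0 < B := by
  linarith [S.hB, S.hD₂]

theorem massC_pos (S : Setting M p D₂ D₃ v₀ ρ c B r₁ K k Ed v₁ η rH lH θH nH F a b) :
    0 < massC M c := by
  have := S.hM
  have := S.hc
  unfold massC
  positivity

theorem r_pos (S : Setting M p D₂ D₃ v₀ ρ c B r₁ K k Ed v₁ η rH lH θH nH F a b)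
    (hU : U ∈ Icc 0 a) (hv : v ∈ Icc v₀ b) : 0 < F.r U v := S.rect.sol.r_pos U hU v hv

theorem q_le_late (S : Setting M p D₂ D₃ v₀ ρ c B r₁ K k Ed v₁ η rH lH θH nH F a b)
    (hv1 : v₁ ≤ v) : wq M p v ≤ wq M p v₁ :=
  wq_anti S.hM S.hp (S.hv₀.trans_le S.late.v₀_le) hv1

theorem q_ge_early (S : Setting M p D₂ D₃ v₀ ρ c B r₁ K k Ed v₁ η rH lH θH nH F a b)
    (hv : v ∈ Icc v₀ b) (hv1 : v ≤ v₁) : wq M p v₁ ≤ wq M p v :=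
  wq_anti S.hM S.hp (S.v_pos hv) hv1

theorem q_le_start (S : Setting M p D₂ D₃ v₀ ρ c B r₁ K k Ed v₁ η rH lH θH nH F a b)
    (hv : v ∈ Icc v₀ b) : wq M p v ≤ wq M p v₀ := wq_anti S.hM S.hp S.hv₀ hv.1

theorem P_le_start (S : Setting M p D₂ D₃ v₀ ρ c B r₁ K k Ed v₁ η rH lH θH nH F a b)
    (hv : v ∈ Icc v₀ b) : wP M p v ≤ wP M p v₀ :=
  wP_anti S.hM (by linarith [S.hp]) S.hv₀ hv.1

theorem log_ratio (S : Setting M p D₂ D₃ v₀ ρ c B r₁ K k Ed v₁ η rH lH θH nH F a b)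
    (hU : U ∈ Icc 0 a) (hv : v ∈ Icc v₀ b) :
    Real.log (rH v) - Real.log (F.r U v) ≤ Real.log (2 * M / r₁) := by
  have h1 := S.rect.rH_pos hv
  have h2 := S.boot.r_ge U hU v hv
  have h3 := S.rect.hor.r_le v hv.1
  have h4 := S.hr₁
  have h5 := S.hM
  rw [Real.log_div (by positivity) h4.ne']
  have := Real.log_le_log h1 h3
  have := Real.log_le_log h4 h2
  linarith

theorem log_nonneg (S : Setting M p D₂ D₃ v₀ ρ c B r₁ K k Ed v₁ η rH lH θH nH F a b) :
    0 ≤ Real.log (2 * M / r₁) := by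
  have := S.hr₁
  have := S.hr₁M
  have := S.hM
  exact Real.log_nonneg (by rw [le_div_iff₀ S.hr₁]; linarith)

/-- `f = -Ω⁻² ∂_u r` is close to `1/2`. -/
theorem f_near (S : Setting M p D₂ D₃ v₀ ρ c B r₁ K k Ed v₁ η rH lH θH nH F a b)
    (hU : U ∈ Icc 0 a) (hv : v ∈ Icc v₀ b) :
    |-F.ν U v / F.Ω U v - 1 / 2| ≤ (c + 1) * wq M p v := by
  have hM := S.hM
  have hq := S.q_pos hv
  have h1 := S.rect.f_ge hU hv
  have h2 := abs_le.1 (S.rect.hor.f_near v hv.1)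
  have h3 := S.rect.fH_pos hv
  have hc0 : 0 < c := by linarith [S.hc]
  have hq0 := wq_pos (p := p) hM S.hv₀
  set fH := nH v / (rH v * ΩH M v) with hfH
  have h4 : 2 * fH ≤ 1 + 2 * (c * wq M p v₀) := by
    have := mul_le_mul_of_nonneg_left (S.q_le_start hv) hc0.le
    linarith
  -- the factor between `f` and its value on the horizon
  obtain ⟨X, hX0, hX1, hX2, hX3⟩ : ∃ X, 0 ≤ X ∧ X ≤ 1 ∧ (1 + 2 * (c * wq M p v₀)) * X ≤ wq M p v ∧
      -F.ν U v / F.Ω U v ≤ fH * Real.exp X := by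
    rcases le_total v v₁ with hv1 | hv1
    · exact ⟨η, S.η_pos.le, by linarith [S.η_le], S.η_f.trans (S.q_ge_early hv hv1),
        S.near.f U hU v hv hv1⟩
    · have hsub : Icc 0 U ⊆ Icc 0 a := Icc_subset_Icc_right hU.2
      have hL := S.log_nonneg
      have hP := S.P_pos hv
      have hv0 := S.v_pos hv
      have hv10 : 0 < v₁ := S.hv₀.trans_le S.late.v₀_le
      refine ⟨(B * wP M p v) ^ 2 * Real.log (2 * M / r₁), by positivity, ?_, ?_, ?_⟩
      · refine le_trans ?_ S.late.X_le
        rw [mul_pow]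
        have := wP_anti (p := p) hM (by linarith [S.hp]) hv10 hv1
        gcongr
      · rw [mul_pow, wP_sq hM hv0]
        calc _ = wq M p v * ((1 + 2 * (c * wq M p v₀)) * (B ^ 2 * (M / v) * Real.log (2 * M / r₁))) := by
              ring
          _ ≤ wq M p v * ((1 + 2 * (c * wq M p v₀)) * (B ^ 2 * (M / v₁) * Real.log (2 * M / r₁))) := by
              gcongr
          _ ≤ wq M p v * 1 := by gcongr; exact S.late.X_q
          _ = _ := mul_one _
      · refine (S.rect.f_le hU hv (fun s hs => S.boot.ζ_le s (hsub hs) v hv)).trans ?_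
        have := S.log_ratio hU hv
        gcongr
  have h5 := exp_le_one_add_two_mul hX0 hX1
  have h6 : fH * Real.exp X ≤ fH + wq M p v := by
    calc fH * Real.exp X ≤ fH * (1 + 2 * X) := by gcongr
      _ = fH + (2 * fH) * X := by ring
      _ ≤ fH + (1 + 2 * (c * wq M p v₀)) * X := by gcongr
      _ ≤ _ := by gcongr
  rw [abs_le]
  constructor <;> linarith

theorem f_late (S : Setting M p D₂ D₃ v₀ ρ c B r₁ K k Ed v₁ η rH lH θH nH F a b)
    (hU : U ∈ Icc 0 a) (hv : v ∈ Icc v₀ b) (hv1 : v₁ ≤ v) :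
    1 / 4 ≤ -F.ν U v / F.Ω U v ∧ -F.ν U v / F.Ω U v ≤ 3 / 4 := by
  have h1 := abs_le.1 (S.f_near hU hv)
  have h2 := S.late.quarter
  have h3 := mul_le_mul_of_nonneg_left (S.q_le_late hv1) (show 0 ≤ c + 1 by linarith [S.hc])
  constructor <;> linarith

/-- The form in which `f ≈ 1/2` enters: `∂_U (r ∂_v r) = (1 / 4f) ∂_U r`. -/
theorem inv_f_late (S : Setting M p D₂ D₃ v₀ ρ c B r₁ K k Ed v₁ η rH lH θH nH F a b)
    (hU : U ∈ Icc 0 a) (hv : v ∈ Icc v₀ b) (hv1 : v₁ ≤ v) :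
    |1 / (4 * (-F.ν U v / F.Ω U v)) - 1 / 2| ≤ 2 * (c + 1) * wq M p v := by
  obtain ⟨h1, h2⟩ := S.f_late hU hv hv1
  have h3 := S.f_near hU hv
  set f := -F.ν U v / F.Ω U v with hf
  have hf0 : 0 < f := by linarith
  have e : 1 / (4 * f) - 1 / 2 = -(f - 1 / 2) / (2 * f) := by field_simp; ring
  rw [e, abs_div, abs_neg, abs_of_pos (by positivity : 0 < 2 * f), div_le_iff₀ (by positivity)]
  nlinarith [abs_nonneg (f - 1 / 2)]

/-- `r ∂_v r + M - r/2`, whose `U`-derivative is proportional to `f - 1/2`. -/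
theorem massFn_U (S : Setting M p D₂ D₃ v₀ ρ c B r₁ K k Ed v₁ η rH lH θH nH F a b)
    (hU : U ∈ Icc 0 a) (hv : v ∈ Icc v₀ b) :
    HasDerivWithinAt (fun U => F.r U v * F.lam U v + (M - 1 / 2 * F.r U v))
      (F.ν U v * (1 / (4 * (-F.ν U v / F.Ω U v)) - 1 / 2)) (Icc 0 a) U := by
  have hν := (S.rect.ν_neg hU hv).ne
  have hΩ := (S.rect.sol.Ω_pos U hU v hv).ne'
  refine ((S.rect.sol.rlam_U hU hv).add
    (((S.rect.sol.r_U U hU v hv).const_mul (1 / 2)).const_sub M)).congr_deriv ?_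
  field_simp
  ring

theorem massFn_H (S : Setting M p D₂ D₃ v₀ ρ c B r₁ K k Ed v₁ η rH lH θH nH F a b)
    (hv : v ∈ Icc v₀ b) :
    |rH v * lH v + (M - 1 / 2 * rH v)| ≤ (2 * M + 1) * c * wq M p v := by
  have hM := S.hM
  have h1 := S.rect.hor.lam_nonneg v hv.1
  have h2 := S.rect.hor.lam_le v hv.1
  have h3 := S.rect.hor.r_le v hv.1
  have h4 := S.rect.hor.r_near v hv.1
  have h5 := S.rect.rH_pos hv
  have h6 : rH v * lH v ≤ 2 * M * (c * wq M p v) := by gcongr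
  have h7 : 0 ≤ rH v * lH v := by positivity
  rw [abs_of_nonneg (by linarith)]
  have : 0 ≤ c * wq M p v := h1.trans h2
  linarith

/-- The mass function estimate. For `v ≤ v₁` it follows from the closeness to the horizon; for later
`v` the equation `massFn_U` is integrated in `U`. -/
theorem massFn_le (S : Setting M p D₂ D₃ v₀ ρ c B r₁ K k Ed v₁ η rH lH θH nH F a b)
    (hU : U ∈ Icc 0 a) (hv : v ∈ Icc v₀ b) :
    |F.r U v * F.lam U v + (M - 1 / 2 * F.r U v)| ≤ massC M c * wq M p v := by
  have hM := S.hM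
  have hq := S.q_pos hv
  have hH := S.massFn_H hv
  have hc0 : 0 < c := by linarith [S.hc]
  rcases le_total v v₁ with hv1 | hv1
  · have h1 := S.near.lam U hU v hv hv1
    have h2 := S.near.r U hU v hv hv1
    have h3 := S.rect.r_le_H hU hv
    have h4 := S.rect.hor.lam_nonneg v hv.1
    have h5 := S.rect.hor.lam_le v hv.1
    have h6 := S.q_le_start hv
    have h7 := S.rect.r_le hU hv
    have h8 := S.r_pos hU hv
    have h9 := S.η_pos
    have e : F.r U v * F.lam U v + (M - 1 / 2 * F.r U v) = (rH v * lH v + (M - 1 / 2 * rH v))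
        + (F.r U v * (F.lam U v - lH v) + -((rH v - F.r U v) * lH v) + 1 / 2 * (rH v - F.r U v)) := by
      ring
    have e1 : |F.r U v * (F.lam U v - lH v)| ≤ 2 * M * η := by
      rw [abs_mul, abs_of_pos h8]; gcongr
    have e2 : |-((rH v - F.r U v) * lH v)| ≤ η * (c * wq M p v₀) := by
      rw [abs_neg, abs_mul, abs_of_nonneg (sub_nonneg.2 h3), abs_of_nonneg h4]
      have : c * wq M p v ≤ c * wq M p v₀ := by gcongr
      gcongr
      linarith
    have e3 : |1 / 2 * (rH v - F.r U v)| ≤ η := by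
      rw [abs_of_nonneg (by linarith)]; linarith
    have e4 := S.η_mass
    have e5 := S.q_ge_early hv hv1
    have e6 : 0 ≤ 4 * M * (c + 1) * wq M p v := by positivity
    rw [e, massC]
    refine (abs_add_le _ _).trans ?_
    have := (abs_add_le (F.r U v * (F.lam U v - lH v) + -((rH v - F.r U v) * lH v))
      (1 / 2 * (rH v - F.r U v)))
    have := (abs_add_le (F.r U v * (F.lam U v - lH v)) (-((rH v - F.r U v) * lH v)))
    linarith
  · have hsub : Icc 0 U ⊆ Icc 0 a := Icc_subset_Icc_right hU.2
    have h1 := abs_sub_le_of_abs_deriv_le hU.1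
      (g := fun U => -(2 * (c + 1) * wq M p v * F.r U v))
      (fun s hs => (S.massFn_U (hsub hs) hv).mono hsub)
      (fun s hs => (((S.rect.sol.r_U s (hsub hs) v hv).mono hsub).const_mul _).neg)
      (fun s hs => by
        have h2 := S.inv_f_late (hsub hs) hv hv1
        have h3 := S.rect.ν_neg (hsub hs) hv
        rw [abs_mul, abs_of_neg h3]
        calc _ ≤ -F.ν s v * (2 * (c + 1) * wq M p v) := by
              have : 0 ≤ -F.ν s v := by linarith
              gcongr
          _ = _ := by ring)
    rw [S.rect.r_H v hv, S.rect.lam_H v hv] at h1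
    have h2 := S.rect.hor.r_le v hv.1
    have h3 := S.r_pos hU hv
    have h4 : 2 * (c + 1) * wq M p v * (rH v - F.r U v) ≤ 2 * (c + 1) * wq M p v * (2 * M) := by
      gcongr; linarith
    have h5 := abs_sub_abs_le_abs_sub (F.r U v * F.lam U v + (M - 1 / 2 * F.r U v))
      (rH v * lH v + (M - 1 / 2 * rH v))
    rw [massC]
    linarith

/-- The bound on `r |∂_v r|` is strictly below `M`. This is the gain that closes the bootstrap. -/
theorem abs_rlam_le_late (S : Setting M p D₂ D₃ v₀ ρ c B r₁ K k Ed v₁ η rH lH θH nH F a b)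
    (hU : U ∈ Icc 0 a) (hv : v ∈ Icc v₀ b) (hv1 : v₁ ≤ v) :
    |F.r U v * F.lam U v| ≤ M - r₁ / 4 := by
  have h1 := abs_le.1 (S.massFn_le hU hv)
  have h2 := mul_le_mul_of_nonneg_left (S.q_le_late hv1) S.massC_pos.le
  have h3 := S.late.mass
  have h4 := S.boot.r_ge U hU v hv
  have h5 := S.rect.r_le hU hv
  have h6 := S.hr₁M
  rw [abs_le]
  constructor <;> linarith

theorem abs_rlam_le (S : Setting M p D₂ D₃ v₀ ρ c B r₁ K k Ed v₁ η rH lH θH nH F a b)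
    (hU : U ∈ Icc 0 a) (hv : v ∈ Icc v₀ b) :
    |F.r U v * F.lam U v| ≤ massC M c * wq M p v₀ + M := by
  have h1 := abs_le.1 (S.massFn_le hU hv)
  have h2 := mul_le_mul_of_nonneg_left (S.q_le_start hv) S.massC_pos.le
  have h4 := S.r_pos hU hv
  have h5 := S.rect.r_le hU hv
  rw [abs_le]
  constructor <;> linarith [S.hM]

/-- The improved bound for `r² ∂_v φ`: for late `v` the coefficient `r ∂_v r` in its equation is
smaller than `M` in absolute value. -/
theorem A_le (S : Setting M p D₂ D₃ v₀ ρ c B r₁ K k Ed v₁ η rH lH θH nH F a b)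
    (hU : U ∈ Icc 0 a) (hv : v ∈ Icc v₀ b) :
    |F.r U v ^ 2 * F.θ U v| ≤ (M - r₁ / 4) * B * wP M p v := by
  have hM := S.hM
  have hP := S.P_pos hv
  have hD₂ := S.hD₂
  have hB := S.hB
  have hr₁M := S.hr₁M
  -- The contribution of the data is small because `B` is large compared with `D₂`.
  have key : 4 * M * D₂ * wP M p v ≤ (M - r₁ / 4) * B * wP M p v := by
    have : 4 * M * D₂ ≤ (M - r₁ / 4) * B := by
      have : M / 2 * (64 * D₂) ≤ (M - r₁ / 4) * B := by
        have := S.hr₁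
        exact mul_le_mul (by linarith) hB (by positivity) (by linarith)
      have : 0 < M * D₂ := by positivity
      linarith
    gcongr
  rcases le_total v v₁ with hv1 | hv1
  · have h1 := S.rect.r_abs_θ_le_strip hM S.hp hD₂ S.hv₀ S.near S.η_pos S.η_θ hU hv hv1
    have h2 := S.rect.r_le hU hv
    have h3 := S.r_pos hU hv
    rw [abs_mul, abs_of_pos (by positivity), sq, mul_assoc]
    refine le_trans ?_ key
    calc F.r U v * (F.r U v * |F.θ U v|) ≤ 2 * M * (2 * D₂ * wP M p v) := by gcongr
      _ = _ := by ring
  -- `∂_U (r² ∂_v φ) = (ν / r) r² ∂_v φ - λ r ∂_U φ`, where damping and forcing are both proportional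
  -- to `-ν`.
  · have hsub : Icc 0 U ⊆ Icc 0 a := Icc_subset_Icc_right hU.2
    refine abs_le_of_damped (y := fun U => F.r U v ^ 2 * F.θ U v) (κ := fun U => -F.ν U v / F.r U v)
      (g := fun U => -(F.lam U v * (F.r U v * F.ζ U v))) hU.1 (fun s hs => ?_) (fun s hs => ?_)
      (fun s hs => ?_) ?_
    · have hr := (S.r_pos (hsub hs) hv).ne'
      have e : (fun U => F.r U v ^ 2 * F.θ U v) = fun U => F.r U v * (F.r U v * F.θ U v) := by
        funext; ring
      rw [e]
      refine (((S.rect.sol.r_U s (hsub hs) v hv).mul (S.rect.sol.rθ_U (hsub hs) hv)).mono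
        hsub).congr_deriv ?_
      field_simp
    · have := S.rect.ν_neg (hsub hs) hv
      have := S.r_pos (hsub hs) hv
      exact div_nonneg (by linarith) this.le
    · have h1 := S.rect.ν_neg (hsub hs) hv
      have h2 := S.r_pos (hsub hs) hv
      have h3 := S.abs_rlam_le_late (hsub hs) hv hv1
      have h4 := S.boot.ζ_le s (hsub hs) v hv
      rw [abs_neg, div_mul_eq_mul_div, le_div_iff₀ h2]
      calc |F.lam s v * (F.r s v * F.ζ s v)| * F.r s v
          = |F.r s v * F.lam s v| * |F.r s v * F.ζ s v| := by
            rw [abs_mul (F.lam s v), abs_mul (F.r s v) (F.lam s v), abs_of_pos h2]; ring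
        _ ≤ (M - r₁ / 4) * (B * wP M p v * -F.ν s v) := by gcongr; linarith
        _ = _ := by ring
    · have h1 := S.rect.hor.rθ_nonneg v hv.1
      have h2 := S.rect.hor.rθ_le v hv.1
      have h3 := S.rect.hor.r_le v hv.1
      have h4 := S.rect.rH_pos hv
      rw [S.rect.r_H v hv, S.rect.θ_H v hv, sq, mul_assoc, abs_of_nonneg (by positivity)]
      refine le_trans ?_ key
      calc rH v * (rH v * θH v) ≤ 2 * M * (D₂ * wP M p v) := by gcongr
        _ ≤ _ := by
          have : 0 < M * (D₂ * wP M p v) := by positivity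
          linarith

/-- The improved bound for `r Y φ`. -/
theorem rYφ_le (S : Setting M p D₂ D₃ v₀ ρ c B r₁ K k Ed v₁ η rH lH θH nH F a b)
    (hU : U ∈ Icc 0 a) (hv : v ∈ Icc v₀ b) :
    |F.r U v * F.ζ U v / -F.ν U v| ≤ B * (1 - r₁ / (8 * M)) * wP M p v := by
  have hM := S.hM
  have hP := S.P_pos hv
  have hB := S.B_pos
  have hr₁ := S.hr₁
  have hr₁M := S.hr₁M
  have hx1 : r₁ / (8 * M) ≤ 1 / 2 := by rw [div_le_iff₀ (by positivity)]; linarith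
  have key : B / 2 ≤ B * (1 - r₁ / (8 * M)) := by
    calc B / 2 = B * (1 - 1 / 2) := by ring
      _ ≤ _ := by gcongr
  rcases le_total v v₁ with hv1 | hv1
  · exact (S.strip U hU v hv hv1).trans (by gcongr)
  · have hv1mem : v₁ ∈ Icc v₀ b := ⟨S.late.v₀_le, hv1.trans hv.2⟩
    have hsub : Icc v₁ v ⊆ Icc v₀ b := Icc_subset_Icc S.late.v₀_le hv.2
    have hv10 := S.v_pos hv1mem
    have hr2 : ∀ s ∈ Icc v₁ v, M - r₁ / 16 ≤ F.r U s ^ 2 * (damp F U s - p / s) := by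
      intro s hs
      have hsb := hsub hs
      have hs0 := S.v_pos hsb
      have hr := S.r_pos hU hsb
      have hrM := S.rect.r_le hU hsb
      have h1 := abs_le.1 (S.inv_f_late hU hsb hs.1)
      have h2 := abs_le.1 (S.massFn_le hU hsb)
      have h3 := S.late.damp
      have h4 := S.q_le_late hs.1
      have hf := S.rect.f_pos hU hsb
      have hc0 : 0 < c := by linarith [S.hc]
      have hq := S.q_pos hsb
      have hmc := S.massC_pos
      -- `M` is the main term; the others are small for late `v`.
      have e : F.r U s ^ 2 * (damp F U s - p / s)
          = M + F.r U s * (1 / (4 * (-F.ν U s / F.Ω U s)) - 1 / 2)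
            - (F.r U s * F.lam U s + (M - 1 / 2 * F.r U s)) - F.r U s ^ 2 * (p / s) := by
        rw [damp]
        set f := -F.ν U s / F.Ω U s with hf'
        field_simp
        ring
      have e1 : -(4 * M * (c + 1) * wq M p s)
          ≤ F.r U s * (1 / (4 * (-F.ν U s / F.Ω U s)) - 1 / 2) := by
        have g1 := mul_le_mul_of_nonneg_left h1.1 hr.le
        have g2 : F.r U s * (2 * (c + 1) * wq M p s) ≤ 2 * M * (2 * (c + 1) * wq M p s) := by gcongr
        linarith
      have e2 : F.r U s ^ 2 * (p / s) ≤ 4 * M ^ 2 * (p / v₁) := by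
        have : 0 < p := by linarith [S.hp]
        have g1 : F.r U s ^ 2 ≤ (2 * M) ^ 2 := by gcongr
        calc _ ≤ (2 * M) ^ 2 * (p / v₁) := by
              have := hs.1
              gcongr
          _ = _ := by ring
      have e3 : (4 * M * (c + 1) + massC M c) * wq M p s
          ≤ (4 * M * (c + 1) + massC M c) * wq M p v₁ := by gcongr
      rw [e]
      linarith
    have h0 : |F.r U v₁ * F.ζ U v₁ / -F.ν U v₁ / wP M p v₁| ≤ B * (1 - r₁ / (8 * M)) := by
      have := S.P_pos hv1mem
      rw [abs_div, abs_of_pos this, div_le_iff₀ this]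
      exact (S.strip U hU v₁ hv1mem le_rfl).trans (by gcongr)
    have h1 := abs_le_of_damped (y := fun v => F.r U v * F.ζ U v / -F.ν U v / wP M p v)
      (κ := fun s => damp F U s - p / s) (g := fun s => F.θ U s / wP M p s) hv1
      (fun s hs => (RectSol.rYφ_div_v hM S.hv₀ S.rect hU (hsub hs)).mono hsub)
      (fun s hs => by
        have h2 := hr2 s hs
        have h3 := S.r_pos hU (hsub hs)
        exact (pos_of_mul_pos_right (lt_of_lt_of_le (by linarith) h2) (by positivity)).le)
      (fun s hs => by
        have hsb := hsub hs
        have h2 := hr2 s hs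
        have h3 := S.r_pos hU hsb
        have h4 := S.A_le hU hsb
        have h5 := S.P_pos hsb
        have h6 : 0 < F.r U s ^ 2 := by positivity
        rw [abs_mul, abs_of_pos h6] at h4
        rw [abs_div, abs_of_pos h5, div_le_iff₀ h5]
        refine le_of_mul_le_mul_left ?_ h6
        -- The gain in the bound for `r² ∂_v φ` beats the loss in the damping.
        have e : M - r₁ / 4 ≤ (M - r₁ / 16) * (1 - r₁ / (8 * M)) := by
          have : (M - r₁ / 16) * (1 - r₁ / (8 * M)) = M - 3 / 16 * r₁ + r₁ ^ 2 / (128 * M) := by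
            field_simp; ring
          have : 0 ≤ r₁ ^ 2 / (128 * M) := by positivity
          linarith
        calc F.r U s ^ 2 * |F.θ U s| ≤ (M - r₁ / 4) * B * wP M p s := h4
          _ ≤ (M - r₁ / 16) * (1 - r₁ / (8 * M)) * B * wP M p s := by gcongr
          _ ≤ F.r U s ^ 2 * (damp F U s - p / s) * (1 - r₁ / (8 * M)) * B * wP M p s := by
            have : 0 ≤ 1 - r₁ / (8 * M) := by linarith
            gcongr
          _ = _ := by ring) h0
    rw [abs_div, abs_of_pos hP, div_le_iff₀ hP] at h1
    exact h1

theorem Ω_pos (S : Setting M p D₂ D₃ v₀ ρ c B r₁ K k Ed v₁ η rH lH θH nH F a b)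
    (hU : U ∈ Icc 0 a) (hv : v ∈ Icc v₀ b) : 0 < F.Ω U v := S.rect.sol.Ω_pos U hU v hv

/-- The growth of `-r ∂_U r` before the time `v₁`, from the closeness to the horizon. -/
theorem n_early (S : Setting M p D₂ D₃ v₀ ρ c B r₁ K k Ed v₁ η rH lH θH nH F a b)
    (hU : U ∈ Icc 0 a) (hv : v ∈ Icc v₀ b) (hv1 : v ≤ v₁) :
    Real.log (-(F.r U v * F.ν U v)) ≤ Real.log c + v / (4 * M) - 1 / 2 := by
  have hΩ := S.Ω_pos hU hv
  have hr := S.r_pos hU hv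
  have hrH := S.rect.rH_pos hv
  have h1 := S.near.f U hU v hv hv1
  have h2 := S.near.Ω U hU v hv hv1
  have h3 := S.rect.r_le_H hU hv
  have h4 := S.rect.f_pos hU hv
  have h5 := S.rect.fH_pos hv
  have h6 := S.rect.hor.n_le v hv.1
  have hΩH := ΩH_pos M v
  have hc0 : 0 < c := by linarith [S.hc]
  have hn := S.rect.n_pos hU hv
  have e1 : -(F.r U v * F.ν U v) = F.r U v * (-F.ν U v / F.Ω U v) * F.Ω U v := by field_simp
  have e2 : -(F.r U v * F.ν U v) ≤ c * Real.exp (-1 + v / (4 * M) + 2 * η) := by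
    calc -(F.r U v * F.ν U v) = F.r U v * (-F.ν U v / F.Ω U v) * F.Ω U v := e1
      _ ≤ rH v * (nH v / (rH v * ΩH M v) * Real.exp η) * (ΩH M v * Real.exp η) := by gcongr
      _ = nH v * (Real.exp η * Real.exp η) := by field_simp
      _ ≤ c * ΩH M v * (Real.exp η * Real.exp η) := by gcongr
      _ = _ := by
        rw [ΩH, mul_assoc, ← Real.exp_add, ← Real.exp_add]
        congr 2
        ring
  have e3 := Real.log_le_log hn e2
  rw [Real.log_mul hc0.ne' (Real.exp_ne_zero _), Real.log_exp] at e3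
  linarith [S.η_le]

theorem logn_v (S : Setting M p D₂ D₃ v₀ ρ c B r₁ K k Ed v₁ η rH lH θH nH F a b)
    (hU : U ∈ Icc 0 a) (hv : v ∈ Icc v₀ b) :
    HasDerivWithinAt (fun v => Real.log (-(F.r U v * F.ν U v)))
      (1 / (4 * (-F.ν U v / F.Ω U v)) / F.r U v) (Icc v₀ b) v := by
  have hr := (S.r_pos hU hv).ne'
  have hΩ := (S.Ω_pos hU hv).ne'
  have hν := (S.rect.ν_neg hU hv).ne
  refine ((S.rect.n_v hU hv).log (S.rect.n_pos hU hv).ne').congr_deriv ?_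
  field_simp

/-- Exponential growth of `-r ∂_U r` at the rate `k`. Unlike `n_redShift` it does not need `E` to be
small, so it holds up to the singularity. -/
theorem n_crude (S : Setting M p D₂ D₃ v₀ ρ c B r₁ K k Ed v₁ η rH lH θH nH F a b)
    (hU : U ∈ Icc 0 a) (hv : v ∈ Icc v₀ b) :
    -(F.r U v * F.ν U v) ≤ c * Real.exp (v₀ / (4 * M)) * Real.exp (k * (v - v₀)) := by
  have hM := S.hM
  have hr₁ := S.hr₁
  have hc0 : 0 < c := by linarith [S.hc]
  have hv0' : 0 ≤ v - v₀ := by linarith [hv.1]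
  have main : Real.log (-(F.r U v * F.ν U v)) ≤ Real.log c + v₀ / (4 * M) + k * (v - v₀) := by
    rw [S.hk]
    rcases le_total v v₁ with hv1 | hv1
    · have h1 := S.n_early hU hv hv1
      have e : v / (4 * M) = v₀ / (4 * M) + 1 / (4 * M) * (v - v₀) := by field_simp; ring
      have : 0 ≤ 1 / r₁ * (v - v₀) := by positivity
      linarith
    · have hv1mem : v₁ ∈ Icc v₀ b := ⟨S.late.v₀_le, hv1.trans hv.2⟩
      have hsub : Icc v₁ v ⊆ Icc v₀ b := Icc_subset_Icc S.late.v₀_le hv.2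
      have h1 := S.n_early hU hv1mem le_rfl
      have h2 := sub_le_sub_of_deriv_le (g := fun v => 1 / r₁ * v) (g' := fun _ => 1 / r₁) hv1
        (fun s hs => (S.logn_v hU (hsub hs)).mono hsub)
        (fun s _ => by simpa using ((hasDerivAt_id s).const_mul (1 / r₁)).hasDerivWithinAt)
        (fun s hs => by
          obtain ⟨f1, f2⟩ := S.f_late hU (hsub hs) hs.1
          have hr := S.boot.r_ge U hU s (hsub hs)
          have f3 : 1 / (4 * (-F.ν U s / F.Ω U s)) ≤ 1 := by
            rw [div_le_one (by linarith)]; linarith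
          gcongr)
      have e : v₁ / (4 * M) = v₀ / (4 * M) + 1 / (4 * M) * (v₁ - v₀) := by field_simp; ring
      have e2 : 0 ≤ 1 / (4 * M) * (v - v₁) := by
        have : 0 ≤ v - v₁ := by linarith
        positivity
      have e3 : 0 ≤ 1 / r₁ * (v₁ - v₀) := by
        have : 0 ≤ v₁ - v₀ := by linarith [S.late.v₀_le]
        positivity
      linarith
  rw [Real.log_le_iff_le_exp (S.rect.n_pos hU hv), Real.exp_add, Real.exp_add,
    Real.exp_log hc0] at main
  exact main

/-- In the red-shift region `r` is close to `2M`. -/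
theorem r_near (S : Setting M p D₂ D₃ v₀ ρ c B r₁ K k Ed v₁ η rH lH θH nH F a b)
    (hU : U ∈ Icc 0 a) (hv : v ∈ Icc v₀ b) (hE : EE M U v ≤ Ed) :
    2 * M - F.r U v ≤ 2 * c * wq M p v + 32 * c * EE M U v := by
  have hM := S.hM
  have hsub : Icc 0 U ⊆ Icc 0 a := Icc_subset_Icc_right hU.2
  have h1 := sub_le_sub_of_deriv_le (f := fun _ => 0) (f' := fun _ => 0)
    (g := fun U => F.r U v ^ 2 + 16 * c * Real.exp (v / (4 * M)) * U) hU.1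
    (fun s _ => hasDerivWithinAt_const ..)
    (fun s hs => (((S.rect.sol.r_U s (hsub hs) v hv).mono hsub).pow 2).add
      ((hasDerivAt_id s).const_mul (16 * c * Real.exp (v / (4 * M)))).hasDerivWithinAt)
    (fun s hs => by
      have := S.boot.n_le s (hsub hs) v hv ((EE_mono hM hs.1 hs.2 le_rfl).trans hE)
      simp only [Nat.cast_ofNat, Nat.add_one_sub_one, pow_one, mul_one]
      linarith)
  simp only [mul_zero, add_zero, sub_zero] at h1
  rw [S.rect.r_H v hv] at h1
  have h2 := S.rect.hor.r_le v hv.1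
  have h3 := S.rect.hor.r_near v hv.1
  have h4 := S.rect.r_le hU hv
  have h5 := S.r_pos hU hv
  have h6 := S.rect.rH_pos hv
  have e : 16 * c * Real.exp (v / (4 * M)) * U = 64 * M * c * EE M U v := by
    rw [EE]; field_simp; ring
  have h7 : (2 * M - rH v) * (2 * M + rH v) ≤ c * wq M p v * (4 * M) := by
    have : 0 ≤ 2 * M - rH v := by linarith
    have : 0 ≤ c * wq M p v := by linarith
    gcongr
    linarith
  have h8 : (2 * M - F.r U v) * (2 * M) ≤ (2 * M - F.r U v) * (2 * M + F.r U v) := by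
    have : 0 ≤ 2 * M - F.r U v := by linarith
    gcongr
    linarith
  have h9 : (2 * M - F.r U v) * (2 * M) ≤ (2 * c * wq M p v + 32 * c * EE M U v) * (2 * M) := by
    linarith
  exact le_of_mul_le_mul_right h9 (by positivity)

/-- In the red-shift region `r ∂_U r` grows like `exp (v / 4M)`. -/
theorem n_redShift (S : Setting M p D₂ D₃ v₀ ρ c B r₁ K k Ed v₁ η rH lH θH nH F a b)
    (hU : U ∈ Icc 0 a) (hv : v ∈ Icc v₀ b) (hE : EE M U v ≤ Ed) :
    -(F.r U v * F.ν U v) ≤ c * Real.exp (v / (4 * M)) := by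
  have hM := S.hM
  have hp := S.hp
  have hc0 : 0 < c := by linarith [S.hc]
  have main : Real.log (-(F.r U v * F.ν U v)) ≤ Real.log c + v / (4 * M) := by
    rcases le_total v v₁ with hv1 | hv1
    · linarith [S.n_early hU hv hv1]
    · have hv1mem : v₁ ∈ Icc v₀ b := ⟨S.late.v₀_le, hv1.trans hv.2⟩
      have hsub : Icc v₁ v ⊆ Icc v₀ b := Icc_subset_Icc S.late.v₀_le hv.2
      have h1 := S.n_early hU hv1mem le_rfl
      set A₁ := c / (2 * M ^ 2) + 2 * (c + 1) / M with hA₁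
      have hA₁0 : 0 < A₁ := by positivity
      -- The weight is integrable because `p > 1`, and `E` integrates to `4M E`.
      have h2 := sub_le_sub_of_deriv_le
        (g := fun v => 1 / (4 * M) * v + A₁ * (-(v * wq M p v) / (2 * p - 2))
          + 8 * c / M ^ 2 * (4 * M * EE M U v))
        (g' := fun v => 1 / (4 * M) + A₁ * wq M p v + 8 * c / M ^ 2 * EE M U v) hv1
        (fun s hs => (S.logn_v hU (hsub hs)).mono hsub)
        (fun s hs => by
          have hs0 := S.v_pos (hsub hs)
          refine (((((hasDerivAt_id s).const_mul (1 / (4 * M))).add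
            ((((hasDerivAt_id s).mul (hasDerivAt_wq (p := p) hM hs0)).neg.div_const
              (2 * p - 2)).const_mul A₁)).add
            (((hasDerivAt_EE_v M U s).const_mul (4 * M)).const_mul
              (8 * c / M ^ 2))).congr_deriv ?_).hasDerivWithinAt
          have : p - 1 ≠ 0 := by linarith
          simp only [id]
          field_simp
          ring)
        (fun s hs => by
          have hsb := hsub hs
          have hEs : EE M U s ≤ Ed := (EE_mono hM hU.1 le_rfl hs.2).trans hE
          have hEs0 : 0 ≤ EE M U s := EE_nonneg hM hU.1
          have hq := S.q_pos hsb
          have hr := S.r_pos hU hsb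
          have e1 := S.r_near hU hsb hEs
          have e2 := (abs_le.1 (S.inv_f_late hU hsb hs.1)).2
          have e3 : 2 * c * wq M p s ≤ 2 * c * wq M p v₁ := by
            have := S.q_le_late hs.1
            gcongr
          have e4 : 32 * c * EE M U s ≤ 32 * c * Ed := by gcongr
          have e5 : M ≤ F.r U s := by linarith [S.late.near, S.Ed_le']
          have e6 := S.rect.r_le hU hsb
          have e7 : 1 / F.r U s - 1 / (2 * M) ≤ (2 * c * wq M p s + 32 * c * EE M U s) / (2 * M ^ 2) := by
            have : 1 / F.r U s - 1 / (2 * M) = (2 * M - F.r U s) / (F.r U s * (2 * M)) := by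
              field_simp
            rw [this]
            have : 0 ≤ 2 * M - F.r U s := by linarith
            calc _ ≤ (2 * M - F.r U s) / (M * (2 * M)) := by gcongr
              _ = (2 * M - F.r U s) / (2 * M ^ 2) := by ring
              _ ≤ _ := by gcongr
          have e8 : 1 / (4 * (-F.ν U s / F.Ω U s)) / F.r U s
              ≤ (1 / 2 + 2 * (c + 1) * wq M p s) / F.r U s := by
            gcongr
            linarith
          have e9 : (2 * (c + 1) * wq M p s) / F.r U s ≤ (2 * (c + 1) * wq M p s) / M := by gcongr
          have e10 : (1 / 2 + 2 * (c + 1) * wq M p s) / F.r U s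
              = 1 / 2 * (1 / F.r U s - 1 / (2 * M)) + 1 / (4 * M)
                + (2 * (c + 1) * wq M p s) / F.r U s := by field_simp; ring
          have e11 : A₁ * wq M p s + 8 * c / M ^ 2 * EE M U s
              = 1 / 2 * ((2 * c * wq M p s + 32 * c * EE M U s) / (2 * M ^ 2))
                + (2 * (c + 1) * wq M p s) / M := by rw [hA₁]; field_simp; ring
          linarith)
      have hq := S.q_pos hv
      have hv0 := S.v_pos hv
      have hE1 : 0 ≤ EE M U v₁ := EE_nonneg hM hU.1
      have g1 : A₁ * (-(v * wq M p v) / (2 * p - 2)) ≤ 0 := by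
        refine mul_nonpos_of_nonneg_of_nonpos hA₁0.le
          (div_nonpos_of_nonpos_of_nonneg ?_ (by linarith))
        have := mul_pos hv0 hq
        linarith
      have g2 : A₁ * (-(v₁ * wq M p v₁) / (2 * p - 2)) = -(A₁ * (v₁ * wq M p v₁ / (2 * p - 2))) := by
        ring
      have g3 := S.late.n
      have g4 : 8 * c / M ^ 2 * (4 * M * EE M U v) ≤ 1 / 4 := by
        refine le_trans ?_ S.Ed_le
        calc _ = 32 * c / M * EE M U v := by field_simp; ring
          _ ≤ _ := by gcongr
      have g5 : 0 ≤ 8 * c / M ^ 2 * (4 * M * EE M U v₁) := by positivity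
      have g6 : 1 / (4 * M) * v = v / (4 * M) := by ring
      have g7 : 1 / (4 * M) * v₁ = v₁ / (4 * M) := by ring
      linarith
  rw [Real.log_le_iff_le_exp (S.rect.n_pos hU hv), Real.exp_add, Real.exp_log hc0] at main
  exact main

/-- The deviation of `∂_v log (r² Ω²)` from its Schwarzschild value. -/
theorem lapse_le (S : Setting M p D₂ D₃ v₀ ρ c B r₁ K k Ed v₁ η rH lH θH nH F a b)
    (hU : U ∈ Icc 0 a) (hv : v ∈ Icc v₀ b) :
    |F.α U v + 2 * F.lam U v / F.r U v - 1 / F.r U v + M / F.r U v ^ 2|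
      ≤ lapseC M v₀ c B ρ * wq M p v / F.r U v ^ 2 := by
  have hM := S.hM
  have hv0 := S.v_pos hv
  have hq := S.q_pos hv
  have hr := S.r_pos hU hv
  have hρ := S.hρ
  have hv₀ := S.hv₀
  have hc0 : 0 < c := by linarith [S.hc]
  have hmc := S.massC_pos
  have hsub : Icc 0 U ⊆ Icc 0 a := Icc_subset_Icc_right hU.2
  -- Integration in `U` from the horizon; `-m ν / r³` is the `U`-derivative of `m / (2r²)`.
  set m := 2 * (M * B ^ 2 * wP M p v ^ 2 + massC M c * wq M p v) with hm
  have h1 := abs_sub_le_of_abs_deriv_le hU.1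
    (f := fun U => F.α U v + 2 * F.lam U v / F.r U v - 1 / F.r U v + M / F.r U v ^ 2)
    (f' := fun U => -2 * F.ζ U v * F.θ U v
      - 2 * F.ν U v / F.r U v ^ 3 * (F.r U v * F.lam U v + (M - 1 / 2 * F.r U v)))
    (g := fun U => m * (1 / (2 * F.r U v ^ 2))) (g' := fun U => m * (-F.ν U v / F.r U v ^ 3))
    (fun s hs => by
      have hr := (S.r_pos (hsub hs) hv).ne'
      have hr2 : F.r s v ^ 2 ≠ 0 := pow_ne_zero 2 hr
      refine ((((S.rect.sol.α_U s (hsub hs) v hv).add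
        (((S.rect.sol.lam_U s (hsub hs) v hv).const_mul 2).div (S.rect.sol.r_U s (hsub hs) v hv)
          hr)).sub ((hasDerivWithinAt_const ..).div (S.rect.sol.r_U s (hsub hs) v hv) hr)).add
        ((hasDerivWithinAt_const ..).div ((S.rect.sol.r_U s (hsub hs) v hv).pow 2) hr2)).congr_deriv ?_
        |>.mono hsub
      simp only [Fields.A, Fields.N, Pi.pow_apply]
      field_simp
      ring)
    (fun s hs => by
      have hr := (S.r_pos (hsub hs) hv).ne'
      have hr2 : 2 * F.r s v ^ 2 ≠ 0 := mul_ne_zero two_ne_zero (pow_ne_zero 2 hr)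
      refine (((hasDerivWithinAt_const ..).div
        (((S.rect.sol.r_U s (hsub hs) v hv).pow 2).const_mul 2) hr2).const_mul m).congr_deriv ?_
        |>.mono hsub
      simp only [Pi.pow_apply]
      field_simp
      ring)
    (fun s hs => by
      have hr := S.r_pos (hsub hs) hv
      have hν : 0 < -F.ν s v := by linarith [S.rect.ν_neg (hsub hs) hv]
      have e1 := S.boot.ζ_le s (hsub hs) v hv
      have e2 := S.boot.A_le s (hsub hs) v hv
      have e3 := S.massFn_le (hsub hs) hv
      have e4 : |-2 * F.ζ s v * F.θ s v| ≤ 2 * (M * B ^ 2 * wP M p v ^ 2) * (-F.ν s v / F.r s v ^ 3) := by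
        have : -2 * F.ζ s v * F.θ s v
            = -2 * ((F.r s v * F.ζ s v) * (F.r s v ^ 2 * F.θ s v)) / F.r s v ^ 3 := by
          field_simp
        rw [this, abs_div, abs_mul, abs_mul, abs_neg, abs_two, abs_of_pos (by positivity : 0 < F.r s v ^ 3)]
        have := S.B_pos
        have := S.P_pos hv
        calc _ ≤ 2 * (B * wP M p v * -F.ν s v * (M * B * wP M p v)) / F.r s v ^ 3 := by gcongr
          _ = _ := by ring
      have e5 : |2 * F.ν s v / F.r s v ^ 3 * (F.r s v * F.lam s v + (M - 1 / 2 * F.r s v))|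
          ≤ 2 * (massC M c * wq M p v) * (-F.ν s v / F.r s v ^ 3) := by
        rw [abs_mul, abs_div, abs_mul, abs_two, abs_of_neg (by linarith : F.ν s v < 0),
          abs_of_pos (by positivity : 0 < F.r s v ^ 3)]
        calc _ ≤ 2 * -F.ν s v / F.r s v ^ 3 * (massC M c * wq M p v) := by gcongr
          _ = _ := by ring
      refine (abs_sub _ _).trans ((add_le_add e4 e5).trans (le_of_eq ?_))
      rw [hm]
      ring)
  rw [S.rect.α_H v hv, S.rect.r_H v hv, S.rect.lam_H v hv] at h1
  -- on the horizon
  have hrH := S.rect.rH_pos hv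
  have hrHρ := S.rect.hor.r_ge v hv.1
  have hlam := S.rect.hor.lam_le v hv.1
  have hlam0 := S.rect.hor.lam_nonneg v hv.1
  have hnear := S.rect.hor.r_near v hv.1
  have hrM := S.rect.hor.r_le v hv.1
  have h2 : |1 / (4 * M) + 2 * lH v / rH v - 1 / rH v + M / rH v ^ 2|
      ≤ (c / (2 * ρ ^ 2) + 2 * c / ρ) * wq M p v := by
    have e : 1 / (4 * M) + 2 * lH v / rH v - 1 / rH v + M / rH v ^ 2
        = (2 * M - rH v) * (2 * M - rH v) / (4 * M * rH v ^ 2) + 2 * lH v / rH v := by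
      field_simp; ring
    have e0 : 0 ≤ 2 * M - rH v := by linarith
    rw [e, abs_of_nonneg (by positivity)]
    have e1 : (2 * M - rH v) * (2 * M - rH v) / (4 * M * rH v ^ 2)
        ≤ (c * wq M p v) * (2 * M) / (4 * M * ρ ^ 2) := by
      have : 2 * M - rH v ≤ 2 * M := by linarith
      gcongr
    have e2 : 2 * lH v / rH v ≤ 2 * (c * wq M p v) / ρ := by gcongr
    have e3 : (c * wq M p v) * (2 * M) / (4 * M * ρ ^ 2) = c / (2 * ρ ^ 2) * wq M p v := by
      field_simp; norm_num
    have e4 : 2 * (c * wq M p v) / ρ = 2 * c / ρ * wq M p v := by ring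
    linarith
  have h3 := abs_sub_abs_le_abs_sub
    (F.α U v + 2 * F.lam U v / F.r U v - 1 / F.r U v + M / F.r U v ^ 2)
    (1 / (4 * M) + 2 * lH v / rH v - 1 / rH v + M / rH v ^ 2)
  have hm0 : 0 ≤ m := by have := S.B_pos; positivity
  have h4 : 0 ≤ m * (1 / (2 * rH v ^ 2)) := by positivity
  have h5 : m * (1 / (2 * F.r U v ^ 2))
      ≤ (M * B ^ 2 * (M / v₀) + massC M c) * wq M p v / F.r U v ^ 2 := by
    have e1 : wP M p v ^ 2 ≤ wq M p v * (M / v₀) := by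
      rw [wP_sq hM hv0]
      have := hv.1
      gcongr
    have e2 : m * (1 / (2 * F.r U v ^ 2))
        = (M * B ^ 2 * wP M p v ^ 2 + massC M c * wq M p v) / F.r U v ^ 2 := by
      rw [hm]; field_simp
    rw [e2]
    have e3 : M * B ^ 2 * wP M p v ^ 2 ≤ M * B ^ 2 * (wq M p v * (M / v₀)) := by gcongr
    gcongr
    linarith
  have h6 : (c / (2 * ρ ^ 2) + 2 * c / ρ) * wq M p v
      ≤ 4 * M ^ 2 * (c / (2 * ρ ^ 2) + 2 * c / ρ) * wq M p v / F.r U v ^ 2 := by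
    rw [le_div_iff₀ (by positivity)]
    have e1 : F.r U v ^ 2 ≤ (2 * M) ^ 2 := by
      have := S.rect.r_le hU hv
      gcongr
    calc _ ≤ (c / (2 * ρ ^ 2) + 2 * c / ρ) * wq M p v * (2 * M) ^ 2 := by gcongr
      _ = _ := by ring
  have h7 : lapseC M v₀ c B ρ * wq M p v / F.r U v ^ 2
      = (M * B ^ 2 * (M / v₀) + massC M c) * wq M p v / F.r U v ^ 2
        + 4 * M ^ 2 * (c / (2 * ρ ^ 2) + 2 * c / ρ) * wq M p v / F.r U v ^ 2 := by
    rw [lapseC]; ring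
  linarith

theorem lapseC_nonneg (S : Setting M p D₂ D₃ v₀ ρ c B r₁ K k Ed v₁ η rH lH θH nH F a b) :
    0 ≤ lapseC M v₀ c B ρ := by
  have := S.hM
  have := S.hv₀
  have := S.hρ
  have := S.massC_pos
  have : 0 < c := by linarith [S.hc]
  unfold lapseC
  positivity

/-- The crude bounds, with a constant that does not depend on `K`. -/
theorem crude (S : Setting M p D₂ D₃ v₀ ρ c B r₁ K k Ed v₁ η rH lH θH nH F a b)
    (hU : U ∈ Icc 0 a) (hv : v ∈ Icc v₀ b) :
    |F.lam U v| ≤ crudeC M p v₀ c B ρ r₁ ∧ |F.θ U v| ≤ crudeC M p v₀ c B ρ r₁ ∧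
    |F.α U v| ≤ crudeC M p v₀ c B ρ r₁ ∧
    |F.ν U v| ≤ crudeC M p v₀ c B ρ r₁ * Real.exp (k * (v - v₀)) ∧
    |F.Ω U v| ≤ crudeC M p v₀ c B ρ r₁ * Real.exp (k * (v - v₀)) ∧
    |F.ζ U v| ≤ crudeC M p v₀ c B ρ r₁ * Real.exp (k * (v - v₀)) := by
  have hM := S.hM
  have hr₁ := S.hr₁
  have hr := S.r_pos hU hv
  have hr1 := S.boot.r_ge U hU v hv
  have hc1 := S.hc
  have hc0 : 0 < c := by linarith
  have hB := S.B_pos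
  have hq₀ := wq_pos (p := p) hM S.hv₀
  have hP₀ := wP_pos (p := p) hM S.hv₀
  have hP := S.P_pos hv
  have hmc := S.massC_pos
  have hlc := S.lapseC_nonneg
  have hν : 0 < -F.ν U v := by linarith [S.rect.ν_neg hU hv]
  have hΩ := S.Ω_pos hU hv
  set X := Real.exp (k * (v - v₀)) with hX
  have hX0 : 0 < X := Real.exp_pos _
  set m := massC M c * wq M p v₀ + M with hm
  set T := 4 * c * Real.exp (v₀ / (4 * M)) with hT
  have hT0 : 0 < T := by positivity
  have hm0 : 0 < m := by positivity
  have a1 : 0 ≤ m / r₁ := by positivity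
  have a2 : 0 ≤ M * B * wP M p v₀ / r₁ ^ 2 := by positivity
  have a3 : 0 ≤ (lapseC M v₀ c B ρ * wq M p v₀ + M) / r₁ ^ 2 + 1 / r₁ + 2 * (m / r₁ ^ 2) := by
    positivity
  have a4 : 0 ≤ T * (1 + 1 / r₁ + 4 / r₁ + B * wP M p v₀ / r₁ ^ 2) := by positivity
  have hC : crudeC M p v₀ c B ρ r₁ = m / r₁ + M * B * wP M p v₀ / r₁ ^ 2
      + ((lapseC M v₀ c B ρ * wq M p v₀ + M) / r₁ ^ 2 + 1 / r₁ + 2 * (m / r₁ ^ 2))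
      + T * (1 + 1 / r₁ + 4 / r₁ + B * wP M p v₀ / r₁ ^ 2) := rfl
  have hlam : F.r U v * |F.lam U v| ≤ m := by
    have := S.abs_rlam_le hU hv
    rwa [abs_mul, abs_of_pos hr] at this
  have hn : F.r U v * -F.ν U v ≤ T / 4 * X := by
    have := S.n_crude hU hv
    rw [hT]
    linarith
  have hνT : -F.ν U v ≤ T / 4 * X / r₁ := by
    rw [le_div_iff₀ hr₁]
    have : -F.ν U v * r₁ ≤ -F.ν U v * F.r U v := by gcongr
    linarith
  have big : ∀ y, y ≤ T * (1 + 1 / r₁ + 4 / r₁ + B * wP M p v₀ / r₁ ^ 2) →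
      y * X ≤ crudeC M p v₀ c B ρ r₁ * X := fun y hy => by
    gcongr
    rw [hC]
    linarith
  have b1 : 0 ≤ T * (1 / r₁) := by positivity
  have b2 : 0 ≤ T * (B * wP M p v₀ / r₁ ^ 2) := by positivity
  refine ⟨?_, ?_, ?_, ?_, ?_, ?_⟩
  · have : |F.lam U v| ≤ m / r₁ := by
      rw [le_div_iff₀ hr₁]
      calc |F.lam U v| * r₁ ≤ |F.lam U v| * F.r U v := by gcongr
        _ ≤ m := by linarith
    linarith
  · have h1 := S.boot.A_le U hU v hv
    rw [abs_mul, abs_of_pos (by positivity : 0 < F.r U v ^ 2)] at h1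
    have : |F.θ U v| ≤ M * B * wP M p v₀ / r₁ ^ 2 := by
      rw [le_div_iff₀ (by positivity)]
      calc |F.θ U v| * r₁ ^ 2 ≤ |F.θ U v| * F.r U v ^ 2 := by gcongr
        _ ≤ M * B * wP M p v := by linarith
        _ ≤ _ := by have := S.P_le_start hv; gcongr
    linarith
  · have h1 := S.lapse_le hU hv
    have e1 : lapseC M v₀ c B ρ * wq M p v / F.r U v ^ 2 ≤ lapseC M v₀ c B ρ * wq M p v₀ / r₁ ^ 2 := by
      have := S.q_le_start hv
      gcongr
    have e2 : M / F.r U v ^ 2 ≤ M / r₁ ^ 2 := by gcongr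
    have e3 : 1 / F.r U v ≤ 1 / r₁ := by gcongr
    have e4 : |2 * F.lam U v / F.r U v| ≤ 2 * (m / r₁ ^ 2) := by
      rw [abs_div, abs_mul, abs_two, abs_of_pos hr]
      have : 2 * |F.lam U v| / F.r U v = 2 * (F.r U v * |F.lam U v| / F.r U v ^ 2) := by
        field_simp
      rw [this]
      gcongr
    have e5 : 0 < M / F.r U v ^ 2 := by positivity
    have e6 : 0 < 1 / F.r U v := by positivity
    have e7 : |F.α U v| ≤ (lapseC M v₀ c B ρ * wq M p v₀ + M) / r₁ ^ 2 + 1 / r₁ + 2 * (m / r₁ ^ 2) := by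
      rw [add_div]
      have h2 := abs_le.1 h1
      have h3 := abs_le.1 e4
      rw [abs_le]
      constructor <;> linarith
    linarith
  · rw [abs_of_neg (by linarith)]
    refine hνT.trans ?_
    have e : T / 4 * X / r₁ = T / 4 * (1 / r₁) * X := by ring
    rw [e]
    refine big _ ?_
    have : T * (4 / r₁) = 4 * (T * (1 / r₁)) := by ring
    linarith
  · rw [abs_of_pos hΩ]
    rcases le_total v v₁ with hv1 | hv1
    · have h1 := S.near.Ω U hU v hv hv1
      rw [ΩH, ← Real.exp_add] at h1
      have h2 : Real.exp (-1 + v / (4 * M) + η) ≤ Real.exp (v₀ / (4 * M)) * X := by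
        rw [hX, ← Real.exp_add]
        apply Real.exp_le_exp.2
        rw [S.hk]
        have e : v / (4 * M) = v₀ / (4 * M) + 1 / (4 * M) * (v - v₀) := by field_simp; ring
        have : 0 ≤ 1 / r₁ * (v - v₀) := by
          have : 0 ≤ v - v₀ := by linarith [hv.1]
          positivity
        linarith [S.η_le]
      refine (h1.trans h2).trans (big _ ?_)
      have : Real.exp (v₀ / (4 * M)) ≤ T := by
        rw [hT]
        have := Real.exp_pos (v₀ / (4 * M))
        nlinarith
      have : T * (4 / r₁) = 4 * (T * (1 / r₁)) := by ring
      linarith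
    · obtain ⟨f1, f2⟩ := S.f_late hU hv hv1
      rw [le_div_iff₀ hΩ] at f1
      have h1 : F.Ω U v ≤ T * (1 / r₁) * X := by
        have : T * (1 / r₁) * X = 4 * (T / 4 * X / r₁) := by ring
        rw [this]
        linarith
      refine h1.trans (big _ ?_)
      have : T * (4 / r₁) = 4 * (T * (1 / r₁)) := by ring
      linarith
  · have h1 := S.boot.ζ_le U hU v hv
    rw [abs_mul, abs_of_pos hr] at h1
    have h2 : |F.ζ U v| ≤ T / 4 * (B * wP M p v₀ / r₁ ^ 2) * X := by
      have : T / 4 * (B * wP M p v₀ / r₁ ^ 2) * X = B * wP M p v₀ * (T / 4 * X / r₁) / r₁ := by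
        field_simp
      rw [this, le_div_iff₀ hr₁]
      calc |F.ζ U v| * r₁ ≤ |F.ζ U v| * F.r U v := by gcongr
        _ ≤ B * wP M p v * -F.ν U v := by linarith
        _ ≤ _ := by have := S.P_le_start hv; gcongr
    refine h2.trans (big _ ?_)
    have : T * (4 / r₁) = 4 * (T * (1 / r₁)) := by ring
    linarith

end Setting

/-- The strict forms of the bootstrap assumptions at a point, except for the lower bound of `r`. -/
structure GoodAt (M p v₀ c B K k Ed : ℝ) (F : Fields) (U v : ℝ) : Prop where
  A_lt : |F.r U v ^ 2 * F.θ U v| < M * B * wP M p v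
  ζ_lt : |F.r U v * F.ζ U v| < B * wP M p v * -F.ν U v
  lam_lt : |F.lam U v| < K
  θ_lt : |F.θ U v| < K
  α_lt : |F.α U v| < K
  ν_lt : |F.ν U v| < K * Real.exp (k * (v - v₀))
  Ω_lt : |F.Ω U v| < K * Real.exp (k * (v - v₀))
  ζ_lt' : |F.ζ U v| < K * Real.exp (k * (v - v₀))
  n_lt : EE M U v ≤ Ed → -(F.r U v * F.ν U v) < 8 * c * Real.exp (v / (4 * M))

namespace Setting

variable {M p D₂ D₃ v₀ ρ c B r₁ K k Ed v₁ η a b U v : ℝ} {rH lH θH nH : ℝ → ℝ} {F : Fields}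

/-- The bootstrap assumptions improve themselves. -/
theorem goodAt (S : Setting M p D₂ D₃ v₀ ρ c B r₁ K k Ed v₁ η rH lH θH nH F a b)
    (hK : crudeC M p v₀ c B ρ r₁ < K) (hU : U ∈ Icc 0 a) (hv : v ∈ Icc v₀ b) :
    GoodAt M p v₀ c B K k Ed F U v := by
  have hM := S.hM
  have hr₁ := S.hr₁
  have hB := S.B_pos
  have hP := S.P_pos hv
  have hν : 0 < -F.ν U v := by linarith [S.rect.ν_neg hU hv]
  have hX : 0 < Real.exp (k * (v - v₀)) := Real.exp_pos _
  have hKX := mul_lt_mul_of_pos_right hK hX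
  obtain ⟨h1, h2, h3, h4, h5, h6⟩ := S.crude hU hv
  refine ⟨(S.A_le hU hv).trans_lt ?_, lt_of_le_of_lt ((S.rect.abs_ζ_le_iff hU hv).2 (S.rYφ_le hU hv)) ?_,
    h1.trans_lt hK, h2.trans_lt hK, h3.trans_lt hK, h4.trans_lt hKX, h5.trans_lt hKX,
    h6.trans_lt hKX, fun hE => (S.n_redShift hU hv hE).trans_lt ?_⟩
  · gcongr
    linarith
  · have : 0 < r₁ / (8 * M) := by positivity
    have : B * (1 - r₁ / (8 * M)) < B := by nlinarith
    gcongr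
  · have hc0 : 0 < c := by linarith [S.hc]
    gcongr
    linarith

end Setting

/-- For a suitable constant `B` in the decay rates, which depends on the parameters of the data
only, every solution on a rectangle that satisfies the bootstrap assumptions is in the range in
which they improve, if the range of `U` is small. -/
theorem exists_setting {M p D₂ D₃ v₀ ρ c : ℝ} (hM : 0 < M) (hp : 1 < p) (hD₂ : 0 < D₂)
    (hD₃ : 0 < D₃) (hv₀ : 0 < v₀) (hρ : 0 < ρ) (hc : 1 ≤ c) :
    ∃ B : ℝ, 64 * D₂ ≤ B ∧ D₃ < B * wP M p v₀ ∧ ∀ r₁ Ed K : ℝ, 0 < r₁ → r₁ ≤ M / 2 → 32 * c / M * Ed ≤ 1 / 4 →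
      32 * c * Ed ≤ M / 2 → 0 < K → ∃ v₁ η a₀ : ℝ, 0 < a₀ ∧
      ∀ (rH lH θH nH : ℝ → ℝ) (F : Fields) (a b : ℝ), a ≤ a₀ →
        RectSol M p D₂ D₃ v₀ ρ c rH lH θH nH F a b →
        Bootstrap M p v₀ c B r₁ K (1 / r₁ + 1 / (4 * M)) Ed F a b →
        Setting M p D₂ D₃ v₀ ρ c B r₁ K (1 / r₁ + 1 / (4 * M)) Ed v₁ η rH lH θH nH F a b := by
  obtain ⟨B₀, hB₀, hstrip⟩ := RectSol.exists_strip_bound hM hp hD₂ hD₃ hv₀ hρ hc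
  have hP₀ := wP_pos (p := p) hM hv₀
  obtain ⟨B₁, hB₁, hB₀₁, hB₁D⟩ : ∃ B₁, 32 * D₂ ≤ B₁ ∧ B₀ ≤ B₁ ∧ D₃ ≤ B₁ * wP M p v₀ := by
    refine ⟨max B₀ (D₃ / wP M p v₀), hB₀.trans (le_max_left _ _), le_max_left _ _, ?_⟩
    rw [← div_le_iff₀ hP₀]
    exact le_max_right _ _
  refine ⟨2 * B₁, by linarith, by linarith, fun r₁ Ed K hr₁ hr₁M hEd hEd' hK => ?_⟩
  obtain ⟨v₁, hv₁⟩ := exists_lateTime (v₀ := v₀) (c := c) (B := 2 * B₁) hM hp hr₁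
  have hv10 : 0 < v₁ := hv₀.trans_le hv₁.v₀_le
  have hP := wP_pos (p := p) hM hv10
  have hq := wq_pos (p := p) hM hv10
  have hq₀ := wq_pos (p := p) hM hv₀
  have hB₁0 : 0 < B₁ := by linarith
  set T := 1 + (2 * M + c * wq M p v₀ + 1) + (1 + 2 * (c * wq M p v₀)) with hT
  have hT0 : 0 < T := by positivity
  obtain ⟨η, hη, h1, h2, h3, h4, h5⟩ : ∃ η : ℝ, 0 < η ∧ η ≤ 1 / 64 ∧ η ≤ M / 2 ∧ η ≤ ρ / 2 ∧
      2 * M * η ≤ D₂ * wP M p v₁ ∧ T * η ≤ wq M p v₁ := by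
    refine ⟨min (1 / 64) (min (M / 2) (min (ρ / 2) (min (D₂ * wP M p v₁ / (2 * M)) (wq M p v₁ / T)))),
      by positivity, min_le_left _ _, (min_le_right _ _).trans (min_le_left _ _),
      (min_le_right _ _).trans ((min_le_right _ _).trans (min_le_left _ _)), ?_, ?_⟩
    · rw [← le_div_iff₀' (by positivity)]
      exact (min_le_right _ _).trans ((min_le_right _ _).trans ((min_le_right _ _).trans
        (min_le_left _ _)))
    · rw [← le_div_iff₀' hT0]
      exact (min_le_right _ _).trans ((min_le_right _ _).trans ((min_le_right _ _).trans
        (min_le_right _ _)))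
  have hcq : 0 < c * wq M p v₀ := by positivity
  have hk : 0 < 1 / r₁ + 1 / (4 * M) := by positivity
  obtain ⟨a₀, ha₀, hnear⟩ := RectSol.exists_nearHorizon (p := p) (B := 2 * B₁) hM hv₀ hp hv₁.v₀_le hη
    (by linarith) hr₁ hK hk
  refine ⟨v₁, η, a₀, ha₀, fun rH lH θH nH F a b ha hR hW => ?_⟩
  have hN := hnear _ _ _ _ _ _ _ _ _ _ _ _ ha hR hW
  have hTη : ∀ t, t ≤ T → t * η ≤ wq M p v₁ := fun t ht => le_trans (by gcongr) h5
  exact ⟨hM, hp, hD₂, hv₀, hρ, hc, hr₁, hr₁M, by linarith, rfl, hR, hW, hN, hv₁, hη, h1, h3, h4,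
    hTη _ (by linarith), hTη _ (by linarith), hEd, hEd', fun U hU v hv hv1 => by
      have := hstrip v₁ η rH lH θH nH F a b hR hN hη h1 h2 h3 h4 U hU v hv hv1
      rw [mul_div_cancel_left₀ _ (two_ne_zero)]
      refine this.trans ?_
      have := (wP_pos (p := p) hM (hv₀.trans_le hv.1)).le
      gcongr⟩

/-! ### Comparison with Schwarzschild in the red-shift region -/

section Kruskal

variable {M U v : ℝ}

theorem half_le_kInv {E : ℝ} (hE : E ≤ 1 / 2) : 1 / 2 ≤ kInv E := by
  have hk : kruskal (1 / 2) > 1 / 2 := by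
    have := Real.add_one_lt_exp (x := 1 / 2) (by norm_num)
    unfold kruskal
    linarith
  by_contra hlt
  push Not at hlt
  obtain ⟨h1, h2⟩ := kInv_spec (show E < 1 by linarith)
  have := strictAntiOn_kruskal (show (0 : ℝ) ≤ _ from h1.le) (show (0 : ℝ) ≤ 1 / 2 by norm_num) hlt
  linarith

theorem rK_ge (hM : 0 < M) (hE : EE M U v ≤ 1 / 2) : M ≤ rK M U v := by
  have := half_le_kInv hE
  unfold rK
  nlinarith

theorem rK_le (hM : 0 < M) (hU : 0 ≤ U) (hE : EE M U v ≤ 1 / 2) : rK M U v ≤ 2 * M := by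
  have := kInv_le_one (EE_nonneg (v := v) hM hU) (show EE M U v < 1 by linarith)
  unfold rK
  nlinarith

theorem ΩK_le (hE : EE M U v ≤ 1 / 2) : ΩK M U v ≤ 2 * Real.exp (v / (4 * M)) := by
  have h1 := half_le_kInv hE
  have h2 : Real.exp (-kInv (EE M U v)) ≤ 1 := Real.exp_le_one_iff.2 (by linarith)
  have h3 : Real.exp (-kInv (EE M U v)) / kInv (EE M U v) ≤ 2 := by
    rw [div_le_iff₀ (by linarith)]
    linarith
  unfold ΩK
  gcongr

end Kruskal

theorem abs_sub_le_mul_abs_log {x y m : ℝ} (hx : 0 < x) (hy : 0 < y) (hxm : x ≤ m) (hym : y ≤ m) :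
    |x - y| ≤ m * |Real.log x - Real.log y| := by
  have key : ∀ s t : ℝ, 0 < s → 0 < t → s ≤ m → s - t ≤ m * |Real.log s - Real.log t| := by
    intro s t hs ht hsm
    have h1 := Real.log_le_sub_one_of_pos (div_pos ht hs)
    rw [Real.log_div ht.ne' hs.ne'] at h1
    have h2 : s * (t / s - 1) = t - s := by field_simp
    have h3 := mul_le_mul_of_nonneg_left h1 hs.le
    rw [h2] at h3
    have h4 : s * (Real.log s - Real.log t) ≤ m * |Real.log s - Real.log t| := by
      calc _ ≤ s * |Real.log s - Real.log t| := by gcongr; exact le_abs_self _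
        _ ≤ _ := by gcongr
    linarith
  rw [abs_le]
  have h1 := key x y hx hy hxm
  have h2 := key y x hy hx hym
  rw [abs_sub_comm] at h2
  constructor <;> linarith

/-- Closeness to Schwarzschild at a point of the red-shift region, with error `D`. -/
structure CloseToKruskal (M m : ℝ) (F : Fields) (U v D : ℝ) : Prop where
  ν : |F.ν U v + 1 / 2 * ΩK M U v| ≤ m * Real.exp (v / (4 * M)) * D
  r : |F.r U v - rK M U v| ≤ m * D
  lam : |F.lam U v - (1 / 2 - M / rK M U v)| ≤ m * D
  logr : |F.ν U v / F.r U v - -(1 / 2) * ΩK M U v / rK M U v| ≤ m * Real.exp (v / (4 * M)) * D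
  A : |F.A U v - ΩK M U v * M / rK M U v ^ 3| ≤ m * Real.exp (v / (4 * M)) * D

namespace Setting

variable {M p D₂ D₃ v₀ ρ c B r₁ K k Ed v₁ η a b U v : ℝ} {rH lH θH nH : ℝ → ℝ} {F : Fields}

/-- In the red-shift region `r` stays above half of its lower bound on the horizon. -/
theorem r_ge_redShift (S : Setting M p D₂ D₃ v₀ ρ c B r₁ K k Ed v₁ η rH lH θH nH F a b)
    (hU : U ∈ Icc 0 a) (hv : v ∈ Icc v₀ b) (hE : EE M U v ≤ Ed) : ρ / 2 ≤ F.r U v := by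
  have h0 := S.rect.hor.r_ge v hv.1
  have h1 := S.rect.hor.r_le v hv.1
  have hc0 : 0 < c := by linarith [S.hc]
  rcases le_total v v₁ with hv1 | hv1
  · linarith [S.near.r U hU v hv hv1, S.η_ρ]
  · have e1 := S.r_near hU hv hE
    have e2 := S.late.near
    have e3 := S.Ed_le'
    have e4 : 2 * c * wq M p v ≤ 2 * c * wq M p v₁ := by
      have := S.q_le_late hv1
      gcongr
    have e5 : 32 * c * EE M U v ≤ 32 * c * Ed := by gcongr
    linarith

/-- In the red-shift region `-∂_U r` and `Ω̂²` are at most of the size that they have on Schwarzschild. -/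
theorem Ω_le_redShift (S : Setting M p D₂ D₃ v₀ ρ c B r₁ K k Ed v₁ η rH lH θH nH F a b)
    (hU : U ∈ Icc 0 a) (hv : v ∈ Icc v₀ b) (hE : EE M U v ≤ Ed) :
    -F.ν U v ≤ c / (ρ / 2) * Real.exp (v / (4 * M)) ∧
      F.Ω U v ≤ (2 + 4 * (c / (ρ / 2))) * Real.exp (v / (4 * M)) := by
  have hρ := S.hρ
  have hr := S.r_ge_redShift hU hv hE
  have hn := S.n_redShift hU hv hE
  have hν : 0 < -F.ν U v := by linarith [S.rect.ν_neg hU hv]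
  have hc0 : 0 < c := by linarith [S.hc]
  have hΩ := S.Ω_pos hU hv
  set e := Real.exp (v / (4 * M)) with he
  have he0 : 0 < e := Real.exp_pos _
  have h1 : -F.ν U v ≤ c / (ρ / 2) * e := by
    rw [div_mul_eq_mul_div, le_div_iff₀ (by positivity)]
    have : -F.ν U v * (ρ / 2) ≤ -F.ν U v * F.r U v := by gcongr
    linarith
  refine ⟨h1, ?_⟩
  have h2 : 0 ≤ c / (ρ / 2) * e := by positivity
  rcases le_total v v₁ with hv1 | hv1
  · have h3 := S.near.Ω U hU v hv hv1
    rw [ΩH, ← Real.exp_add] at h3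
    have h4 : Real.exp (-1 + v / (4 * M) + η) ≤ e := Real.exp_le_exp.2 (by linarith [S.η_le])
    linarith
  · have h3 := (S.f_late hU hv hv1).1
    rw [le_div_iff₀ hΩ] at h3
    linarith

set_option maxHeartbeats 1000000 in
/-- If `∂_U log Ω̂²` deviates from Schwarzschild by at most `Λ v^{-2p+1} e^{v/4M}`, then the other
quantities deviate by an error in which `Λ` is multiplied by the small number `E`. -/
theorem exists_redShift_step (M p v₀ ρ c B : ℝ) (hM : 0 < M) (hv₀ : 0 < v₀) (hρ : 0 < ρ)
    (hc : 1 ≤ c) (hB : 0 < B) : ∃ m : ℝ, 0 < m ∧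
    ∀ (D₂ D₃ r₁ K k Ed v₁ η a b Λ : ℝ) (rH lH θH nH : ℝ → ℝ) (F : Fields),
      Setting M p D₂ D₃ v₀ ρ c B r₁ K k Ed v₁ η rH lH θH nH F a b → Ed ≤ 1 / 2 →
      EE M a b ≤ Ed → 0 ≤ Λ →
      (∀ U ∈ Icc 0 a, ∀ v ∈ Icc v₀ b,
        |F.β U v - βK M U v| ≤ Λ * (wq M p v * Real.exp (v / (4 * M)))) →
      ∀ U ∈ Icc 0 a, ∀ v ∈ Icc v₀ b,
        |Real.log (F.Ω U v) - Real.log (ΩK M U v)| ≤ 4 * M * Λ * wq M p v * EE M U v ∧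
        CloseToKruskal M m F U v ((1 + Λ * EE M U v) * wq M p v) := by
  have hc0 : 0 < c := by linarith
  set m := ρ / 2 with hm
  have hm0 : 0 < m := by positivity
  set c₀ := 2 + 4 * (c / m) with hc₀
  have hc₀0 : 0 < c₀ := by positivity
  set c₃ := c₀ * (c + 1 + 2 * M) with hc₃
  have hc₃0 : 0 < c₃ := by positivity
  set c₄ := c + 2 * M * c₃ with hc₄
  have hc₄0 : 0 < c₄ := by positivity
  have hmc : 0 < massC M c := by unfold massC; positivity
  set c₅ := (massC M c + c₄) / m with hc₅
  have hc₅0 : 0 < c₅ := by positivity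
  set c₆ := c₃ / m + c₄ / (m * M) with hc₆
  have hc₆0 : 0 < c₆ := by positivity
  set c₇ := 2 * (M * B ^ 2 * (M / v₀)) * (c / m) / m ^ 3
    + (2 * M * c₀ + 2 * (c / m) * c₅ + c₃) / m ^ 2 + 8 * c₄ / (m ^ 2 * M) with hc₇
  have hc₇0 : 0 < c₇ := by positivity
  refine ⟨c₃ + c₄ + c₅ + c₆ + c₇, by positivity, ?_⟩
  intro D₂ D₃ r₁ K k Ed v₁ η a b Λ rH lH θH nH F S hEd hab hΛ hβ
  have hEE : ∀ U ∈ Icc 0 a, ∀ v ∈ Icc v₀ b, EE M U v ≤ Ed := fun U hU v hv =>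
    (EE_mono hM hU.1 hU.2 hv.2).trans hab
  have hE2 : ∀ U ∈ Icc 0 a, ∀ v ∈ Icc v₀ b, EE M U v ≤ 1 / 2 := fun U hU v hv =>
    (hEE U hU v hv).trans hEd
  have hE1 : ∀ U ∈ Icc 0 a, ∀ v ∈ Icc v₀ b, EE M U v < 1 := fun U hU v hv => by
    linarith [hE2 U hU v hv]
  -- The hypothesis is integrated in `U`, which turns `e^{v/4M}` into `4M E`.
  have hlog : ∀ U ∈ Icc 0 a, ∀ v ∈ Icc v₀ b,
      |Real.log (F.Ω U v) - Real.log (ΩK M U v)| ≤ 4 * M * Λ * wq M p v * EE M U v := by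
    intro U hU v hv
    have hsub : Icc 0 U ⊆ Icc 0 a := Icc_subset_Icc_right hU.2
    have h1 := abs_sub_le_of_abs_deriv_le_const (f := fun U => Real.log (F.Ω U v) - Real.log (ΩK M U v))
      (C := Λ * (wq M p v * Real.exp (v / (4 * M)))) hU.1
      (fun s hs => ((S.rect.sol.logΩ_U (hsub hs) hv).mono hsub).sub
        ((hasDerivAt_ΩK_U hM (hE1 s (hsub hs) v hv)).log
          (ΩK_pos (hE1 s (hsub hs) v hv)).ne').hasDerivWithinAt)
      (fun s hs => by
        rw [mul_div_cancel_right₀ _ (ΩK_pos (hE1 s (hsub hs) v hv)).ne']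
        exact hβ s (hsub hs) v hv)
    rw [S.rect.Ω_H v hv, ΩK_zero, ΩH, sub_self, sub_zero, sub_zero] at h1
    refine h1.trans (le_of_eq ?_)
    rw [EE]
    field_simp
  -- This controls `Ω̂²` and, through `f ≈ 1/2`, also `ν`.
  have hν : ∀ U ∈ Icc 0 a, ∀ v ∈ Icc v₀ b, |F.Ω U v - ΩK M U v|
      ≤ 4 * M * c₀ * Real.exp (v / (4 * M)) * ((1 + Λ * EE M U v) * wq M p v) ∧
      |F.ν U v + 1 / 2 * ΩK M U v|
        ≤ c₃ * Real.exp (v / (4 * M)) * ((1 + Λ * EE M U v) * wq M p v) := by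
    intro U hU v hv
    have hΩ := S.Ω_pos hU hv
    have hΩK := ΩK_pos (hE1 U hU v hv)
    have hq := S.q_pos hv
    set e := Real.exp (v / (4 * M)) with he
    have he0 : 0 < e := Real.exp_pos _
    have hE0 : 0 ≤ EE M U v := EE_nonneg hM hU.1
    have h1 := (S.Ω_le_redShift hU hv (hEE U hU v hv)).2
    have h2 : ΩK M U v ≤ c₀ * e := by
      refine (ΩK_le (hE2 U hU v hv)).trans ?_
      have : 0 < c / m * e := by positivity
      rw [hc₀]
      linarith
    have h3 := abs_sub_le_mul_abs_log hΩ hΩK h1 h2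
    have h4 : |F.Ω U v - ΩK M U v| ≤ c₀ * e * (4 * M * Λ * wq M p v * EE M U v) := by
      refine h3.trans ?_
      have := hlog U hU v hv
      gcongr
    have h5 := S.f_near hU hv
    have e1 : F.ν U v + 1 / 2 * ΩK M U v = -((-F.ν U v / F.Ω U v - 1 / 2) * F.Ω U v)
        - 1 / 2 * (F.Ω U v - ΩK M U v) := by field_simp; ring
    have h6 : |(-F.ν U v / F.Ω U v - 1 / 2) * F.Ω U v| ≤ (c + 1) * wq M p v * (c₀ * e) := by
      rw [abs_mul, abs_of_pos hΩ]
      gcongr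
    have h7 : |1 / 2 * (F.Ω U v - ΩK M U v)| ≤ 1 / 2 * (c₀ * e * (4 * M * Λ * wq M p v * EE M U v)) := by
      rw [abs_mul, abs_of_pos (by norm_num : (0 : ℝ) < 1 / 2)]
      gcongr
    have t1 : 0 ≤ 4 * M * c₀ * e * wq M p v := by positivity
    have t2 : 0 ≤ c₀ * (c + 1) * e * (Λ * EE M U v * wq M p v) := by positivity
    have t3 : 0 ≤ c₀ * (2 * M) * e * wq M p v := by positivity
    constructor
    · linarith
    · rw [e1]
      refine (abs_sub _ _).trans ?_
      rw [abs_neg, hc₃]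
      linarith
  -- Integration of `ν` gives `r`.
  have hr : ∀ U ∈ Icc 0 a, ∀ v ∈ Icc v₀ b,
      |F.r U v - rK M U v| ≤ c₄ * ((1 + Λ * EE M U v) * wq M p v) := by
    intro U hU v hv
    have hsub : Icc 0 U ⊆ Icc 0 a := Icc_subset_Icc_right hU.2
    have hq := S.q_pos hv
    have hE0 : 0 ≤ EE M U v := EE_nonneg hM hU.1
    have h1 := abs_sub_le_of_abs_deriv_le_const (f := fun U => F.r U v - rK M U v)
      (C := c₃ * Real.exp (v / (4 * M)) * ((1 + Λ * EE M U v) * wq M p v)) hU.1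
      (fun s hs => ((S.rect.sol.r_U s (hsub hs) v hv).mono hsub).sub
        (hasDerivAt_rK_U hM (hE1 s (hsub hs) v hv)).hasDerivWithinAt)
      (fun s hs => by
        have h2 := (hν s (hsub hs) v hv).2
        have e1 : F.ν s v - -(1 / 2) * ΩK M s v = F.ν s v + 1 / 2 * ΩK M s v := by ring
        rw [e1]
        refine h2.trans ?_
        have := EE_mono (v := v) hM hs.1 hs.2 le_rfl
        gcongr)
    rw [S.rect.r_H v hv, rK_zero, sub_zero] at h1
    have h2 := S.rect.hor.r_near v hv.1
    have h3 := S.rect.hor.r_le v hv.1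
    have h4 : |rH v - 2 * M| ≤ c * wq M p v := by rw [abs_le]; constructor <;> linarith
    have h5 := abs_sub_abs_le_abs_sub (F.r U v - rK M U v) (rH v - 2 * M)
    have e2 : c₃ * Real.exp (v / (4 * M)) * ((1 + Λ * EE M U v) * wq M p v) * U
        = 4 * M * EE M U v * c₃ * ((1 + Λ * EE M U v) * wq M p v) := by rw [EE]; field_simp
    have h6 : 4 * M * EE M U v * c₃ * ((1 + Λ * EE M U v) * wq M p v)
        ≤ 4 * M * (1 / 2) * c₃ * ((1 + Λ * EE M U v) * wq M p v) := by
      have := hE2 U hU v hv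
      gcongr
    have t1 : 0 ≤ c * (Λ * EE M U v * wq M p v) := by positivity
    rw [hc₄]
    linarith
  intro U hU v hv
  refine ⟨hlog U hU v hv, ?_⟩
  have hE0 : 0 ≤ EE M U v := EE_nonneg hM hU.1
  have hq := S.q_pos hv
  have hv0 := S.v_pos hv
  set D := (1 + Λ * EE M U v) * wq M p v with hD
  have hqD : wq M p v ≤ D := by
    have : 0 ≤ Λ * EE M U v * wq M p v := by positivity
    rw [hD]; linarith
  have hD0 : 0 < D := hq.trans_le hqD
  set e := Real.exp (v / (4 * M)) with he
  have he0 : 0 < e := Real.exp_pos _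
  obtain ⟨hΩ', hν'⟩ := hν U hU v hv
  have hr' := hr U hU v hv
  have hEv := hEE U hU v hv
  have hrm : m ≤ F.r U v := S.r_ge_redShift hU hv hEv
  have hr0 : 0 < F.r U v := hm0.trans_le hrm
  have hrM := S.rect.r_le hU hv
  have hRM := rK_ge hM (hE2 U hU v hv)
  have hR2 := rK_le hM hU.1 (hE2 U hU v hv)
  have hΩK0 := ΩK_pos (hE1 U hU v hv)
  have hΩK := ΩK_le (hE2 U hU v hv)
  have hνle := (S.Ω_le_redShift hU hv hEv).1
  have hνneg : 0 < -F.ν U v := by linarith [S.rect.ν_neg hU hv]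
  have hmass := S.massFn_le hU hv
  have hζ := S.boot.ζ_le U hU v hv
  have hA := S.boot.A_le U hU v hv
  set R := rK M U v with hR
  have hR0 : 0 < R := by linarith
  -- The mass function gives `λ` in terms of `r`.
  have hlam : |F.lam U v - (1 / 2 - M / R)| ≤ c₅ * D := by
    have e1 : F.lam U v - (1 / 2 - M / R)
        = (F.r U v * F.lam U v + (M - 1 / 2 * F.r U v)) / F.r U v + M * (F.r U v - R) / (F.r U v * R) := by
      field_simp; ring
    have h1 : |(F.r U v * F.lam U v + (M - 1 / 2 * F.r U v)) / F.r U v| ≤ massC M c * D / m := by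
      rw [abs_div, abs_of_pos hr0]
      have : massC M c * wq M p v ≤ massC M c * D := by gcongr
      have := hmass.trans this
      gcongr
    have h2 : |M * (F.r U v - R) / (F.r U v * R)| ≤ M * (c₄ * D) / (m * M) := by
      rw [abs_div, abs_mul, abs_of_pos hM, abs_of_pos (by positivity : 0 < F.r U v * R)]
      gcongr
    have h3 : M * (c₄ * D) / (m * M) = c₄ * D / m := by field_simp
    have h4 : c₅ * D = massC M c * D / m + c₄ * D / m := by rw [hc₅]; ring
    rw [e1, h4, ← h3]
    exact (abs_add_le _ _).trans (add_le_add h1 h2)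
  have hlogr : |F.ν U v / F.r U v - -(1 / 2) * ΩK M U v / R| ≤ c₆ * e * D := by
    have e1 : F.ν U v / F.r U v - -(1 / 2) * ΩK M U v / R
        = (F.ν U v + 1 / 2 * ΩK M U v) / F.r U v + 1 / 2 * ΩK M U v * (F.r U v - R) / (F.r U v * R) := by
      field_simp; ring
    have h1 : |(F.ν U v + 1 / 2 * ΩK M U v) / F.r U v| ≤ c₃ * e * D / m := by
      rw [abs_div, abs_of_pos hr0]
      gcongr
    have h2 : |1 / 2 * ΩK M U v * (F.r U v - R) / (F.r U v * R)|
        ≤ 1 / 2 * (2 * e) * (c₄ * D) / (m * M) := by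
      rw [abs_div, abs_mul, abs_of_pos (by positivity : 0 < 1 / 2 * ΩK M U v),
        abs_of_pos (by positivity : 0 < F.r U v * R)]
      gcongr
    have h3 : c₆ * e * D = c₃ * e * D / m + 1 / 2 * (2 * e) * (c₄ * D) / (m * M) := by
      rw [hc₆]; ring
    rw [e1, h3]
    exact (abs_add_le _ _).trans (add_le_add h1 h2)
  have hAA : |F.A U v - ΩK M U v * M / R ^ 3| ≤ c₇ * e * D := by
    have e1 : F.A U v - ΩK M U v * M / R ^ 3 = -2 * F.ζ U v * F.θ U v
        + (1 / 2 * (F.Ω U v - ΩK M U v) + 2 * F.ν U v * (F.lam U v - (1 / 2 - M / R))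
          + 2 * (F.ν U v + 1 / 2 * ΩK M U v) * (1 / 2 - M / R)) / F.r U v ^ 2
        + -((F.r U v - R) * (F.r U v + R) * (ΩK M U v * (M / R)) / (F.r U v ^ 2 * R ^ 2)) := by
      rw [Fields.A]; field_simp; ring
    have h1 : |-2 * F.ζ U v * F.θ U v| ≤ 2 * (M * B ^ 2 * (M / v₀)) * (c / m) / m ^ 3 * e * D := by
      have : -2 * F.ζ U v * F.θ U v
          = -2 * ((F.r U v * F.ζ U v) * (F.r U v ^ 2 * F.θ U v)) / F.r U v ^ 3 := by field_simp
      rw [this, abs_div, abs_mul, abs_mul, abs_neg, abs_two,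
        abs_of_pos (by positivity : 0 < F.r U v ^ 3)]
      have hP := S.P_pos hv
      have hPq : wP M p v ^ 2 ≤ (M / v₀) * D := by
        rw [wP_sq hM hv0, mul_comm]
        have := hv.1
        gcongr
      calc _ ≤ 2 * (B * wP M p v * -F.ν U v * (M * B * wP M p v)) / F.r U v ^ 3 := by gcongr
        _ = 2 * (M * B ^ 2 * wP M p v ^ 2) * -F.ν U v / F.r U v ^ 3 := by ring
        _ ≤ 2 * (M * B ^ 2 * ((M / v₀) * D)) * (c / m * e) / m ^ 3 := by gcongr
        _ = _ := by ring
    have hlK : |1 / 2 - M / R| ≤ 1 / 2 := by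
      have h1 : M / R ≤ 1 := by rw [div_le_one hR0]; exact hRM
      have h2 : 0 < M / R := by positivity
      rw [abs_le]; constructor <;> linarith
    have h2 : |(1 / 2 * (F.Ω U v - ΩK M U v) + 2 * F.ν U v * (F.lam U v - (1 / 2 - M / R))
          + 2 * (F.ν U v + 1 / 2 * ΩK M U v) * (1 / 2 - M / R)) / F.r U v ^ 2|
        ≤ (2 * M * c₀ + 2 * (c / m) * c₅ + c₃) / m ^ 2 * e * D := by
      have g1 : |1 / 2 * (F.Ω U v - ΩK M U v)| ≤ 2 * M * c₀ * e * D := by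
        rw [abs_mul, abs_of_pos (by norm_num : (0 : ℝ) < 1 / 2)]
        linarith
      have g2 : |2 * F.ν U v * (F.lam U v - (1 / 2 - M / R))| ≤ 2 * (c / m * e) * (c₅ * D) := by
        rw [abs_mul, abs_mul, abs_two, abs_of_neg (by linarith : F.ν U v < 0)]
        gcongr
      have g3 : |2 * (F.ν U v + 1 / 2 * ΩK M U v) * (1 / 2 - M / R)| ≤ 2 * (c₃ * e * D) * (1 / 2) := by
        rw [abs_mul, abs_mul, abs_two]
        gcongr
      rw [abs_div, abs_of_pos (by positivity : 0 < F.r U v ^ 2)]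
      have g4 := abs_add_le (1 / 2 * (F.Ω U v - ΩK M U v) + 2 * F.ν U v * (F.lam U v - (1 / 2 - M / R)))
        (2 * (F.ν U v + 1 / 2 * ΩK M U v) * (1 / 2 - M / R))
      have g5 := abs_add_le (1 / 2 * (F.Ω U v - ΩK M U v))
        (2 * F.ν U v * (F.lam U v - (1 / 2 - M / R)))
      have g6 : |1 / 2 * (F.Ω U v - ΩK M U v) + 2 * F.ν U v * (F.lam U v - (1 / 2 - M / R))
          + 2 * (F.ν U v + 1 / 2 * ΩK M U v) * (1 / 2 - M / R)|
          ≤ (2 * M * c₀ + 2 * (c / m) * c₅ + c₃) * e * D := by linarith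
      calc _ ≤ (2 * M * c₀ + 2 * (c / m) * c₅ + c₃) * e * D / m ^ 2 := by gcongr
        _ = _ := by ring
    have h3 : |-((F.r U v - R) * (F.r U v + R) * (ΩK M U v * (M / R)) / (F.r U v ^ 2 * R ^ 2))|
        ≤ 8 * c₄ / (m ^ 2 * M) * e * D := by
      rw [abs_neg, abs_div, abs_mul, abs_mul, abs_of_pos (by positivity : 0 < F.r U v + R),
        abs_of_pos (by positivity : 0 < ΩK M U v * (M / R)),
        abs_of_pos (by positivity : 0 < F.r U v ^ 2 * R ^ 2)]
      have g1 : M / R ≤ 1 := by rw [div_le_one hR0]; exact hRM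
      calc _ ≤ c₄ * D * (2 * M + 2 * M) * (2 * e * 1) / (m ^ 2 * M ^ 2) := by gcongr
        _ = _ := by field_simp; ring
    have h4 : c₇ * e * D = 2 * (M * B ^ 2 * (M / v₀)) * (c / m) / m ^ 3 * e * D
        + (2 * M * c₀ + 2 * (c / m) * c₅ + c₃) / m ^ 2 * e * D + 8 * c₄ / (m ^ 2 * M) * e * D := by
      rw [hc₇]; ring
    rw [e1, h4]
    exact (abs_add_le _ _).trans (add_le_add ((abs_add_le _ _).trans (add_le_add h1 h2)) h3)
  refine ⟨hν'.trans ?_, hr'.trans ?_, hlam.trans ?_, hlogr.trans ?_, hAA.trans ?_⟩ <;> gcongr <;>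
    linarith

/-- The red-shift region is close to Schwarzschild. The largest value `Λ` of
`|∂_U log Ω̂² - ∂_U log Ω̂_S²| v^{2p-1} e^{-v/4M}` satisfies `Λ ≤ C (1 + Λ E)`, because an
exponential weight absorbs the integral in `v`. -/
theorem exists_redShift (M p v₀ ρ c B : ℝ) (hM : 0 < M) (hp : 1 < p) (hv₀ : 0 < v₀) (hρ : 0 < ρ)
    (hc : 1 ≤ c) (hB : 0 < B) : ∃ m : ℝ, 1 ≤ m ∧ ∃ E₀ : ℝ, 0 < E₀ ∧ E₀ ≤ 1 / 2 ∧
    ∀ (D₂ D₃ r₁ K k Ed v₁ η a b : ℝ) (rH lH θH nH : ℝ → ℝ) (F : Fields),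
      Setting M p D₂ D₃ v₀ ρ c B r₁ K k Ed v₁ η rH lH θH nH F a b → Ed ≤ E₀ →
      ∀ U ∈ Icc 0 a, ∀ v ∈ Icc v₀ b, EE M U v ≤ Ed →
        |F.β U v - βK M U v| ≤ m * (wq M p v * Real.exp (v / (4 * M))) ∧
        |Real.log (F.Ω U v) - Real.log (ΩK M U v)| ≤ m * wq M p v * EE M U v ∧
        CloseToKruskal M m F U v (wq M p v) := by
  obtain ⟨m, hm, hstep⟩ := exists_redShift_step M p v₀ ρ c B hM hv₀ hρ hc hB
  obtain ⟨Kq, hKq, hexp⟩ := exists_wq_le_exp hM hp hv₀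
  set C := 8 * M * Kq * m with hC
  have hC0 : 0 < C := by positivity
  refine ⟨1 + 2 * C + 4 * M * (2 * C) + m * (1 + 2 * C), by
    have : 0 ≤ 2 * C + 4 * M * (2 * C) + m * (1 + 2 * C) := by positivity
    linarith, min (1 / 2) (1 / (2 * C)), by positivity, min_le_left _ _, ?_⟩
  intro D₂ D₃ r₁ K k Ed v₁ η a b rH lH θH nH F S hEd U hU v hv hE
  have hEd1 : Ed ≤ 1 / 2 := hEd.trans (min_le_left _ _)
  have hEd2 : C * Ed ≤ 1 / 2 := by
    have := hEd.trans (min_le_right _ _)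
    rw [le_div_iff₀ (by positivity)] at this
    linarith
  -- the smaller rectangle lies in the red-shift region
  have hsU : Icc 0 U ⊆ Icc 0 a := Icc_subset_Icc_right hU.2
  have hsv : Icc v₀ v ⊆ Icc v₀ b := Icc_subset_Icc_right hv.2
  have S' : Setting M p D₂ D₃ v₀ ρ c B r₁ K k Ed v₁ η rH lH θH nH F U v :=
    { S with
      rect :=
        { S.rect with
          sol := S.rect.sol.mono hU.2 hv.2
          ha := hU.1
          hb := hv.1
          r_H := fun t ht => S.rect.r_H t (hsv ht)
          lam_H := fun t ht => S.rect.lam_H t (hsv ht)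
          θ_H := fun t ht => S.rect.θ_H t (hsv ht)
          α_H := fun t ht => S.rect.α_H t (hsv ht)
          Ω_H := fun t ht => S.rect.Ω_H t (hsv ht)
          n_H := fun t ht => S.rect.n_H t (hsv ht)
          Ω_I := fun s hs => S.rect.Ω_I s (hsU hs)
          β_I := fun s hs => S.rect.β_I s (hsU hs)
          ζ_I := fun s hs => S.rect.ζ_I s (hsU hs) }
      boot := ⟨fun s hs t ht => S.boot.r_ge s (hsU hs) t (hsv ht),
        fun s hs t ht => S.boot.A_le s (hsU hs) t (hsv ht),
        fun s hs t ht => S.boot.ζ_le s (hsU hs) t (hsv ht),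
        fun s hs t ht => S.boot.lam_le s (hsU hs) t (hsv ht),
        fun s hs t ht => S.boot.θ_le s (hsU hs) t (hsv ht),
        fun s hs t ht => S.boot.α_le s (hsU hs) t (hsv ht),
        fun s hs t ht => S.boot.ν_le s (hsU hs) t (hsv ht),
        fun s hs t ht => S.boot.Ω_le s (hsU hs) t (hsv ht),
        fun s hs t ht => S.boot.ζ_le' s (hsU hs) t (hsv ht),
        fun s hs t ht => S.boot.n_le s (hsU hs) t (hsv ht)⟩
      near := ⟨fun s hs t ht => S.near.lam s (hsU hs) t (hsv ht),
        fun s hs t ht => S.near.θ s (hsU hs) t (hsv ht),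
        fun s hs t ht => S.near.r s (hsU hs) t (hsv ht),
        fun s hs t ht => S.near.Ω s (hsU hs) t (hsv ht),
        fun s hs t ht => S.near.f s (hsU hs) t (hsv ht)⟩
      strip := fun s hs t ht => S.strip s (hsU hs) t (hsv ht) }
  have hE1 : ∀ s ∈ Icc 0 U, ∀ t ∈ Icc v₀ v, EE M s t < 1 := fun s hs t ht => by
    linarith [EE_mono hM hs.1 hs.2 ht.2]
  have hβc : ContinuousOn (fun x : ℝ × ℝ => F.β x.1 x.2) (Icc 0 U ×ˢ Icc v₀ v) :=
    S'.rect.sol.β_c.continuousOn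
  have hcont : ContinuousOn (fun x : ℝ × ℝ => |F.β x.1 x.2 - βK M x.1 x.2|
      / (wq M p x.2 * Real.exp (x.2 / (4 * M)))) (Icc 0 U ×ˢ Icc v₀ v) := by
    refine ContinuousOn.div ((hβc.sub fun x hx =>
      (contDiffAt_βK hM (hE1 x.1 hx.1 x.2 hx.2)).continuousAt.continuousWithinAt).abs)
      (ContinuousOn.mul (fun x hx => ?_) (by fun_prop)) (fun x hx => ?_)
    · exact ((hasDerivAt_wq hM (S'.v_pos hx.2)).continuousAt.comp
        (f := Prod.snd) continuousAt_snd).continuousWithinAt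
    · exact (mul_pos (S'.q_pos hx.2) (Real.exp_pos _)).ne'
  -- A point at which the weighted deviation is maximal.
  obtain ⟨⟨s₀, t₀⟩, hst, hmax⟩ := (isCompact_Icc.prod isCompact_Icc).exists_isMaxOn
    (nonempty_Icc.2 hU.1 |>.prod (nonempty_Icc.2 hv.1)) hcont
  set Λ := |F.β s₀ t₀ - βK M s₀ t₀| / (wq M p t₀ * Real.exp (t₀ / (4 * M))) with hΛ
  have hw₀ : 0 < wq M p t₀ * Real.exp (t₀ / (4 * M)) := mul_pos (S'.q_pos hst.2) (Real.exp_pos _)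
  have hΛ0 : 0 ≤ Λ := by positivity
  have hβ : ∀ s ∈ Icc 0 U, ∀ t ∈ Icc v₀ v,
      |F.β s t - βK M s t| ≤ Λ * (wq M p t * Real.exp (t / (4 * M))) := by
    intro s hs t ht
    have := hmax (show (s, t) ∈ Icc 0 U ×ˢ Icc v₀ v from ⟨hs, ht⟩)
    rwa [mem_ofPred_eq, div_le_iff₀ (mul_pos (S'.q_pos ht) (Real.exp_pos _))] at this
  have hall := hstep D₂ D₃ r₁ K k Ed v₁ η U v Λ rH lH θH nH F S' hEd1 hE hΛ0 hβ
  have hΛC : Λ ≤ 2 * C := by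
    -- integrate the equation for `β` in `v` up to the point where the maximum is attained
    have hsub : Icc v₀ t₀ ⊆ Icc v₀ v := Icc_subset_Icc_right hst.2.2
    have hEd0 : 0 ≤ Ed := (EE_nonneg hM hU.1).trans hE
    have h8M : (8 * M) ≠ 0 := by positivity
    have h1 := abs_sub_le_of_abs_deriv_le hst.2.1 (f := fun t => F.β s₀ t - βK M s₀ t)
      (g := fun t => m * (1 + Λ * Ed) * (Kq * wq M p t₀ * Real.exp (t₀ / (8 * M)))
        * (8 * M * Real.exp (t / (8 * M))))
      (g' := fun t => m * (1 + Λ * Ed) * (Kq * wq M p t₀ * Real.exp (t₀ / (8 * M)))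
        * Real.exp (t / (8 * M)))
      (fun t ht => ((S'.rect.sol.β_v s₀ hst.1 t (hsub ht)).mono hsub).sub
        (hasDerivAt_βK_v hM (hE1 s₀ hst.1 t (hsub ht))).hasDerivWithinAt)
      (fun t _ => ((((hasDerivAt_id t).div_const (8 * M)).exp.const_mul (8 * M)).const_mul
        (m * (1 + Λ * Ed) * (Kq * wq M p t₀ * Real.exp (t₀ / (8 * M))))).congr_deriv (by
          simp only [id]; field_simp) |>.hasDerivWithinAt)
      (fun t ht => by
        have htb := hsub ht
        refine ((hall s₀ hst.1 t htb).2.A).trans ?_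
        have g1 : EE M s₀ t ≤ Ed := (EE_mono hM hst.1.1 hst.1.2 htb.2).trans hE
        have g2 := hexp t t₀ ht.1 ht.2
        have g3 : Real.exp (t / (4 * M)) = Real.exp (t / (8 * M)) * Real.exp (t / (8 * M)) := by
          rw [← Real.exp_add]; congr 1; field_simp; ring
        have g4 : Real.exp ((t₀ - t) / (8 * M)) * Real.exp (t / (8 * M)) = Real.exp (t₀ / (8 * M)) := by
          rw [← Real.exp_add]; congr 1; field_simp; ring
        have hE0 : 0 ≤ EE M s₀ t := EE_nonneg hM hst.1.1
        have hqt := S'.q_pos htb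
        calc m * Real.exp (t / (4 * M)) * ((1 + Λ * EE M s₀ t) * wq M p t)
            ≤ m * Real.exp (t / (4 * M)) * ((1 + Λ * Ed)
              * (Kq * wq M p t₀ * Real.exp ((t₀ - t) / (8 * M)))) := by gcongr
          _ = m * (1 + Λ * Ed) * (Kq * wq M p t₀
              * (Real.exp ((t₀ - t) / (8 * M)) * Real.exp (t / (8 * M)))) * Real.exp (t / (8 * M)) := by
            rw [g3]; ring
          _ = _ := by rw [g4])
    rw [S'.rect.β_I s₀ hst.1, sub_self, sub_zero] at h1
    have hqt := S'.q_pos hst.2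
    have e1 : Real.exp (t₀ / (8 * M)) * Real.exp (t₀ / (8 * M)) = Real.exp (t₀ / (4 * M)) := by
      rw [← Real.exp_add]; congr 1; field_simp; ring
    have h2 : |F.β s₀ t₀ - βK M s₀ t₀| ≤ C * (1 + Λ * Ed) * (wq M p t₀ * Real.exp (t₀ / (4 * M))) := by
      have : 0 ≤ m * (1 + Λ * Ed) * (Kq * wq M p t₀ * Real.exp (t₀ / (8 * M)))
        * (8 * M * Real.exp (v₀ / (8 * M))) := by positivity
      calc _ ≤ m * (1 + Λ * Ed) * (Kq * wq M p t₀ * Real.exp (t₀ / (8 * M)))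
            * (8 * M * Real.exp (t₀ / (8 * M))) := by linarith
        _ = 8 * M * Kq * m * (1 + Λ * Ed) * (wq M p t₀
            * (Real.exp (t₀ / (8 * M)) * Real.exp (t₀ / (8 * M)))) := by ring
        _ = _ := by rw [e1]
    have h3 : Λ ≤ C * (1 + Λ * Ed) := by rw [hΛ, div_le_iff₀ hw₀]; exact h2
    have h4 : Λ * (C * Ed) ≤ Λ * (1 / 2) := by gcongr
    linarith
  have hUm := right_mem_Icc.2 hU.1
  have hvm := right_mem_Icc.2 hv.1
  obtain ⟨h1, h2⟩ := hall U hUm v hvm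
  have h3 := hβ U hUm v hvm
  have hq := S'.q_pos hvm
  have hE0 : 0 ≤ EE M U v := EE_nonneg hM hU.1
  have he0 : 0 < Real.exp (v / (4 * M)) := Real.exp_pos _
  have t1 : 0 ≤ 4 * M * (2 * C) := by positivity
  have t2 : 0 ≤ m * (1 + 2 * C) := by positivity
  have hD : (1 + Λ * EE M U v) * wq M p v ≤ (1 + 2 * C) * wq M p v := by
    have : Λ * EE M U v ≤ 2 * C * 1 := mul_le_mul hΛC (by linarith) hE0 (by positivity)
    exact mul_le_mul_of_nonneg_right (by linarith) hq.le
  have big : ∀ x y, 0 ≤ y → x ≤ m * y * ((1 + Λ * EE M U v) * wq M p v) →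
      x ≤ (1 + 2 * C + 4 * M * (2 * C) + m * (1 + 2 * C)) * y * wq M p v := by
    intro x y hy hx
    refine hx.trans ?_
    calc m * y * ((1 + Λ * EE M U v) * wq M p v) ≤ m * y * ((1 + 2 * C) * wq M p v) := by gcongr
      _ = m * (1 + 2 * C) * y * wq M p v := by ring
      _ ≤ _ := by gcongr; linarith
  refine ⟨h3.trans (by gcongr; linarith), h1.trans ?_, big _ _ he0.le h2.ν, ?_, ?_,
    big _ _ he0.le h2.logr, big _ _ he0.le h2.A⟩
  · calc 4 * M * Λ * wq M p v * EE M U v ≤ 4 * M * (2 * C) * wq M p v * EE M U v := by gcongr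
      _ ≤ _ := by gcongr; linarith
  · simpa using big _ 1 zero_le_one (by simpa using h2.r)
  · simpa using big _ 1 zero_le_one (by simpa using h2.lam)

end Setting

/-! ### The no-shift region -/

/-- The difference `(2M - r_S) / 2` on the curve `E = e`. -/
noncomputable def gap (M e : ℝ) : ℝ := M * (1 - kInv e)

/-- The constant in the comparison with Schwarzschild on the curve `E = e`. -/
noncomputable def gammaC (M e : ℝ) : ℝ := 1 + 2 / M + 1 / gap M e

/-- A bound for the length in `v` of the no-shift region. -/
noncomputable def noShiftLength (M e : ℝ) : ℝ := 8 * M ^ 2 / gap M e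

/-- The constant in the estimates of the no-shift region. -/
noncomputable def noShiftC (M e r₀ : ℝ) : ℝ :=
  (gammaC M e + noShiftLength M e * ((1 + 2 * M / gap M e) / r₀ ^ 2)
    + (2 * (1 + 2 * M / gap M e) + noShiftLength M e * (2 / gap M e)))
    * Real.exp (noShiftLength M e / (8 * M))

theorem gap_pos {M e : ℝ} (hM : 0 < M) (h0 : 0 < e) (h1 : e < 1) : 0 < gap M e :=
  mul_pos hM (by linarith [kInv_lt_one h0 h1])

theorem gap_le {M e : ℝ} (hM : 0 < M) (h1 : e ≤ 1 / 2) : gap M e ≤ M / 2 := by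
  have := half_le_kInv h1
  unfold gap
  nlinarith

theorem abs_log_sub_log_le {x y m : ℝ} (hm : 0 < m) (hx : m ≤ x) (hy : m ≤ y) :
    |Real.log x - Real.log y| ≤ |x - y| / m := by
  have key : ∀ s t : ℝ, m ≤ s → m ≤ t → Real.log s - Real.log t ≤ |s - t| / m := by
    intro s t hs ht
    have hs0 := hm.trans_le hs
    have ht0 := hm.trans_le ht
    have h1 := Real.log_le_sub_one_of_pos (div_pos hs0 ht0)
    rw [Real.log_div hs0.ne' ht0.ne'] at h1
    have h2 : s / t - 1 = (s - t) / t := by field_simp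
    have h3 : (s - t) / t ≤ |s - t| / m := by
      calc _ ≤ |s - t| / t := by gcongr; exact le_abs_self _
        _ ≤ _ := by gcongr
    linarith
  rw [abs_le]
  have h1 := key x y hx hy
  have h2 := key y x hy hx
  rw [abs_sub_comm] at h2
  constructor <;> linarith

/-- The bounds at a point of the no-shift region, with error `X`. -/
structure NoShiftBounds (M d X : ℝ) (F : Fields) (U v : ℝ) : Prop where
  r_le : F.r U v ≤ 2 * M - d
  lam_le : F.r U v * F.lam U v ≤ -(d / 4)
  lapse : |Real.log (F.r U v ^ 2 * (F.Ω U v * (U / (4 * M))))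
    - Real.log (2 * M * F.r U v - F.r U v ^ 2)| ≤ X
  level : |v + 4 * M * Real.log (U / (4 * M)) - 2 * rStar M (F.r U v)| ≤ X

namespace Setting

variable {M p D₂ D₃ v₀ ρ c B r₁ K k Ed v₁ η a b U v m : ℝ} {rH lH θH nH : ℝ → ℝ} {F : Fields}

/-- On Schwarzschild `r² Ω² = 2Mr - r²`; the factor `U / 4M` is `dU / du`. -/
theorem mul_Omega_kruskal {U v : ℝ} (hM : 0 < M) (hU : 0 < U) (hE : EE M U v < 1) :
    Real.log (rK M U v ^ 2 * (ΩK M U v * (U / (4 * M))))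
      = Real.log (2 * M * rK M U v - rK M U v ^ 2) := by
  congr 1
  have h1 := exp_neg_kInv_mul hE
  have h2 := (kInv_spec hE).1.ne'
  have h3 : Real.exp (v / (4 * M)) * (U / (4 * M)) = EE M U v := by rw [EE]; ring
  calc rK M U v ^ 2 * (ΩK M U v * (U / (4 * M)))
      = 4 * M ^ 2 * kInv (EE M U v) * (Real.exp (-kInv (EE M U v))
        * (Real.exp (v / (4 * M)) * (U / (4 * M)))) := by
        simp only [rK, ΩK]; field_simp; norm_num
    _ = _ := by rw [h3, h1, rK]; ring

/-- Comparison with Schwarzschild on the curve that separates the two regions. -/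
theorem on_gamma (S : Setting M p D₂ D₃ v₀ ρ c B r₁ K k Ed v₁ η rH lH θH nH F a b)
    (hEd1 : Ed ≤ 1 / 2) (hm : 0 < m) (hU0 : 0 < U) (hU : U ∈ Icc 0 a) (hv : v ∈ Icc v₀ b)
    (hE : EE M U v = Ed) (hlog : |Real.log (F.Ω U v) - Real.log (ΩK M U v)| ≤ m * wq M p v * EE M U v)
    (hclose : CloseToKruskal M m F U v (wq M p v)) (hsmall : m * wq M p v ≤ gap M Ed) :
    F.r U v ≤ 2 * M - gap M Ed ∧ M / 2 ≤ F.r U v ∧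
    |Real.log (F.r U v ^ 2 * (F.Ω U v * (U / (4 * M))))
      - Real.log (2 * M * F.r U v - F.r U v ^ 2)| ≤ gammaC M Ed * (m * wq M p v) := by
  have hM := S.hM
  have hE0 : 0 < EE M U v := EE_pos hM hU0
  have hE1 : EE M U v < 1 := by linarith
  have hd := gap_pos hM (hE ▸ hE0) (hE ▸ hE1)
  have hdM := gap_le hM hEd1
  have hr := S.r_pos hU hv
  have hΩ := S.Ω_pos hU hv
  have hΩK := ΩK_pos hE1
  have hq := S.q_pos hv
  set d := gap M Ed with hd'
  have hR : rK M U v = 2 * M - 2 * d := by rw [rK, hE, hd', gap]; ring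
  have hrR := hclose.r
  obtain ⟨h1, h2⟩ := abs_le.1 hrR
  have hRM := rK_ge hM (hE.trans_le hEd1)
  have h3 : F.r U v ≤ 2 * M - d := by linarith
  have h4 : M / 2 ≤ F.r U v := by linarith
  refine ⟨h3, h4, ?_⟩
  have hR0 : 0 < rK M U v := by linarith
  have hU4 : 0 < U / (4 * M) := by positivity
  have key : ∀ r Ω : ℝ, 0 < r → r < 2 * M → 0 < Ω → Real.log (r ^ 2 * (Ω * (U / (4 * M))))
      - Real.log (2 * M * r - r ^ 2)
      = Real.log Ω + Real.log (U / (4 * M)) + Real.log r - Real.log (2 * M - r) := by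
    intro r Ω hr hr2 hΩ
    have : 2 * M * r - r ^ 2 = r * (2 * M - r) := by ring
    rw [this, Real.log_mul hr.ne' (by linarith), Real.log_mul (by positivity) (by positivity),
      Real.log_mul hΩ.ne' hU4.ne', Real.log_pow]
    push_cast
    ring
  have e1 := key (F.r U v) (F.Ω U v) hr (by linarith) hΩ
  have e2 := key (rK M U v) (ΩK M U v) hR0 (by linarith) hΩK
  rw [mul_Omega_kruskal hM hU0 hE1, sub_self] at e2
  have e3 := abs_log_sub_log_le (x := F.r U v) (y := rK M U v) (by positivity) h4 (by linarith)
  have e4 := abs_log_sub_log_le (x := 2 * M - F.r U v) (y := 2 * M - rK M U v) hd (by linarith)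
    (by linarith)
  have e5 : |2 * M - F.r U v - (2 * M - rK M U v)| = |F.r U v - rK M U v| := by
    rw [abs_sub_comm]; congr 1; ring
  rw [e5] at e4
  have e6 : |F.r U v - rK M U v| / (M / 2) ≤ m * wq M p v / (M / 2) := by gcongr
  have e7 : |F.r U v - rK M U v| / d ≤ m * wq M p v / d := by gcongr
  have e8 : m * wq M p v * EE M U v ≤ m * wq M p v * 1 := by gcongr
  have e9 : gammaC M Ed * (m * wq M p v)
      = m * wq M p v * 1 + m * wq M p v / (M / 2) + m * wq M p v / d := by
    rw [gammaC, ← hd']; field_simp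
  rw [e1, e9]
  have := abs_le.1 hlog
  have := abs_le.1 e3
  have := abs_le.1 e4
  rw [abs_le]
  constructor <;> linarith

/-- Where `∂_v r` is negative it stays negative, by the Raychaudhuri equation. -/
theorem lam_neg_of_le (S : Setting M p D₂ D₃ v₀ ρ c B r₁ K k Ed v₁ η rH lH θH nH F a b) {w : ℝ}
    (hU : U ∈ Icc 0 a) (hw : w ∈ Icc v₀ b) (hv : v ∈ Icc v₀ b) (hwv : w ≤ v)
    (h : F.lam U w < 0) : F.lam U v < 0 := by
  have hsub : Icc w v ⊆ Icc v₀ b := Icc_subset_Icc hw.1 hv.2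
  have h1 := le_of_deriv_nonpos hwv (f := fun v => F.lam U v / F.Ω U v)
    (f' := fun v => -(F.r U v * F.θ U v ^ 2 / F.Ω U v))
    (fun s hs => by
      have hΩ := (S.Ω_pos hU (hsub hs)).ne'
      refine (((S.rect.sol.lam_v U hU s (hsub hs)).div (S.rect.sol.Ω_v U hU s (hsub hs))
        hΩ).mono hsub).congr_deriv ?_
      field_simp
      ring)
    (fun s hs => by
      have hΩ := S.Ω_pos hU (hsub hs)
      have hr := S.r_pos hU (hsub hs)
      have : 0 ≤ F.r U s * F.θ U s ^ 2 / F.Ω U s := by positivity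
      linarith)
  have h2 := div_neg_of_neg_of_pos h (S.Ω_pos hU hw)
  have h3 : F.lam U v / F.Ω U v < 0 := h1.trans_lt h2
  by_contra hn
  push Not at hn
  have := div_nonneg hn (S.Ω_pos hU hv).le
  linarith

/-- The estimates of the no-shift region, by integration in `v` from the curve that bounds the
red-shift region. -/
theorem noShift (S : Setting M p D₂ D₃ v₀ ρ c B r₁ K k Ed v₁ η rH lH θH nH F a b)
    (hEd0 : 0 < Ed) (hEd1 : Ed ≤ 1 / 2) (hm : 0 < m)
    (hred : ∀ U ∈ Icc 0 a, ∀ v ∈ Icc v₀ b, EE M U v ≤ Ed →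
      |Real.log (F.Ω U v) - Real.log (ΩK M U v)| ≤ m * wq M p v * EE M U v ∧
        CloseToKruskal M m F U v (wq M p v))
    {Kq Y r₀ vd : ℝ} (hY : m + massC M c + lapseC M v₀ c B ρ ≤ Y) (hr₀ : 0 < r₀)
    (hqexp : ∀ t v : ℝ, v₀ ≤ t → t ≤ v →
      wq M p t ≤ Kq * wq M p v * Real.exp ((v - t) / (8 * M)))
    (hvd : v₀ ≤ vd) (had : EE M a vd ≤ Ed)
    (hsmall : ∀ t, vd ≤ t → Y * wq M p t ≤ gap M Ed / 4 ∧ Y * wq M p t ≤ gap M Ed / (4 * M))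
    (hU : U ∈ Icc 0 a) (hv : v ∈ Icc v₀ b) (hE : Ed < EE M U v) (hr : r₀ ≤ F.r U v) :
    vd ≤ v ∧
    NoShiftBounds M (gap M Ed) (noShiftC M Ed r₀ * (Kq * Y * wq M p v)) F U v := by
  have hM := S.hM
  have hp := S.hp
  have hd := gap_pos hM hEd0 (by linarith : Ed < 1)
  have hdM := gap_le hM hEd1
  set d := gap M Ed with hd'
  have hU0 : 0 < U := by
    rcases hU.1.eq_or_lt with h0 | h0
    · rw [← h0] at hE
      have : EE M 0 v = 0 := by simp [EE]
      linarith
    · exact h0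
  have hmc := S.massC_pos
  have hlc := S.lapseC_nonneg
  have hY0 : 0 < Y := by linarith
  -- the point of the curve with the same `U`
  set w := 4 * M * Real.log (4 * M * Ed / U) with hw
  have hEw : EE M U w = Ed := by
    have : w / (4 * M) = Real.log (4 * M * Ed / U) := by rw [hw]; field_simp
    rw [EE, this, Real.exp_log (by positivity)]
    field_simp
  have hlt : ∀ s t, EE M U s < EE M U t → s < t := by
    intro s t hst
    by_contra hts
    push Not at hts
    linarith [EE_mono hM hU.1 (le_refl U) hts]
  have hwv : w < v := hlt _ _ (hEw ▸ hE)
  have hdw : vd ≤ w := by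
    by_contra hcon
    push Not at hcon
    have h1 : EE M U w < EE M U vd := by
      unfold EE
      gcongr
    have h2 := EE_mono (v := vd) hM hU.1 hU.2 le_rfl
    linarith
  have hwb : w ∈ Icc v₀ b := ⟨hvd.trans hdw, hwv.le.trans hv.2⟩
  have hsub : Icc w v ⊆ Icc v₀ b := Icc_subset_Icc hwb.1 hv.2
  obtain ⟨hlogw, hclosew⟩ := hred U hU w hwb hEw.le
  obtain ⟨hs1, hs2⟩ := hsmall w hdw
  have hqw := S.q_pos hwb
  have hqv := S.q_pos hv
  have hmY : m * wq M p w ≤ Y * wq M p w := by gcongr; linarith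
  obtain ⟨hrw, hrw2, hlapw⟩ := S.on_gamma hEd1 hm hU0 hU hwb hEw hlogw hclosew (by linarith)
  have hR : rK M U w = 2 * M - 2 * d := by rw [rK, hEw, hd', gap]; ring
  have hqt : ∀ t ∈ Icc w v, wq M p t ≤ wq M p w := fun t ht => wq_anti hM hp (S.v_pos hwb) ht.1
  have hqt0 : ∀ t ∈ Icc w v, 0 < wq M p t := fun t ht => S.q_pos (hsub ht)
  have hmass : ∀ t ∈ Icc w v, |F.r U t * F.lam U t + (M - 1 / 2 * F.r U t)| ≤ Y * wq M p w :=
    fun t ht => (S.massFn_le hU (hsub ht)).trans (by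
      have := hqt t ht
      have := hqt0 t ht
      gcongr
      linarith)
  have hlamw : F.lam U w < 0 := by
    have h1 := (abs_le.1 hclosew.lam).2
    have h2 : 1 / 2 - M / rK M U w ≤ -(d / (2 * M)) := by
      have hR0 : 0 < rK M U w := by rw [hR]; linarith
      have h3 : 1 / 2 - M / rK M U w = -(d / rK M U w) := by
        rw [hR]
        have hMd : M - d ≠ 0 := by linarith
        have hMd' : 2 * M - 2 * d ≠ 0 := by linarith
        field_simp
        ring
      have h4 : d / (2 * M) ≤ d / rK M U w := by
        gcongr
        linarith
      linarith
    have h5 : d / (2 * M) = 2 * (d / (4 * M)) := by field_simp; norm_num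
    have h6 : 0 < d / (4 * M) := by positivity
    linarith
  have hlam : ∀ t ∈ Icc w v, F.lam U t < 0 := fun t ht =>
    S.lam_neg_of_le hU hwb (hsub ht) ht.1 hlamw
  have hranti : ∀ s t, w ≤ s → s ≤ t → t ≤ v → F.r U t ≤ F.r U s := by
    intro s t hs hst ht
    have hsub' : Icc s t ⊆ Icc w v := Icc_subset_Icc hs ht
    exact le_of_deriv_nonpos hst
      (fun x hx => (S.rect.sol.r_v U hU x (hsub (hsub' hx))).mono (hsub'.trans hsub))
      (fun x hx => (hlam x (hsub' hx)).le)
  have hrt : ∀ t ∈ Icc w v, r₀ ≤ F.r U t ∧ F.r U t ≤ 2 * M - d := fun t ht =>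
    ⟨hr.trans (hranti t v ht.1 ht.2 le_rfl), (hranti w t le_rfl ht.1 ht.2).trans hrw⟩
  have hrlam : ∀ t ∈ Icc w v, F.r U t * F.lam U t ≤ -(d / 4) := fun t ht => by
    have := (abs_le.1 (hmass t ht)).2
    linarith [(hrt t ht).2]
  -- the length of the segment is bounded because `r²` decreases at a definite rate
  set T := noShiftLength M Ed with hT
  have hT0 : 0 < T := by rw [hT, noShiftLength]; positivity
  have hlen : v - w ≤ T := by
    have h1 := sub_le_sub_of_deriv_le (f := fun t => F.r U t ^ 2) (g := fun t => -(d / 2) * t)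
      (g' := fun _ => -(d / 2)) hwv.le
      (fun t ht => ((S.rect.sol.r_v U hU t (hsub ht)).mono hsub).pow 2)
      (fun t _ => by simpa using ((hasDerivAt_id t).const_mul (-(d / 2))).hasDerivWithinAt)
      (fun t ht => by
        have := hrlam t ht
        simp only [Nat.cast_ofNat, Nat.add_one_sub_one, pow_one]
        linarith)
    have h2 : F.r U w ^ 2 ≤ (2 * M) ^ 2 := by
      have := S.r_pos hU hwb
      gcongr
      linarith
    have h3 : 0 ≤ F.r U v ^ 2 := sq_nonneg _
    rw [hT, noShiftLength, le_div_iff₀ hd]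
    linarith
  have hqwv : wq M p w ≤ Kq * wq M p v * Real.exp (T / (8 * M)) := by
    have h1 := hqexp w v hwb.1 hwv.le
    have hKq : 0 < Kq := by
      have h2 := hqexp w w hwb.1 le_rfl
      simp only [sub_self, zero_div, Real.exp_zero, mul_one] at h2
      nlinarith
    refine h1.trans ?_
    gcongr
  refine ⟨hdw.trans hwv.le, (hrt v (right_mem_Icc.2 hwv.le)).2, hrlam v (right_mem_Icc.2 hwv.le),
    ?_, ?_⟩
  · -- the lapse
    have hU4 : 0 < U / (4 * M) := by positivity
    have key : ∀ t ∈ Icc w v, Real.log (F.r U t ^ 2 * (F.Ω U t * (U / (4 * M))))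
        - Real.log (2 * M * F.r U t - F.r U t ^ 2)
        = Real.log (F.Ω U t) + Real.log (U / (4 * M)) + Real.log (F.r U t)
          - Real.log (2 * M - F.r U t) := by
      intro t ht
      have hr := S.r_pos hU (hsub ht)
      have hΩ := S.Ω_pos hU (hsub ht)
      have h2 := (hrt t ht).2
      have : 2 * M * F.r U t - F.r U t ^ 2 = F.r U t * (2 * M - F.r U t) := by ring
      rw [this, Real.log_mul hr.ne' (by linarith), Real.log_mul (by positivity) (by positivity),
        Real.log_mul hΩ.ne' hU4.ne', Real.log_pow]
      push_cast
      ring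
    have h1 := abs_sub_le_of_abs_deriv_le_const (C := (1 + 2 * M / d) / r₀ ^ 2 * (Y * wq M p w)) hwv.le
      (f := fun t => Real.log (F.Ω U t) + Real.log (U / (4 * M)) + Real.log (F.r U t)
          - Real.log (2 * M - F.r U t))
      (fun t ht => by
        have hr := S.r_pos hU (hsub ht)
        have h2 := (hrt t ht).2
        exact ((((S.rect.sol.logΩ_v hU (hsub ht)).add_const _).add
          ((S.rect.sol.r_v U hU t (hsub ht)).log hr.ne')).sub
          (((S.rect.sol.r_v U hU t (hsub ht)).const_sub (2 * M)).log (by linarith))).mono hsub)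
      (fun t ht => by
        have hr := S.r_pos hU (hsub ht)
        obtain ⟨h2, h3⟩ := hrt t ht
        have hq0 := hqt0 t ht
        have hqt := hqt t ht
        have g1 := S.lapse_le hU (hsub ht)
        have g2 := hmass t ht
        have h4 : 0 < 2 * M - F.r U t := by linarith
        have e1 : F.α U t + F.lam U t / F.r U t - -F.lam U t / (2 * M - F.r U t)
            = (F.α U t + 2 * F.lam U t / F.r U t - 1 / F.r U t + M / F.r U t ^ 2)
              + 2 * (F.r U t - M) * (F.r U t * F.lam U t + (M - 1 / 2 * F.r U t))
                / (F.r U t ^ 2 * (2 * M - F.r U t)) := by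
          field_simp
          ring
        have e2 : lapseC M v₀ c B ρ * wq M p t / F.r U t ^ 2 ≤ Y * wq M p w / r₀ ^ 2 := by
          gcongr
          linarith
        have e3 : |F.r U t - M| ≤ M := by rw [abs_le]; constructor <;> linarith
        have e4 : |2 * (F.r U t - M) * (F.r U t * F.lam U t + (M - 1 / 2 * F.r U t))
                / (F.r U t ^ 2 * (2 * M - F.r U t))| ≤ 2 * M * (Y * wq M p w) / (r₀ ^ 2 * d) := by
          rw [abs_div, abs_mul, abs_mul, abs_two,
            abs_of_pos (by positivity : 0 < F.r U t ^ 2 * (2 * M - F.r U t))]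
          gcongr
          linarith
        rw [e1]
        refine (abs_add_le _ _).trans ((add_le_add (g1.trans e2) e4).trans (le_of_eq ?_))
        field_simp)
    rw [← key w (left_mem_Icc.2 hwv.le), ← key v (right_mem_Icc.2 hwv.le)] at h1
    have h2 := abs_sub_abs_le_abs_sub (Real.log (F.r U v ^ 2 * (F.Ω U v * (U / (4 * M))))
        - Real.log (2 * M * F.r U v - F.r U v ^ 2)) (Real.log (F.r U w ^ 2 * (F.Ω U w * (U / (4 * M))))
        - Real.log (2 * M * F.r U w - F.r U w ^ 2))
    have hgC : 0 < gammaC M Ed := by rw [gammaC]; positivity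
    have h3 : gammaC M Ed * (m * wq M p w) ≤ gammaC M Ed * (Y * wq M p w) := by gcongr
    have h4 : (1 + 2 * M / d) / r₀ ^ 2 * (Y * wq M p w) * (v - w)
        ≤ (1 + 2 * M / d) / r₀ ^ 2 * (Y * wq M p w) * T := by gcongr
    have h5 : 0 ≤ (2 * (1 + 2 * M / d) + T * (2 / d)) * (Y * wq M p w) := by positivity
    have h6 : |Real.log (F.r U v ^ 2 * (F.Ω U v * (U / (4 * M))))
        - Real.log (2 * M * F.r U v - F.r U v ^ 2)|
        ≤ (gammaC M Ed + T * ((1 + 2 * M / d) / r₀ ^ 2) + (2 * (1 + 2 * M / d) + T * (2 / d)))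
          * (Y * wq M p w) := by linarith
    refine h6.trans ?_
    calc _ ≤ (gammaC M Ed + T * ((1 + 2 * M / d) / r₀ ^ 2) + (2 * (1 + 2 * M / d) + T * (2 / d)))
          * (Y * (Kq * wq M p v * Real.exp (T / (8 * M)))) := by gcongr
      _ = _ := by rw [noShiftC]; ring
  · -- the level curves of `r`
    have h1 := abs_sub_le_of_abs_deriv_le_const (C := 2 / d * (Y * wq M p w)) hwv.le
      (f := fun t => t + 4 * M * Real.log (U / (4 * M)) - 2 * rStar M (F.r U t))
      (f' := fun t => 2 * (F.r U t * F.lam U t + (M - 1 / 2 * F.r U t)) / (2 * M - F.r U t))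
      (fun t ht => by
        have hr := S.r_pos hU (hsub ht)
        have h2 := (hrt t ht).2
        have h4 : 0 < 2 * M - F.r U t := by linarith
        have h3 : (2 * M - F.r U t) / (2 * M) ≠ 0 := (div_pos h4 (by positivity)).ne'
        have hd1 := S.rect.sol.r_v U hU t (hsub ht)
        refine ((((hasDerivWithinAt_id t (Icc v₀ b)).add_const (4 * M * Real.log (U / (4 * M)))).sub
          ((hd1.add ((((hd1.const_sub (2 * M)).div_const (2 * M)).log h3).const_mul
            (2 * M))).const_mul 2)).congr_deriv ?_).mono hsub
        field_simp
        ring)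
      (fun t ht => by
        have h3 := (hrt t ht).2
        have h4 : 0 < 2 * M - F.r U t := by linarith
        have g2 := hmass t ht
        rw [abs_div, abs_mul, abs_two, abs_of_pos h4]
        calc _ ≤ 2 * (Y * wq M p w) / d := by
              gcongr
              linarith
          _ = _ := by ring)
    have hRlow : 0 < rK M U w := by rw [hR]; linarith
    have hstar : w + 4 * M * Real.log (U / (4 * M)) = 2 * rStar M (rK M U w) := by
      have e1 : (2 * M - rK M U w) / (2 * M) = Real.exp (-kInv Ed) * Ed := by
        rw [exp_neg_kInv_mul (by linarith), rK, hEw]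
        field_simp
      have e2 : 4 * M * Ed / U = Ed * (U / (4 * M))⁻¹ := by field_simp
      have hU4 : 0 < U / (4 * M) := by positivity
      have e3 : rK M U w = 2 * M * kInv Ed := by rw [rK, hEw]
      rw [rStar, e1, e3, Real.log_mul (Real.exp_ne_zero _) hEd0.ne', Real.log_exp, hw, e2,
        Real.log_mul hEd0.ne' (inv_pos.2 hU4).ne', Real.log_inv]
      ring
    have h2 : |w + 4 * M * Real.log (U / (4 * M)) - 2 * rStar M (F.r U w)|
        ≤ 2 * (1 + 2 * M / d) * (Y * wq M p w) := by
      have hrpos := S.r_pos hU hwb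
      have e0 : ∀ r, 2 * M - r > 0 → rStar M r = r + 2 * M * (Real.log (2 * M - r) - Real.log (2 * M)) :=
        fun r h => by rw [rStar, Real.log_div h.ne' (by positivity)]
      rw [hstar, e0 _ (by linarith), e0 _ (by linarith)]
      have e4 := abs_log_sub_log_le (x := 2 * M - F.r U w) (y := 2 * M - rK M U w) hd (by linarith)
        (by linarith)
      have e5 : |2 * M - F.r U w - (2 * M - rK M U w)| = |F.r U w - rK M U w| := by
        rw [abs_sub_comm]; congr 1; ring
      rw [e5] at e4
      have e6 := hclosew.r.trans hmY
      have e7 : |F.r U w - rK M U w| / d ≤ Y * wq M p w / d := by gcongr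
      have e8 : 2 * (1 + 2 * M / d) * (Y * wq M p w)
          = 2 * (Y * wq M p w) + 4 * M * (Y * wq M p w / d) := by ring
      have e9 : |4 * M * (Real.log (2 * M - F.r U w) - Real.log (2 * M - rK M U w))|
          ≤ 4 * M * (Y * wq M p w / d) := by
        rw [abs_mul, abs_of_pos (by positivity : 0 < 4 * M)]
        have := e4.trans e7
        gcongr
      have := abs_le.1 e6
      have := abs_le.1 e9
      rw [e8, abs_le]
      constructor <;> linarith
    have h3 := abs_sub_abs_le_abs_sub (v + 4 * M * Real.log (U / (4 * M)) - 2 * rStar M (F.r U v))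
      (w + 4 * M * Real.log (U / (4 * M)) - 2 * rStar M (F.r U w))
    have h4 : 2 / d * (Y * wq M p w) * (v - w) ≤ 2 / d * (Y * wq M p w) * T := by gcongr
    have hgC : 0 < gammaC M Ed := by rw [gammaC]; positivity
    have h5 : 0 ≤ (gammaC M Ed + T * ((1 + 2 * M / d) / r₀ ^ 2)) * (Y * wq M p w) := by positivity
    have h6 : |v + 4 * M * Real.log (U / (4 * M)) - 2 * rStar M (F.r U v)|
        ≤ (gammaC M Ed + T * ((1 + 2 * M / d) / r₀ ^ 2) + (2 * (1 + 2 * M / d) + T * (2 / d)))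
          * (Y * wq M p w) := by linarith
    refine h6.trans ?_
    calc _ ≤ (gammaC M Ed + T * ((1 + 2 * M / d) / r₀ ^ 2) + (2 * (1 + 2 * M / d) + T * (2 / d)))
          * (Y * (Kq * wq M p v * Real.exp (T / (8 * M)))) := by gcongr
      _ = _ := by rw [noShiftC]; ring

end Setting

/-! ### Global existence for the truncated system -/

/-- A `C¹` function agrees on a ball with a globally Lipschitz function. -/
theorem exists_lipschitz_cutoff {X : Type*} [NormedAddCommGroup X] [NormedSpace ℝ X]
    [FiniteDimensional ℝ X] {h : X → ℝ} (hh : ContDiff ℝ 1 h) {R : ℝ} (hR : 0 < R) :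
    ∃ T : X → ℝ, (∃ L, LipschitzWith L T) ∧ ∀ x, ‖x‖ ≤ R → T x = h x := by
  let χ : ContDiffBump (0 : X) := ⟨R, R + 1, hR, by linarith⟩
  refine ⟨fun x => χ x * h x, ?_, fun x hx => ?_⟩
  · exact ContDiff.lipschitzWith_of_hasCompactSupport (𝕂 := ℝ) (n := 1)
      (χ.hasCompactSupport.mul_right) (χ.contDiff.mul hh) one_ne_zero
  · simp only [χ.one_of_mem_closedBall (x := x) (by simpa using hx), one_mul]

/-- The function `1 / r` on `r ≥ r₁` extends to a `C¹` function on the line, since `r₁ > 0`. -/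
theorem exists_smooth_inv {r₁ : ℝ} (hr₁ : 0 < r₁) :
    ∃ g : ℝ → ℝ, ContDiff ℝ 1 g ∧ ∀ r, r₁ ≤ r → g r = r⁻¹ := by
  refine ⟨fun r => Real.smoothTransition (2 * r / r₁ - 1) * r⁻¹, ?_, fun r hr => ?_⟩
  · rw [contDiff_iff_contDiffAt]
    intro r
    have hs : ContDiffAt ℝ 1 (fun r : ℝ => Real.smoothTransition (2 * r / r₁ - 1)) r :=
      (Real.smoothTransition.contDiff (n := 1)).contDiffAt.comp r
        ((contDiffAt_const.mul contDiffAt_id).div_const _ |>.sub contDiffAt_const)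
    rcases eq_or_ne r 0 with rfl | hr
    · refine (contDiffAt_const (c := (0 : ℝ))).congr_of_eventuallyEq ?_
      filter_upwards [Iio_mem_nhds (show (0 : ℝ) < r₁ / 2 by positivity)] with s hs
      have : s < r₁ / 2 := hs
      have h2 : 2 * s / r₁ - 1 ≤ 0 := by
        rw [sub_nonpos, div_le_one hr₁]; linarith
      simp [Real.smoothTransition.zero_of_nonpos h2]
    · exact hs.mul (contDiffAt_inv ℝ hr)
  · have h1 : 1 ≤ 2 * r / r₁ - 1 := by
      have : 2 ≤ 2 * r / r₁ := by rw [le_div_iff₀ hr₁]; linarith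
      linarith
    simp [Real.smoothTransition.one_of_one_le h1]

theorem hasDerivWithinAt_fst {E E' : Type*} [NormedAddCommGroup E] [NormedSpace ℝ E]
    [NormedAddCommGroup E'] [NormedSpace ℝ E'] {f : ℝ → E × E'} {f' : E × E'} {s : Set ℝ} {x : ℝ}
    (h : HasDerivWithinAt f f' s x) : HasDerivWithinAt (fun x => (f x).1) f'.1 s x := by
  simpa using (HasFDerivWithinAt.fst h.hasFDerivWithinAt).hasDerivWithinAt

theorem hasDerivWithinAt_snd {E E' : Type*} [NormedAddCommGroup E] [NormedSpace ℝ E]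
    [NormedAddCommGroup E'] [NormedSpace ℝ E'] {f : ℝ → E × E'} {f' : E × E'} {s : Set ℝ} {x : ℝ}
    (h : HasDerivWithinAt f f' s x) : HasDerivWithinAt (fun x => (f x).2) f'.2 s x := by
  simpa using (HasFDerivWithinAt.snd h.hasFDerivWithinAt).hasDerivWithinAt

section Lipschitz

variable {X Y Z : Type*} [PseudoEMetricSpace X] [PseudoEMetricSpace Y] [PseudoEMetricSpace Z]

theorem exists_lipschitz_fst {f : X → Y × Z} (h : ∃ L, LipschitzWith L f) :
    ∃ L, LipschitzWith L (fun x => (f x).1) :=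
  let ⟨_, hL⟩ := h
  ⟨_, LipschitzWith.prod_fst.comp hL⟩

theorem exists_lipschitz_snd {f : X → Y × Z} (h : ∃ L, LipschitzWith L f) :
    ∃ L, LipschitzWith L (fun x => (f x).2) :=
  let ⟨_, hL⟩ := h
  ⟨_, LipschitzWith.prod_snd.comp hL⟩

theorem exists_lipschitz_prodMk {f : X → Y} {g : X → Z} (hf : ∃ L, LipschitzWith L f)
    (hg : ∃ L, LipschitzWith L g) : ∃ L, LipschitzWith L (fun x => (f x, g x)) :=
  let ⟨_, hL⟩ := hf
  let ⟨_, hL'⟩ := hg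
  ⟨_, hL.prodMk hL'⟩

theorem exists_lipschitz_sub_mul {f g : X → ℝ} (hf : ∃ L, LipschitzWith L f)
    (hg : ∃ L, LipschitzWith L g) (k : ℝ) : ∃ L, LipschitzWith L (fun x => f x - k * g x) :=
  let ⟨_, hL⟩ := hf
  let ⟨_, hL'⟩ := hg
  ⟨_, hL.sub ((lipschitzWith_smul k).comp hL')⟩

end Lipschitz

/-- Initial data in first-order form; on the ingoing cone `Ω̂²` is that of Schwarzschild and on the
horizon `∂_v log Ω̂² = 1/4M`. The last two fields of each group are the constraint equation and the
regularity of the derivative of `φ`. -/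
structure CharData (M v₀ U₀ : ℝ) (rH lH φH θH rI nI φI ζI : ℝ → ℝ) : Prop where
  rH_v : ∀ v ∈ Ici v₀, HasDerivWithinAt rH (lH v) (Ici v₀) v
  φH_v : ∀ v ∈ Ici v₀, HasDerivWithinAt φH (θH v) (Ici v₀) v
  lH_v : ∀ v ∈ Ici v₀,
    HasDerivWithinAt lH (1 / (4 * M) * lH v - rH v * θH v ^ 2) (Ici v₀) v
  θH_c : ContinuousOn θH (Ici v₀)
  bdd : ∃ C, ∀ v ∈ Ici v₀, |lH v| ≤ C ∧ |θH v| ≤ C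
  rI_U : ∀ U ∈ Icc 0 U₀, HasDerivWithinAt rI (nI U) (Icc 0 U₀) U
  φI_U : ∀ U ∈ Icc 0 U₀, HasDerivWithinAt φI (ζI U) (Icc 0 U₀) U
  nI_U : ∀ U ∈ Icc 0 U₀,
    HasDerivWithinAt nI (βK M U v₀ * nI U - rI U * ζI U ^ 2) (Icc 0 U₀) U
  ζI_c : ContinuousOn ζI (Icc 0 U₀)
  corner_r : rH v₀ = rI 0
  corner_φ : φH v₀ = φI 0

/-- The range of the unknowns in which the truncated system is the original one. The quantities that
are transported in the direction of `v` may grow like `e^{k(v-v₀)}`. -/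
structure Tame (M r₁ K k v₀ : ℝ) (F : Fields) (U v : ℝ) : Prop where
  r_ge : r₁ ≤ F.r U v
  r_le : F.r U v ≤ 3 * M
  lam_le : |F.lam U v| ≤ K
  θ_le : |F.θ U v| ≤ K
  α_le : |F.α U v| ≤ K
  ν_le : |F.ν U v| ≤ K * Real.exp (k * (v - v₀))
  Ω_le : |F.Ω U v| ≤ K * Real.exp (k * (v - v₀))
  ζ_le : |F.ζ U v| ≤ K * Real.exp (k * (v - v₀))

/-- Continuous fields with the given data that solve the system on every rectangle on which they
are tame. -/
structure TruncatedSol (M r₁ K k v₀ U₀ : ℝ) (rH lH φH θH rI nI φI ζI : ℝ → ℝ) (F : Fields) :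
    Prop where
  r_c : Continuous fun x : ℝ × ℝ => F.r x.1 x.2
  Ω_c : Continuous fun x : ℝ × ℝ => F.Ω x.1 x.2
  ν_c : Continuous fun x : ℝ × ℝ => F.ν x.1 x.2
  ζ_c : Continuous fun x : ℝ × ℝ => F.ζ x.1 x.2
  lam_c : Continuous fun x : ℝ × ℝ => F.lam x.1 x.2
  θ_c : Continuous fun x : ℝ × ℝ => F.θ x.1 x.2
  α_c : Continuous fun x : ℝ × ℝ => F.α x.1 x.2
  r_H : ∀ v ∈ Ici v₀, F.r 0 v = rH v
  φ_H : ∀ v ∈ Ici v₀, F.φ 0 v = φH v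
  lam_H : ∀ v ∈ Ici v₀, F.lam 0 v = lH v
  θ_H : ∀ v ∈ Ici v₀, F.θ 0 v = θH v
  α_H : ∀ v ∈ Ici v₀, F.α 0 v = 1 / (4 * M)
  r_I : ∀ U ∈ Icc 0 U₀, F.r U v₀ = rI U
  φ_I : ∀ U ∈ Icc 0 U₀, F.φ U v₀ = φI U
  Ω_I : ∀ U ∈ Icc 0 U₀, F.Ω U v₀ = ΩK M U v₀
  ν_I : ∀ U ∈ Icc 0 U₀, F.ν U v₀ = nI U
  ζ_I : ∀ U ∈ Icc 0 U₀, F.ζ U v₀ = ζI U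
  β_I : ∀ U ∈ Icc 0 U₀, F.β U v₀ = βK M U v₀
  isPreSol : ∀ a b, 0 ≤ a → a ≤ U₀ → v₀ ≤ b →
    (∀ U ∈ Icc 0 a, ∀ v ∈ Icc v₀ b, Tame M r₁ K k v₀ F U v) → IsPreSol F 0 a v₀ b

set_option maxHeartbeats 1000000 in
/-- Global existence for the truncated system. After division by suitable weights all the unknowns of
a tame solution lie in a fixed ball, so the nonlinearities may be replaced by Lipschitz functions
and `exists_goursat` applies. -/
theorem exists_truncatedSol {M r₁ K k v₀ U₀ : ℝ} {rH lH φH θH rI nI φI ζI : ℝ → ℝ} (hM : 0 < M)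
    (hr₁ : 0 < r₁) (hK : 0 < K) (hk : 0 ≤ k) (hU₀ : 0 ≤ U₀) (hE : EE M U₀ v₀ < 1)
    (hD : CharData M v₀ U₀ rH lH φH θH rI nI φI ζI) :
    ∃ F, TruncatedSol M r₁ K k v₀ U₀ rH lH φH θH rI nI φI ζI F := by
  have hE' : ∀ U ∈ Icc 0 U₀, EE M U v₀ < 1 := fun U hU => (EE_mono hM hU.1 hU.2 le_rfl).trans_lt hE
  obtain ⟨g, hg, hgr⟩ := exists_smooth_inv hr₁
  set R := max K (3 * M) with hR
  have hR0 : 0 < R := hK.trans_le (le_max_left _ _)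
  have hKR : K ≤ R := le_max_left _ _
  have hMR : 3 * M ≤ R := le_max_right _ _
  -- the variables are `((λ, θ, α), (r, σ, ν, ζ))`
  let X := (ℝ × ℝ × ℝ) × (ℝ × ℝ × ℝ × ℝ)
  have hgX : ContDiff ℝ 1 (fun x : X => g x.2.1) := hg.comp (by fun_prop)
  obtain ⟨TN, ⟨LN, hLN⟩, hTN⟩ := exists_lipschitz_cutoff (X := X) (R := R)
    (h := fun x => (-x.2.2.1 / 4 - x.2.2.2.1 * x.1.1) * g x.2.1)
    (ContDiff.mul (by fun_prop) hgX) hR0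
  obtain ⟨TH, ⟨LH, hLH⟩, hTH⟩ := exists_lipschitz_cutoff (X := X) (R := R)
    (h := fun x => -(x.1.1 * x.2.2.2.2 + x.2.2.2.1 * x.1.2.1) * g x.2.1)
    (ContDiff.mul (by fun_prop) hgX) hR0
  obtain ⟨TA, ⟨LA, hLA⟩, hTA⟩ := exists_lipschitz_cutoff (X := X) (R := R)
    (h := fun x => -2 * x.2.2.2.2 * x.1.2.1 + (1 / 2 * x.2.2.1 + 2 * x.2.2.2.1 * x.1.1) * g x.2.1 ^ 2)
    (ContDiff.add (by fun_prop) (ContDiff.mul (by fun_prop) (hgX.pow 2))) hR0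
  obtain ⟨TΩ, ⟨LΩ, hLΩ⟩, hTΩ⟩ := exists_lipschitz_cutoff (X := X) (R := R)
    (h := fun x => x.1.2.2 * x.2.2.1) (by fun_prop) hR0
  -- `(λ, θ, α)` are transported in `U`, and `(r, σ, ν, ζ, β, φ)` in `v`, where `σ = Ω̂² / S`.
  let E₁ := ℝ × ℝ × ℝ
  let E₂ := ℝ × ℝ × ℝ × ℝ × ℝ × ℝ
  let P : E₁ × E₂ → X := fun y => (y.1, y.2.1, y.2.2.1, y.2.2.2.1, y.2.2.2.2.1)
  have h1 : ∃ L, LipschitzWith L (fun y : E₁ × E₂ => y.1) := ⟨_, LipschitzWith.prod_fst⟩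
  have h2 : ∃ L, LipschitzWith L (fun y : E₁ × E₂ => y.2) := ⟨_, LipschitzWith.prod_snd⟩
  have hr := exists_lipschitz_fst h2
  have h3 := exists_lipschitz_snd h2
  have hσ := exists_lipschitz_fst h3
  have h4 := exists_lipschitz_snd h3
  have hν := exists_lipschitz_fst h4
  have h5 := exists_lipschitz_snd h4
  have hζ := exists_lipschitz_fst h5
  have hβ := exists_lipschitz_fst (exists_lipschitz_snd h5)
  obtain ⟨LP, hP⟩ : ∃ L, LipschitzWith L P := exists_lipschitz_prodMk h1
    (exists_lipschitz_prodMk hr (exists_lipschitz_prodMk hσ (exists_lipschitz_prodMk hν hζ)))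
  have hN : ∃ L, LipschitzWith L (fun y => TN (P y)) := ⟨_, hLN.comp hP⟩
  have hH : ∃ L, LipschitzWith L (fun y => TH (P y)) := ⟨_, hLH.comp hP⟩
  have hA : ∃ L, LipschitzWith L (fun y => TA (P y)) := ⟨_, hLA.comp hP⟩
  have hΩ : ∃ L, LipschitzWith L (fun y => TΩ (P y)) := ⟨_, hLΩ.comp hP⟩
  let FF : E₁ × E₂ → E₁ := fun y => (TN (P y), TH (P y), TA (P y))
  let GG : E₁ × E₂ → E₂ := fun y => (y.1.1, TΩ (P y) - k * y.2.2.1, TN (P y) - k * y.2.2.2.1,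
    TH (P y) - k * y.2.2.2.2.1, TA (P y) - k * y.2.2.2.2.2.1, y.1.2.1)
  obtain ⟨L₁, hL₁⟩ : ∃ L, LipschitzWith L FF :=
    exists_lipschitz_prodMk hN (exists_lipschitz_prodMk hH hA)
  obtain ⟨L₂, hL₂⟩ : ∃ L, LipschitzWith L GG :=
    exists_lipschitz_prodMk (exists_lipschitz_fst h1) <| exists_lipschitz_prodMk
      (exists_lipschitz_sub_mul hΩ hσ k) <| exists_lipschitz_prodMk
      (exists_lipschitz_sub_mul hN hν k) <| exists_lipschitz_prodMk
      (exists_lipschitz_sub_mul hH hζ k) <| exists_lipschitz_prodMk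
      (exists_lipschitz_sub_mul hA hβ k) (exists_lipschitz_fst (exists_lipschitz_snd h1))
  -- Tame solutions grow at most like `S`; the growing unknowns are divided by `S`, which adds a
  -- term `-k` to their equations in `v`.
  let S : ℝ → ℝ := fun v => Real.exp (k * (v - v₀))
  have hS : ∀ v, HasDerivAt S (k * S v) v := fun v =>
    ((((hasDerivAt_id v).sub_const v₀).const_mul k).exp).congr_deriv (by simp only [S, id]; ring)
  have hSc : Continuous S := by fun_prop
  have hSm : Monotone S := fun x y h => by simp only [S]; gcongr
  have hS1 : S v₀ = 1 := by simp [S]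
  have hS0 : ∀ v, 0 < S v := fun v => Real.exp_pos _
  -- the data, extended to the whole line
  have hlc : ContinuousOn lH (Ici v₀) := fun v hv => (hD.lH_v v hv).continuousWithinAt
  have hmax : ∀ v, max v v₀ ∈ Ici v₀ := fun v => mem_Ici.2 (le_max_right _ _)
  let w₀ : ℝ → E₁ := fun v => (lH (max v v₀), θH (max v v₀), 1 / (4 * M))
  have hw₀ : Continuous w₀ := (hlc.comp_continuous (by fun_prop) hmax).prodMk
    ((hD.θH_c.comp_continuous (by fun_prop) hmax).prodMk continuous_const)
  let cl : ℝ → ℝ := fun U => projIcc 0 U₀ hU₀ U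
  have hclc : Continuous cl := by fun_prop
  have hclm : ∀ U, cl U ∈ Icc 0 U₀ := fun U => Subtype.mem _
  have hcl : ∀ U ∈ Icc 0 U₀, cl U = U := fun U hU => by simp only [cl, projIcc_of_mem hU₀ hU]
  let ζ₀ : ℝ → E₂ := fun U => (rI U, ΩK M U v₀, nI U, ζI U, βK M U v₀, φI U)
  have hζ₀ : ContinuousOn ζ₀ (Icc 0 U₀) := by
    refine ContinuousOn.prodMk (fun U hU => (hD.rI_U U hU).continuousWithinAt) <|
      ContinuousOn.prodMk (fun U hU => (hasDerivAt_ΩK_U hM (hE' U hU)).continuousAt.continuousWithinAt) <|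
      ContinuousOn.prodMk (fun U hU => (hD.nI_U U hU).continuousWithinAt) <|
      ContinuousOn.prodMk hD.ζI_c <| ContinuousOn.prodMk (fun U hU => ?_)
        (fun U hU => (hD.φI_U U hU).continuousWithinAt)
    have h := (contDiffAt_βK hM (x := (U, v₀)) (hE' U hU)).continuousAt
    exact (ContinuousAt.comp (f := fun U : ℝ => (U, v₀)) h (by fun_prop)).continuousWithinAt
  obtain ⟨Cz, hCz⟩ := isCompact_Icc.exists_bound_of_continuousOn hζ₀
  obtain ⟨Cw, hCw⟩ := hD.bdd
  obtain ⟨w, z, hwc, hzc, hwz⟩ := exists_goursat FF GG (hL₁.weaken (le_max_left L₁ L₂))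
    (hL₂.weaken (le_max_right L₁ L₂)) S hSc hSm hS0 v₀ w₀ (fun U => ζ₀ (cl U)) hw₀
    (hζ₀.comp_continuous hclc hclm) (C := max Cz (max Cw (1 / (4 * M))))
    (fun v => by
      obtain ⟨e1, e2⟩ := hCw _ (hmax v)
      rw [Prod.norm_def, Prod.norm_def]
      refine max_le ?_ (max_le ?_ ?_)
      · exact e1.trans ((le_max_left _ _).trans (le_max_right _ _))
      · exact e2.trans ((le_max_left _ _).trans (le_max_right _ _))
      · refine le_trans (le_of_eq ?_) ((le_max_right _ _).trans (le_max_right _ _))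
        exact abs_of_pos (by positivity))
    (fun U => (hCz _ (hclm U)).trans (le_max_left _ _))
  have hFFc : Continuous FF := hL₁.continuous
  have hGGc : Continuous GG := hL₂.continuous
  have hw0 : ∀ v, v₀ ≤ v → w 0 v = w₀ v := fun v hv => by simpa using (hwz 0 v le_rfl hv).1
  have hz0 : ∀ U ∈ Icc 0 U₀, z U v₀ = ζ₀ U := fun U hU => by
    simpa [hcl U hU] using (hwz U v₀ hU.1 le_rfl).2
  have hwd : ∀ U v, 0 ≤ U → v₀ ≤ v →
      HasDerivWithinAt (fun U => w U v) (S v • FF (w U v, z U v)) (Ici 0) U := by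
    intro U v hU hv
    have hc : Continuous fun s => S v • FF (w s v, z s v) :=
      (hFFc.comp (((hwc.comp (by fun_prop : Continuous fun s : ℝ => (s, v)))).prodMk
        (hzc.comp (by fun_prop : Continuous fun s : ℝ => (s, v))))).const_smul (S v)
    have := (hc.integral_hasStrictDerivAt 0 U).hasDerivAt.const_add (w₀ v)
    exact this.hasDerivWithinAt.congr (fun s hs => (hwz s v hs hv).1) (hwz U v hU hv).1
  have hzd : ∀ U v, 0 ≤ U → v₀ ≤ v →
      HasDerivWithinAt (fun v => z U v) (GG (w U v, z U v)) (Ici v₀) v := by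
    intro U v hU hv
    have hc : Continuous fun t => GG (w U t, z U t) :=
      hGGc.comp (((hwc.comp (by fun_prop : Continuous fun t : ℝ => (U, t)))).prodMk
        (hzc.comp (by fun_prop : Continuous fun t : ℝ => (U, t))))
    have := (hc.integral_hasStrictDerivAt v₀ v).hasDerivAt.const_add (ζ₀ (cl U))
    exact this.hasDerivWithinAt.congr (fun t ht => (hwz U t hU ht).2) (hwz U v hU hv).2
  let F : Fields :=
    { r := fun U v => (z U v).1
      Ω := fun U v => S v * (z U v).2.1
      φ := fun U v => (z U v).2.2.2.2.2
      ν := fun U v => S v * (z U v).2.2.1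
      ζ := fun U v => S v * (z U v).2.2.2.1
      β := fun U v => S v * (z U v).2.2.2.2.1
      lam := fun U v => (w U v).1
      θ := fun U v => (w U v).2.1
      α := fun U v => (w U v).2.2 }
  have hSc' : Continuous fun x : ℝ × ℝ => S x.2 := hSc.comp continuous_snd
  have cr : Continuous fun x : ℝ × ℝ => F.r x.1 x.2 := continuous_fst.comp hzc
  have c1 := continuous_snd.comp hzc
  have cΩ : Continuous fun x : ℝ × ℝ => F.Ω x.1 x.2 := hSc'.mul (continuous_fst.comp c1)
  have c2 := continuous_snd.comp c1
  have cν : Continuous fun x : ℝ × ℝ => F.ν x.1 x.2 := hSc'.mul (continuous_fst.comp c2)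
  have c3 := continuous_snd.comp c2
  have cζ : Continuous fun x : ℝ × ℝ => F.ζ x.1 x.2 := hSc'.mul (continuous_fst.comp c3)
  have c4 := continuous_snd.comp c3
  have cβ : Continuous fun x : ℝ × ℝ => F.β x.1 x.2 := hSc'.mul (continuous_fst.comp c4)
  have cφ : Continuous fun x : ℝ × ℝ => F.φ x.1 x.2 := continuous_snd.comp c4
  have clam : Continuous fun x : ℝ × ℝ => F.lam x.1 x.2 := continuous_fst.comp hwc
  have c5 := continuous_snd.comp hwc
  have cθ : Continuous fun x : ℝ × ℝ => F.θ x.1 x.2 := continuous_fst.comp c5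
  have cα : Continuous fun x : ℝ × ℝ => F.α x.1 x.2 := continuous_snd.comp c5
  have zero_mem : (0 : ℝ) ∈ Icc 0 U₀ := left_mem_Icc.2 hU₀
  have lamH : ∀ v ∈ Ici v₀, F.lam 0 v = lH v := fun v hv => by
    simp only [F, hw0 v hv, w₀, max_eq_left (show v₀ ≤ v from hv)]
  have θH' : ∀ v ∈ Ici v₀, F.θ 0 v = θH v := fun v hv => by
    simp only [F, hw0 v hv, w₀, max_eq_left (show v₀ ≤ v from hv)]
  have rd : ∀ U v, 0 ≤ U → v₀ ≤ v → HasDerivWithinAt (fun v => F.r U v) (F.lam U v) (Ici v₀) v :=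
    fun U v hU hv => hasDerivWithinAt_fst (hzd U v hU hv)
  have hz1 := fun U v hU hv => hasDerivWithinAt_snd (hzd U v hU hv)
  have hz2 := fun U v hU hv => hasDerivWithinAt_snd (hz1 U v hU hv)
  have hz3 := fun U v hU hv => hasDerivWithinAt_snd (hz2 U v hU hv)
  have hz4 := fun U v hU hv => hasDerivWithinAt_snd (hz3 U v hU hv)
  have φd : ∀ U v, 0 ≤ U → v₀ ≤ v → HasDerivWithinAt (fun v => F.φ U v) (F.θ U v) (Ici v₀) v :=
    fun U v hU hv => hasDerivWithinAt_snd (hz4 U v hU hv)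
  have hw1 := fun U v hU hv => hasDerivWithinAt_snd (hwd U v hU hv)
  have eq_of_deriv : ∀ f h d : ℝ → ℝ, f v₀ = h v₀ →
      (∀ v ∈ Ici v₀, HasDerivWithinAt f (d v) (Ici v₀) v) →
      (∀ v ∈ Ici v₀, HasDerivWithinAt h (d v) (Ici v₀) v) → ∀ v ∈ Ici v₀, f v = h v := by
    intro f h d h0 hf hh v hv
    have hsub : Icc v₀ v ⊆ Ici v₀ := Icc_subset_Ici_self
    have := le_of_deriv_nonneg (f := fun v => f v - h v) (f' := fun v => d v - d v)
      (show v₀ ≤ v from hv)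
      (fun t ht => ((hf t (hsub ht)).sub (hh t (hsub ht))).mono hsub) (fun _ _ => by simp)
    have := le_of_deriv_nonneg (f := fun v => h v - f v) (f' := fun v => d v - d v)
      (show v₀ ≤ v from hv)
      (fun t ht => ((hh t (hsub ht)).sub (hf t (hsub ht))).mono hsub) (fun _ _ => by simp)
    linarith
  have mulS : ∀ {f : ℝ → ℝ} {y v b : ℝ}, v ∈ Icc v₀ b →
      HasDerivWithinAt f (y - k * f v) (Ici v₀) v →
      HasDerivWithinAt (fun v => S v * f v) (S v * y) (Icc v₀ b) v := by
    intro f y v b _ hf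
    exact (((hS v).hasDerivWithinAt.mul hf).congr_deriv (by ring)).mono Icc_subset_Ici_self
  have rHeq : ∀ v ∈ Ici v₀, F.r 0 v = rH v :=
    eq_of_deriv _ _ lH (by simp only [F, hz0 0 zero_mem, ζ₀, hD.corner_r])
      (fun v hv => (rd 0 v le_rfl hv).congr_deriv (lamH v hv)) hD.rH_v
  refine ⟨F, cr, cΩ, cν, cζ, clam, cθ, cα,
    rHeq,
    eq_of_deriv _ _ θH (by simp only [F, hz0 0 zero_mem, ζ₀, hD.corner_φ])
      (fun v hv => (φd 0 v le_rfl hv).congr_deriv (θH' v hv)) hD.φH_v,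
    lamH, θH', fun v hv => by simp only [F, hw0 v hv, w₀],
    fun U hU => by simp only [F, hz0 U hU, ζ₀], fun U hU => by simp only [F, hz0 U hU, ζ₀],
    fun U hU => by simp only [F, hz0 U hU, ζ₀, hS1, one_mul],
    fun U hU => by simp only [F, hz0 U hU, ζ₀, hS1, one_mul],
    fun U hU => by simp only [F, hz0 U hU, ζ₀, hS1, one_mul],
    fun U hU => by simp only [F, hz0 U hU, ζ₀, hS1, one_mul], ?_⟩
  intro a b ha haU hb hT
  have hUa : ∀ U ∈ Icc 0 a, U ∈ Icc 0 U₀ := fun U hU => ⟨hU.1, hU.2.trans haU⟩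
  have subU : Icc 0 a ⊆ Icc 0 U₀ := Icc_subset_Icc_right haU
  have subU' : Icc 0 a ⊆ Ici 0 := Icc_subset_Ici_self
  have subV : Icc v₀ b ⊆ Ici v₀ := Icc_subset_Ici_self
  -- on the rectangle nothing is cut off
  have hle : ∀ {x y : ℝ} (v : ℝ), |S v * x| ≤ y * S v → |x| ≤ y := by
    intro x y v h
    rw [abs_mul, abs_of_pos (hS0 v), mul_comm] at h
    exact le_of_mul_le_mul_right h (hS0 v)
  have hP : ∀ U ∈ Icc 0 a, ∀ v ∈ Icc v₀ b, ‖P (w U v, z U v)‖ ≤ R := by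
    intro U hU v hv
    have h := hT U hU v hv
    refine norm_prod_le_iff.2 ⟨norm_prod_le_iff.2 ⟨h.lam_le.trans hKR, norm_prod_le_iff.2
      ⟨h.θ_le.trans hKR, h.α_le.trans hKR⟩⟩, norm_prod_le_iff.2 ⟨?_, norm_prod_le_iff.2
      ⟨(hle v h.Ω_le).trans hKR, norm_prod_le_iff.2 ⟨(hle v h.ν_le).trans hKR,
      (hle v h.ζ_le).trans hKR⟩⟩⟩⟩
    have : 0 < F.r U v := hr₁.trans_le h.r_ge
    refine abs_le.2 ?_
    constructor <;> linarith [h.r_le]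
  have hrpos : ∀ U ∈ Icc 0 a, ∀ v ∈ Icc v₀ b, 0 < F.r U v := fun U hU v hv =>
    hr₁.trans_le (hT U hU v hv).r_ge
  have eN : ∀ U ∈ Icc 0 a, ∀ v ∈ Icc v₀ b, S v * TN (P (w U v, z U v)) = F.N U v := by
    intro U hU v hv
    have := (hrpos U hU v hv).ne'
    have e := hgr _ (hT U hU v hv).r_ge
    simp only [F] at this e
    rw [hTN _ (hP U hU v hv)]
    simp only [P, Fields.N, F, e]
    field_simp
  have eH : ∀ U ∈ Icc 0 a, ∀ v ∈ Icc v₀ b, S v * TH (P (w U v, z U v)) = F.H U v := by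
    intro U hU v hv
    have := (hrpos U hU v hv).ne'
    have e := hgr _ (hT U hU v hv).r_ge
    simp only [F] at this e
    rw [hTH _ (hP U hU v hv)]
    simp only [P, Fields.H, F, e]
    field_simp
  have eA : ∀ U ∈ Icc 0 a, ∀ v ∈ Icc v₀ b, S v * TA (P (w U v, z U v)) = F.A U v := by
    intro U hU v hv
    have := (hrpos U hU v hv).ne'
    have e := hgr _ (hT U hU v hv).r_ge
    simp only [F] at this e
    rw [hTA _ (hP U hU v hv)]
    simp only [P, Fields.A, F, e]
    field_simp
    ring
  have eΩ : ∀ U ∈ Icc 0 a, ∀ v ∈ Icc v₀ b,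
      S v * TΩ (P (w U v, z U v)) = F.α U v * F.Ω U v := by
    intro U hU v hv
    rw [hTΩ _ (hP U hU v hv)]
    simp only [P, F]
    ring
  have Ωv : ∀ U ∈ Icc 0 a, ∀ v ∈ Icc v₀ b,
      HasDerivWithinAt (fun v => F.Ω U v) (F.α U v * F.Ω U v) (Icc v₀ b) v := fun U hU v hv =>
    (mulS hv (hasDerivWithinAt_fst (hz1 U v hU.1 hv.1))).congr_deriv (eΩ U hU v hv)
  have slice : ∀ {f : ℝ × ℝ → ℝ}, Continuous f → CkOn 0 a v₀ b 0 (fun U v => f (U, v)) :=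
    fun hf => contDiffOn_zero.2 hf.continuousOn
  refine
    { r_c := slice cr, Ω_c := slice cΩ, φ_c := slice cφ, ν_c := slice cν, ζ_c := slice cζ
      β_c := slice cβ, lam_c := slice clam, θ_c := slice cθ, α_c := slice cα
      r_pos := hrpos
      Ω_pos := fun U hU v hv => ?_
      r_v := fun U hU v hv => (rd U v hU.1 hv.1).mono subV
      φ_v := fun U hU v hv => (φd U v hU.1 hv.1).mono subV
      Ω_v := Ωv
      ν_v := fun U hU v hv => (mulS hv (hasDerivWithinAt_fst (hz2 U v hU.1 hv.1))).congr_deriv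
        (eN U hU v hv)
      ζ_v := fun U hU v hv => (mulS hv (hasDerivWithinAt_fst (hz3 U v hU.1 hv.1))).congr_deriv
        (eH U hU v hv)
      β_v := fun U hU v hv => (mulS hv (hasDerivWithinAt_fst (hz4 U v hU.1 hv.1))).congr_deriv
        (eA U hU v hv)
      lam_U := fun U hU v hv => ((hasDerivWithinAt_fst (hwd U v hU.1 hv.1)).mono subU').congr_deriv
        (eN U hU v hv)
      θ_U := fun U hU v hv => ((hasDerivWithinAt_fst (hw1 U v hU.1 hv.1)).mono subU').congr_deriv
        (eH U hU v hv)
      α_U := fun U hU v hv => ((hasDerivWithinAt_snd (hw1 U v hU.1 hv.1)).mono subU').congr_deriv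
        (eA U hU v hv)
      r_U₀ := fun U hU => ?_
      φ_U₀ := fun U hU => ?_
      Ω_U₀ := fun U hU => ?_
      ν_U₀ := fun U hU => ?_
      lam_v₀ := fun v hv => ?_ }
  · have h0 : 0 < F.Ω U v₀ := by
      simp only [F, hz0 U (hUa U hU), ζ₀, hS1, one_mul]
      exact ΩK_pos (hE' U (hUa U hU))
    have hsub : Icc v₀ v ⊆ Icc v₀ b := Icc_subset_Icc_right hv.2
    exact pos_of_linear hv.1 (fun t ht => (Ωv U hU t (hsub ht)).mono hsub)
      (cα.comp (by fun_prop : Continuous fun t : ℝ => (U, t))).continuousOn h0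
  · refine (((hD.rI_U U (hUa U hU)).mono subU).congr (fun s hs => ?_) ?_).congr_deriv ?_
    · simp only [F, hz0 s (hUa s hs), ζ₀]
    · simp only [F, hz0 U (hUa U hU), ζ₀]
    · simp only [F, hz0 U (hUa U hU), ζ₀, hS1, one_mul]
  · refine (((hD.φI_U U (hUa U hU)).mono subU).congr (fun s hs => ?_) ?_).congr_deriv ?_
    · simp only [F, hz0 s (hUa s hs), ζ₀]
    · simp only [F, hz0 U (hUa U hU), ζ₀]
    · simp only [F, hz0 U (hUa U hU), ζ₀, hS1, one_mul]
  · refine ((hasDerivAt_ΩK_U hM (hE' U (hUa U hU))).hasDerivWithinAt.congr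
      (fun s hs => ?_) ?_).congr_deriv ?_
    · simp only [F, hz0 s (hUa s hs), ζ₀, hS1, one_mul]
    · simp only [F, hz0 U (hUa U hU), ζ₀, hS1, one_mul]
    · simp only [F, hz0 U (hUa U hU), ζ₀, hS1, one_mul]
  · refine (((hD.nI_U U (hUa U hU)).mono subU).congr (fun s hs => ?_) ?_).congr_deriv ?_
    · simp only [F, hz0 s (hUa s hs), ζ₀, hS1, one_mul]
    · simp only [F, hz0 U (hUa U hU), ζ₀, hS1, one_mul]
    · simp only [F, hz0 U (hUa U hU), ζ₀, hS1, one_mul]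
  · refine (((hD.lH_v v hv.1).mono subV).congr (fun t ht => lamH t ht.1) (lamH v hv.1)).congr_deriv ?_
    rw [lamH v hv.1, θH' v hv.1, rHeq v hv.1]
    simp only [F, hw0 v hv.1, w₀]

/-! ### The maximal region of validity of the bootstrap assumptions -/

theorem eq_of_deriv_eq_zero {f : ℝ → ℝ} {a b : ℝ} (hab : a ≤ b)
    (hf : ∀ t ∈ Icc a b, HasDerivWithinAt f 0 (Icc a b) t) : f a = f b :=
  le_antisymm (le_of_deriv_nonneg hab hf fun _ _ => le_rfl)
    (le_of_deriv_nonpos hab hf fun _ _ => le_rfl)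

/-- Continuous induction on `[a,T]` for a property that is inherited by smaller arguments. -/
theorem forall_Icc_of_step {P : ℝ → Prop} {a T : ℝ} (hdown : ∀ s t, a ≤ s → s ≤ t → P t → P s)
    (h0 : P a) (hopen : ∀ t ∈ Ico a T, P t → ∃ s, t < s ∧ P s)
    (hstep : ∀ t ∈ Ioc a T, (∀ s ∈ Ico a t, P s) → P t) : ∀ t ∈ Icc a T, P t := by
  by_contra! hcon
  obtain ⟨t₁, ht₁, hP₁⟩ := hcon
  set A := {t | a ≤ t ∧ t ≤ T ∧ ¬P t} with hA
  have hne : A.Nonempty := ⟨t₁, ht₁.1, ht₁.2, hP₁⟩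
  have hbd : BddBelow A := ⟨a, fun t ht => ht.1⟩
  set τ := sInf A with hτ
  have haτ : a ≤ τ := le_csInf hne fun t ht => ht.1
  have hτt : τ ≤ t₁ := csInf_le hbd ⟨ht₁.1, ht₁.2, hP₁⟩
  have hlt : ∀ s ∈ Ico a τ, P s := by
    intro s hs
    by_contra hn
    exact (not_le.2 hs.2) (csInf_le hbd ⟨hs.1, hs.2.le.trans (hτt.trans ht₁.2), hn⟩)
  have hPτ : P τ := by
    rcases haτ.eq_or_lt with h | h
    · rw [← h]; exact h0
    · exact hstep τ ⟨h, hτt.trans ht₁.2⟩ hlt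
  have hτT : τ < T := (hτt.lt_of_ne fun h => hP₁ (h ▸ hPτ)).trans_le ht₁.2
  obtain ⟨s, hs, hPs⟩ := hopen τ ⟨haτ, hτT⟩ hPτ
  have : s ≤ τ := le_csInf hne fun t ht => by
    by_contra hts
    exact ht.2.2 (hdown t s ht.1 (not_le.1 hts).le hPs)
  linarith

/-- A bound for the absolute values of the first derivatives at the corner. -/
noncomputable def cornerC (M p D₂ D₃ v₀ ρ c : ℝ) : ℝ :=
  c * wq M p v₀ + D₂ * wP M p v₀ / ρ + 1 / (4 * M) + c * ΩH M v₀ / ρ * (1 + D₃ / ρ) + ΩH M v₀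

/-- The situation to which the continuity argument applies: a solution of the truncated system with
suitable data, such that solutions on rectangles that satisfy the bootstrap assumptions are in the
range in which these improve. -/
structure Problem (M p D₂ D₃ v₀ ρ c B r₁ K k Ed v₁ η U₀ : ℝ)
    (rH lH φH θH nH rI nI φI ζI : ℝ → ℝ) (F : Fields) : Prop where
  hM : 0 < M
  hD₂ : 0 < D₂
  hD₃ : 0 < D₃
  hv₀ : 0 < v₀
  hρ : 0 < ρ
  hc : 1 ≤ c
  hB : 64 * D₂ ≤ B
  hBD : D₃ < B * wP M p v₀
  hr₁ : 0 < r₁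
  hU₀ : 0 < U₀
  hE : EE M U₀ v₀ < 1
  trunc : TruncatedSol M r₁ K k v₀ U₀ rH lH φH θH rI nI φI ζI F
  hor : HorizonBounds M p D₂ v₀ ρ c rH lH θH nH
  r_I : ∀ U ∈ Icc 0 U₀, r₁ < rI U
  ζ_I : ∀ U ∈ Icc 0 U₀, |rI U * ζI U| ≤ D₃ * -nI U
  corner : rI 0 * nI 0 = -nH v₀
  rH_v : ∀ v ∈ Ici v₀, HasDerivWithinAt rH (lH v) (Ici v₀) v
  crude_lt : crudeC M p v₀ c B ρ r₁ < K
  corner_lt : cornerC M p D₂ D₃ v₀ ρ c < K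
  setting : ∀ a b, a ≤ U₀ → RectSol M p D₂ D₃ v₀ ρ c rH lH θH nH F a b →
    Bootstrap M p v₀ c B r₁ K k Ed F a b →
    Setting M p D₂ D₃ v₀ ρ c B r₁ K k Ed v₁ η rH lH θH nH F a b

/-- The bootstrap assumptions hold strictly at a point, and the radius is in the range that the
truncation leaves alone. -/
structure Admissible (M p v₀ c B r₁ K k Ed : ℝ) (F : Fields) (U v : ℝ) : Prop where
  r_gt : r₁ < F.r U v
  r_lt : F.r U v < 3 * M
  good : GoodAt M p v₀ c B K k Ed F U v

/-- The past set on which the bootstrap assumptions hold. -/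
def goodRegion (M p v₀ c B r₁ K k Ed U₀ : ℝ) (F : Fields) : Set (ℝ × ℝ) :=
  {x | x ∈ Ico 0 U₀ ×ˢ Ici v₀ ∧ ∀ U ∈ Icc 0 x.1, ∀ v ∈ Icc v₀ x.2,
    Admissible M p v₀ c B r₁ K k Ed F U v}

namespace Problem

variable {M p D₂ D₃ v₀ ρ c B r₁ K k Ed v₁ η U₀ : ℝ}
  {rH lH φH θH nH rI nI φI ζI : ℝ → ℝ} {F : Fields}

/-- On a rectangle on which the truncated solution is tame, the truncation is inactive and the
Einstein equations hold. -/
theorem rectSol (Pb : Problem M p D₂ D₃ v₀ ρ c B r₁ K k Ed v₁ η U₀ rH lH φH θH nH rI nI φI ζI F)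
    {a b : ℝ} (ha : 0 ≤ a) (haU : a ≤ U₀) (hb : v₀ ≤ b)
    (hT : ∀ U ∈ Icc 0 a, ∀ v ∈ Icc v₀ b, Tame M r₁ K k v₀ F U v) :
    RectSol M p D₂ D₃ v₀ ρ c rH lH θH nH F a b := by
  have T := Pb.trunc
  have hsol := (T.isPreSol a b ha haU hb hT).isCharSol ha hb
  have h0 : (0 : ℝ) ∈ Icc 0 a := left_mem_Icc.2 ha
  have h0' : (0 : ℝ) ∈ Icc 0 U₀ := ⟨le_rfl, Pb.hU₀.le⟩
  have hUa : ∀ U ∈ Icc 0 a, U ∈ Icc 0 U₀ := fun U hU => ⟨hU.1, hU.2.trans haU⟩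
  have hΩ : ∀ v ∈ Icc v₀ b, F.Ω 0 v = ΩH M v := by
    intro v hv
    have hsub : Icc v₀ v ⊆ Icc v₀ b := Icc_subset_Icc_right hv.2
    have := eq_of_deriv_eq_zero (f := fun v => F.Ω 0 v / ΩH M v) hv.1 (fun t ht => by
      have := (ΩH_pos M t).ne'
      refine (((hsol.Ω_v 0 h0 t (hsub ht)).mono hsub).div (hasDerivAt_ΩH M t).hasDerivWithinAt
        this).congr_deriv ?_
      rw [T.α_H t ht.1]
      ring)
    have e : F.Ω 0 v₀ = ΩH M v₀ := by rw [T.Ω_I 0 h0', ΩK_zero, ΩH]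
    simp only [e, div_self (ΩH_pos M v₀).ne'] at this
    exact ((div_eq_one_iff_eq (ΩH_pos M v).ne').1 this.symm)
  refine ⟨hsol, Pb.hor, ha, hb, fun v hv => T.r_H v hv.1, fun v hv => T.lam_H v hv.1,
    fun v hv => T.θ_H v hv.1, fun v hv => T.α_H v hv.1, hΩ, fun v hv => ?_,
    fun U hU => T.Ω_I U (hUa U hU), fun U hU => T.β_I U (hUa U hU), fun U hU => ?_⟩
  · have hsub : Icc v₀ v ⊆ Icc v₀ b := Icc_subset_Icc_right hv.2
    have := eq_of_deriv_eq_zero (f := fun v => F.r 0 v * F.ν 0 v + nH v) hv.1 (fun t ht => by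
      refine (((hsol.rν_v h0 (hsub ht)).mono hsub).add
        (Pb.hor.n_deriv t).hasDerivWithinAt).congr_deriv ?_
      rw [hΩ t (hsub ht)]
      ring)
    simp only [T.r_I 0 h0', T.ν_I 0 h0', Pb.corner] at this
    linarith
  · rw [T.r_I U (hUa U hU), T.ζ_I U (hUa U hU), T.ν_I U (hUa U hU)]
    exact Pb.ζ_I U (hUa U hU)

theorem B_pos (Pb : Problem M p D₂ D₃ v₀ ρ c B r₁ K k Ed v₁ η U₀ rH lH φH θH nH rI nI φI ζI F) :
    0 < B := by linarith [Pb.hB, Pb.hD₂]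

/-- If every point of a rectangle is a limit of admissible points from the past, then the rectangle
is in the range in which the bootstrap assumptions improve. -/
theorem setting_of_closure
    (Pb : Problem M p D₂ D₃ v₀ ρ c B r₁ K k Ed v₁ η U₀ rH lH φH θH nH rI nI φI ζI F)
    {a b : ℝ} (ha : 0 ≤ a) (haU : a ≤ U₀) (hb : v₀ ≤ b)
    (hcl : ∀ U ∈ Icc 0 a, ∀ v ∈ Icc v₀ b, (U, v) ∈ closure {x : ℝ × ℝ | x.1 ∈ Icc 0 U ∧ x.2 ∈ Icc v₀ v ∧
      Admissible M p v₀ c B r₁ K k Ed F x.1 x.2}) :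
    Setting M p D₂ D₃ v₀ ρ c B r₁ K k Ed v₁ η rH lH θH nH F a b := by
  have T := Pb.trunc
  have key : ∀ U ∈ Icc 0 a, ∀ v ∈ Icc v₀ b, ∀ f g : ℝ × ℝ → ℝ, ContinuousAt f (U, v) →
      ContinuousAt g (U, v) → (∀ x : ℝ × ℝ, x.1 ∈ Icc 0 U → x.2 ∈ Icc v₀ v →
        Admissible M p v₀ c B r₁ K k Ed F x.1 x.2 → f x ≤ g x) → f (U, v) ≤ g (U, v) :=
    fun U hU v hv f g hf hg h => hf.continuousWithinAt.closure_le (hcl U hU v hv)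
      hg.continuousWithinAt fun x hx => h x hx.1 hx.2.1 hx.2.2
  have cr := T.r_c
  have cΩ := T.Ω_c
  have cν := T.ν_c
  have cζ := T.ζ_c
  have cl := T.lam_c
  have cθ := T.θ_c
  have cα := T.α_c
  have cP : ∀ (U : ℝ), ∀ v ∈ Icc v₀ b, ContinuousAt (fun x : ℝ × ℝ => wP M p x.2) (U, v) := fun U v hv =>
    ContinuousAt.comp (f := Prod.snd) (g := wP M p) (x := ((U, v) : ℝ × ℝ))
      (hasDerivAt_wP Pb.hM (Pb.hv₀.trans_le hv.1)).continuousAt continuousAt_snd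
  have hT : ∀ U ∈ Icc 0 a, ∀ v ∈ Icc v₀ b, Tame M r₁ K k v₀ F U v := fun U hU v hv =>
    ⟨key U hU v hv (fun _ => r₁) _ (by fun_prop) cr.continuousAt fun x _ _ h => h.r_gt.le,
      key U hU v hv _ (fun _ => 3 * M) cr.continuousAt (by fun_prop) fun x _ _ h => h.r_lt.le,
      key U hU v hv _ (fun _ => K) cl.abs.continuousAt (by fun_prop) fun x _ _ h => h.good.lam_lt.le,
      key U hU v hv _ (fun _ => K) cθ.abs.continuousAt (by fun_prop) fun x _ _ h => h.good.θ_lt.le,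
      key U hU v hv _ (fun _ => K) cα.abs.continuousAt (by fun_prop) fun x _ _ h => h.good.α_lt.le,
      key U hU v hv _ (fun x => K * Real.exp (k * (x.2 - v₀))) cν.abs.continuousAt (by fun_prop)
        fun x _ _ h => h.good.ν_lt.le,
      key U hU v hv _ (fun x => K * Real.exp (k * (x.2 - v₀))) cΩ.abs.continuousAt (by fun_prop)
        fun x _ _ h => h.good.Ω_lt.le,
      key U hU v hv _ (fun x => K * Real.exp (k * (x.2 - v₀))) cζ.abs.continuousAt (by fun_prop)
        fun x _ _ h => h.good.ζ_lt'.le⟩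
  refine Pb.setting a b haU (Pb.rectSol ha haU hb hT)
    ⟨fun U hU v hv => (hT U hU v hv).r_ge, fun U hU v hv => ?_, fun U hU v hv => ?_,
      fun U hU v hv => (hT U hU v hv).lam_le, fun U hU v hv => (hT U hU v hv).θ_le,
      fun U hU v hv => (hT U hU v hv).α_le, fun U hU v hv => (hT U hU v hv).ν_le,
      fun U hU v hv => (hT U hU v hv).Ω_le, fun U hU v hv => (hT U hU v hv).ζ_le,
      fun U hU v hv hE => ?_⟩
  · exact key U hU v hv _ (fun x => M * B * wP M p x.2) (((cr.pow 2).mul cθ).abs.continuousAt)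
      (continuousAt_const.mul (cP U v hv)) fun x _ _ h => h.good.A_lt.le
  · exact key U hU v hv _ (fun x => B * wP M p x.2 * -F.ν x.1 x.2) ((cr.mul cζ).abs.continuousAt)
      ((continuousAt_const.mul (cP U v hv)).mul cν.neg.continuousAt) fun x _ _ h => h.good.ζ_lt.le
  · exact key U hU v hv (fun x => -(F.r x.1 x.2 * F.ν x.1 x.2))
      (fun x => 8 * c * Real.exp (x.2 / (4 * M))) ((cr.mul cν).neg.continuousAt) (by fun_prop)
      fun x h1 h2 h => (h.good.n_lt ((EE_mono Pb.hM h1.1 h1.2 h2.2).trans hE)).le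

/-- At the points of such a rectangle the bootstrap assumptions hold strictly, if `r > r₁`. -/
theorem admissible_of_setting
    (Pb : Problem M p D₂ D₃ v₀ ρ c B r₁ K k Ed v₁ η U₀ rH lH φH θH nH rI nI φI ζI F)
    {a b : ℝ} (S : Setting M p D₂ D₃ v₀ ρ c B r₁ K k Ed v₁ η rH lH θH nH F a b) {U v : ℝ}
    (hU : U ∈ Icc 0 a) (hv : v ∈ Icc v₀ b) (hr : r₁ < F.r U v) :
    Admissible M p v₀ c B r₁ K k Ed F U v :=
  ⟨hr, by linarith [S.rect.r_le hU hv, Pb.hM], S.goodAt Pb.crude_lt hU hv⟩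

/-- The conditions hold at the corner because `B` was chosen large compared with the data. -/
theorem admissible_corner
    (Pb : Problem M p D₂ D₃ v₀ ρ c B r₁ K k Ed v₁ η U₀ rH lH φH θH nH rI nI φI ζI F) :
    Admissible M p v₀ c B r₁ K k Ed F 0 v₀ := by
  have T := Pb.trunc
  have hM := Pb.hM
  have hρ := Pb.hρ
  have hD₂ := Pb.hD₂
  have hD₃ := Pb.hD₃
  have hc0 : 0 < c := by linarith [Pb.hc]
  have h0 : (0 : ℝ) ∈ Icc 0 U₀ := ⟨le_rfl, Pb.hU₀.le⟩
  have hv : v₀ ∈ Ici v₀ := self_mem_Ici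
  have eΩ : F.Ω 0 v₀ = ΩH M v₀ := by rw [T.Ω_I 0 h0, ΩK_zero, ΩH]
  have hq := wq_pos (p := p) hM Pb.hv₀
  have hP := wP_pos (p := p) hM Pb.hv₀
  have hΩ := ΩH_pos M v₀
  have er : F.r 0 v₀ = rH v₀ := T.r_H v₀ hv
  have hr1 := Pb.hor.r_ge v₀ le_rfl
  have hr2 := Pb.hor.r_le v₀ le_rfl
  have hr0 : 0 < rH v₀ := hρ.trans_le hr1
  have hrI : rI 0 = rH v₀ := by rw [← T.r_I 0 h0, er]
  have hn := Pb.hor.n_le v₀ le_rfl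
  have hn0 := Pb.hor.n_pos v₀ le_rfl
  have hcor := Pb.corner
  rw [hrI] at hcor
  have hν0 : 0 < -nI 0 := by
    by_contra hneg
    have : 0 ≤ rH v₀ * nI 0 := mul_nonneg hr0.le (by linarith)
    linarith
  have hνle : -nI 0 ≤ c * ΩH M v₀ / ρ := by
    rw [le_div_iff₀ hρ]
    have : -nI 0 * ρ ≤ -nI 0 * rH v₀ := by gcongr
    linarith
  have hθ0 := Pb.hor.rθ_nonneg v₀ le_rfl
  have hθ1 := Pb.hor.rθ_le v₀ le_rfl
  have hθ : |θH v₀| ≤ D₂ * wP M p v₀ / ρ := by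
    rw [le_div_iff₀ hρ]
    have : |θH v₀| * ρ ≤ |θH v₀| * rH v₀ := by gcongr
    have e : |θH v₀| * rH v₀ = rH v₀ * θH v₀ := by
      rw [← abs_of_pos hr0, ← abs_mul, mul_comm, abs_of_pos hr0, abs_of_nonneg hθ0]
    linarith
  have hζ1 := Pb.ζ_I 0 h0
  rw [hrI] at hζ1
  have hζ : |ζI 0| ≤ c * ΩH M v₀ / ρ * (D₃ / ρ) := by
    rw [abs_mul, abs_of_pos hr0] at hζ1
    have h1 : ρ * |ζI 0| ≤ rH v₀ * |ζI 0| := by gcongr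
    have h2 : D₃ * -nI 0 ≤ D₃ * (c * ΩH M v₀ / ρ) := by gcongr
    have : |ζI 0| ≤ D₃ * (c * ΩH M v₀ / ρ) / ρ := by
      rw [le_div_iff₀ hρ]; linarith
    exact this.trans_eq (by ring)
  have hK := Pb.corner_lt
  unfold cornerC at hK
  have p1 : 0 < c * wq M p v₀ := by positivity
  have p2 : 0 < D₂ * wP M p v₀ / ρ := by positivity
  have p3 : 0 < 1 / (4 * M) := by positivity
  have p4 : 0 < c * ΩH M v₀ / ρ := by positivity
  have p5 : 0 < c * ΩH M v₀ / ρ * (D₃ / ρ) := by positivity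
  have hexp : K * Real.exp (k * (v₀ - v₀)) = K := by simp
  have hl0 := Pb.hor.lam_nonneg v₀ le_rfl
  have hl1 := Pb.hor.lam_le v₀ le_rfl
  have hB := Pb.B_pos
  refine ⟨?_, ?_, ?_, ?_, ?_, ?_, ?_, ?_, ?_, ?_, ?_⟩
  · rw [T.r_I 0 h0]; exact Pb.r_I 0 h0
  · rw [er]; linarith
  · rw [er, T.θ_H v₀ hv, pow_two, mul_assoc, abs_mul, abs_of_pos hr0, abs_of_nonneg hθ0]
    calc _ ≤ 2 * M * (D₂ * wP M p v₀) := by gcongr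
      _ = M * (2 * D₂) * wP M p v₀ := by ring
      _ < _ := by gcongr; linarith [Pb.hB]
  · rw [er, T.ζ_I 0 h0, T.ν_I 0 h0]
    exact hζ1.trans_lt (mul_lt_mul_of_pos_right Pb.hBD hν0)
  · rw [T.lam_H v₀ hv, abs_of_nonneg hl0]; linarith
  · rw [T.θ_H v₀ hv]; linarith
  · rw [T.α_H v₀ hv, abs_of_pos p3]; linarith
  · rw [T.ν_I 0 h0, hexp, ← abs_neg, abs_of_pos hν0]; linarith
  · rw [eΩ, hexp, abs_of_pos hΩ]; linarith
  · rw [T.ζ_I 0 h0, hexp]; linarith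
  · intro _
    rw [er, T.ν_I 0 h0, hcor, neg_neg]
    have : ΩH M v₀ ≤ Real.exp (v₀ / (4 * M)) := Real.exp_le_exp.2 (by linarith)
    have e : c * ΩH M v₀ ≤ c * Real.exp (v₀ / (4 * M)) := by gcongr
    have : 0 < c * Real.exp (v₀ / (4 * M)) := by positivity
    linarith

/-- The conditions are strict inequalities between continuous functions, hence open. -/
theorem eventually_admissible
    (Pb : Problem M p D₂ D₃ v₀ ρ c B r₁ K k Ed v₁ η U₀ rH lH φH θH nH rI nI φI ζI F)
    {U v : ℝ} (hv : v₀ ≤ v) (h : Admissible M p v₀ c B r₁ K k Ed F U v) :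
    ∀ᶠ x : ℝ × ℝ in 𝓝 (U, v), Admissible M p v₀ c B r₁ K k Ed F x.1 x.2 := by
  have T := Pb.trunc
  have cr := T.r_c
  have cΩ := T.Ω_c
  have cν := T.ν_c
  have cζ := T.ζ_c
  have cl := T.lam_c
  have cθ := T.θ_c
  have cα := T.α_c
  have cP : ContinuousAt (fun x : ℝ × ℝ => wP M p x.2) (U, v) :=
    ContinuousAt.comp (f := Prod.snd) (g := wP M p) (x := ((U, v) : ℝ × ℝ))
      (hasDerivAt_wP Pb.hM (Pb.hv₀.trans_le hv)).continuousAt continuousAt_snd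
  have cE : Continuous (fun x : ℝ × ℝ => EE M x.1 x.2) := by unfold EE; fun_prop
  have key : ∀ f g : ℝ × ℝ → ℝ, ContinuousAt f (U, v) → ContinuousAt g (U, v) →
      f (U, v) < g (U, v) → ∀ᶠ x in 𝓝 (U, v), f x < g x :=
    fun f g hf hg h => hf.eventually_lt hg h
  have e11 : ∀ᶠ x : ℝ × ℝ in 𝓝 (U, v), EE M x.1 x.2 ≤ Ed →
      -(F.r x.1 x.2 * F.ν x.1 x.2) < 8 * c * Real.exp (x.2 / (4 * M)) := by
    rcases le_or_gt (EE M U v) Ed with hE | hE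
    · exact (key (fun x => -(F.r x.1 x.2 * F.ν x.1 x.2)) (fun x => 8 * c * Real.exp (x.2 / (4 * M)))
        (cr.mul cν).neg.continuousAt (by fun_prop) (h.good.n_lt hE)).mono fun _ hx _ => hx
    · exact (key (fun _ => Ed) _ (by fun_prop) cE.continuousAt hE).mono
        fun _ hx hx' => absurd hx' (not_le.2 hx)
  filter_upwards [key (fun _ => r₁) _ (by fun_prop) cr.continuousAt h.r_gt,
    key _ (fun _ => 3 * M) cr.continuousAt (by fun_prop) h.r_lt,
    key _ (fun x => M * B * wP M p x.2) ((cr.pow 2).mul cθ).abs.continuousAt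
      (continuousAt_const.mul cP) h.good.A_lt,
    key _ (fun x => B * wP M p x.2 * -F.ν x.1 x.2) (cr.mul cζ).abs.continuousAt
      ((continuousAt_const.mul cP).mul cν.neg.continuousAt) h.good.ζ_lt,
    key _ (fun _ => K) cl.abs.continuousAt (by fun_prop) h.good.lam_lt,
    key _ (fun _ => K) cθ.abs.continuousAt (by fun_prop) h.good.θ_lt,
    key _ (fun _ => K) cα.abs.continuousAt (by fun_prop) h.good.α_lt,
    key _ (fun x => K * Real.exp (k * (x.2 - v₀))) cν.abs.continuousAt (by fun_prop) h.good.ν_lt,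
    key _ (fun x => K * Real.exp (k * (x.2 - v₀))) cΩ.abs.continuousAt (by fun_prop) h.good.Ω_lt,
    key _ (fun x => K * Real.exp (k * (x.2 - v₀))) cζ.abs.continuousAt (by fun_prop) h.good.ζ_lt',
    e11] with x h1 h2 h3 h4 h5 h6 h7 h8 h9 h10 h11
  exact ⟨h1, h2, h3, h4, h5, h6, h7, h8, h9, h10, h11⟩

theorem past {a b U v : ℝ} (h : (a, b) ∈ goodRegion M p v₀ c B r₁ K k Ed U₀ F) (hU : 0 ≤ U)
    (hUa : U ≤ a) (hv : v₀ ≤ v) (hvb : v ≤ b) :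
    (U, v) ∈ goodRegion M p v₀ c B r₁ K k Ed U₀ F :=
  ⟨⟨⟨hU, hUa.trans_lt h.1.1.2⟩, hv⟩, fun s hs t ht =>
    h.2 s ⟨hs.1, hs.2.trans hUa⟩ t ⟨ht.1, ht.2.trans hvb⟩⟩

/-- A point of the good region lies in the interior of a larger rectangle of the good region: the
conditions are open and the rectangle is compact (the generalized tube lemma). -/
theorem exists_gt_mem
    (Pb : Problem M p D₂ D₃ v₀ ρ c B r₁ K k Ed v₁ η U₀ rH lH φH θH nH rI nI φI ζI F)
    {U v : ℝ} (h : (U, v) ∈ goodRegion M p v₀ c B r₁ K k Ed U₀ F) :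
    ∃ a b, U < a ∧ v < b ∧ (a, b) ∈ goodRegion M p v₀ c B r₁ K k Ed U₀ F := by
  have hU : 0 ≤ U := h.1.1.1
  have hU₀ : U < U₀ := h.1.1.2
  have hv : v₀ ≤ v := h.1.2
  set W := interior {x : ℝ × ℝ | Admissible M p v₀ c B r₁ K k Ed F x.1 x.2}
  have hbox : Icc 0 U ×ˢ Icc v₀ v ⊆ W := by
    rintro ⟨s, t⟩ ⟨hs, ht⟩
    exact mem_interior_iff_mem_nhds.2 (Pb.eventually_admissible ht.1 (h.2 s hs t ht))
  obtain ⟨u, w, hu, hw, hsu, htw, huw⟩ := generalized_tube_lemma isCompact_Icc isCompact_Icc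
    isOpen_interior hbox
  obtain ⟨e₁, he₁, hb₁⟩ := Metric.isOpen_iff.1 hu U (hsu ⟨hU, le_rfl⟩)
  obtain ⟨e₂, he₂, hb₂⟩ := Metric.isOpen_iff.1 hw v (htw ⟨hv, le_rfl⟩)
  obtain ⟨a, ha1, ha2⟩ := exists_between (lt_min hU₀ (show U < U + e₁ by linarith))
  have ha3 := ha2.trans_le (min_le_right _ _)
  refine ⟨a, v + e₂ / 2, ha1, by linarith,
    ⟨⟨hU.trans ha1.le, ha2.trans_le (min_le_left _ _)⟩, show v₀ ≤ v + e₂ / 2 by linarith⟩,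
    fun s hs t ht => ?_⟩
  have hs' : s ∈ u := by
    rcases le_total s U with hsU | hsU
    · exact hsu ⟨hs.1, hsU⟩
    · refine hb₁ ?_
      rw [Metric.mem_ball, Real.dist_eq, abs_of_nonneg (by linarith)]
      linarith [hs.2]
  have ht' : t ∈ w := by
    rcases le_total t v with htv | htv
    · exact htw ⟨ht.1, htv⟩
    · refine hb₂ ?_
      rw [Metric.mem_ball, Real.dist_eq, abs_of_nonneg (by linarith)]
      have : t ≤ v + e₂ / 2 := ht.2
      linarith
  exact interior_subset (s := {x : ℝ × ℝ | Admissible M p v₀ c B r₁ K k Ed F x.1 x.2})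
    (huw (show (s, t) ∈ u ×ˢ w from ⟨hs', ht'⟩))

theorem exists_isOpen
    (Pb : Problem M p D₂ D₃ v₀ ρ c B r₁ K k Ed v₁ η U₀ rH lH φH θH nH rI nI φI ζI F) :
    ∃ O : Set (ℝ × ℝ), IsOpen O ∧
      goodRegion M p v₀ c B r₁ K k Ed U₀ F = O ∩ (Ico 0 U₀ ×ˢ Ici v₀) := by
  set Q := goodRegion M p v₀ c B r₁ K k Ed U₀ F with hQ
  refine ⟨interior (Q ∪ (Ico 0 U₀ ×ˢ Ici v₀)ᶜ), isOpen_interior, Subset.antisymm ?_ ?_⟩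
  · rintro ⟨U, v⟩ h
    refine ⟨mem_interior_iff_mem_nhds.2 ?_, h.1⟩
    obtain ⟨a, b, ha, hb, hab⟩ := Pb.exists_gt_mem h
    filter_upwards [prod_mem_nhds (Iio_mem_nhds ha) (Iio_mem_nhds hb)] with x hx
    by_cases hxq : x ∈ Ico 0 U₀ ×ˢ Ici v₀
    · exact Or.inl (past hab hxq.1.1 (le_of_lt hx.1) hxq.2 (le_of_lt hx.2))
    · exact Or.inr hxq
  · rintro x ⟨h1, h2⟩
    exact (interior_subset h1).resolve_right fun h => h h2

theorem setting_of_mem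
    (Pb : Problem M p D₂ D₃ v₀ ρ c B r₁ K k Ed v₁ η U₀ rH lH φH θH nH rI nI φI ζI F)
    {a b : ℝ} (h : (a, b) ∈ goodRegion M p v₀ c B r₁ K k Ed U₀ F) :
    Setting M p D₂ D₃ v₀ ρ c B r₁ K k Ed v₁ η rH lH θH nH F a b :=
  Pb.setting_of_closure h.1.1.1 h.1.1.2.le h.1.2 fun U hU v hv =>
    subset_closure ⟨⟨hU.1, le_rfl⟩, ⟨hv.1, le_rfl⟩, h.2 U hU v hv⟩

/-- The bootstrap assumptions pass to the closed rectangle when the right end of the `U`-interval is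
added, since they are used in non-strict form. -/
theorem setting_of_forall_lt_left
    (Pb : Problem M p D₂ D₃ v₀ ρ c B r₁ K k Ed v₁ η U₀ rH lH φH θH nH rI nI φI ζI F)
    {a b : ℝ} (ha : 0 < a) (haU : a < U₀) (hb : v₀ ≤ b)
    (h : ∀ s ∈ Ico 0 a, (s, b) ∈ goodRegion M p v₀ c B r₁ K k Ed U₀ F) :
    Setting M p D₂ D₃ v₀ ρ c B r₁ K k Ed v₁ η rH lH θH nH F a b := by
  refine Pb.setting_of_closure ha.le haU.le hb fun U hU v hv => ?_
  have hadm : ∀ s ∈ Ico 0 a, Admissible M p v₀ c B r₁ K k Ed F s v := fun s hs =>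
    (h s hs).2 s ⟨hs.1, le_rfl⟩ v hv
  rcases hU.2.lt_or_eq with hlt | rfl
  · exact subset_closure ⟨⟨hU.1, le_rfl⟩, ⟨hv.1, le_rfl⟩, hadm U ⟨hU.1, hlt⟩⟩
  · have h1 : U ∈ closure (Ico 0 U) := by rw [closure_Ico ha.ne]; exact ⟨hU.1, le_rfl⟩
    have h2 := image_closure_subset_closure_image (f := fun s : ℝ => (s, v)) (by fun_prop)
      (mem_image_of_mem _ h1)
    refine closure_mono ?_ h2
    rintro _ ⟨s, hs, rfl⟩
    exact ⟨⟨hs.1, hs.2.le⟩, ⟨hv.1, le_rfl⟩, hadm s hs⟩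

/-- The same when the upper end of the `v`-interval is added. -/
theorem setting_of_forall_lt_right
    (Pb : Problem M p D₂ D₃ v₀ ρ c B r₁ K k Ed v₁ η U₀ rH lH φH θH nH rI nI φI ζI F)
    {a b : ℝ} (ha : 0 ≤ a) (haU : a < U₀) (hb : v₀ < b)
    (h : ∀ t ∈ Ico v₀ b, (a, t) ∈ goodRegion M p v₀ c B r₁ K k Ed U₀ F) :
    Setting M p D₂ D₃ v₀ ρ c B r₁ K k Ed v₁ η rH lH θH nH F a b := by
  refine Pb.setting_of_closure ha haU.le hb.le fun U hU v hv => ?_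
  have hadm : ∀ t ∈ Ico v₀ b, Admissible M p v₀ c B r₁ K k Ed F U t := fun t ht =>
    (h t ht).2 U hU t ⟨ht.1, le_rfl⟩
  rcases hv.2.lt_or_eq with hlt | rfl
  · exact subset_closure ⟨⟨hU.1, le_rfl⟩, ⟨hv.1, le_rfl⟩, hadm v ⟨hv.1, hlt⟩⟩
  · have h1 : v ∈ closure (Ico v₀ v) := by rw [closure_Ico hb.ne]; exact ⟨hv.1, le_rfl⟩
    have h2 := image_closure_subset_closure_image (f := fun t : ℝ => (U, t)) (by fun_prop)
      (mem_image_of_mem _ h1)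
    refine closure_mono ?_ h2
    rintro _ ⟨t, ht, rfl⟩
    exact ⟨⟨hU.1, le_rfl⟩, ⟨ht.1, ht.2.le⟩, hadm t ht⟩

theorem mem_of_setting
    (Pb : Problem M p D₂ D₃ v₀ ρ c B r₁ K k Ed v₁ η U₀ rH lH φH θH nH rI nI φI ζI F)
    {a b : ℝ} (S : Setting M p D₂ D₃ v₀ ρ c B r₁ K k Ed v₁ η rH lH θH nH F a b) (haU : a < U₀)
    (hr : ∀ v ∈ Icc v₀ b, r₁ < F.r a v) : (a, b) ∈ goodRegion M p v₀ c B r₁ K k Ed U₀ F :=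
  ⟨⟨⟨S.rect.ha, haU⟩, S.rect.hb⟩, fun _ hU v hv => Pb.admissible_of_setting S hU hv
    ((hr v hv).trans_le (S.rect.r_anti hU.1 hU.2 le_rfl hv))⟩

theorem corner_mem
    (Pb : Problem M p D₂ D₃ v₀ ρ c B r₁ K k Ed v₁ η U₀ rH lH φH θH nH rI nI φI ζI F) :
    ((0 : ℝ), v₀) ∈ goodRegion M p v₀ c B r₁ K k Ed U₀ F := by
  refine ⟨⟨⟨le_rfl, Pb.hU₀⟩, self_mem_Ici⟩, fun U hU v hv => ?_⟩
  obtain rfl : U = 0 := le_antisymm hU.2 hU.1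
  obtain rfl : v = v₀ := le_antisymm hv.2 hv.1
  exact Pb.admissible_corner

theorem horizon_mem
    (Pb : Problem M p D₂ D₃ v₀ ρ c B r₁ K k Ed v₁ η U₀ rH lH φH θH nH rI nI φI ζI F)
    {v : ℝ} (hv : v₀ ≤ v) : ((0 : ℝ), v) ∈ goodRegion M p v₀ c B r₁ K k Ed U₀ F := by
  have T := Pb.trunc
  refine forall_Icc_of_step (P := fun v => ((0 : ℝ), v) ∈ goodRegion M p v₀ c B r₁ K k Ed U₀ F)
    (a := v₀) (T := v) (fun s t hs hst h => past h le_rfl le_rfl hs hst) Pb.corner_mem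
    (fun t _ h => ?_) (fun t ht h => ?_) v ⟨hv, le_rfl⟩
  · obtain ⟨a, b, ha, hb, hab⟩ := Pb.exists_gt_mem h
    exact ⟨b, hb, past hab le_rfl ha.le hab.1.2 le_rfl⟩
  · have S := Pb.setting_of_forall_lt_right le_rfl Pb.hU₀ ht.1 h
    refine Pb.mem_of_setting S Pb.hU₀ fun s hs => ?_
    -- on the horizon `r` does not decrease
    have hsub : Icc v₀ s ⊆ Ici v₀ := Icc_subset_Ici_self
    have h1 := le_of_deriv_nonneg hs.1 (fun t ht => (Pb.rH_v t (hsub ht)).mono hsub)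
      (fun t ht => Pb.hor.lam_nonneg t ht.1)
    have h0 : (0 : ℝ) ∈ Icc 0 U₀ := ⟨le_rfl, Pb.hU₀.le⟩
    have h2 := Pb.r_I 0 h0
    rw [← T.r_I 0 h0, T.r_H v₀ self_mem_Ici] at h2
    rw [T.r_H s hs.1]
    linarith

theorem ingoing_mem
    (Pb : Problem M p D₂ D₃ v₀ ρ c B r₁ K k Ed v₁ η U₀ rH lH φH θH nH rI nI φI ζI F)
    {U : ℝ} (hU : U ∈ Ico 0 U₀) : (U, v₀) ∈ goodRegion M p v₀ c B r₁ K k Ed U₀ F := by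
  refine forall_Icc_of_step (P := fun U => (U, v₀) ∈ goodRegion M p v₀ c B r₁ K k Ed U₀ F)
    (a := 0) (T := U) (fun s t hs hst h => past h hs hst le_rfl le_rfl) Pb.corner_mem
    (fun t _ h => ?_) (fun t ht h => ?_) U ⟨hU.1, le_rfl⟩
  · obtain ⟨a, b, ha, hb, hab⟩ := Pb.exists_gt_mem h
    exact ⟨a, ha, past hab hab.1.1.1 le_rfl le_rfl hb.le⟩
  · have htU : t < U₀ := ht.2.trans_lt hU.2
    have S := Pb.setting_of_forall_lt_left ht.1 htU le_rfl h
    refine Pb.mem_of_setting S htU fun s hs => ?_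
    obtain rfl : s = v₀ := le_antisymm hs.2 hs.1
    rw [Pb.trunc.r_I t ⟨ht.1.le, htU.le⟩]
    exact Pb.r_I t ⟨ht.1.le, htU.le⟩

end Problem

/-- On an outgoing null line `r` first increases and then decreases. -/
theorem Setting.min_le_r {M p D₂ D₃ v₀ ρ c B r₁ K k Ed v₁ η a b U v w : ℝ} {rH lH θH nH : ℝ → ℝ}
    {F : Fields} (S : Setting M p D₂ D₃ v₀ ρ c B r₁ K k Ed v₁ η rH lH θH nH F a b)
    (hU : U ∈ Icc 0 a) (hv : v ∈ Icc v₀ b) (hw : w ∈ Icc v₀ v) :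
    min (F.r U v₀) (F.r U v) ≤ F.r U w := by
  have hwb : w ∈ Icc v₀ b := ⟨hw.1, hw.2.trans hv.2⟩
  rcases lt_or_ge (F.lam U w) 0 with h | h
  · have hsub : Icc w v ⊆ Icc v₀ b := Icc_subset_Icc hw.1 hv.2
    exact (min_le_right _ _).trans (le_of_deriv_nonpos hw.2
      (fun s hs => (S.rect.sol.r_v U hU s (hsub hs)).mono hsub)
      (fun s hs => (S.lam_neg_of_le hU hwb (hsub hs) hs.1 h).le))
  · have hsub : Icc v₀ w ⊆ Icc v₀ b := Icc_subset_Icc_right hwb.2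
    refine (min_le_left _ _).trans (le_of_deriv_nonneg hw.1
      (fun s hs => (S.rect.sol.r_v U hU s (hsub hs)).mono hsub) (fun s hs => ?_))
    by_contra hneg
    exact absurd (S.lam_neg_of_le hU (hsub hs) hwb hs.2 (not_le.1 hneg)) (not_lt.2 h)

namespace Problem

variable {M p D₂ D₃ v₀ ρ c B r₁ K k Ed v₁ η U₀ : ℝ}
  {rH lH φH θH nH rI nI φI ζI : ℝ → ℝ} {F : Fields}

/-- The good region contains the whole region `r ≥ r₀`. Inside a `Setting` the bounds hold with better
constants, so a segment of good points can end only where `r` reaches `r₁`; along an outgoing line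
`r` first increases and then decreases, so this happens only after `r` has fallen below `r₀ > r₁`. -/
theorem isFullDomain
    (Pb : Problem M p D₂ D₃ v₀ ρ c B r₁ K k Ed v₁ η U₀ rH lH φH θH nH rI nI φI ζI F)
    {r₀ : ℝ} (hr₀ : r₁ < r₀) (hrI : ∀ U ∈ Icc 0 U₀, r₀ < rI U) :
    IsFullDomain v₀ U₀ r₀ (goodRegion M p v₀ c B r₁ K k Ed U₀ F) F.r where
  rel_open := Pb.exists_isOpen
  past _ _ _ _ h h1 h2 h3 h4 := past h h1 h2 h3 h4
  horizon _ hv := Pb.horizon_mem hv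
  ingoing_cone _ hU := Pb.ingoing_mem hU
  full U hU v hv hnot := by
    have hv' : v₀ ≤ v := hv
    -- If `r ≥ r₀` at all the good points of the ingoing segment, then by continuous induction the
    -- whole segment is good.
    by_contra! hcon
    have hall := forall_Icc_of_step (P := fun s => (s, v) ∈ goodRegion M p v₀ c B r₁ K k Ed U₀ F)
      (a := 0) (T := U) (fun s t hs hst h => past h hs hst hv' le_rfl) (Pb.horizon_mem hv')
      (fun t _ h => ?_) (fun t ht h => ?_) U ⟨hU.1, le_rfl⟩
    · exact hnot ⟨hall, hcon U hU.1 le_rfl hall⟩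
    · obtain ⟨a, b, ha, hb, hab⟩ := Pb.exists_gt_mem h
      exact ⟨a, ha, past hab hab.1.1.1 le_rfl hv' hb.le⟩
    · have htU : t < U₀ := ht.2.trans_lt hU.2
      have S := Pb.setting_of_forall_lt_left ht.1 htU hv' h
      have hta : t ∈ Icc 0 t := right_mem_Icc.2 ht.1.le
      have hvv : v ∈ Icc v₀ v := right_mem_Icc.2 hv'
      have hr : r₀ ≤ F.r t v := by
        have h1 : t ∈ closure (Ico 0 t) := by rw [closure_Ico ht.1.ne]; exact hta
        have hc : Continuous fun s => F.r s v :=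
          Pb.trunc.r_c.comp (by fun_prop : Continuous fun s : ℝ => (s, v))
        exact continuousWithinAt_const.closure_le h1 hc.continuousWithinAt
          (fun s hs => hcon s hs.1 (hs.2.le.trans ht.2) (h s hs))
      refine Pb.mem_of_setting S htU fun w hw => hr₀.trans_le ?_
      refine le_trans (le_min ?_ hr) (S.min_le_r hta hvv hw)
      rw [Pb.trunc.r_I t ⟨ht.1.le, htU.le⟩]
      exact (hrI t ⟨ht.1.le, htU.le⟩).le

end Problem

/-! ### The initial data -/

theorem OmegaHat2S_zero (M v : ℝ) : OmegaHat2S M 0 v = ΩH M v := if_pos rfl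

namespace IsInitialData

variable {M p q D₁ D₂ D₃ v₀ U₀ : ℝ} {rH φH rI φI : ℝ → ℝ}

theorem rH_v (h : IsInitialData M p q D₁ D₂ D₃ v₀ U₀ rH φH rI φI) :
    ∀ v ∈ Ici v₀, HasDerivWithinAt rH (derivWithin rH (Ici v₀) v) (Ici v₀) v := fun v hv =>
  ((h.rH_smooth.differentiableOn (by simp)) v hv).hasDerivWithinAt

theorem rI_U (h : IsInitialData M p q D₁ D₂ D₃ v₀ U₀ rH φH rI φI) :
    ∀ U ∈ Icc 0 U₀, HasDerivWithinAt rI (derivWithin rI (Icc 0 U₀) U) (Icc 0 U₀) U := fun U hU =>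
  ((h.rI_smooth.differentiableOn (by simp)) U hU).hasDerivWithinAt

theorem φH_v (h : IsInitialData M p q D₁ D₂ D₃ v₀ U₀ rH φH rI φI) :
    ∀ v ∈ Ici v₀, HasDerivWithinAt φH (derivWithin φH (Ici v₀) v) (Ici v₀) v := fun v hv =>
  ((h.φH_smooth.differentiableOn (by simp)) v hv).hasDerivWithinAt

theorem φI_U (h : IsInitialData M p q D₁ D₂ D₃ v₀ U₀ rH φH rI φI) :
    ∀ U ∈ Icc 0 U₀, HasDerivWithinAt φI (derivWithin φI (Icc 0 U₀) U) (Icc 0 U₀) U := fun U hU =>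
  ((h.φI_smooth.differentiableOn (by simp)) U hU).hasDerivWithinAt

theorem contDiffOn_θH (h : IsInitialData M p q D₁ D₂ D₃ v₀ U₀ rH φH rI φI) :
    ContDiffOn ℝ ∞ (derivWithin φH (Ici v₀)) (Ici v₀) :=
  h.φH_smooth.derivWithin (uniqueDiffOn_Ici _) (by simp)

theorem contDiffOn_ζI (h : IsInitialData M p q D₁ D₂ D₃ v₀ U₀ rH φH rI φI) (hU₀ : 0 < U₀) :
    ContDiffOn ℝ ∞ (derivWithin φI (Icc 0 U₀)) (Icc 0 U₀) :=
  h.φI_smooth.derivWithin (uniqueDiffOn_Icc hU₀) (by simp)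

theorem contDiffOn_lH (h : IsInitialData M p q D₁ D₂ D₃ v₀ U₀ rH φH rI φI) :
    ContDiffOn ℝ ∞ (derivWithin rH (Ici v₀)) (Ici v₀) :=
  h.rH_smooth.derivWithin (uniqueDiffOn_Ici _) (by simp)

theorem contDiffOn_nI (h : IsInitialData M p q D₁ D₂ D₃ v₀ U₀ rH φH rI φI) (hU₀ : 0 < U₀) :
    ContDiffOn ℝ ∞ (derivWithin rI (Icc 0 U₀)) (Icc 0 U₀) :=
  h.rI_smooth.derivWithin (uniqueDiffOn_Icc hU₀) (by simp)

theorem raychaudhuri_H (h : IsInitialData M p q D₁ D₂ D₃ v₀ U₀ rH φH rI φI) :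
    ∀ v ∈ Ici v₀, HasDerivWithinAt (fun v => (ΩH M v)⁻¹ * derivWithin rH (Ici v₀) v)
      (-rH v * (ΩH M v)⁻¹ * derivWithin φH (Ici v₀) v ^ 2) (Ici v₀) v := by
  intro v hv
  have h1 := h.constraint_H v hv
  simp only [OmegaHat2S_zero] at h1
  rw [← h1]
  refine DifferentiableWithinAt.hasDerivWithinAt ?_
  exact ((hasDerivAt_ΩH M v).inv (ΩH_pos M v).ne').differentiableAt.differentiableWithinAt.mul
    (h.contDiffOn_lH.differentiableOn (by simp) v hv)

theorem raychaudhuri_I (h : IsInitialData M p q D₁ D₂ D₃ v₀ U₀ rH φH rI φI) (hM : 0 < M)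
    (hU₀ : 0 < U₀) (hE : EE M U₀ v₀ < 1) :
    ∀ U ∈ Icc 0 U₀, HasDerivWithinAt (fun U => (ΩK M U v₀)⁻¹ * derivWithin rI (Icc 0 U₀) U)
      (-rI U * (ΩK M U v₀)⁻¹ * derivWithin φI (Icc 0 U₀) U ^ 2) (Icc 0 U₀) U := by
  intro U hU
  have hE' : ∀ U ∈ Icc 0 U₀, EE M U v₀ < 1 := fun U hU => (EE_mono hM hU.1 hU.2 le_rfl).trans_lt hE
  have hΩ : ∀ U ∈ Icc 0 U₀, OmegaHat2S M U v₀ = ΩK M U v₀ := fun U hU =>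
    OmegaHat2S_eq_ΩK hM hU.1 (hE' U hU)
  have h1 := h.constraint_I U hU
  rw [derivWithin_congr (f := fun U => (ΩK M U v₀)⁻¹ * derivWithin rI (Icc 0 U₀) U)
    (fun s hs => by simp only [hΩ s hs]) (by simp only [hΩ U hU]), hΩ U hU] at h1
  rw [← h1]
  refine DifferentiableWithinAt.hasDerivWithinAt ?_
  exact ((hasDerivAt_ΩK_U hM (hE' U hU)).inv
    (ΩK_pos (hE' U hU)).ne').differentiableAt.differentiableWithinAt.mul
    ((h.contDiffOn_nI hU₀).differentiableOn (by simp) U hU)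

theorem rI_U_neg (h : IsInitialData M p q D₁ D₂ D₃ v₀ U₀ rH φH rI φI) (hM : 0 < M)
    (hU₀ : 0 < U₀) (hE : EE M U₀ v₀ < 1) :
    ∀ U ∈ Icc 0 U₀, derivWithin rI (Icc 0 U₀) U < 0 := by
  intro U hU
  have hE' : ∀ U ∈ Icc 0 U₀, EE M U v₀ < 1 := fun U hU => (EE_mono hM hU.1 hU.2 le_rfl).trans_lt hE
  have hsub : Icc 0 U ⊆ Icc 0 U₀ := Icc_subset_Icc_right hU.2
  have h1 := le_of_deriv_nonpos hU.1
    (fun s hs => (h.raychaudhuri_I hM hU₀ hE s (hsub hs)).mono hsub) (fun s hs => by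
      have e1 := h.rI_pos s (hsub hs)
      have e2 := ΩK_pos (hE' s (hsub hs))
      have : 0 ≤ rI s * (ΩK M s v₀)⁻¹ * derivWithin φI (Icc 0 U₀) s ^ 2 := by positivity
      linarith)
  have h2 := ΩK_pos (hE' 0 ⟨le_rfl, hU₀.le⟩)
  have h3 := ΩK_pos (hE' U hU)
  have h4 : (ΩK M 0 v₀)⁻¹ * derivWithin rI (Icc 0 U₀) 0 < 0 :=
    mul_neg_of_pos_of_neg (inv_pos.2 h2) h.ingoing
  by_contra hneg
  have : 0 ≤ (ΩK M U v₀)⁻¹ * derivWithin rI (Icc 0 U₀) U :=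
    mul_nonneg (inv_pos.2 h3).le (not_lt.1 hneg)
  linarith

theorem rθ_nonneg (h : IsInitialData M p q D₁ D₂ D₃ v₀ U₀ rH φH rI φI) (hM : 0 < M)
    (hv₀ : 0 < v₀) (hD₁ : 0 < D₁) {v : ℝ} (hv : v₀ ≤ v) :
    0 ≤ rH v * derivWithin φH (Ici v₀) v := by
  refine le_trans ?_ (h.bound_H v hv).1
  have : 0 < v / M := div_pos (hv₀.trans_le hv) hM
  positivity

/-- The bounds on the event horizon, with the constant of `exists_horizonBounds`. -/
theorem horizonBounds (h : IsInitialData M p q D₁ D₂ D₃ v₀ U₀ rH φH rI φI) (hM : 0 < M)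
    (hv₀ : 0 < v₀) (hD₁ : 0 < D₁) (hD₃ : 0 < D₃) (hU₀ : 0 < U₀) {ρ c : ℝ} (hρ : ρ ≤ rH v₀)
    (hc : ∀ (r lam θ : ℝ → ℝ) (n₀ : ℝ),
      ρ ≤ r v₀ → (∀ v, v₀ ≤ v → 0 < r v) → Tendsto r atTop (𝓝 (2 * M)) →
      (∀ v ∈ Ici v₀, HasDerivWithinAt r (lam v) (Ici v₀) v) →
      (∀ v ∈ Ici v₀, HasDerivWithinAt (fun v => (ΩH M v)⁻¹ * lam v)
        (-r v * (ΩH M v)⁻¹ * θ v ^ 2) (Ici v₀) v) →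
      (∀ v, v₀ ≤ v → 0 ≤ r v * θ v) → (∀ v, v₀ ≤ v → r v * θ v ≤ D₂ * wP M p v) →
      0 < n₀ → n₀ ≤ 2 * M * D₃ →
      HorizonBounds M p D₂ v₀ ρ c r lam θ (fun v => n₀ + M * (ΩH M v - ΩH M v₀))) :
    HorizonBounds M p D₂ v₀ ρ c rH (derivWithin rH (Ici v₀)) (derivWithin φH (Ici v₀))
      (fun v => -(rI 0 * derivWithin rI (Icc 0 U₀) 0) + M * (ΩH M v - ΩH M v₀)) := by
  have key := fun n₀ => hc rH (derivWithin rH (Ici v₀)) (derivWithin φH (Ici v₀)) n₀ hρ h.rH_pos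
    h.rH_lim h.rH_v h.raychaudhuri_H (fun v hv => h.rθ_nonneg hM hv₀ hD₁ hv)
    (fun v hv => (h.bound_H v hv).2)
  -- the upper bound for `r` is needed to bound `r ∂_U r` at the corner
  have hr := (key (2 * M * D₃) (by positivity) le_rfl).r_le v₀ le_rfl
  rw [h.corner_r] at hr
  have h0 : (0 : ℝ) ∈ Icc 0 U₀ := ⟨le_rfl, hU₀.le⟩
  have hr0 := h.rI_pos 0 h0
  have hn := h.ingoing
  have hn' : -derivWithin rI (Icc 0 U₀) 0 ≤ D₃ := by
    have h1 := h.bound_I 0 h0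
    have h2 := abs_nonneg (rI 0 * (derivWithin φI (Icc 0 U₀) 0 / (-derivWithin rI (Icc 0 U₀) 0)))
    rw [abs_of_neg hn] at h1
    linarith
  refine key _ ?_ ?_
  · have := mul_pos hr0 (neg_pos.2 hn)
    linarith
  · calc -(rI 0 * derivWithin rI (Icc 0 U₀) 0) = rI 0 * -derivWithin rI (Icc 0 U₀) 0 := by ring
      _ ≤ 2 * M * D₃ := by
        have : 0 ≤ -derivWithin rI (Icc 0 U₀) 0 := by linarith
        gcongr

/-- Initial data in the sense of the theorem, together with the bounds on the horizon, give
characteristic data for the first-order system. -/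
theorem charData (h : IsInitialData M p q D₁ D₂ D₃ v₀ U₀ rH φH rI φI) (hM : 0 < M) (hp : 1 < p)
    (hv₀ : 0 < v₀) (hU₀ : 0 < U₀) (hE : EE M U₀ v₀ < 1) {ρ c : ℝ} (hρ : 0 < ρ) (hc : 1 ≤ c)
    {nH : ℝ → ℝ} (hor : HorizonBounds M p D₂ v₀ ρ c rH (derivWithin rH (Ici v₀))
      (derivWithin φH (Ici v₀)) nH) :
    CharData M v₀ U₀ rH (derivWithin rH (Ici v₀)) φH (derivWithin φH (Ici v₀)) rI
      (derivWithin rI (Icc 0 U₀)) φI (derivWithin φI (Icc 0 U₀)) where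
  rH_v := h.rH_v
  φH_v := h.φH_v
  lH_v v hv := by
    have hΩ := (ΩH_pos M v).ne'
    have h1 := (hasDerivAt_ΩH M v).hasDerivWithinAt.mul (h.raychaudhuri_H v hv)
    refine (h1.congr (fun t _ => ?_) ?_).congr_deriv ?_
    · simp only [Pi.mul_apply, mul_inv_cancel_left₀ (ΩH_pos M t).ne']
    · simp only [Pi.mul_apply, mul_inv_cancel_left₀ hΩ]
    · field_simp
      ring
  θH_c := h.contDiffOn_θH.continuousOn
  bdd := by
    refine ⟨c * wq M p v₀ + D₂ * wP M p v₀ / ρ, fun v hv => ?_⟩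
    have hv' : v₀ ≤ v := hv
    have hv0 := hv₀.trans_le hv'
    have hD₂ : 0 ≤ D₂ * wP M p v₀ := (hor.rθ_nonneg v₀ le_rfl).trans (hor.rθ_le v₀ le_rfl)
    have hD₂' : 0 ≤ D₂ := nonneg_of_mul_nonneg_left hD₂ (wP_pos hM hv₀)
    have e1 := hor.lam_nonneg v hv
    have e2 := hor.lam_le v hv
    have hq := wq_anti hM hp hv₀ hv'
    have hq' : c * wq M p v ≤ c * wq M p v₀ := by gcongr
    have e3 : 0 ≤ D₂ * wP M p v₀ / ρ := by positivity
    have e4 : 0 ≤ c * wq M p v₀ := by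
      have := wq_pos (p := p) hM hv₀
      positivity
    refine ⟨by rw [abs_of_nonneg e1]; linarith, ?_⟩
    have hr := hor.r_ge v hv
    have hr0 : 0 < rH v := hρ.trans_le hr
    have e5 := hor.rθ_nonneg v hv
    have e6 := hor.rθ_le v hv
    have hP := wP_anti hM (by linarith : 0 < p) hv₀ hv'
    have : |derivWithin φH (Ici v₀) v| ≤ D₂ * wP M p v₀ / ρ := by
      rw [le_div_iff₀ hρ]
      calc _ ≤ |derivWithin φH (Ici v₀) v| * rH v := by gcongr
        _ = rH v * derivWithin φH (Ici v₀) v := by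
          rw [← abs_of_pos hr0, ← abs_mul, mul_comm, abs_of_pos hr0, abs_of_nonneg e5]
        _ ≤ D₂ * wP M p v := e6
        _ ≤ _ := by gcongr
    linarith
  rI_U := h.rI_U
  φI_U := h.φI_U
  nI_U U hU := by
    have hE' : ∀ U ∈ Icc 0 U₀, EE M U v₀ < 1 := fun U hU =>
      (EE_mono hM hU.1 hU.2 le_rfl).trans_lt hE
    have hΩ := (ΩK_pos (hE' U hU)).ne'
    have h1 := (hasDerivAt_ΩK_U hM (hE' U hU)).hasDerivWithinAt.mul (h.raychaudhuri_I hM hU₀ hE U hU)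
    refine (h1.congr (fun s hs => ?_) ?_).congr_deriv ?_
    · simp only [Pi.mul_apply, mul_inv_cancel_left₀ (ΩK_pos (hE' s hs)).ne']
    · simp only [Pi.mul_apply, mul_inv_cancel_left₀ hΩ]
    · field_simp
      ring
  ζI_c := (h.contDiffOn_ζI hU₀).continuousOn
  corner_r := h.corner_r
  corner_φ := h.corner_φ

theorem ζI_le (h : IsInitialData M p q D₁ D₂ D₃ v₀ U₀ rH φH rI φI) (hM : 0 < M)
    (hU₀ : 0 < U₀) (hE : EE M U₀ v₀ < 1) {U : ℝ} (hU : U ∈ Icc 0 U₀) :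
    |rI U * derivWithin φI (Icc 0 U₀) U| ≤ D₃ * -derivWithin rI (Icc 0 U₀) U := by
  have hn := neg_pos.2 (h.rI_U_neg hM hU₀ hE U hU)
  have h1 := h.bound_I U hU
  have h2 := abs_nonneg (derivWithin rI (Icc 0 U₀) 0)
  rw [← mul_div_assoc, abs_div, abs_of_pos hn] at h1
  rw [← div_le_iff₀ hn]
  linarith

end IsInitialData

/-! ### The solution in terms of derivatives -/

theorem dU_eq {f : ℝ → ℝ → ℝ} {g : ℝ → ℝ} {U v a g' : ℝ} (hU : U ∈ Ico 0 a)
    (hf : ∀ s ∈ Ico 0 a, f s v = g s) (hg : HasDerivWithinAt g g' (Icc 0 a) U) :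
    dU f U v = g' := by
  have h1 : HasDerivWithinAt g g' (Ico 0 a) U := hg.mono Ico_subset_Icc_self
  have h2 : HasDerivWithinAt (fun s => f s v) g' (Ico 0 a) U := h1.congr hf (hf U hU)
  have h3 : HasDerivWithinAt (fun s => f s v) g' (Ici 0) U := by
    refine h2.mono_of_mem_nhdsWithin ?_
    filter_upwards [self_mem_nhdsWithin, mem_nhdsWithin_of_mem_nhds (Iio_mem_nhds hU.2)] with s h4 h5
    exact ⟨h4, h5⟩
  exact h3.derivWithin (uniqueDiffOn_Ici _ _ hU.1)

theorem dV_eq {f : ℝ → ℝ → ℝ} {g : ℝ → ℝ} {U v v₀ b g' : ℝ} (hv : v ∈ Ico v₀ b)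
    (hf : ∀ t ∈ Ico v₀ b, f U t = g t) (hg : HasDerivWithinAt g g' (Icc v₀ b) v) :
    dV v₀ f U v = g' := by
  have h1 : HasDerivWithinAt g g' (Ico v₀ b) v := hg.mono Ico_subset_Icc_self
  have h2 : HasDerivWithinAt (fun t => f U t) g' (Ico v₀ b) v := h1.congr hf (hf v hv)
  have h3 : HasDerivWithinAt (fun t => f U t) g' (Ici v₀) v := by
    refine h2.mono_of_mem_nhdsWithin ?_
    filter_upwards [self_mem_nhdsWithin, mem_nhdsWithin_of_mem_nhds (Iio_mem_nhds hv.2)] with t h4 h5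
    exact ⟨h4, h5⟩
  exact h3.derivWithin (uniqueDiffOn_Ici _ _ hv.1)

namespace IsCharSol

variable {F : Fields} {a v₀ b U v : ℝ}

theorem dU_r (h : IsCharSol F 0 a v₀ b) (hU : U ∈ Ico 0 a) (hv : v ∈ Icc v₀ b) :
    dU F.r U v = F.ν U v := dU_eq hU (fun _ _ => rfl) (h.r_U _ (Ico_subset_Icc_self hU) _ hv)

theorem dU_φ (h : IsCharSol F 0 a v₀ b) (hU : U ∈ Ico 0 a) (hv : v ∈ Icc v₀ b) :
    dU F.φ U v = F.ζ U v := dU_eq hU (fun _ _ => rfl) (h.φ_U _ (Ico_subset_Icc_self hU) _ hv)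

theorem dV_r (h : IsCharSol F 0 a v₀ b) (hU : U ∈ Icc 0 a) (hv : v ∈ Ico v₀ b) :
    dV v₀ F.r U v = F.lam U v := dV_eq hv (fun _ _ => rfl) (h.r_v _ hU _ (Ico_subset_Icc_self hv))

theorem dV_φ (h : IsCharSol F 0 a v₀ b) (hU : U ∈ Icc 0 a) (hv : v ∈ Ico v₀ b) :
    dV v₀ F.φ U v = F.θ U v := dV_eq hv (fun _ _ => rfl) (h.φ_v _ hU _ (Ico_subset_Icc_self hv))

end IsCharSol

/-- Every point of the domain lies in the interior, relative to the quadrant, of a rectangle on which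
the fields solve the full system; what the derivatives are can be read off there. -/
theorem isSolutionOn_of_rect {v₀ : ℝ} {Q : Set (ℝ × ℝ)} {F : Fields} (hQ : ∀ x ∈ Q, 0 ≤ x.1 ∧ v₀ ≤ x.2)
    (h : ∀ U v, (U, v) ∈ Q → ∃ a b, U < a ∧ v < b ∧ IsCharSol F 0 a v₀ b ∧
      (∀ k : ℕ, CkOn 0 a v₀ b k F.r ∧ CkOn 0 a v₀ b k F.Ω ∧ CkOn 0 a v₀ b k F.φ)) :
    IsSolutionOn v₀ Q F.r F.Ω F.φ := by
  have smooth : ∀ f : ℝ → ℝ → ℝ, (∀ U v, (U, v) ∈ Q → ∃ a b, U < a ∧ v < b ∧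
      ∀ k : ℕ, CkOn 0 a v₀ b k f) → ContDiffOn ℝ ∞ (fun x : ℝ × ℝ => f x.1 x.2) Q := by
    rintro f hf ⟨U, v⟩ hx
    obtain ⟨a, b, ha, hb, hk⟩ := hf U v hx
    obtain ⟨hU, hv⟩ := hQ _ hx
    have h1 : ContDiffOn ℝ ∞ (fun x : ℝ × ℝ => f x.1 x.2) (Icc 0 a ×ˢ Icc v₀ b) :=
      contDiffOn_infty.2 fun k => hk k
    refine (h1 (U, v) ⟨⟨hU, ha.le⟩, ⟨hv, hb.le⟩⟩).mono_of_mem_nhdsWithin ?_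
    filter_upwards [self_mem_nhdsWithin, mem_nhdsWithin_of_mem_nhds
      (prod_mem_nhds (Iio_mem_nhds ha) (Iio_mem_nhds hb))] with y h4 h5
    exact ⟨⟨(hQ y h4).1, le_of_lt h5.1⟩, ⟨(hQ y h4).2, le_of_lt h5.2⟩⟩
  have get : ∀ U v, (U, v) ∈ Q → ∃ a b, U ∈ Ico 0 a ∧ v ∈ Ico v₀ b ∧ IsCharSol F 0 a v₀ b := by
    intro U v hx
    obtain ⟨a, b, ha, hb, hs, -⟩ := h U v hx
    exact ⟨a, b, ⟨(hQ _ hx).1, ha⟩, ⟨(hQ _ hx).2, hb⟩, hs⟩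
  refine ⟨smooth _ fun U v hx => ?_, smooth _ fun U v hx => ?_, smooth _ fun U v hx => ?_,
    fun U v hx => ?_, fun U v hx => ?_, fun U v hx => ?_, fun U v hx => ?_, fun U v hx => ?_,
    fun U v hx => ?_, fun U v hx => ?_, fun U v hx => ?_, fun U v hx => ?_⟩
  · obtain ⟨a, b, ha, hb, -, hk⟩ := h U v hx
    exact ⟨a, b, ha, hb, fun k => (hk k).1⟩
  · obtain ⟨a, b, ha, hb, -, hk⟩ := h U v hx
    exact ⟨a, b, ha, hb, fun k => (hk k).2.1⟩
  · obtain ⟨a, b, ha, hb, -, hk⟩ := h U v hx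
    exact ⟨a, b, ha, hb, fun k => (hk k).2.2⟩
  all_goals obtain ⟨a, b, hU, hv, hs⟩ := get U v hx
  · exact hs.r_pos U (Ico_subset_Icc_self hU) v (Ico_subset_Icc_self hv)
  · exact hs.Ω_pos U (Ico_subset_Icc_self hU) v (Ico_subset_Icc_self hv)
  · exact dU_eq hU (fun s hs' => by rw [hs.dV_r (Ico_subset_Icc_self hs') hv]) (hs.rlam_U (Ico_subset_Icc_self hU) (Ico_subset_Icc_self hv))
  · exact dV_eq hv (fun t ht => by rw [hs.dU_r hU (Ico_subset_Icc_self ht)]) (hs.rν_v (Ico_subset_Icc_self hU) (Ico_subset_Icc_self hv))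
  · rw [dU_eq hU (g := fun s => F.α s v) (fun s hs' => dV_eq hv (fun _ _ => rfl)
      (hs.logΩ_v (Ico_subset_Icc_self hs') (Ico_subset_Icc_self hv))) (hs.α_U U (Ico_subset_Icc_self hU) v (Ico_subset_Icc_self hv)), hs.dU_r hU (Ico_subset_Icc_self hv), hs.dU_φ hU (Ico_subset_Icc_self hv),
      hs.dV_r (Ico_subset_Icc_self hU) hv, hs.dV_φ (Ico_subset_Icc_self hU) hv]
    simp only [Fields.A]
  · have hΩ := (hs.Ω_pos U (Ico_subset_Icc_self hU) v (Ico_subset_Icc_self hv)).ne'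
    rw [hs.dU_φ hU (Ico_subset_Icc_self hv)]
    refine dU_eq hU (g := fun s => (F.Ω s v)⁻¹ * F.ν s v)
      (fun s hs' => by simp only [hs.dU_r hs' (Ico_subset_Icc_self hv)]) ?_
    refine (((hs.Ω_U U (Ico_subset_Icc_self hU) v (Ico_subset_Icc_self hv)).inv hΩ).mul (hs.ν_U U (Ico_subset_Icc_self hU) v (Ico_subset_Icc_self hv))).congr_deriv ?_
    simp only [Pi.inv_apply]
    field_simp
    ring
  · have hΩ := (hs.Ω_pos U (Ico_subset_Icc_self hU) v (Ico_subset_Icc_self hv)).ne'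
    rw [hs.dV_φ (Ico_subset_Icc_self hU) hv]
    refine dV_eq hv (g := fun t => (F.Ω U t)⁻¹ * F.lam U t)
      (fun t ht => by simp only [hs.dV_r (Ico_subset_Icc_self hU) ht]) ?_
    refine (((hs.Ω_v U (Ico_subset_Icc_self hU) v (Ico_subset_Icc_self hv)).inv hΩ).mul (hs.lam_v U (Ico_subset_Icc_self hU) v (Ico_subset_Icc_self hv))).congr_deriv ?_
    simp only [Pi.inv_apply]
    field_simp
    ring
  · rw [hs.dV_r (Ico_subset_Icc_self hU) hv, hs.dU_φ hU (Ico_subset_Icc_self hv)]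
    exact dU_eq hU (fun s hs' => by rw [hs.dV_φ (Ico_subset_Icc_self hs') hv]) (hs.rθ_U (Ico_subset_Icc_self hU) (Ico_subset_Icc_self hv))
  · rw [hs.dU_r hU (Ico_subset_Icc_self hv), hs.dV_φ (Ico_subset_Icc_self hU) hv]
    exact dV_eq hv (fun t ht => by rw [hs.dU_φ hU (Ico_subset_Icc_self ht)]) (hs.rζ_v (Ico_subset_Icc_self hU) (Ico_subset_Icc_self hv))

/-- The data give rise to a solution of the truncated system which satisfies all the requirements of
`Problem`. -/
theorem IsInitialData.exists_problem {M p q D₁ D₂ D₃ v₀ U₀ ρ c B r₁ K k Ed v₁ η a₀ : ℝ}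
    {rH φH rI φI : ℝ → ℝ} (h : IsInitialData M p q D₁ D₂ D₃ v₀ U₀ rH φH rI φI) (hM : 0 < M)
    (hp : 1 < p) (hD₁ : 0 < D₁) (hD₂ : 0 < D₂) (hD₃ : 0 < D₃) (hv₀ : 0 < v₀) (hρ : 0 < ρ)
    (hρH : ρ ≤ rH v₀) (hc1 : 1 ≤ c)
    (hc : ∀ (r lam θ : ℝ → ℝ) (n₀ : ℝ),
      ρ ≤ r v₀ → (∀ v, v₀ ≤ v → 0 < r v) → Tendsto r atTop (𝓝 (2 * M)) →
      (∀ v ∈ Ici v₀, HasDerivWithinAt r (lam v) (Ici v₀) v) →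
      (∀ v ∈ Ici v₀, HasDerivWithinAt (fun v => (ΩH M v)⁻¹ * lam v)
        (-r v * (ΩH M v)⁻¹ * θ v ^ 2) (Ici v₀) v) →
      (∀ v, v₀ ≤ v → 0 ≤ r v * θ v) → (∀ v, v₀ ≤ v → r v * θ v ≤ D₂ * wP M p v) →
      0 < n₀ → n₀ ≤ 2 * M * D₃ →
      HorizonBounds M p D₂ v₀ ρ c r lam θ (fun v => n₀ + M * (ΩH M v - ΩH M v₀)))
    (hB : 64 * D₂ ≤ B) (hBD : D₃ < B * wP M p v₀) (hr₁ : 0 < r₁) (hk : 0 ≤ k) (hU₀ : 0 < U₀)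
    (hE : EE M U₀ v₀ < 1) (hrI : ∀ U ∈ Icc 0 U₀, r₁ < rI U)
    (hK : crudeC M p v₀ c B ρ r₁ < K) (hK' : cornerC M p D₂ D₃ v₀ ρ c < K) (hUa : U₀ ≤ a₀)
    (hset : ∀ (rH lH θH nH : ℝ → ℝ) (F : Fields) (a b : ℝ), a ≤ a₀ →
      RectSol M p D₂ D₃ v₀ ρ c rH lH θH nH F a b → Bootstrap M p v₀ c B r₁ K k Ed F a b →
      Setting M p D₂ D₃ v₀ ρ c B r₁ K k Ed v₁ η rH lH θH nH F a b) :
    ∃ (nH : ℝ → ℝ) (F : Fields), Problem M p D₂ D₃ v₀ ρ c B r₁ K k Ed v₁ η U₀ rH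
      (derivWithin rH (Ici v₀)) φH (derivWithin φH (Ici v₀)) nH rI (derivWithin rI (Icc 0 U₀)) φI
      (derivWithin φI (Icc 0 U₀)) F := by
  have hor := h.horizonBounds hM hv₀ hD₁ hD₃ hU₀ hρH hc
  have hP := wP_pos (p := p) hM hv₀
  have hq := wq_pos (p := p) hM hv₀
  have hΩ := ΩH_pos M v₀
  have hK0 : 0 < K := by
    refine lt_trans ?_ hK'
    unfold cornerC
    positivity
  obtain ⟨F, hF⟩ := exists_truncatedSol hM hr₁ hK0 hk hU₀.le hE
    (h.charData hM hp hv₀ hU₀ hE hρ hc1 hor)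
  refine ⟨_, F, hM, hD₂, hD₃, hv₀, hρ, hc1, hB, hBD, hr₁, hU₀, hE, hF, hor, hrI,
    fun U hU => h.ζI_le hM hU₀ hE hU, by ring, h.rH_v, hK, hK',
    fun a b ha => hset _ _ _ _ F a b (ha.trans hUa)⟩

namespace Problem

variable {M p D₂ D₃ v₀ ρ c B r₁ K k Ed v₁ η U₀ : ℝ}
  {rH lH φH θH nH rI nI φI ζI : ℝ → ℝ} {F : Fields}

/-- A point of the region of validity lies below a rectangle that is contained in it. -/
theorem exists_setting
    (Pb : Problem M p D₂ D₃ v₀ ρ c B r₁ K k Ed v₁ η U₀ rH lH φH θH nH rI nI φI ζI F)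
    {U v : ℝ} (h : (U, v) ∈ goodRegion M p v₀ c B r₁ K k Ed U₀ F) :
    ∃ a b, U ∈ Ico 0 a ∧ v ∈ Ico v₀ b ∧ a ≤ U₀ ∧
      Setting M p D₂ D₃ v₀ ρ c B r₁ K k Ed v₁ η rH lH θH nH F a b := by
  obtain ⟨a, b, ha, hb, hab⟩ := Pb.exists_gt_mem h
  exact ⟨a, b, ⟨h.1.1.1, ha⟩, ⟨h.1.2, hb⟩, hab.1.1.2.le, Pb.setting_of_mem hab⟩

/-- On the good region the fields solve the equations in the sense of iterated one-sided derivatives. -/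
theorem isSolutionOn
    (Pb : Problem M p D₂ D₃ v₀ ρ c B r₁ K k Ed v₁ η U₀ rH lH φH θH nH rI nI φI ζI F)
    (hrH : ContDiffOn ℝ ∞ rH (Ici v₀)) (hθH : ContDiffOn ℝ ∞ θH (Ici v₀))
    (hrI : ContDiffOn ℝ ∞ rI (Icc 0 U₀)) (hζI : ContDiffOn ℝ ∞ ζI (Icc 0 U₀)) :
    IsSolutionOn v₀ (goodRegion M p v₀ c B r₁ K k Ed U₀ F) F.r F.Ω F.φ := by
  have T := Pb.trunc
  refine isSolutionOn_of_rect (fun x hx => ⟨hx.1.1.1, hx.1.2⟩) fun U v hx => ?_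
  obtain ⟨a, b, hU, hv, haU, S⟩ := Pb.exists_setting hx
  have ha : 0 < a := hU.1.trans_lt hU.2
  have hb : v₀ < b := hv.1.trans_lt hv.2
  have subU : Icc 0 a ⊆ Icc 0 U₀ := Icc_subset_Icc_right haU
  have subV : Icc v₀ b ⊆ Ici v₀ := Icc_subset_Ici_self
  refine ⟨a, b, hU.2, hv.2, S.rect.sol, fun k => ?_⟩
  have hβ : ContDiffOn ℝ ∞ (fun s => F.β s v₀) (Icc 0 a) := by
    refine ContDiffOn.congr (f := fun s => βK M s v₀) (fun s hs => ?_) fun s hs => T.β_I s (subU hs)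
    have hE : EE M s v₀ < 1 := (EE_mono Pb.hM hs.1 (hs.2.trans haU) le_rfl).trans_lt Pb.hE
    exact (ContDiffAt.comp s (f := fun s : ℝ => (s, v₀)) (contDiffAt_βK Pb.hM hE)
      (by fun_prop)).contDiffWithinAt
  have hk := S.rect.sol.ckOn_all ha hb
    (((hrH.mul hθH).mono subV).congr fun t ht => by rw [T.r_H t ht.1, T.θ_H t ht.1])
    (((hrI.mul hζI).mono subU).congr fun s hs => by rw [T.r_I s (subU hs), T.ζ_I s (subU hs)])
    ((contDiffOn_const (c := 1 / (4 * M))).congr fun t ht => T.α_H t ht.1)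
    hβ k
  exact ⟨hk.1, hk.2.1, hk.2.2.1⟩

theorem attainsData
    (Pb : Problem M p D₂ D₃ v₀ ρ c B r₁ K k Ed v₁ η U₀ rH lH φH θH nH rI nI φI ζI F) :
    AttainsData M v₀ U₀ rH φH rI φI F.r F.Ω F.φ where
  on_H v hv := by
    have h := Pb.horizon_mem hv
    refine ⟨Pb.trunc.r_H v hv, Pb.trunc.φ_H v hv, ?_⟩
    rw [(Pb.setting_of_mem h).rect.Ω_H v ⟨hv, le_rfl⟩, OmegaHat2S_zero]
  on_I U hU := by
    have hU' : U ∈ Icc 0 U₀ := Ico_subset_Icc_self hU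
    refine ⟨Pb.trunc.r_I U hU', Pb.trunc.φ_I U hU', ?_⟩
    rw [Pb.trunc.Ω_I U hU', OmegaHat2S_eq_ΩK Pb.hM hU.1
      ((EE_mono Pb.hM hU.1 hU.2.le le_rfl).trans_lt Pb.hE)]

theorem dU_r_neg
    (Pb : Problem M p D₂ D₃ v₀ ρ c B r₁ K k Ed v₁ η U₀ rH lH φH θH nH rI nI φI ζI F)
    {U v : ℝ} (h : (U, v) ∈ goodRegion M p v₀ c B r₁ K k Ed U₀ F) : dU F.r U v < 0 := by
  obtain ⟨a, b, hU, hv, -, S⟩ := Pb.exists_setting h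
  rw [S.rect.sol.dU_r hU (Ico_subset_Icc_self hv)]
  exact S.rect.ν_neg (Ico_subset_Icc_self hU) (Ico_subset_Icc_self hv)

theorem globalEstimates
    (Pb : Problem M p D₂ D₃ v₀ ρ c B r₁ K k Ed v₁ η U₀ rH lH φH θH nH rI nI φI ζI F)
    {r₀ Δ₁ C : ℝ} (hΔ : B ≤ Δ₁) (hC : c + 1 ≤ C) (hC' : massC M c ≤ C * M) :
    GlobalEstimates M p v₀ Δ₁ C (DReg (goodRegion M p v₀ c B r₁ K k Ed U₀ F) F.r r₀)
      F.r F.Ω F.φ := by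
  have hM := Pb.hM
  have hB := Pb.B_pos
  have hr₁ := Pb.hr₁
  refine ⟨fun U v h => ?_, fun U v h => ?_, fun U v h => ?_, fun U v h => ?_⟩
  all_goals
    obtain ⟨a, b, hU, hv, -, S⟩ := Pb.exists_setting h.1
    have hU' := Ico_subset_Icc_self hU
    have hv' := Ico_subset_Icc_self hv
    have hr := S.r_pos hU' hv'
    have hP := S.P_pos hv'
    have hq := S.q_pos hv'
  · have h1 := S.boot.A_le U hU' v hv'
    rw [abs_mul, abs_of_pos (pow_pos hr 2)] at h1
    rw [S.rect.sol.dV_φ hU' hv]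
    refine h1.trans ?_
    calc M * B * wP M p v ≤ M * (2 * Δ₁) * wP M p v := by gcongr; linarith
      _ = 2 * Δ₁ * M * wP M p v := by ring
  · have h1 := (S.rect.abs_ζ_le_iff hU' hv').1 (S.boot.ζ_le U hU' v hv')
    rw [mul_div_assoc, abs_mul, abs_of_pos hr] at h1
    rw [Yd, S.rect.sol.dU_φ hU hv', S.rect.sol.dU_r hU hv']
    refine h1.trans ?_
    calc B * wP M p v ≤ (2 * Δ₁) * wP M p v := by gcongr; linarith
      _ = 2 * Δ₁ * wP M p v := by ring
  · have h1 := S.f_near hU' hv'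
    rw [S.rect.sol.dU_r hU hv']
    calc _ = |-F.ν U v / F.Ω U v - 1 / 2| := by congr 1; ring
      _ ≤ (c + 1) * wq M p v := h1
      _ ≤ C * wq M p v := by gcongr
  · have h1 := S.massFn_le hU' hv'
    rw [S.rect.sol.dV_r hU' hv]
    exact h1.trans (mul_le_mul_of_nonneg_right hC' hq.le)

end Problem

/-! ### The coordinate `u` -/

theorem UOf_pos {M : ℝ} (hM : 0 < M) (u : ℝ) : 0 < UOf M u := by
  unfold UOf; positivity

theorem hasDerivAt_UOf {M : ℝ} (hM : 0 < M) (u : ℝ) :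
    HasDerivAt (UOf M) (UOf M u / (4 * M)) u :=
  ((((hasDerivAt_id u).div_const (4 * M)).exp).const_mul (4 * M)).congr_deriv (by
    simp only [UOf, id]; field_simp)

theorem exp_eq_UOf {M : ℝ} (hM : 0 < M) (u : ℝ) : Real.exp (u / (4 * M)) = UOf M u / (4 * M) := by
  unfold UOf; field_simp

theorem hasDerivAt_comp_UOf {M a u f' : ℝ} {f : ℝ → ℝ} (hM : 0 < M) (hU : UOf M u ∈ Ico 0 a)
    (hf : HasDerivWithinAt f f' (Icc 0 a) (UOf M u)) :
    HasDerivAt (fun u => f (UOf M u)) (f' * (UOf M u / (4 * M))) u :=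
  (hf.hasDerivAt (Icc_mem_nhds (UOf_pos hM u) hU.2)).comp u (hasDerivAt_UOf hM u)

theorem hasDerivAt_rS_u {M u v : ℝ} (hM : 0 < M) (huv : u + v < 0) :
    HasDerivAt (fun u => rS M u v)
      (-(1 / 2) * ΩK M (UOf M u) v * (UOf M u / (4 * M))) u := by
  have hE : EE M (UOf M u) v < 1 := by
    rw [EE_UOf hM, Real.exp_lt_one_iff]
    exact div_neg_of_neg_of_pos huv (by positivity)
  refine ((hasDerivAt_rK_U hM hE).comp u (hasDerivAt_UOf hM u)).congr_of_eventuallyEq ?_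
  filter_upwards [Iio_mem_nhds (show u < -v by linarith)] with s hs
  have : s < -v := hs
  exact rS_eq_rK hM (by linarith)

theorem hasDerivAt_rS_v {M u v : ℝ} (hM : 0 < M) (huv : u + v < 0) :
    HasDerivAt (fun v => rS M u v) (1 / 2 - M / rK M (UOf M u) v) v := by
  have hE : EE M (UOf M u) v < 1 := by
    rw [EE_UOf hM, Real.exp_lt_one_iff]
    exact div_neg_of_neg_of_pos huv (by positivity)
  refine (hasDerivAt_rK_v hM hE).congr_of_eventuallyEq ?_
  filter_upwards [Iio_mem_nhds (show v < -u by linarith)] with s hs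
  have : s < -u := hs
  exact rS_eq_rK hM (by linarith)

/-! ### The estimates in the red-shift region -/

/-- The numbers `Ed`, `m`, `C` and so on that enter the estimates, with the relations between them;
`vd` is a lower bound for `v` in the no-shift region. -/
structure Constants (M p v₀ ρ c B Δ₁ Δ₂ C ε δ r₀ Ed m Kq vd U₀ : ℝ) : Prop where
  hδ : 0 < δ
  hε : 0 < ε
  hr₀ : 0 < r₀
  Ed_eq : Ed = Real.exp (-δ⁻¹ / (4 * M))
  Ed_half : Ed ≤ 1 / 2
  hm : 1 ≤ m
  Δ₁_B : 2 * B ≤ Δ₁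
  Δ₁_ρ : 8 * M * B / ρ ≤ Δ₁
  C_one : 1 ≤ C
  C_m : m ≤ C
  C_m' : m ≤ C * M
  C_f : c + 1 ≤ C
  C_mass : 2 * massC M c ≤ C * M
  C_lapse : lapseC M v₀ c B ρ ≤ C
  C_Y : Kq * (m + massC M c + lapseC M v₀ c B ρ) ≤ C
  Δ₂_m : 6 * m ≤ Δ₂
  Ed_small : m * wq M p v₀ * Ed ≤ 1
  Ed_ε : 2 * m * Ed ≤ ε * Δ₂
  hqexp : ∀ t v : ℝ, v₀ ≤ t → t ≤ v →
    wq M p t ≤ Kq * wq M p v * Real.exp ((v - t) / (8 * M))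
  hvd : v₀ ≤ vd
  vd_M : M ≤ vd
  vd_two : 2 ≤ vd
  U₀_vd : EE M U₀ vd ≤ Ed
  small : ∀ t, vd ≤ t →
    (m + massC M c + lapseC M v₀ c B ρ) * wq M p t ≤ gap M Ed / 4 ∧
    (m + massC M c + lapseC M v₀ c B ρ) * wq M p t ≤ gap M Ed / (4 * M)
  small' : ∀ t, vd ≤ t →
    noShiftC M Ed r₀ * (Kq * (m + massC M c + lapseC M v₀ c B ρ) * wq M p t) ≤ 1 / 4 ∧
    (c + 1) * wq M p t ≤ 1 / 8
  U₀_v₀ : U₀ ≤ 4 * M * Real.exp (-v₀ / (4 * M))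

theorem abs_eq_neg_of_UOf_lt {M v₀ U₀ u : ℝ} (hM : 0 < M) (hv₀ : 0 < v₀)
    (hU₀ : U₀ ≤ 4 * M * Real.exp (-v₀ / (4 * M))) (h : UOf M u < U₀) : u < -v₀ ∧ |u| = -u := by
  have h1 := h.trans_le hU₀
  rw [UOf, mul_lt_mul_iff_right₀ (by positivity), Real.exp_lt_exp,
    div_lt_div_iff_of_pos_right (by positivity)] at h1
  exact ⟨h1, abs_of_neg (by linarith)⟩

section RedShiftPoint

variable {M p D₂ D₃ v₀ ρ c B r₁ K k Ed v₁ η a b m u v : ℝ} {rH lH θH nH : ℝ → ℝ} {F : Fields}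

/-- The factor `dU / du` cancels in the quotient `Ω² / Ω_S²`. -/
theorem log_Omega2_quotient (hM : 0 < M) (huv : u + v < 0) (hΩ : 0 < F.Ω (UOf M u) v) :
    Real.log (Omega2 M F.Ω u v / Omega2S M u v)
      = Real.log (F.Ω (UOf M u) v) - Real.log (ΩK M (UOf M u) v) := by
  have hE : EE M (UOf M u) v < 1 := by
    rw [EE_UOf hM, Real.exp_lt_one_iff]
    exact div_neg_of_neg_of_pos huv (by positivity)
  rw [Omega2S_eq hM huv, Omega2, mul_div_mul_right _ _ (Real.exp_pos _).ne',
    Real.log_div hΩ.ne' (ΩK_pos hE).ne']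

theorem UOf_mem_Ico_eventually (hM : 0 < M) (h : UOf M u ∈ Ico 0 a) :
    ∀ᶠ s in 𝓝 u, UOf M s ∈ Ico 0 a := by
  have hc := (hasDerivAt_UOf hM u).continuousAt
  filter_upwards [hc.eventually (Iio_mem_nhds h.2)] with s hs
  exact ⟨(UOf_pos hM s).le, hs⟩

theorem hasDerivAt_log_Omega2 (hM : 0 < M) (sol : IsCharSol F 0 a v₀ b) (hU : UOf M u ∈ Ico 0 a)
    (hv : v ∈ Icc v₀ b) (huv : u + v < 0) :
    HasDerivAt (fun u => Real.log (Omega2 M F.Ω u v / Omega2S M u v))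
      ((F.β (UOf M u) v - βK M (UOf M u) v) * (UOf M u / (4 * M))) u := by
  have hE : EE M (UOf M u) v < 1 := by
    rw [EE_UOf hM, Real.exp_lt_one_iff]
    exact div_neg_of_neg_of_pos huv (by positivity)
  have h1 := hasDerivAt_comp_UOf hM hU ((sol.logΩ_U (Ico_subset_Icc_self hU) hv).sub
    ((hasDerivAt_ΩK_U hM hE).log (ΩK_pos hE).ne').hasDerivWithinAt)
  refine (h1.congr_of_eventuallyEq ?_).congr_deriv ?_
  · filter_upwards [UOf_mem_Ico_eventually hM hU, Iio_mem_nhds (show u < -v by linarith)] with s h2 h3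
    have : s < -v := h3
    exact log_Omega2_quotient hM (by linarith) (sol.Ω_pos _ (Ico_subset_Icc_self h2) _ hv)
  · rw [mul_div_cancel_right₀ _ (ΩK_pos hE).ne']

theorem hasDerivAt_log_r2Omega2 (hM : 0 < M) (sol : IsCharSol F 0 a v₀ b)
    (hU : UOf M u ∈ Ico 0 a) (hv : v ∈ Icc v₀ b) (huv : u + v < 0) :
    HasDerivAt (fun u => Real.log (toEF M F.r u v ^ 2 * Omega2 M F.Ω u v
        / (rS M u v ^ 2 * Omega2S M u v)))
      ((2 * (F.ν (UOf M u) v / F.r (UOf M u) v - -(1 / 2) * ΩK M (UOf M u) v / rK M (UOf M u) v)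
        + (F.β (UOf M u) v - βK M (UOf M u) v)) * (UOf M u / (4 * M))) u := by
  have hE : ∀ s, s + v < 0 → EE M (UOf M s) v < 1 := fun s hs => by
    rw [EE_UOf hM, Real.exp_lt_one_iff]
    exact div_neg_of_neg_of_pos hs (by positivity)
  have hr := sol.r_pos _ (Ico_subset_Icc_self hU) v hv
  have hrK := rK_pos hM (hE u huv)
  have h1 := hasDerivAt_comp_UOf hM hU (((sol.r_U _ (Ico_subset_Icc_self hU) v hv).log hr.ne').sub
    ((hasDerivAt_rK_U hM (hE u huv)).log hrK.ne').hasDerivWithinAt)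
  refine (((h1.const_mul 2).add (hasDerivAt_log_Omega2 hM sol hU hv huv)).congr_of_eventuallyEq
    ?_).congr_deriv ?_
  · filter_upwards [UOf_mem_Ico_eventually hM hU, Iio_mem_nhds (show u < -v by linarith)] with s h2 h3
    have h4 : s < -v := h3
    have huv' : s + v < 0 := by linarith
    have e1 := sol.r_pos _ (Ico_subset_Icc_self h2) v hv
    have e2 := rK_pos hM (hE s huv')
    have e3 := sol.Ω_pos _ (Ico_subset_Icc_self h2) v hv
    have e4 : 0 < Omega2 M F.Ω s v := mul_pos e3 (Real.exp_pos _)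
    have e5 : 0 < Omega2S M s v := by
      rw [Omega2S_eq hM huv']
      exact mul_pos (ΩK_pos (hE s huv')) (Real.exp_pos _)
    simp only [Pi.add_apply, Pi.sub_apply]
    rw [rS_eq_rK hM huv', toEF, mul_div_mul_comm, Real.log_mul (by positivity) (by positivity),
      Real.log_div (by positivity) (by positivity), Real.log_pow, Real.log_pow]
    push_cast
    ring
  · ring

theorem abs_mul_UOf_le {x D : ℝ} (hM : 0 < M) (h : |x| ≤ m * Real.exp (v / (4 * M)) * D) :
    |x * (UOf M u / (4 * M))| ≤ m * EE M (UOf M u) v * D := by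
  have hU := UOf_pos hM u
  have h0 : 0 < UOf M u / (4 * M) := by positivity
  rw [abs_mul, abs_of_pos h0]
  calc _ ≤ m * Real.exp (v / (4 * M)) * D * (UOf M u / (4 * M)) := by gcongr
    _ = _ := by unfold EE; ring

end RedShiftPoint

namespace Problem

variable {M p D₂ D₃ v₀ ρ c B r₁ K k Ed v₁ η U₀ Δ₁ Δ₂ C ε δ r₀ m Kq vd : ℝ}
  {rH lH φH θH nH rI nI φI ζI : ℝ → ℝ} {F : Fields}

theorem exp_eq_EE {u v : ℝ} (hM : 0 < M) (hu : |u| = -u) :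
    Real.exp ((v - |u|) / (4 * M)) = EE M (UOf M u) v := by
  rw [EE_UOf hM, hu, sub_neg_eq_add, add_comm]

theorem redShift_iff {u v : ℝ} (hM : 0 < M) (hδ : Ed = Real.exp (-δ⁻¹ / (4 * M))) (hu : |u| = -u) :
    v - |u| ≤ -δ⁻¹ ↔ EE M (UOf M u) v ≤ Ed := by
  rw [← exp_eq_EE hM hu, hδ, Real.exp_le_exp, div_le_div_iff_of_pos_right (by positivity)]

set_option maxHeartbeats 1000000 in
/-- The estimates of the red-shift region in the form of the theorem, in the coordinates `(u, v)`.
The factor `U / 4M` between `∂_u` and `∂_U` turns `e^{v/4M}` into `E`. -/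
theorem redShiftEstimates
    (Pb : Problem M p D₂ D₃ v₀ ρ c B r₁ K k Ed v₁ η U₀ rH lH φH θH nH rI nI φI ζI F)
    (Cs : Constants M p v₀ ρ c B Δ₁ Δ₂ C ε δ r₀ Ed m Kq vd U₀)
    (hred : ∀ a b, Setting M p D₂ D₃ v₀ ρ c B r₁ K k Ed v₁ η rH lH θH nH F a b →
      ∀ U ∈ Icc 0 a, ∀ v ∈ Icc v₀ b, EE M U v ≤ Ed →
        |F.β U v - βK M U v| ≤ m * (wq M p v * Real.exp (v / (4 * M))) ∧
        |Real.log (F.Ω U v) - Real.log (ΩK M U v)| ≤ m * wq M p v * EE M U v ∧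
        CloseToKruskal M m F U v (wq M p v)) :
    RedShiftEstimates M p v₀ Δ₁ Δ₂ 1 C ε δ (gammaC M Ed)
      (DReg (goodRegion M p v₀ c B r₁ K k Ed U₀ F) F.r r₀) F.r F.Ω F.φ := by
  have hM := Pb.hM
  have hB := Pb.B_pos
  have hρ := Pb.hρ
  have hm0 : 0 < m := by linarith [Cs.hm]
  have hC0 : 0 < C := by linarith [Cs.C_one]
  have hε := Cs.hε
  have hΔ₂ : 0 < Δ₂ := by linarith [Cs.Δ₂_m]
  have hEd0 : 0 < Ed := by rw [Cs.Ed_eq]; exact Real.exp_pos _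
  have hEd1 : Ed < 1 := by linarith [Cs.Ed_half]
  have hgap := gap_pos hM hEd0 hEd1
  -- Since `r ≥ ρ / 2` here, the bootstrap bounds give the improved constants.
  have hΔρ : B ≤ 1 / 4 * Δ₁ * (ρ / 2) / M := by
    have h1 := Cs.Δ₁_ρ
    rw [div_le_iff₀ hρ] at h1
    rw [le_div_iff₀ hM]
    linarith
  -- the data at a point of the red-shift region
  have pt : ∀ u v, (u, v) ∈ EFReg M (DReg (goodRegion M p v₀ c B r₁ K k Ed U₀ F) F.r r₀) →
      |u| = -u ∧ 0 < wq M p v ∧ 0 < wP M p v ∧ ∃ a b, UOf M u ∈ Ico 0 a ∧ v ∈ Ico v₀ b ∧ a ≤ U₀ ∧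
        Setting M p D₂ D₃ v₀ ρ c B r₁ K k Ed v₁ η rH lH θH nH F a b := by
    intro u v h
    have h1 : (UOf M u, v) ∈ goodRegion M p v₀ c B r₁ K k Ed U₀ F := h.1
    obtain ⟨a, b, hU, hv, ha, S⟩ := Pb.exists_setting h1
    exact ⟨(abs_eq_neg_of_UOf_lt hM Pb.hv₀ Cs.U₀_v₀ h1.1.1.2).2, S.q_pos (Ico_subset_Icc_self hv),
      S.P_pos (Ico_subset_Icc_self hv), a, b, hU, hv, ha, S⟩
  have neg : ∀ u v, |u| = -u → EE M (UOf M u) v ≤ Ed → u + v < 0 := by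
    intro u v hu hE
    by_contra hn
    rw [EE_UOf hM] at hE
    have : 1 ≤ Real.exp ((u + v) / (4 * M)) := by
      rw [Real.one_le_exp_iff]
      exact div_nonneg (not_lt.1 hn) (by positivity)
    linarith
  refine ⟨fun u v h => ?_, fun u v h => ?_, fun u v h => ?_, fun u v h => ?_, fun u v h => ?_,
    fun u v h => ?_, fun u v h hz => ?_, fun u v h => ?_, fun u v h => ?_, fun u v h => ?_⟩
  all_goals
    obtain ⟨hu, hq, hP, a, b, hU, hv, ha, S⟩ := pt u v (by first | exact h.1 | exact h)
    have hU' := Ico_subset_Icc_self hU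
    have hv' := Ico_subset_Icc_self hv
    have hE0 := EE_pos (v := v) hM (UOf_pos hM u)
    have hr := S.r_pos hU' hv'
  · have hE := (redShift_iff hM Cs.Ed_eq hu).1 h.2
    obtain ⟨h1, -, -⟩ := hred a b S _ hU' v hv' hE
    rw [exp_eq_EE hM hu, du, (hasDerivAt_log_Omega2 hM S.rect.sol hU hv' (neg u v hu hE)).deriv]
    refine (abs_mul_UOf_le hM (D := wq M p v) (h1.trans_eq (by ring))).trans ?_
    change _ ≤ Δ₂ * EE M (UOf M u) v * wq M p v
    gcongr
    linarith [Cs.Δ₂_m]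
  · have hE := (redShift_iff hM Cs.Ed_eq hu).1 h.2
    obtain ⟨-, h1, -⟩ := hred a b S _ hU' v hv' hE
    have huv := neg u v hu hE
    have hΩ := S.Ω_pos hU' hv'
    have hE1 : EE M (UOf M u) v < 1 := by linarith
    rw [← log_Omega2_quotient hM huv hΩ] at h1
    have hpos : 0 < Omega2 M F.Ω u v / Omega2S M u v := by
      rw [Omega2S_eq hM huv]
      exact div_pos (mul_pos hΩ (Real.exp_pos _)) (mul_pos (ΩK_pos hE1) (Real.exp_pos _))
    have h2 : m * wq M p v * EE M (UOf M u) v ≤ m * wq M p v * Ed := by gcongr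
    have h3 : m * wq M p v * Ed ≤ 1 := by
      refine le_trans ?_ Cs.Ed_small
      have := S.q_le_start hv'
      gcongr
    have h4 := Real.abs_exp_sub_one_le (x := Real.log (Omega2 M F.Ω u v / Omega2S M u v))
      (by linarith)
    rw [Real.exp_log hpos] at h4
    change _ ≤ 1 * ε * Δ₂ * wq M p v
    calc _ ≤ 2 * (m * wq M p v * Ed) := by linarith
      _ = 2 * m * Ed * wq M p v := by ring
      _ ≤ ε * Δ₂ * wq M p v := mul_le_mul_of_nonneg_right Cs.Ed_ε hq.le
      _ = _ := by ring
  · have hE := (redShift_iff hM Cs.Ed_eq hu).1 h.2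
    obtain ⟨-, -, h1⟩ := hred a b S _ hU' v hv' hE
    have hd := (hasDerivAt_comp_UOf hM hU (S.rect.sol.r_U _ hU' v hv')).sub
      (hasDerivAt_rS_u (v := v) hM (neg u v hu hE))
    have e : du (fun u' v' => toEF M F.r u' v' - rS M u' v') u v
        = (F.ν (UOf M u) v + 1 / 2 * ΩK M (UOf M u) v) * (UOf M u / (4 * M)) :=
      hd.deriv.trans (by ring)
    rw [e, exp_eq_EE hM hu]
    refine (abs_mul_UOf_le hM h1.ν).trans ?_
    change _ ≤ 1 * ε * Δ₂ * EE M (UOf M u) v * wq M p v + C * EE M (UOf M u) v * wq M p v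
    have h2 : m * EE M (UOf M u) v * wq M p v ≤ C * EE M (UOf M u) v * wq M p v := by
      gcongr; exact Cs.C_m
    have h3 : 0 ≤ 1 * ε * Δ₂ * EE M (UOf M u) v * wq M p v := by positivity
    linarith
  · have hE := (redShift_iff hM Cs.Ed_eq hu).1 h.2
    obtain ⟨-, -, h1⟩ := hred a b S _ hU' v hv' hE
    rw [exp_eq_EE hM hu, rS_eq_rK hM (neg u v hu hE)]
    refine h1.r.trans ?_
    change _ ≤ 1 * ε * Δ₂ * M * EE M (UOf M u) v * wq M p v + C * M * wq M p v
    have h2 : m * wq M p v ≤ C * M * wq M p v := mul_le_mul_of_nonneg_right Cs.C_m' hq.le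
    have h3 : 0 ≤ 1 * ε * Δ₂ * M * EE M (UOf M u) v * wq M p v := by positivity
    linarith
  · have hE := (redShift_iff hM Cs.Ed_eq hu).1 h.2
    obtain ⟨-, -, h1⟩ := hred a b S _ hU' v hv' hE
    have hd := (S.rect.sol.r_v _ hU' v hv').sub
      (hasDerivAt_rS_v (v := v) hM (neg u v hu hE)).hasDerivWithinAt
    have e : dV v₀ (fun u' v' => toEF M F.r u' v' - rS M u' v') u v
        = F.lam (UOf M u) v - (1 / 2 - M / rK M (UOf M u) v) :=
      dV_eq hv (fun _ _ => rfl) hd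
    rw [e, exp_eq_EE hM hu]
    refine h1.lam.trans ?_
    change _ ≤ 1 * ε * Δ₂ * EE M (UOf M u) v * wq M p v + C * wq M p v
    have h2 : m * wq M p v ≤ C * wq M p v := mul_le_mul_of_nonneg_right Cs.C_m hq.le
    have h3 : 0 ≤ 1 * ε * Δ₂ * EE M (UOf M u) v * wq M p v := by positivity
    linarith
  · have hEq : EE M (UOf M u) v = Ed := by
      rw [← exp_eq_EE hM hu, h.2, Cs.Ed_eq]
    obtain ⟨-, h1, h2⟩ := hred a b S _ hU' v hv' hEq.le
    -- the curve lies in `v ≥ vd`, since the range of `U` is small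
    have hvd : vd ≤ v := by
      -- A point with `∂_v r = 0` lies in the red-shift region because `∂_v r < 0` in the no-shift region.
      by_contra hlt
      have h3 := EE_mono (v := v) (v' := vd) hM (UOf_pos hM u).le (hU.2.le.trans ha) (not_le.1 hlt).le
      have h4 : EE M (UOf M u) v < EE M (UOf M u) vd := by
        unfold EE
        have := UOf_pos hM u
        gcongr
        exact not_le.1 hlt
      have h5 := EE_mono (v := vd) (v' := vd) hM (UOf_pos hM u).le (hU.2.le.trans ha) le_rfl
      linarith [Cs.U₀_vd]
    have hmass := S.massC_pos
    have hlap := S.lapseC_nonneg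
    have hsm : m * wq M p v ≤ gap M Ed := by
      have h3 := (Cs.small v hvd).1
      have : m * wq M p v ≤ (m + massC M c + lapseC M v₀ c B ρ) * wq M p v := by
        gcongr; linarith
      linarith
    obtain ⟨h3, h4, h5⟩ := S.on_gamma Cs.Ed_half hm0 (UOf_pos hM u) hU' hv' hEq h1 h2 hsm
    refine ⟨by unfold toEF; linarith, ?_⟩
    have hX : 0 < 2 * M * F.r (UOf M u) v - F.r (UOf M u) v ^ 2 := by nlinarith
    have hΩ := S.Ω_pos hU' hv'
    have hg : 0 ≤ gammaC M Ed := by unfold gammaC; positivity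
    have hUp := UOf_pos hM u
    rw [toEF, Omega2, exp_eq_UOf hM, Real.log_div (by positivity) hX.ne', exp_eq_EE hM hu]
    refine h5.trans ?_
    change _ ≤ gammaC M Ed * (ε * Δ₂ * EE M (UOf M u) v + C) * wq M p v
    rw [mul_assoc]
    have h6 : 0 ≤ ε * Δ₂ * EE M (UOf M u) v := by positivity
    have h7 : m ≤ ε * Δ₂ * EE M (UOf M u) v + C := by linarith [Cs.C_m]
    gcongr
  · have hz' : F.lam (UOf M u) v = 0 := by
      rw [← S.rect.sol.dV_r hU' hv]; exact hz
    constructor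
    · refine ⟨h, (redShift_iff hM Cs.Ed_eq hu).2 ?_⟩
      by_contra hlt
      have haE : EE M a vd ≤ Ed :=
        (EE_mono hM (hU.1.trans hU.2.le) ha le_rfl).trans Cs.U₀_vd
      obtain ⟨-, h1⟩ := S.noShift hEd0 Cs.Ed_half hm0
        (fun U hU v hv hE => (hred a b S U hU v hv hE).2) le_rfl Cs.hr₀ Cs.hqexp Cs.hvd haE Cs.small
        hU' hv' (not_le.1 hlt) h.2
      have h2 := h1.lam_le
      rw [hz', mul_zero] at h2
      linarith
    · have h1 := S.massFn_le hU' hv'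
      rw [hz', mul_zero, zero_add] at h1
      have h2 : |F.r (UOf M u) v - 2 * M| = 2 * |M - 1 / 2 * F.r (UOf M u) v| := by
        rw [show F.r (UOf M u) v - 2 * M = -(2 * (M - 1 / 2 * F.r (UOf M u) v)) by ring, abs_neg,
          abs_mul, abs_two]
      rw [toEF, h2]
      change _ ≤ C * M * wq M p v
      calc _ ≤ 2 * (massC M c * wq M p v) := by linarith
        _ = 2 * massC M c * wq M p v := by ring
        _ ≤ _ := mul_le_mul_of_nonneg_right Cs.C_mass hq.le
  · have hE := (redShift_iff hM Cs.Ed_eq hu).1 h.2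
    obtain ⟨h1, -, h2⟩ := hred a b S _ hU' v hv' hE
    rw [exp_eq_EE hM hu, du, (hasDerivAt_log_r2Omega2 hM S.rect.sol hU hv' (neg u v hu hE)).deriv]
    have h3 := h2.logr
    refine (abs_mul_UOf_le hM (m := 3 * m) (v := v) (D := wq M p v) ?_).trans ?_
    · refine (abs_add_le _ _).trans ?_
      rw [abs_mul, abs_two]
      linarith
    · change _ ≤ 1 / 2 * Δ₂ * EE M (UOf M u) v * wq M p v
      exact mul_le_mul_of_nonneg_right
        (mul_le_mul_of_nonneg_right (by linarith [Cs.Δ₂_m]) hE0.le) hq.le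
  · have hE := (redShift_iff hM Cs.Ed_eq hu).1 h.2
    have h1 := S.boot.A_le _ hU' v hv'
    have h2 := S.r_ge_redShift hU' hv' hE
    have e : dV v₀ (toEF M F.φ) u v = F.θ (UOf M u) v := S.rect.sol.dV_φ hU' hv
    rw [e, toEF]
    change _ ≤ 1 / 4 * Δ₁ * wP M p v
    rw [abs_mul, abs_of_pos (pow_pos hr 2)] at h1
    have h3 : F.r (UOf M u) v * |F.θ (UOf M u) v| * (ρ / 2) ≤ M * B * wP M p v := by
      calc _ ≤ F.r (UOf M u) v * |F.θ (UOf M u) v| * F.r (UOf M u) v := by gcongr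
        _ = F.r (UOf M u) v ^ 2 * |F.θ (UOf M u) v| := by ring
        _ ≤ _ := h1
    rw [le_div_iff₀ hM] at hΔρ
    have h4 : B * M * wP M p v ≤ 1 / 4 * Δ₁ * (ρ / 2) * wP M p v := by gcongr
    have : F.r (UOf M u) v * |F.θ (UOf M u) v| * (ρ / 2) ≤ 1 / 4 * Δ₁ * wP M p v * (ρ / 2) := by
      linarith
    exact le_of_mul_le_mul_right this (by positivity)
  · have hE := (redShift_iff hM Cs.Ed_eq hu).1 h.2
    have h1 := (S.rect.abs_ζ_le_iff hU' hv').1 (S.boot.ζ_le _ hU' v hv')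
    have h2 := S.r_ge_redShift hU' hv' hE
    rw [toEF, Yd, S.rect.sol.dU_φ hU hv', S.rect.sol.dU_r hU hv']
    change _ ≤ 1 / 4 * M⁻¹ * Δ₁ * wP M p v
    rw [mul_div_assoc, abs_mul, abs_of_pos hr] at h1
    have h3 : (ρ / 2) * |F.ζ (UOf M u) v / -F.ν (UOf M u) v| ≤ B * wP M p v :=
      le_trans (by gcongr) h1
    have h4 : B * wP M p v ≤ 1 / 4 * Δ₁ * (ρ / 2) / M * wP M p v := by gcongr
    have : (ρ / 2) * |F.ζ (UOf M u) v / -F.ν (UOf M u) v|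
        ≤ (ρ / 2) * (1 / 4 * M⁻¹ * Δ₁ * wP M p v) := by
      refine (h3.trans h4).trans_eq ?_
      field_simp
    exact le_of_mul_le_mul_left this (by positivity)

end Problem

/-! ### The estimates in the no-shift region -/

/-- The constant `C_{δ,r₀}`. -/
noncomputable def noShiftK (M δ e r₀ : ℝ) : ℝ :=
  2 * noShiftC M e r₀ + 2 * M / r₀ * (3 + noShiftC M e r₀)
    + 4 / gap M e * (2 * M * (2 * M / r₀ * (3 + noShiftC M e r₀)) + M)
    + 2 * (δ⁻¹ + 1) / M

namespace Problem

variable {M p D₂ D₃ v₀ ρ c B r₁ K k Ed v₁ η U₀ Δ₁ Δ₂ C ε δ r₀ m Kq vd : ℝ}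
  {rH lH φH θH nH rI nI φI ζI : ℝ → ℝ} {F : Fields}

theorem rStar_nonpos {r : ℝ} (hM : 0 < M) (hr : r < 2 * M) : rStar M r ≤ 0 := by
  have h0 : 0 < (2 * M - r) / (2 * M) := div_pos (by linarith) (by positivity)
  have h1 := Real.log_le_sub_one_of_pos h0
  have h2 : 2 * M * ((2 * M - r) / (2 * M) - 1) = -r := by field_simp; ring
  have h3 : 2 * M * Real.log ((2 * M - r) / (2 * M)) ≤ 2 * M * ((2 * M - r) / (2 * M) - 1) := by
    gcongr
  unfold rStar
  linarith

/-- In the no-shift region `-∂_u r = (-Ω̂⁻² ∂_U r) Ω²` is close to `M/r - 1/2`. -/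
theorem abs_mul_sub_le {f ψ r d X : ℝ} (hM : 0 < M) (hr₀ : 0 < r₀) (hr : r₀ ≤ r)
    (hr2 : r < 2 * M) (hX : X ≤ 1) (hf : |f - 1 / 2| ≤ d) (hψ : |ψ| ≤ X) :
    |f * (Real.exp ψ * ((2 * M * r - r ^ 2) / r ^ 2)) - (M / r - 1 / 2)|
      ≤ 2 * M / r₀ * (3 * d + X) := by
  have hr0 : 0 < r := hr₀.trans_le hr
  have e1 : f * (Real.exp ψ * ((2 * M * r - r ^ 2) / r ^ 2)) - (M / r - 1 / 2)
      = (2 * M / r - 1) * ((f - 1 / 2) * Real.exp ψ + 1 / 2 * (Real.exp ψ - 1)) := by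
    field_simp; ring
  have h1 : 0 ≤ 2 * M / r - 1 := by
    rw [sub_nonneg, le_div_iff₀ hr0]; linarith
  have h2 : 2 * M / r - 1 ≤ 2 * M / r₀ := by
    have : 2 * M / r ≤ 2 * M / r₀ := by gcongr
    linarith
  have h3 := Real.abs_exp_sub_one_le (hψ.trans hX)
  have h4 : Real.exp ψ ≤ 3 := by
    have := (abs_le.1 h3).2
    linarith
  have h5 : |(f - 1 / 2) * Real.exp ψ + 1 / 2 * (Real.exp ψ - 1)| ≤ 3 * d + X := by
    refine (abs_add_le _ _).trans ?_
    rw [abs_mul, abs_mul, abs_of_pos (Real.exp_pos ψ), abs_of_pos (by norm_num : (0 : ℝ) < 1 / 2)]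
    have : |f - 1 / 2| * Real.exp ψ ≤ d * 3 := by
      have := (abs_nonneg _).trans hf
      gcongr
    linarith
  rw [e1, abs_mul, abs_of_nonneg h1]
  gcongr

set_option maxHeartbeats 1000000 in
/-- The estimates of the no-shift region in the form of the theorem, in the coordinates `(u, v)`. -/
theorem noShiftEstimates
    (Pb : Problem M p D₂ D₃ v₀ ρ c B r₁ K k Ed v₁ η U₀ rH lH φH θH nH rI nI φI ζI F)
    (Cs : Constants M p v₀ ρ c B Δ₁ Δ₂ C ε δ r₀ Ed m Kq vd U₀)
    (hred : ∀ a b, Setting M p D₂ D₃ v₀ ρ c B r₁ K k Ed v₁ η rH lH θH nH F a b →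
      ∀ U ∈ Icc 0 a, ∀ v ∈ Icc v₀ b, EE M U v ≤ Ed →
        |F.β U v - βK M U v| ≤ m * (wq M p v * Real.exp (v / (4 * M))) ∧
        |Real.log (F.Ω U v) - Real.log (ΩK M U v)| ≤ m * wq M p v * EE M U v ∧
        CloseToKruskal M m F U v (wq M p v)) :
    NoShiftEstimates M p v₀ Δ₁ Δ₂ C ε δ (1 / r₀ ^ 2) (noShiftK M δ Ed r₀)
      (DReg (goodRegion M p v₀ c B r₁ K k Ed U₀ F) F.r r₀) F.r F.Ω F.φ := by
  have hM := Pb.hM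
  have hB := Pb.B_pos
  have hδ := Cs.hδ
  have hm0 : 0 < m := by linarith [Cs.hm]
  have hC0 : 0 < C := by linarith [Cs.C_one]
  have hε := Cs.hε
  have hr₀ := Cs.hr₀
  have hc := Pb.hc
  have hΔ₂ : 0 < Δ₂ := by linarith [Cs.Δ₂_m]
  have hEd0 : 0 < Ed := by rw [Cs.Ed_eq]; exact Real.exp_pos _
  have hEd1 : Ed < 1 := by linarith [Cs.Ed_half]
  have hgap := gap_pos hM hEd0 hEd1
  set d := gap M Ed with hd
  set N := noShiftC M Ed r₀ with hN
  have hN0 : 0 < N := by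
    rw [hN]
    unfold noShiftC gammaC noShiftLength
    rw [← hd]
    positivity
  have hΔB : B ≤ Δ₁ := by linarith [Cs.Δ₁_B]
  have hεΔ : 0 < ε * Δ₂ := by positivity
  -- the data at a point of the no-shift region
  have pt : ∀ u v, (u, v) ∈ NoShift M δ (DReg (goodRegion M p v₀ c B r₁ K k Ed U₀ F) F.r r₀) →
      |u| = -u ∧ r₀ ≤ F.r (UOf M u) v ∧ vd ≤ v ∧ -δ⁻¹ < v - |u| ∧
      ∃ a b X, UOf M u ∈ Ico 0 a ∧ v ∈ Ico v₀ b ∧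
        Setting M p D₂ D₃ v₀ ρ c B r₁ K k Ed v₁ η rH lH θH nH F a b ∧
        NoShiftBounds M d X F (UOf M u) v ∧ 0 ≤ X ∧ X ≤ 1 / 4 ∧ X ≤ N * (C * wq M p v) := by
    rintro u v ⟨h, hn⟩
    have h1 : (UOf M u, v) ∈ goodRegion M p v₀ c B r₁ K k Ed U₀ F := h.1
    obtain ⟨a, b, hU, hv, ha, S⟩ := Pb.exists_setting h1
    have hu := (abs_eq_neg_of_UOf_lt hM Pb.hv₀ Cs.U₀_v₀ h1.1.1.2).2
    have hgt : -δ⁻¹ < v - |u| := by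
      by_contra hle
      exact hn ⟨h, not_lt.1 hle⟩
    have hE : Ed < EE M (UOf M u) v := by
      by_contra hle
      exact absurd ((redShift_iff hM Cs.Ed_eq hu).2 (not_lt.1 hle)) (not_le.2 hgt)
    have hU' := Ico_subset_Icc_self hU
    have hv' := Ico_subset_Icc_self hv
    have haE : EE M a vd ≤ Ed :=
      (EE_mono hM (hU.1.trans hU.2.le) ha le_rfl).trans Cs.U₀_vd
    obtain ⟨h2, h3⟩ := S.noShift hEd0 Cs.Ed_half hm0
      (fun U hU v hv hE => (hred a b S U hU v hv hE).2) le_rfl Cs.hr₀ Cs.hqexp Cs.hvd haE Cs.small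
      hU' hv' hE h.2
    have hq := S.q_pos hv'
    refine ⟨hu, h.2, h2, hgt, a, b, _, hU, hv, S, h3, (abs_nonneg _).trans h3.level,
      (Cs.small' v h2).1, ?_⟩
    have := Cs.C_Y
    gcongr
  -- Since `v / M ≥ 1`, the weight `x^{-2p+1}` is at most `x^{-2p+2}`.
  have fin : ∀ {y κ v : ℝ}, vd ≤ v → y ≤ κ * (C * wq M p v) → 0 ≤ κ → κ ≤ noShiftK M δ Ed r₀ →
      y ≤ noShiftK M δ Ed r₀ * (C + ε * Δ₂) * (v / M) ^ (-2 * p + 2) := by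
    intro y κ v hv hy hκ hκ'
    have h1 : 1 ≤ v / M := by
      rw [le_div_iff₀ hM]; linarith [Cs.vd_M]
    have h2 : wq M p v ≤ (v / M) ^ (-2 * p + 2) :=
      Real.rpow_le_rpow_of_exponent_le h1 (by linarith)
    have h3 : 0 < wq M p v := wq_pos hM (by linarith [Cs.vd_two])
    refine hy.trans ?_
    rw [mul_assoc]
    have : C * wq M p v ≤ (C + ε * Δ₂) * (v / M) ^ (-2 * p + 2) := by
      gcongr; linarith
    have := hκ.trans hκ'
    gcongr
  have hκ₁ : 2 * N ≤ noShiftK M δ Ed r₀ := by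
    unfold noShiftK
    rw [← hN, ← hd]
    have h1 : 0 ≤ 2 * M / r₀ * (3 + N) := by positivity
    have h2 : 0 ≤ 4 / d * (2 * M * (2 * M / r₀ * (3 + N)) + M) := by positivity
    have h3 : 0 ≤ 2 * (δ⁻¹ + 1) / M := by positivity
    linarith
  have hκ₂ : 2 * M / r₀ * (3 + N) ≤ noShiftK M δ Ed r₀ := by
    unfold noShiftK
    rw [← hN, ← hd]
    have h2 : 0 ≤ 4 / d * (2 * M * (2 * M / r₀ * (3 + N)) + M) := by positivity
    have h3 : 0 ≤ 2 * (δ⁻¹ + 1) / M := by positivity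
    linarith
  have hκ₃ : 4 / d * (2 * M * (2 * M / r₀ * (3 + N)) + M) ≤ noShiftK M δ Ed r₀ := by
    unfold noShiftK
    rw [← hN, ← hd]
    have h1 : 0 ≤ 2 * M / r₀ * (3 + N) := by positivity
    have h3 : 0 ≤ 2 * (δ⁻¹ + 1) / M := by positivity
    linarith
  have hκ₄ : 2 * (δ⁻¹ + 1) / M ≤ noShiftK M δ Ed r₀ := by
    unfold noShiftK
    rw [← hN, ← hd]
    have h1 : 0 ≤ 2 * M / r₀ * (3 + N) := by positivity
    have h2 : 0 ≤ 4 / d * (2 * M * (2 * M / r₀ * (3 + N)) + M) := by positivity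
    linarith
  have du_r : ∀ {u v a b : ℝ}, UOf M u ∈ Ico 0 a → v ∈ Ico v₀ b →
      Setting M p D₂ D₃ v₀ ρ c B r₁ K k Ed v₁ η rH lH θH nH F a b →
      du (toEF M F.r) u v = F.ν (UOf M u) v * (UOf M u / (4 * M)) := fun hU hv S =>
    (hasDerivAt_comp_UOf hM hU (S.rect.sol.r_U _ (Ico_subset_Icc_self hU) _
      (Ico_subset_Icc_self hv))).deriv
  -- `-∂_u r` is the product of `-Ω̂⁻² ∂_U r` and `Ω²`
  have hdur_eq : ∀ {u v a b : ℝ}, UOf M u ∈ Ico 0 a → v ∈ Ico v₀ b →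
      Setting M p D₂ D₃ v₀ ρ c B r₁ K k Ed v₁ η rH lH θH nH F a b → F.r (UOf M u) v < 2 * M →
      -(F.ν (UOf M u) v * (UOf M u / (4 * M))) = -F.ν (UOf M u) v / F.Ω (UOf M u) v
        * (Real.exp (Real.log (F.r (UOf M u) v ^ 2 * (F.Ω (UOf M u) v * (UOf M u / (4 * M))))
            - Real.log (2 * M * F.r (UOf M u) v - F.r (UOf M u) v ^ 2))
          * ((2 * M * F.r (UOf M u) v - F.r (UOf M u) v ^ 2) / F.r (UOf M u) v ^ 2)) := by
    intro u v a b hU hv S hr2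
    have hr0 := S.r_pos (Ico_subset_Icc_self hU) (Ico_subset_Icc_self hv)
    have hΩ := S.Ω_pos (Ico_subset_Icc_self hU) (Ico_subset_Icc_self hv)
    have hUp := UOf_pos hM u
    have hX' : 0 < 2 * M * F.r (UOf M u) v - F.r (UOf M u) v ^ 2 := by nlinarith
    rw [Real.exp_sub, Real.exp_log (by positivity), Real.exp_log hX']
    generalize 2 * M * F.r (UOf M u) v - F.r (UOf M u) v ^ 2 = y at hX'
    field_simp
  have hdur : ∀ {u v a b X : ℝ}, UOf M u ∈ Ico 0 a → v ∈ Ico v₀ b →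
      Setting M p D₂ D₃ v₀ ρ c B r₁ K k Ed v₁ η rH lH θH nH F a b →
      r₀ ≤ F.r (UOf M u) v → NoShiftBounds M d X F (UOf M u) v → X ≤ 1 / 4 →
      |-(F.ν (UOf M u) v * (UOf M u / (4 * M))) - (M / F.r (UOf M u) v - 1 / 2)|
        ≤ 2 * M / r₀ * (3 * ((c + 1) * wq M p v) + X) := by
    intro u v a b X hU hv S hr hb hX
    have hU' := Ico_subset_Icc_self hU
    have hv' := Ico_subset_Icc_self hv
    have hr2 : F.r (UOf M u) v < 2 * M := by linarith [hb.r_le]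
    rw [hdur_eq hU hv S hr2]
    exact abs_mul_sub_le hM hr₀ hr hr2 (by linarith : X ≤ 1) (S.f_near hU' hv') hb.lapse
  have hsum : ∀ {v X : ℝ}, 0 < wq M p v → X ≤ N * (C * wq M p v) →
      2 * M / r₀ * (3 * ((c + 1) * wq M p v) + X)
        ≤ 2 * M / r₀ * (3 + N) * (C * wq M p v) := by
    intro v X hq hX
    rw [mul_assoc]
    have : (c + 1) * wq M p v ≤ C * wq M p v := mul_le_mul_of_nonneg_right Cs.C_f hq.le
    gcongr
    linarith
  refine ⟨fun u v h => ?_, fun u v h => ?_, fun u v h => ?_, fun u v h => ?_, fun u v h => ?_,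
    fun u v h => ?_, fun u v h => ?_, fun u v h => ?_, fun u v h => ?_, fun u v h => ?_⟩
  all_goals
    obtain ⟨hu, hr₀r, hvd, hgt, a, b, X, hU, hv, S, hb, hX0, hX1, hX2⟩ := pt u v h
    have hU' := Ico_subset_Icc_self hU
    have hv' := Ico_subset_Icc_self hv
    have hr := S.r_pos hU' hv'
    have hq := S.q_pos hv'
    have hP := S.P_pos hv'
    have hUp := UOf_pos hM u
    have hΩ := S.Ω_pos hU' hv'
    have hr2 : F.r (UOf M u) v < 2 * M := by linarith [hb.r_le]
    have hCq : 0 < C * wq M p v := by positivity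
  · exact hr2
  · have hX' : 0 < 2 * M * F.r (UOf M u) v - F.r (UOf M u) v ^ 2 := by nlinarith
    have h1 := hb.lapse
    have h2 := Real.abs_exp_sub_one_le (h1.trans (hX1.trans (by norm_num)))
    rw [Real.exp_sub, Real.exp_log (by positivity), Real.exp_log hX'] at h2
    rw [toEF, Omega2, exp_eq_UOf hM]
    refine fin hvd (h2.trans ?_) (by positivity) hκ₁
    linarith
  · have h1 := S.lapse_le hU' hv'
    have hd' := (((S.rect.sol.r_v _ hU' v hv').log hr.ne').const_mul 2).add
      (S.rect.sol.logΩ_v hU' hv')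
    have e : dV v₀ (fun u' v' => Real.log (toEF M F.r u' v' ^ 2 * Omega2 M F.Ω u' v')) u v
        = 2 * (F.lam (UOf M u) v / F.r (UOf M u) v) + F.α (UOf M u) v := by
      refine dV_eq hv (g := fun t => 2 * Real.log (F.r (UOf M u) t) + Real.log (F.Ω (UOf M u) t)
        + u / (4 * M)) (fun t ht => ?_) (hd'.add_const _)
      have e1 := S.r_pos hU' (Ico_subset_Icc_self ht)
      have e2 := S.Ω_pos hU' (Ico_subset_Icc_self ht)
      rw [toEF, Omega2, Real.log_mul (by positivity) (mul_pos e2 (Real.exp_pos _)).ne',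
        Real.log_mul e2.ne' (Real.exp_pos _).ne', Real.log_exp, Real.log_pow]
      push_cast
      ring
    rw [e, toEF]
    have hl := S.lapseC_nonneg
    change _ ≤ 1 / r₀ ^ 2 * C * wq M p v
    calc _ = |F.α (UOf M u) v + 2 * F.lam (UOf M u) v / F.r (UOf M u) v - 1 / F.r (UOf M u) v
          + M / F.r (UOf M u) v ^ 2| := by congr 1; ring
      _ ≤ lapseC M v₀ c B ρ * wq M p v / F.r (UOf M u) v ^ 2 := h1
      _ ≤ C * wq M p v / r₀ ^ 2 := by
        have := Cs.C_lapse
        gcongr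
      _ = _ := by ring
  · rw [du_r hU hv S]
    exact fin hvd ((hdur hU hv S hr₀r hb hX1).trans (hsum hq hX2)) (by positivity) hκ₂
  · have h1 := (hdur hU hv S hr₀r hb hX1).trans (hsum hq hX2)
    have h2 := S.massFn_le hU' hv'
    have h3 := hb.lam_le
    have e : dV v₀ (toEF M F.r) u v = F.lam (UOf M u) v := S.rect.sol.dV_r hU' hv
    rw [du_r hU hv S, e]
    set x := F.ν (UOf M u) v * (UOf M u / (4 * M)) with hx
    set r := F.r (UOf M u) v with hr'
    set l := F.lam (UOf M u) v with hl'
    have hl0 : r * l < 0 := by linarith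
    have hl0' : l ≠ 0 := fun h0 => by rw [h0, mul_zero] at hl0; exact lt_irrefl _ hl0
    have e1 : x / l - 1 = (r * x - r * l) / (r * l) := by field_simp
    have e2 : r * x - r * l = -(r * (-x - (M / r - 1 / 2))) - (r * l + (M - 1 / 2 * r)) := by
      field_simp; ring
    have h4 : |r * x - r * l| ≤ 2 * M * (2 * M / r₀ * (3 + N) * (C * wq M p v)) + M * (C * wq M p v) := by
      rw [e2]
      refine (abs_sub _ _).trans ?_
      rw [abs_neg, abs_mul, abs_of_pos hr]
      have h5 : massC M c * wq M p v ≤ C * M * wq M p v := by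
        have := S.massC_pos
        have := Cs.C_mass
        exact mul_le_mul_of_nonneg_right (by linarith) hq.le
      have h6 : r * |-x - (M / r - 1 / 2)| ≤ 2 * M * (2 * M / r₀ * (3 + N) * (C * wq M p v)) := by
        gcongr
      linarith
    have h7 : |x / l - 1| ≤ 4 / d * (2 * M * (2 * M / r₀ * (3 + N)) + M) * (C * wq M p v) := by
      rw [e1, abs_div, abs_of_neg hl0, div_le_iff₀ (by linarith)]
      have h8 : 0 ≤ 4 / d * (2 * M * (2 * M / r₀ * (3 + N)) + M) * (C * wq M p v) := by positivity
      calc _ ≤ _ := h4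
        _ = 4 / d * (2 * M * (2 * M / r₀ * (3 + N)) + M) * (C * wq M p v) * (d / 4) := by
          field_simp
        _ ≤ _ := mul_le_mul_of_nonneg_left (by linarith) h8
    exact fin hvd h7 (by positivity) hκ₃
  · have h1 := S.boot.A_le _ hU' v hv'
    have e : dV v₀ (toEF M F.φ) u v = F.θ (UOf M u) v := S.rect.sol.dV_φ hU' hv
    rw [abs_mul, abs_of_pos (pow_pos hr 2)] at h1
    rw [e, toEF]
    change _ ≤ M * Δ₁ * wP M p v
    exact h1.trans (by gcongr)
  · have h2 := S.boot.ζ_le _ hU' v hv'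
    have e : du (toEF M F.φ) u v = F.ζ (UOf M u) v * (UOf M u / (4 * M)) :=
      (hasDerivAt_comp_UOf hM hU (S.rect.sol.φ_U _ hU' _ hv')).deriv
    rw [e, toEF]
    -- `r (-∂_u r) ≤ 2M`, since `-Ω̂⁻² ∂_U r ≤ 5/8` and `r² Ω² ≤ (3/2) (2M r - r²)`
    have h1 : F.r (UOf M u) v * -(F.ν (UOf M u) v * (UOf M u / (4 * M))) ≤ 2 * M := by
      rw [hdur_eq hU hv S hr2]
      have h3 := (abs_le.1 (S.f_near hU' hv')).2
      have h4 := (Cs.small' v hvd).2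
      have h5 := (abs_le.1 (Real.abs_exp_sub_one_le (hb.lapse.trans (hX1.trans (by norm_num))))).2
      have h6 := hb.lapse
      set f := -F.ν (UOf M u) v / F.Ω (UOf M u) v
      set ψ := Real.log (F.r (UOf M u) v ^ 2 * (F.Ω (UOf M u) v * (UOf M u / (4 * M))))
            - Real.log (2 * M * F.r (UOf M u) v - F.r (UOf M u) v ^ 2)
      have h7 : f * Real.exp ψ ≤ 5 / 8 * (3 / 2) := by
        have := Real.exp_pos ψ
        gcongr
        · linarith
        · linarith
      calc _ = f * Real.exp ψ * (2 * M - F.r (UOf M u) v) := by field_simp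
        _ ≤ 1 * (2 * M - F.r (UOf M u) v) := by
          gcongr
          · linarith
        _ ≤ 2 * M := by linarith
    rw [abs_mul, abs_of_pos hr] at h2
    rw [abs_mul, abs_of_pos (by positivity : 0 < UOf M u / (4 * M))]
    change _ ≤ M * Δ₁ * wP M p v
    have hΔ := Cs.Δ₁_B
    calc _ = F.r (UOf M u) v * (UOf M u / (4 * M))
          * (F.r (UOf M u) v * |F.ζ (UOf M u) v|) := by ring
      _ ≤ F.r (UOf M u) v * (UOf M u / (4 * M)) * (B * wP M p v * -F.ν (UOf M u) v) := by gcongr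
      _ = B * wP M p v
          * (F.r (UOf M u) v * -(F.ν (UOf M u) v * (UOf M u / (4 * M)))) := by ring
      _ ≤ B * wP M p v * (2 * M) := by gcongr
      _ = M * (2 * B) * wP M p v := by ring
      _ ≤ _ := by gcongr
  · have h1 := (S.rect.abs_ζ_le_iff hU' hv').1 (S.boot.ζ_le _ hU' v hv')
    rw [toEF, toEF, Yd, S.rect.sol.dU_φ hU hv', S.rect.sol.dU_r hU hv']
    rw [mul_div_assoc, abs_mul, abs_of_pos hr] at h1
    change _ ≤ Δ₁ * wP M p v
    exact h1.trans (by gcongr)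
  · have h1 := hb.level
    rw [← exp_eq_UOf hM, Real.log_exp] at h1
    have e : 4 * M * (u / (4 * M)) = u := by field_simp
    rw [e] at h1
    rw [hu, toEF, sub_neg_eq_add]
    refine fin hvd (h1.trans (hX2.trans ?_)) (by positivity) hκ₁
    have : 0 < N * (C * wq M p v) := by positivity
    linarith
  · have h1 := hb.level
    rw [← exp_eq_UOf hM, Real.log_exp] at h1
    have e : 4 * M * (u / (4 * M)) = u := by field_simp
    rw [e] at h1
    have h2 := rStar_nonpos hM hr2
    have h3 := (abs_le.1 h1).2
    have hv2 := Cs.vd_two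
    have hδ' : 0 < δ⁻¹ := by positivity
    rw [hu] at hgt
    -- `v - |u|` lies between `-1/δ` and a small number
    have h4 : |u + v| ≤ δ⁻¹ + 1 := by
      rw [abs_le]; constructor <;> linarith
    have h5 : v / 2 ≤ -u := by linarith
    have h6 : 0 < v := by linarith
    have h7 : 1 - v / |u| = -(u + v) / -u := by
      have hne : -u ≠ 0 := by linarith
      rw [hu, eq_div_iff hne, sub_mul, div_mul_cancel₀ _ hne]
      ring
    rw [h7, abs_div, abs_neg, abs_of_pos (by linarith : 0 < -u), Real.rpow_neg_one, inv_div]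
    have h8 : |u + v| / -u ≤ (δ⁻¹ + 1) / (v / 2) := by gcongr
    have h9 : 0 ≤ noShiftK M δ Ed r₀ := le_trans (by positivity) hκ₁
    have h10 : 1 ≤ C + ε * Δ₂ := by linarith [Cs.C_one]
    calc _ ≤ (δ⁻¹ + 1) / (v / 2) := h8
      _ = 2 * (δ⁻¹ + 1) / M * 1 * (M / v) := by field_simp
      _ ≤ _ := by gcongr

end Problem

/-! ### The choice of the constants -/

theorem exp_neg_inv_div_le {M δ e : ℝ} (hM : 0 < M) (hδ : 0 < δ) (h : δ ≤ e / (4 * M)) :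
    Real.exp (-δ⁻¹ / (4 * M)) ≤ e := by
  have h1 : 0 < δ⁻¹ / (4 * M) := by positivity
  have h2 := Real.add_one_le_exp (δ⁻¹ / (4 * M))
  rw [neg_div, Real.exp_neg]
  refine (inv_anti₀ h1 (by linarith)).trans ?_
  rw [inv_div, div_inv_eq_mul]
  rw [le_div_iff₀ (by positivity)] at h
  linarith

theorem massC_pos_of_pos {M c : ℝ} (hM : 0 < M) (hc : 1 ≤ c) : 0 < massC M c := by
  unfold massC; positivity

theorem lapseC_pos_of_pos {M v₀ c B ρ : ℝ} (hM : 0 < M) (hv₀ : 0 < v₀) (hρ : 0 < ρ) (hc : 1 ≤ c) :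
    0 < lapseC M v₀ c B ρ := by
  have := massC_pos_of_pos hM hc
  unfold lapseC; positivity

/-- From some `v` on, all error terms in the no-shift region are small. -/
theorem exists_noShift_time {M p v₀ Y c N e : ℝ} (hM : 0 < M) (hp : 1 < p) (Kq : ℝ) (he : 0 < e) :
    ∃ vd : ℝ, v₀ ≤ vd ∧ M ≤ vd ∧ 2 ≤ vd ∧
      (∀ t, vd ≤ t → Y * wq M p t ≤ e / 4 ∧ Y * wq M p t ≤ e / (4 * M)) ∧
      ∀ t, vd ≤ t → N * (Kq * Y * wq M p t) ≤ 1 / 4 ∧ (c + 1) * wq M p t ≤ 1 / 8 := by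
  have lim : ∀ a : ℝ, Tendsto (fun t => a * wq M p t) atTop (𝓝 0) := fun a => by
    simpa using (tendsto_wq hM hp).const_mul a
  have ev : ∀ᶠ t in atTop, (Y * wq M p t ≤ e / 4 ∧ Y * wq M p t ≤ e / (4 * M)) ∧
      (N * (Kq * Y) * wq M p t ≤ 1 / 4 ∧ (c + 1) * wq M p t ≤ 1 / 8) :=
    (((lim Y).eventually_le_const (by positivity)).and
      ((lim Y).eventually_le_const (by positivity))).and
    (((lim _).eventually_le_const (by norm_num)).and ((lim _).eventually_le_const (by norm_num)))
  obtain ⟨w, hw⟩ := eventually_atTop.1 ev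
  refine ⟨max w (max v₀ (max M 2)), le_max_of_le_right (le_max_left _ _),
    le_max_of_le_right (le_max_of_le_right (le_max_left _ _)),
    le_max_of_le_right (le_max_of_le_right (le_max_right _ _)),
    fun t ht => (hw t ((le_max_left _ _).trans ht)).1, fun t ht => ?_⟩
  have h := (hw t ((le_max_left _ _).trans ht)).2
  rwa [mul_assoc] at h

end EinsteinScalar

open EinsteinScalar in
theorem proposition7 (M p : ℝ) (hM : 0 < M) (hp : 1 < p) :
    -- constants `C`, `C_δ`, `C_{r₀}`, `C_{δ,r₀}`
    ∃ (C₀ : ℝ) (Kδ Kr : ℝ → ℝ) (Kδr : ℝ → ℝ → ℝ),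
    -- `ρ` is a lower bound for the radius of the sphere where the initial hypersurfaces meet
    ∀ D₂ D₃ v₀ ρ : ℝ, 0 < D₂ → 0 < D₃ → 0 < v₀ → 0 < ρ →
    ∃ Δ₁min : ℝ, 0 < Δ₁min ∧ ∀ Δ₁ : ℝ, Δ₁min ≤ Δ₁ →
    ∃ C : ℝ, 0 < C ∧
    ∃ Δ₂min : ℝ, 0 < Δ₂min ∧ ∀ Δ₂ : ℝ, Δ₂min ≤ Δ₂ →
    ∀ ε : ℝ, 0 < ε →
    ∃ δmax : ℝ, 0 < δmax ∧ ∀ δ : ℝ, 0 < δ → δ ≤ δmax →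
    ∀ r₀ : ℝ, 0 < r₀ →
    -- the bound on `Umax` says that the ingoing cone lies in the Schwarzschild coordinate range
    ∃ Umax : ℝ, 0 < Umax ∧ Umax < 4 * M * Real.exp (-v₀ / (4 * M)) ∧
    ∀ U₀ : ℝ, 0 < U₀ → U₀ ≤ Umax →
    ∀ q D₁ : ℝ, p ≤ q → q < 3 * p - 1 → 0 < D₁ →
    ∀ rH φH rI φI : ℝ → ℝ,
    EinsteinScalar.IsInitialData M p q D₁ D₂ D₃ v₀ U₀ rH φH rI φI →
    ρ ≤ rH v₀ → (∀ U ∈ Set.Icc 0 U₀, r₀ < rI U) →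
    ∃ (Q : Set (ℝ × ℝ)) (r Ω2 φ : ℝ → ℝ → ℝ),
      EinsteinScalar.IsFullDomain v₀ U₀ r₀ Q r ∧
      EinsteinScalar.IsSolutionOn v₀ Q r Ω2 φ ∧
      EinsteinScalar.AttainsData M v₀ U₀ rH φH rI φI r Ω2 φ ∧
      (∀ U v, (U, v) ∈ Q → EinsteinScalar.dU r U v < 0) ∧
      EinsteinScalar.GlobalEstimates M p v₀ Δ₁ C (EinsteinScalar.DReg Q r r₀) r Ω2 φ ∧
      EinsteinScalar.RedShiftEstimates M p v₀ Δ₁ Δ₂ C₀ C ε δ (Kδ δ)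
        (EinsteinScalar.DReg Q r r₀) r Ω2 φ ∧
      EinsteinScalar.NoShiftEstimates M p v₀ Δ₁ Δ₂ C ε δ (Kr r₀) (Kδr δ r₀)
        (EinsteinScalar.DReg Q r r₀) r Ω2 φ := by
  refine ⟨1, fun δ => gammaC M (Real.exp (-δ⁻¹ / (4 * M))), fun r₀ => 1 / r₀ ^ 2,
    fun δ r₀ => noShiftK M δ (Real.exp (-δ⁻¹ / (4 * M))) r₀,
    fun D₂ D₃ v₀ ρ hD₂ hD₃ hv₀ hρ => ?_⟩
  obtain ⟨c, hc, hhor⟩ := exists_horizonBounds (D₂ := D₂) hM hp hD₃ hv₀ hρ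
  obtain ⟨B, hBD₂, hBD₃, hset⟩ := exists_setting hM hp hD₂ hD₃ hv₀ hρ hc
  have hB : 0 < B := by linarith
  obtain ⟨m, hm, E₀, hE₀, hE₀', hred⟩ := Setting.exists_redShift M p v₀ ρ c B hM hp hv₀ hρ hc hB
  obtain ⟨Kq, hKq, hqexp⟩ := exists_wq_le_exp hM hp hv₀
  have hmass := massC_pos_of_pos hM hc
  have hlapse := lapseC_pos_of_pos (B := B) hM hv₀ hρ hc
  set Y := m + massC M c + lapseC M v₀ c B ρ with hY
  have hY0 : 0 < Y := by positivity
  have hq₀ := wq_pos (p := p) hM hv₀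
  have hc0 : 0 < c := by linarith
  have hm0 : 0 < m := by linarith
  refine ⟨2 * B + 8 * M * B / ρ, by positivity, fun Δ₁ hΔ₁ => ?_⟩
  set C := m + m / M + (c + 1) + 2 * massC M c / M + lapseC M v₀ c B ρ + Kq * Y with hC
  have hC_M : C * M = m + 2 * massC M c
      + M * (m + (c + 1) + lapseC M v₀ c B ρ + Kq * Y) := by
    rw [hC]; field_simp; ring
  have t1 : 0 < m / M := by positivity
  have t2 : 0 < 2 * massC M c / M := by positivity
  have t3 : 0 < Kq * Y := by positivity
  have t4 : 0 < M * (m + (c + 1) + lapseC M v₀ c B ρ + Kq * Y) := by positivity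
  have t5 : 0 < 8 * M * B / ρ := by positivity
  refine ⟨C, by positivity, 6 * m, by positivity, fun Δ₂ hΔ₂ ε hε => ?_⟩
  have hΔ₂0 : 0 < Δ₂ := by linarith
  -- The bound for `E` on the curve between the regions; the last two entries absorb errors by
  -- `ε Δ₂`.
  set e := min E₀ (min (M / (128 * c)) (min (M / (64 * c)) (min (1 / (m * wq M p v₀))
    (ε * Δ₂ / (2 * m))))) with he
  have he0 : 0 < e := by positivity
  refine ⟨e / (4 * M), by positivity, fun δ hδ hδe r₀ hr₀ => ?_⟩
  set Ed := Real.exp (-δ⁻¹ / (4 * M)) with hEd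
  have hEd0 : 0 < Ed := Real.exp_pos _
  have hEde : Ed ≤ e := exp_neg_inv_div_le hM hδ hδe
  simp only [he, le_min_iff] at hEde
  obtain ⟨hEd₁, hEd₂, hEd₃, hEd₄, hEd₅⟩ := hEde
  rw [le_div_iff₀ (by positivity)] at hEd₂ hEd₃ hEd₄ hEd₅
  have hgap := gap_pos hM hEd0 (by linarith : Ed < 1)
  -- A radius below `r₀` down to which the solution is controlled.
  set r₁ := min r₀ M / 2 with hr₁
  have hr₁0 : 0 < r₁ := by positivity
  have hr₁M : r₁ ≤ M / 2 := by
    rw [hr₁]; linarith [min_le_right r₀ M]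
  have hr₁r₀ : r₁ < r₀ := by
    rw [hr₁]; linarith [min_le_left r₀ M]
  -- `K` exceeds both crude constants.
  set K := |crudeC M p v₀ c B ρ r₁| + |cornerC M p D₂ D₃ v₀ ρ c| + 1 with hK
  have hK0 : 0 < K := by positivity
  have hK₁ : crudeC M p v₀ c B ρ r₁ < K := by
    linarith [le_abs_self (crudeC M p v₀ c B ρ r₁), abs_nonneg (cornerC M p D₂ D₃ v₀ ρ c)]
  have hK₂ : cornerC M p D₂ D₃ v₀ ρ c < K := by
    linarith [le_abs_self (cornerC M p D₂ D₃ v₀ ρ c), abs_nonneg (crudeC M p v₀ c B ρ r₁)]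
  obtain ⟨v₁, η, a₀, ha₀, hset⟩ := hset r₁ Ed K hr₁0 hr₁M
    (by rw [div_mul_eq_mul_div, div_le_iff₀ hM]; linarith) (by linarith) hK0
  obtain ⟨vd, hvd, hvdM, hvd2, hsm, hsm'⟩ := exists_noShift_time (v₀ := v₀) (Y := Y) (c := c)
    (N := noShiftC M Ed r₀) hM hp Kq hgap
  have hexp := Real.exp_pos (-v₀ / (4 * M))
  -- The three conditions on `U₀`: closeness to the horizon up to `v₁`, the range of the Schwarzschild
  -- coordinates, and that the curve between the regions begins after `vd`.
  refine ⟨min a₀ (min (2 * M * Real.exp (-v₀ / (4 * M)))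
    (4 * M * Ed * Real.exp (-vd / (4 * M)))), by positivity,
    (min_le_right _ _).trans_lt ((min_le_left _ _).trans_lt (by gcongr; norm_num)),
    fun U₀ hU₀ hUmax q D₁ _ _ hD₁ rH φH rI φI hdata hρH hrI => ?_⟩
  simp only [le_min_iff] at hUmax
  obtain ⟨hUa, hUv₀, hUvd⟩ := hUmax
  have hexp1 : Real.exp (-v₀ / (4 * M)) * Real.exp (v₀ / (4 * M)) = 1 := by
    rw [← Real.exp_add, neg_div, neg_add_cancel, Real.exp_zero]
  have hexp2 : Real.exp (-vd / (4 * M)) * Real.exp (vd / (4 * M)) = 1 := by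
    rw [← Real.exp_add, neg_div, neg_add_cancel, Real.exp_zero]
  have hE1 : EE M U₀ v₀ < 1 := by
    unfold EE
    calc _ ≤ 2 * M * Real.exp (-v₀ / (4 * M)) / (4 * M) * Real.exp (v₀ / (4 * M)) := by gcongr
      _ = 1 / 2 * (Real.exp (-v₀ / (4 * M)) * Real.exp (v₀ / (4 * M))) := by field_simp; norm_num
      _ < 1 := by rw [hexp1]; norm_num
  have hEvd : EE M U₀ vd ≤ Ed := by
    unfold EE
    calc _ ≤ 4 * M * Ed * Real.exp (-vd / (4 * M)) / (4 * M) * Real.exp (vd / (4 * M)) := by gcongr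
      _ = Ed * (Real.exp (-vd / (4 * M)) * Real.exp (vd / (4 * M))) := by field_simp
      _ = Ed := by rw [hexp2, mul_one]
  obtain ⟨nH, F, Pb⟩ := hdata.exists_problem hM hp hD₁ hD₂ hD₃ hv₀ hρ hρH hc hhor hBD₂ hBD₃ hr₁0
    (by positivity) hU₀ hE1 (fun U hU => hr₁r₀.trans (hrI U hU)) hK₁ hK₂ hUa hset
  have Cs : Constants M p v₀ ρ c B Δ₁ Δ₂ C ε δ r₀ Ed m Kq vd U₀ :=
    { hδ := hδ, hε := hε, hr₀ := hr₀, Ed_eq := rfl, Ed_half := hEd₁.trans hE₀', hm := hm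
      Δ₁_B := by linarith
      Δ₁_ρ := by linarith
      C_one := by rw [hC]; linarith
      C_m := by rw [hC]; linarith
      C_m' := by rw [hC_M]; linarith
      C_f := by rw [hC]; linarith
      C_mass := by rw [hC_M]; linarith
      C_lapse := by rw [hC]; linarith
      C_Y := by rw [← hY, hC]; linarith
      Δ₂_m := hΔ₂
      Ed_small := by linarith
      Ed_ε := by linarith
      hqexp := hqexp, hvd := hvd, vd_M := hvdM, vd_two := hvd2, U₀_vd := hEvd
      small := hsm, small' := hsm'
      U₀_v₀ := hUv₀.trans (by gcongr; norm_num) }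
  have hred' := fun a b S => hred D₂ D₃ r₁ K (1 / r₁ + 1 / (4 * M)) Ed v₁ η a b rH
    (derivWithin rH (Ici v₀)) (derivWithin φH (Ici v₀)) nH F S hEd₁
  exact ⟨_, F.r, F.Ω, F.φ, Pb.isFullDomain hr₁r₀ hrI,
    Pb.isSolutionOn hdata.rH_smooth hdata.contDiffOn_θH hdata.rI_smooth (hdata.contDiffOn_ζI hU₀),
    Pb.attainsData, fun U v h => Pb.dU_r_neg h,
    Pb.globalEstimates (by linarith) Cs.C_f (by linarith [Cs.C_mass]),
    Pb.redShiftEstimates Cs hred', Pb.noShiftEstimates Cs hred'⟩
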